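/- **Setting.** Let $N\ge 1$, $a>b>0$, $\delta\in\mathbb R$, $p_1,\dots,p_N>0$, and let $P_k\neq0$ be real with $P_k^2=(p_k^2-a^2)(p_k^2-b^2)$. For $n\in\mathbb Z^N$ let $e_k$ be the $k$-th unit vector. Let $u:\mathbb Z^N\to\mathbb R$ solve Q3$_\delta$ in all pairs of directions, $$P_j\big(u(n)u(n+e_k)+u(n+e_j)u(n+e_j+e_k)\big)-P_k\big(u(n)u(n+e_j)+u(n+e_k)u(n+e_j+e_k)\big)-(p_j^2-p_k^2)\Big(u(n+e_j)u(n+e_k)+u(n)u(n+e_j+e_k)+\tfrac{\delta^2}{4P_jP_k}\Big)=0,$$ and let $\mathscr U:\mathbb Z^N\to\mathbb R\setminus\{0\}$ be a dual function: $\mathscr U(n)\mathscr U(n+e_k)=P_k(u(n)^2+u(n+e_k)^2)-(2p_k^2-a^2-b^2)u(n)u(n+e_k)+\frac{\delta^2}{4P_k}$ for all $n,k$. Let $\Gamma=(\gamma(i))_{i\in\mathbb Z}$ be a staircase, $\gamma(0)=0$, $\gamma(i+1)=\gamma(i)+e_{d(i)}$ with $d:\mathbb Z\to\{1,\dots,N\}$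 periodic. Put $$\rho_n(\zeta)=\prod_{r=1}^N\Big(\frac{p_r+\zeta}{p_r-\zeta}\Big)^{n_r},\qquad \mathcal F_n(x,y)=\prod_{r=1}^N\Big(\frac{(p_r+x)(p_r+y)}{P_r}\Big)^{n_r}\quad(x=\pm a,\ y=\pm b),$$ $$\Omega_{jk}(n)=\frac{P_ku(n+e_j+e_k)-(p_k^2-p_j^2)u(n+e_j)-P_ju(n)}{\mathscr U(n+e_j)} .$$ *Boundary conditions.* For real constants $\mathscr A,\mathscr B,\mathscr C,\mathscr D,\mathscr K_0,\mathscr K_1$ with $\mathscr A\mathscr D(a+b)^2-\mathscr B\mathscr C(a-b)^2=-\frac{\delta^2}{16ab}$ these require, at $n=m+\gamma(i)$ for every $m\in\mathbb Z^N$ with $m_r=0$ for all $r$ in the range of $d$ (with $f\sim g$ meaning $f-g=o(g)$), $$u\sim\mathscr C\mathcal F(-a,b)+\mathscr D\mathcal F(-a,-b),\quad \mathscr U\sim-(a-b)\mathscr C\mathcal F(-a,b)-(a+b)\mathscr D\mathcal F(-a,-b)\quad(i\to-\infty),$$ $$u\sim\mathscr K_0\mathscr A\mathcal F(a,b)+\mathscr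 K_1\mathscr B\mathcal F(a,-b),\quad \mathscr U\sim\mathscr K_0(a+b)\mathscr A\mathcal F(a,b)+\mathscr K_1(a-b)\mathscr B\mathcal F(a,-b)\quad(i\to+\infty).$$ Assume that they hold for some such constants, and that the potential $\upsilon(i)=\Omega_{d(i-1)d(i)}(\gamma(i-1))-p_{d(i-1)}-p_{d(i)}$ satisfies $\sum_{i\in\mathbb Z}|\upsilon(i)|(1+|i|)<\infty$. *Jost functions.* For $\operatorname{Re}\zeta\ge0$, $\Lambda$ and $\Upsilon$ are the functions of $n\in\mathbb Z^N$ with, for all $n,j,k$, $$(p_k+\zeta)\Lambda(n+e_j+e_k)-\Omega_{jk}(n)\Lambda(n+e_j)+(p_j-\zeta)\Lambda(n)=0,\qquad (p_k-\zeta)\Upsilon(n+e_j+e_k)-\Omega_{jk}(n)\Upsilon(n+e_j)+(p_j+\zeta)\Upsilon(n)=0,$$ and, for every $m\in\mathbb Z^N$, $\Lambda(m+\gamma(i))\to1$ as $i\to-\infty$ and $\Upsilon(m+\gamma(i))\to1$ as $i\to+\infty$. Put, with $p=p_{d(0)}$, $$\mathtt A(\zeta)=\tfrac1{2\zeta}\big[(p+\zeta)\Lambda(\gamma(1);\zeta)\Upsilon(0;\zeta)-(p-\zeta)\Lambda(0;\zeta)\Upsilon(\gamma(1);\zeta)\big],$$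 and for $c\in\{a,b\}$ and any $k$ $$(\zeta^2-c^2)\Lambda_2^{(c)}(n;\zeta)=(p_k+\zeta)\,\mathscr U(n)\Lambda(n+e_k;\zeta)-\big(P_ku(n+e_k)-(p_k^2-c^2)u(n)\big)\Lambda(n;\zeta).$$ **Theorem.** (1) $\Lambda$ and $\Upsilon$ exist and are unique. (2) For all $n$ (and every $k$ in the definition of $\Lambda_2^{(c)}$), $$u(n)=\lim_{|\zeta|\to\infty,\ \operatorname{Re}\zeta\ge0}\frac{\zeta^2\big[\Lambda_2^{(b)}(n;\zeta)-\Lambda_2^{(a)}(n;\zeta)\big]}{a^2-b^2}.$$ (3) Assume that the zeros of $\mathtt A$ in $\operatorname{Re}\zeta>0$ are simple and that $\mathtt A(p_r)\ne0$ for all $r$. Then these zeros are finite in number, $\zeta_1,\dots,\zeta_M$; $\mathtt A\neq0$ on the imaginary axis without $0$; and there is a function $\mathtt B$ with, for all $n$, $\Upsilon(n;\zeta)=\mathtt A(\zeta)\Lambda(n;-\zeta)+\mathtt B(\zeta)\Lambda(n;\zeta)\rho_n(\zeta)$ for $\operatorname{Re}\zeta=0$, $\zeta\ne0$, and $\Upsilon(n;\zeta_k)=\mathtt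 B(\zeta_k)\Lambda(n;\zeta_k)\rho_n(\zeta_k)$, $\mathtt B(\zeta_k)\neq0$. With $R=\mathtt B/\mathtt A$, $\mathtt c_k=\mathtt B(\zeta_k)/\mathtt A'(\zeta_k)$, the functions $\Lambda(n;\cdot)$ and $\Upsilon(n;\cdot)$ are continuous on $\operatorname{Re}\zeta\ge0$, and for all $n$ and $\operatorname{Re}\zeta>0$ (hence, as a limit from the right, for $\operatorname{Re}\zeta=0$) $$\Lambda(n;\zeta)=1-\sum_{k=1}^M\frac{\mathtt c_k\Lambda(n;\zeta_k)}{\zeta+\zeta_k}\rho_n(\zeta_k)-\frac1{2\pi i}\int_{-i\infty}^{+i\infty}\frac{R(\sigma)\Lambda(n;\sigma)}{\sigma+\zeta}\rho_n(\sigma)\,d\sigma,$$ $$\Upsilon(n;\zeta)=1-\sum_{k=1}^M\frac{\mathtt d_k\Upsilon(n;\zeta_k)}{\zeta+\zeta_k}\rho_n(-\zeta_k)+\frac1{2\pi i}\int_{-i\infty}^{+i\infty}\frac{\mathtt B(-\sigma)\Upsilon(n;\sigma)}{\mathtt A(\sigma)(\sigma+\zeta)}\rho_n(-\sigma)\,d\sigma,\qquad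 \mathtt d_k=\frac1{\mathtt A'(\zeta_k)\mathtt B(\zeta_k)},$$ with absolutely convergent integrals; the data $\zeta_k,\mathtt c_k,R$ do not depend on $n$. (4) Assume moreover $\mathtt A(a)\ne0$ and $\mathtt A(b)\neq0$. Then there are constants $\mathscr A,\mathscr B,\mathscr C,\mathscr D,\mathscr K_0,\mathscr K_1$ for which the boundary conditions hold, and, for $s\in\{\pm a,\pm b\}$, functions $\xi_s(n;\cdot)$, continuous on $\operatorname{Re}\zeta\ge0$, $\zeta\neq-s$, that satisfy for $\operatorname{Re}\zeta>0$, $\zeta\ne-s$ $$\xi_s(n;\zeta)=\frac1{\zeta+s}-\sum_{k=1}^M\frac{\mathtt c_k\,\xi_s(n;\zeta_k)}{\zeta+\zeta_k}\rho_n(\zeta_k)-\frac1{2\pi i}\int_{-i\infty}^{+i\infty}\frac{R(\sigma)\,\xi_s(n;\sigma)}{\sigma+\zeta}\rho_n(\sigma)\,d\sigma$$ (absolutely convergent), such that for all $n$, every $k$, and $\operatorname{Re}\zeta\ge0$ (with $\zeta\ne b$ in the first and $\zeta\neq a$ in the second formula; $\mathcal F$, $\Lambda$, $\Upsilon$, $\xi$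 taken at $n$) $$\Lambda_2^{(b)}(\zeta)=(a+b)\tfrac{\mathscr K_0}{\mathtt A(a)\mathtt A(b)}\mathscr A\mathcal F(a,b)\Lambda(a)\xi_b(\zeta)+(a-b)\tfrac{\mathscr K_1\mathtt A(b)}{\mathtt A(a)}\mathscr B\mathcal F(a,-b)\Lambda(a)\xi_{-b}(\zeta)-(a-b)\mathscr C\mathcal F(-a,b)\tfrac{\Upsilon(a)}{\mathtt A(a)}\xi_b(\zeta)-(a+b)\mathscr D\mathcal F(-a,-b)\tfrac{\Upsilon(a)}{\mathtt A(a)}\xi_{-b}(\zeta),$$ $$\Lambda_2^{(a)}(\zeta)=(a+b)\tfrac{\mathscr K_0}{\mathtt A(a)\mathtt A(b)}\mathscr A\mathcal F(a,b)\Lambda(b)\xi_a(\zeta)+(a-b)\tfrac{\mathscr K_1\mathtt A(b)}{\mathtt A(a)}\mathscr B\mathcal F(a,-b)\tfrac{\Upsilon(b)}{\mathtt A(b)}\xi_a(\zeta)-(a-b)\mathscr C\mathcal F(-a,b)\Lambda(b)\xi_{-a}(\zeta)-(a+b)\mathscr D\mathcal F(-a,-b)\tfrac{\Upsilon(b)}{\mathtt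 A(b)}\xi_{-a}(\zeta).$$ -/

import Mathlib

namespace Q3

/-- The parameters of the lattice equation: `a > b > 0`, `δ`, the lattice parameters `p k > 0`, and
real nonzero square roots `P k` of `(p k ^ 2 - a ^ 2) * (p k ^ 2 - b ^ 2)`. -/
structure Params (N : ℕ) where
  a : ℝ
  b : ℝ
  δ : ℝ
  p : Fin N → ℝ
  P : Fin N → ℝ
  b_pos : 0 < b
  b_lt_a : b < a
  p_pos : ∀ k, 0 < p k
  P_sq : ∀ k, P k ^ 2 = (p k ^ 2 - a ^ 2) * (p k ^ 2 - b ^ 2)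
  P_ne_zero : ∀ k, P k ≠ 0

/-- The shift `n_k ↦ n_k + 1`. -/
def shift {N : ℕ} (k : Fin N) (n : Fin N → ℤ) : Fin N → ℤ := n + Pi.single k 1

/-- `u` solves `Q3_δ` on every elementary quadrilateral (for `j = k` the equation is `0 = 0`). -/
def IsSolution {N : ℕ} (D : Params N) (u : (Fin N → ℤ) → ℝ) : Prop :=
  ∀ (n : Fin N → ℤ) (j k : Fin N),
    D.P j * (u n * u (shift k n) + u (shift j n) * u (shift k (shift j n)))
      - D.P k * (u n * u (shift j n) + u (shift k n) * u (shift k (shift j n)))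
      - (D.p j ^ 2 - D.p k ^ 2) *
        ((u (shift j n) * u (shift k n) + u n * u (shift k (shift j n)))
          + D.δ ^ 2 / (4 * D.P j * D.P k)) = 0

/-- `U` is a dual function of `u`. -/
def IsDual {N : ℕ} (D : Params N) (u U : (Fin N → ℤ) → ℝ) : Prop :=
  ∀ (n : Fin N → ℤ) (k : Fin N),
    U n * U (shift k n) =
      D.P k * (u n ^ 2 + u (shift k n) ^ 2)
        - (2 * D.p k ^ 2 - D.a ^ 2 - D.b ^ 2) * u n * u (shift k n) + D.δ ^ 2 / (4 * D.P k)

/-- An infinite staircase through the origin: the `i`-th step is a positive unit step in the lattice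
direction `dir i`, and the steps are produced by a repeated stepping pattern. -/
structure Staircase (N : ℕ) where
  dir : ℤ → Fin N
  periodic : ∃ T : ℕ, 0 < T ∧ ∀ i : ℤ, dir (i + T) = dir i

/-- The lattice point with staircase variable `i`; so `point 0 = 0` and
`point (i + 1) = shift (dir i) (point i)`. -/
noncomputable def Staircase.point {N : ℕ} (Γ : Staircase N) (i : ℤ) : Fin N → ℤ :=
  (∑ r ∈ Finset.Ico 0 i, Pi.single (Γ.dir r) (1 : ℤ))
    - ∑ r ∈ Finset.Ico i 0, Pi.single (Γ.dir r) (1 : ℤ)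

/-- The coefficient `Ω` of the three-point scalar equation along the steps `j`, then `k`, from `n`. -/
noncomputable def Omega {N : ℕ} (D : Params N) (u U : (Fin N → ℤ) → ℝ)
    (n : Fin N → ℤ) (j k : Fin N) : ℝ :=
  (D.P k * u (shift k (shift j n)) - (D.p k ^ 2 - D.p j ^ 2) * u (shift j n) - D.P j * u n)
    / U (shift j n)

/-- The potential along the staircase. -/
noncomputable def potential {N : ℕ} (D : Params N) (Γ : Staircase N) (u U : (Fin N → ℤ) → ℝ)
    (i : ℤ) : ℝ :=
  Omega D u U (Γ.point (i - 1)) (Γ.dir (i - 1)) (Γ.dir i)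
    - D.p (Γ.dir (i - 1)) - D.p (Γ.dir i)

/-- The plane wave `F(x, y)`, for `x = ± a`, `y = ± b`. Since
`((p + x) (p + y) / P) ^ 2 = (p + x) (p + y) / ((p - x) (p - y))`, this is the product of the
powers of order `n_r / 2` of the right-hand side, with the square roots fixed by the choice of
the `P r`. -/
noncomputable def planeF {N : ℕ} (D : Params N) (n : Fin N → ℤ) (x y : ℝ) : ℝ :=
  ∏ r, ((D.p r + x) * (D.p r + y) / D.P r) ^ (n r)

/-- The plane wave `ρ(ζ)`. -/
noncomputable def rho {N : ℕ} (D : Params N) (n : Fin N → ℤ) (ζ : ℂ) : ℂ :=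
  ∏ r, (((D.p r : ℂ) + ζ) / ((D.p r : ℂ) - ζ)) ^ (n r)

/-- The constants of the boundary conditions. -/
structure Coeffs where
  A : ℝ
  B : ℝ
  C : ℝ
  D : ℝ
  K₀ : ℝ
  K₁ : ℝ

/-- The boundary conditions at both ends of the staircase and of its translates in the
directions in which the staircase does not step. -/
def BoundaryConditions {N : ℕ} (D : Params N) (Γ : Staircase N) (u U : (Fin N → ℤ) → ℝ)
    (κ : Coeffs) : Prop :=
  κ.A * κ.D * (D.a + D.b) ^ 2 - κ.B * κ.C * (D.a - D.b) ^ 2 = -D.δ ^ 2 / (16 * D.a * D.b) ∧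
  ∀ m : Fin N → ℤ, (∀ i, m (Γ.dir i) = 0) →
    Asymptotics.IsEquivalent Filter.atBot (fun i : ℤ => u (m + Γ.point i))
      (fun i : ℤ => κ.C * planeF D (m + Γ.point i) (-D.a) D.b
        + κ.D * planeF D (m + Γ.point i) (-D.a) (-D.b)) ∧
    Asymptotics.IsEquivalent Filter.atTop (fun i : ℤ => u (m + Γ.point i))
      (fun i : ℤ => κ.K₀ * κ.A * planeF D (m + Γ.point i) D.a D.b
        + κ.K₁ * κ.B * planeF D (m + Γ.point i) D.a (-D.b)) ∧
    Asymptotics.IsEquivalent Filter.atBot (fun i : ℤ => U (m + Γ.point i))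
      (fun i : ℤ => -(D.a - D.b) * κ.C * planeF D (m + Γ.point i) (-D.a) D.b
        - (D.a + D.b) * κ.D * planeF D (m + Γ.point i) (-D.a) (-D.b)) ∧
    Asymptotics.IsEquivalent Filter.atTop (fun i : ℤ => U (m + Γ.point i))
      (fun i : ℤ => κ.K₀ * (D.a + D.b) * κ.A * planeF D (m + Γ.point i) D.a D.b
        + κ.K₁ * (D.a - D.b) * κ.B * planeF D (m + Γ.point i) D.a (-D.b))

/-- `Λ` is the Jost function normalised at `i → -∞`, for `Re ζ ≥ 0`. The function
`φ = Λ ∏ ((p_r + ζ) / (p_r - ζ)) ^ (n_r / 2)` is the first component of a solution of all `N` Lax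
equations, that is, it satisfies
`(p_k² - ζ²)^(1/2) φ(n + e_j + e_k) - Ω φ(n + e_j) + (p_j² - ζ²)^(1/2) φ(n) = 0` for all `j`, `k`;
this is written below in terms of `Λ`, where no square root occurs. -/
def IsLeftJost {N : ℕ} (D : Params N) (Γ : Staircase N) (u U : (Fin N → ℤ) → ℝ)
    (Λ : (Fin N → ℤ) → ℂ → ℂ) : Prop :=
  ∀ ζ : ℂ, 0 ≤ ζ.re →
    (∀ (n : Fin N → ℤ) (j k : Fin N),
      (D.p k + ζ) * Λ (shift k (shift j n)) ζ - (Omega D u U n j k : ℂ) * Λ (shift j n) ζ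
        + (D.p j - ζ) * Λ n ζ = 0) ∧
    ∀ m : Fin N → ℤ,
      Filter.Tendsto (fun i : ℤ => Λ (m + Γ.point i) ζ) Filter.atBot (nhds 1)

/-- `Υ` is the Jost function normalised at `i → +∞`, for `Re ζ ≥ 0`; here the solution of the Lax
equations is `ψ = Υ ∏ ((p_r - ζ) / (p_r + ζ)) ^ (n_r / 2)`. -/
def IsRightJost {N : ℕ} (D : Params N) (Γ : Staircase N) (u U : (Fin N → ℤ) → ℝ)
    (Υ : (Fin N → ℤ) → ℂ → ℂ) : Prop :=
  ∀ ζ : ℂ, 0 ≤ ζ.re →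
    (∀ (n : Fin N → ℤ) (j k : Fin N),
      (D.p k - ζ) * Υ (shift k (shift j n)) ζ - (Omega D u U n j k : ℂ) * Υ (shift j n) ζ
        + (D.p j + ζ) * Υ n ζ = 0) ∧
    ∀ m : Fin N → ℤ,
      Filter.Tendsto (fun i : ℤ => Υ (m + Γ.point i) ζ) Filter.atTop (nhds 1)

/-- The spectral function `A(ζ) = W(ψ, φ) / (2 ζ)`, evaluated on the first step of the staircase. -/
noncomputable def specA {N : ℕ} (D : Params N) (Γ : Staircase N)
    (Λ Υ : (Fin N → ℤ) → ℂ → ℂ) (ζ : ℂ) : ℂ :=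
  ((D.p (Γ.dir 0) + ζ) * Λ (Γ.point 1) ζ * Υ (Γ.point 0) ζ
    - (D.p (Γ.dir 0) - ζ) * Λ (Γ.point 0) ζ * Υ (Γ.point 1) ζ) / (2 * ζ)

/-- The second component `Λ₂` belonging to `Λ`, computed from the Lax equation in the direction
`k`; `c = b` gives `Λ₂^(b)` and `c = a` gives `Λ₂^(a)`. -/
noncomputable def second {N : ℕ} (D : Params N) (u U : (Fin N → ℤ) → ℝ)
    (Λ : (Fin N → ℤ) → ℂ → ℂ) (c : ℝ) (k : Fin N) (n : Fin N → ℤ) (ζ : ℂ) : ℂ :=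
  ((D.p k + ζ) * U n * Λ (shift k n) ζ
    - (D.P k * u (shift k n) - (D.p k ^ 2 - c ^ 2) * u n : ℝ) * Λ n ζ) / (ζ ^ 2 - c ^ 2)

/-- `f` solves, on `Re ζ ≥ 0` outside the set `E`, the singular integral equation
`f(ζ) = g(ζ) - ∑ k, c_k f(z_k) w(z_k) / (ζ + z_k)
  - (2 π i)⁻¹ ∫ R(σ) f(σ) w(σ) / (σ + ζ) dσ`,
the integral being over the imaginary axis `σ = i t`, upwards. It is required for `Re ζ > 0`, where
the integral converges absolutely; as `f` is continuous up to the imaginary axis, it holds there in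
the sense of limits from the right. -/
def SolvesSIE {M : ℕ} (z c : Fin M → ℂ) (R w g : ℂ → ℂ) (E : Set ℂ) (f : ℂ → ℂ) : Prop :=
  ContinuousOn f ({ζ : ℂ | 0 ≤ ζ.re} \ E) ∧
  ∀ ζ : ℂ, 0 < ζ.re → ζ ∉ E →
    MeasureTheory.Integrable
      (fun t : ℝ => R (t * Complex.I) * f (t * Complex.I) / (t * Complex.I + ζ)
        * w (t * Complex.I)) ∧
    f ζ = g ζ - ∑ k, c k * f (z k) / (ζ + z k) * w (z k)
      - 1 / (2 * Real.pi * Complex.I) *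
        ∫ t : ℝ, (R (t * Complex.I) * f (t * Complex.I) / (t * Complex.I + ζ)
          * w (t * Complex.I)) * Complex.I

end Q3

/-! ### Lattice shifts and the compatible Lax coefficients of Q3. -/

namespace Q3

variable {N : ℕ}

/-! The theorem is inverse scattering for the linear system whose compatibility comes from the
lattice equation. With `laxG` and `laxH` as coefficients g, h, the Lax steps (p_k + ζ) x(n + e_k) =
ψ(n) + g_k x(n), ψ(n + e_k) = h_k x(n + e_k) - (p_k - ζ) x(n) commute for every ζ. What this
requires of the coefficients is free of ζ: the three identities of `LaxCoeff`. They follow from one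
biquadratic identity, `quad_mul`, read at different corners of a quadrilateral (`quad_relations`).

Along a staircase the elimination of ψ leaves a discrete Schrödinger equation with a potential that
has a finite first moment. Its Volterra equation is solved by iteration near the left end, where the
kernel is a contraction, and the solution is continued by the recurrence (`OneDim.exists_jost`); it
is holomorphic in Re ζ > 0, continuous up to the axis, and 1 + O(1/ζ). To have this on all
translates of the staircase, the first moment must pass from one translate to the next. The quantity
`mix` on the strip between two translates obeys a Riccati recursion that contracts backwards, so it
inherits summability from the potential once it tends to zero (`pot_step`). It tends to zero by
periodicity if the staircase steps in that direction (`mix_tendsto_of_mem`), and by the boundary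
conditions otherwise (`EndBC.mix_tendsto`). A Lax step then sends normalised solutions to normalised
solutions, and uniqueness glues them to a function on the lattice (`transport`, `latEq_of_family`).
Reflection in the origin turns left into right, which gives Υ.

The Wronskian of solutions with opposite ζ does not depend on n. It yields A and B, the scattering
relation on the imaginary axis, |A|² - |B|² = 1 there, and proportionality of Λ and Υ at a zero of
A. The delicate point is ζ = 0, where A may blow up but stays away from zero (`specA_near_zero`).
Dividing the scattering relation by A gives a jump relation between a meromorphic function in the
right half-plane and the reflection of a holomorphic one; Cauchy's formula turns it into the
singular integral equation (`Decays.eq_of_jump`, `Jost.solvesSIE`).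

The functions ξ are 2 × 2 determinants of Lax solutions at ζ and at c = a or b, divided by ζ² - c².
They satisfy the same jump relation, with a pole of residue one as inhomogeneity. The second
components are combinations of them by a Plücker identity (`second_eq_xi`), with coefficients built
from the Jost functions at ±a, ±b. Those coefficients become plane waves because `pairing` of a
solution at ±b with one at ±a is multiplied by an explicit factor at each step. Four such pairings
supply the constants, their determinant gives the quadratic relation (`exists_coeffRel`), and
comparison of the resulting four-wave expansion of the dual function with the assumed asymptotics
shows that these constants satisfy the boundary conditions (`EndBC.const_eq`). -/

theorem shift_comm (j k : Fin N) (n : Fin N → ℤ) :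
    shift k (shift j n) = shift j (shift k n) := by
  simp only [shift]; abel

theorem shift_add (k : Fin N) (m n : Fin N → ℤ) : shift k (m + n) = m + shift k n := by
  simp only [shift]; abel

theorem shift_add' (k : Fin N) (m n : Fin N → ℤ) : shift k (m + n) = shift k m + n := by
  simp only [shift]; abel

theorem shift_sub_single (k : Fin N) (n : Fin N → ℤ) : shift k (n - Pi.single k 1) = n := by
  simp [shift]

/-- A property of lattice points that is preserved by all unit steps, in both senses, holds
everywhere once it holds somewhere. -/
theorem lattice_induction {Q : (Fin N → ℤ) → Prop} (n₀ : Fin N → ℤ) (h0 : Q n₀)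
    (hs : ∀ n k, Q n ↔ Q (shift k n)) (n : Fin N → ℤ) : Q n := by
  have key : ∀ (k : Fin N) (c : ℤ) (n : Fin N → ℤ), Q n → Q (n + Pi.single k c) := by
    intro k c
    induction c using Int.induction_on with
    | zero => intro n hn; simpa using hn
    | succ i ih =>
      intro n hn
      have := (hs _ k).1 (ih n hn)
      rwa [shift, add_assoc, ← Pi.single_add] at this
    | pred i ih =>
      intro n hn
      rw [hs _ k, shift, add_assoc, ← Pi.single_add]
      simpa using ih n hn
  have h2 : ∀ s : Finset (Fin N), Q (n₀ + ∑ k ∈ s, Pi.single k ((n - n₀) k)) := by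
    intro s
    induction s using Finset.induction_on with
    | empty => simpa using h0
    | insert k s hk ih =>
      rw [Finset.sum_insert hk, add_comm (Pi.single k _), ← add_assoc]
      exact key _ _ _ ih
  have h3 := h2 Finset.univ
  rw [Finset.univ_sum_single] at h3
  simpa using h3

/-- Compatible coefficients of the Lax equations
`(p_k + ζ) x(n + e_k) = ψ(n) + g_k(n) x(n)`, `ψ(n + e_k) = h_k(n) x(n + e_k) - (p_k - ζ) x(n)`. -/
structure LaxCoeff (p : Fin N → ℝ) (g h : Fin N → (Fin N → ℤ) → ℝ) : Prop where
  symm : ∀ n j k, g k (shift j n) + h j n = g j (shift k n) + h k n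
  mul : ∀ n j k, (g k (shift j n) + h j n) * (g j n - g k n) = p j ^ 2 - p k ^ 2
  cross : ∀ n j k, h k (shift j n) - h j (shift k n) = g k n - g j n

/-- The coefficient of the three-point equation attached to Lax coefficients. -/
def om (g h : Fin N → (Fin N → ℤ) → ℝ) (n : Fin N → ℤ) (j k : Fin N) : ℝ :=
  g k (shift j n) + h j n

/-- The coefficient `g` of the Lax equations of `Q3`. -/
noncomputable def laxG (D : Params N) (u U : (Fin N → ℤ) → ℝ) (k : Fin N) (n : Fin N → ℤ) : ℝ :=
  (D.P k * u (shift k n) - D.p k ^ 2 * u n) / U n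

/-- The coefficient `h` of the Lax equations of `Q3`. -/
noncomputable def laxH (D : Params N) (u U : (Fin N → ℤ) → ℝ) (k : Fin N) (n : Fin N → ℤ) : ℝ :=
  (D.p k ^ 2 * u (shift k n) - D.P k * u n) / U (shift k n)

theorem Omega_eq_om (D : Params N) (u U : (Fin N → ℤ) → ℝ) (n : Fin N → ℤ) (j k : Fin N) :
    Omega D u U n j k = om (laxG D u U) (laxH D u U) n j k := by
  simp only [Omega, om, laxG, laxH, ← add_div]
  congr 1; ring

/-- Modulo the curve relations for P_j and P_k, the difference of the two sides is P_k times the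
lattice equation. The last factor is the biquadratic that defines the dual function on the edge j,
which is how the dual function enters the Lax system. -/
theorem quad_mul {a b δ pj pk Pj Pk u uj uk ujk : ℝ}
    (hj : Pj ^ 2 = (pj ^ 2 - a ^ 2) * (pj ^ 2 - b ^ 2))
    (hk : Pk ^ 2 = (pk ^ 2 - a ^ 2) * (pk ^ 2 - b ^ 2)) (hj0 : Pj ≠ 0) (hk0 : Pk ≠ 0)
    (hq : Pj * (u * uk + uj * ujk) - Pk * (u * uj + uk * ujk)
      - (pj ^ 2 - pk ^ 2) * ((uj * uk + u * ujk) + δ ^ 2 / (4 * Pj * Pk)) = 0) :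
    (Pk * ujk - (pk ^ 2 - pj ^ 2) * uj - Pj * u) * (Pj * uj - Pk * uk - (pj ^ 2 - pk ^ 2) * u)
      = (pj ^ 2 - pk ^ 2) *
        (Pj * (u ^ 2 + uj ^ 2) - (2 * pj ^ 2 - a ^ 2 - b ^ 2) * u * uj + δ ^ 2 / (4 * Pj)) := by
  have e : δ ^ 2 / (4 * Pj) = Pk * (δ ^ 2 / (4 * Pj * Pk)) := by field_simp
  rw [e]
  linear_combination Pk * hq + (hk - hj) * u * uj

/-- The algebraic relations on an elementary quadrilateral. -/
theorem quad_relations {a b δ pj pk Pj Pk u uj uk ujk U Uj Uk Ujk : ℝ}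
    (hj : Pj ^ 2 = (pj ^ 2 - a ^ 2) * (pj ^ 2 - b ^ 2))
    (hk : Pk ^ 2 = (pk ^ 2 - a ^ 2) * (pk ^ 2 - b ^ 2)) (hj0 : Pj ≠ 0) (hk0 : Pk ≠ 0)
    (hq : Pj * (u * uk + uj * ujk) - Pk * (u * uj + uk * ujk)
      - (pj ^ 2 - pk ^ 2) * ((uj * uk + u * ujk) + δ ^ 2 / (4 * Pj * Pk)) = 0)
    (hU : U ≠ 0) (hUj : Uj ≠ 0)
    (d1 : U * Uj = Pj * (u ^ 2 + uj ^ 2) - (2 * pj ^ 2 - a ^ 2 - b ^ 2) * u * uj + δ ^ 2 / (4 * Pj))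
    (d2 : U * Uk = Pk * (u ^ 2 + uk ^ 2) - (2 * pk ^ 2 - a ^ 2 - b ^ 2) * u * uk + δ ^ 2 / (4 * Pk))
    (d3 : Uj * Ujk = Pk * (uj ^ 2 + ujk ^ 2) - (2 * pk ^ 2 - a ^ 2 - b ^ 2) * uj * ujk
      + δ ^ 2 / (4 * Pk)) :
    (Pk * ujk - (pk ^ 2 - pj ^ 2) * uj - Pj * u) * Uk
        = (Pj * ujk - (pj ^ 2 - pk ^ 2) * uk - Pk * u) * Uj ∧
    (Pk * ujk - (pk ^ 2 - pj ^ 2) * uj - Pj * u) * (Pj * uj - Pk * uk - (pj ^ 2 - pk ^ 2) * u)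
        = (pj ^ 2 - pk ^ 2) * (U * Uj) ∧
    (Pj * uj - Pk * uk - (pj ^ 2 - pk ^ 2) * u) * Ujk
        = -(Pj * uk - Pk * uj - (pj ^ 2 - pk ^ 2) * ujk) * U := by
  have m1 := quad_mul hj hk hj0 hk0 hq
  rw [← d1] at m1
  have hq' : Pk * (u * uj + uk * ujk) - Pj * (u * uk + uj * ujk)
      - (pk ^ 2 - pj ^ 2) * ((uk * uj + u * ujk) + δ ^ 2 / (4 * Pk * Pj)) = 0 := by
    rw [mul_right_comm 4 Pk Pj]
    linear_combination -hq
  have m2 := quad_mul hk hj hk0 hj0 hq'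
  rw [← d2] at m2
  -- The same equation read from the opposite vertex, so that `quad_mul` can be used for the edge
  -- from `uj` to `ujk`.
  have hq'' : Pk * (ujk * uk + uj * u) - Pj * (ujk * uj + uk * u)
      - (pk ^ 2 - pj ^ 2) * ((uj * uk + ujk * u) + δ ^ 2 / (4 * Pk * Pj)) = 0 := by
    rw [mul_right_comm 4 Pk Pj]
    linear_combination -hq
  have m3 := quad_mul hk hj hk0 hj0 hq''
  have d3' : Uj * Ujk = Pk * (ujk ^ 2 + uj ^ 2) - (2 * pk ^ 2 - a ^ 2 - b ^ 2) * ujk * uj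
      + δ ^ 2 / (4 * Pk) := by linear_combination d3
  rw [← d3'] at m3
  -- If p_j² = p_k² then P_j = ±P_k and the quadrilateral equation factors into two linear
  -- alternatives, each of which gives the relations directly. Otherwise the right side of `m1` is
  -- nonzero, so its factors may be cancelled.
  by_cases hΔ : pj ^ 2 - pk ^ 2 = 0
  · have hP : (Pj - Pk) * (Pj + Pk) = 0 := by
      linear_combination hj - hk + (pj ^ 2 + pk ^ 2 - a ^ 2 - b ^ 2) * hΔ
    refine ⟨?_, m1, ?_⟩
    all_goals
      generalize pj ^ 2 = qj at *
      generalize pk ^ 2 = qk at *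
      obtain rfl : qk = qj := by linarith
      rcases mul_eq_zero.1 hP with h | h
    · obtain rfl : Pj = Pk := by linarith
      have h0 : Pj * ((u - ujk) * (uk - uj)) = 0 := by linear_combination hq
      rcases mul_eq_zero.1 ((mul_eq_zero.1 h0).resolve_left hj0) with h1 | h1
      · have : ujk = u := by linarith
        subst this; ring
      · have : uk = uj := by linarith
        subst this
        have : Uj = Uk := mul_left_cancel₀ hU (d1.trans d2.symm)
        rw [this]
    · obtain rfl : Pk = -Pj := by linarith
      have h0 : Pj * ((u + ujk) * (uk + uj)) = 0 := by linear_combination hq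
      rcases mul_eq_zero.1 ((mul_eq_zero.1 h0).resolve_left hj0) with h1 | h1
      · have : ujk = -u := by linarith
        subst this; ring
      · have : uk = -uj := by linarith
        subst this
        have e : δ ^ 2 / (4 * -Pj) = -(δ ^ 2 / (4 * Pj)) := by rw [mul_neg, div_neg]
        have : Uk = -Uj := mul_left_cancel₀ hU (by rw [d2, e]; linear_combination d1)
        rw [this]; ring
    · obtain rfl : Pj = Pk := by linarith
      have h0 : Pj * ((u - ujk) * (uk - uj)) = 0 := by linear_combination hq
      rcases mul_eq_zero.1 ((mul_eq_zero.1 h0).resolve_left hj0) with h1 | h1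
      · have : ujk = u := by linarith
        subst this
        have : Ujk = U := mul_left_cancel₀ hUj (d3.trans (by linear_combination -d1))
        rw [this]; ring
      · have : uk = uj := by linarith
        subst this; ring
    · obtain rfl : Pk = -Pj := by linarith
      have h0 : Pj * ((u + ujk) * (uk + uj)) = 0 := by linear_combination hq
      rcases mul_eq_zero.1 ((mul_eq_zero.1 h0).resolve_left hj0) with h1 | h1
      · have : ujk = -u := by linarith
        subst this
        have e : δ ^ 2 / (4 * -Pj) = -(δ ^ 2 / (4 * Pj)) := by rw [mul_neg, div_neg]
        have : Ujk = -U := mul_left_cancel₀ hUj (by rw [d3, e]; linear_combination d1)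
        rw [this]; ring
      · have : uk = -uj := by linarith
        subst this; ring
  · set V := Pj * uj - Pk * uk - (pj ^ 2 - pk ^ 2) * u with hV
    have hV0 : V ≠ 0 := by
      intro h
      rw [h, mul_zero] at m1
      exact mul_ne_zero hΔ (mul_ne_zero hU hUj) m1.symm
    have m2' : (Pj * ujk - (pj ^ 2 - pk ^ 2) * uk - Pk * u) * V = (pj ^ 2 - pk ^ 2) * (U * Uk) := by
      linear_combination -m2
    refine ⟨?_, m1, ?_⟩
    · apply mul_right_cancel₀ hV0
      linear_combination Uk * m1 - Uj * m2'
    · have hW : (Pk * ujk - (pk ^ 2 - pj ^ 2) * uj - Pj * u) ≠ 0 := by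
        intro h
        rw [h, zero_mul] at m1
        exact mul_ne_zero hΔ (mul_ne_zero hU hUj) m1.symm
      apply mul_left_cancel₀ hW
      linear_combination Ujk * m1 + U * m3

theorem laxCoeff (D : Params N) {u U : (Fin N → ℤ) → ℝ} (hu : IsSolution D u) (hU : IsDual D u U)
    (hU0 : ∀ n, U n ≠ 0) : LaxCoeff D.p (laxG D u U) (laxH D u U) := by
  have key := fun n j k => quad_relations (D.P_sq j) (D.P_sq k) (D.P_ne_zero j) (D.P_ne_zero k)
    (hu n j k) (hU0 n) (hU0 (shift j n)) (hU n j) (hU n k) (hU _ k)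
  refine ⟨fun n j k => ?_, fun n j k => ?_, fun n j k => ?_⟩
  · have h := (key n j k).1
    have := Omega_eq_om D u U n j k
    have h' := Omega_eq_om D u U n k j
    simp only [om] at this h'
    rw [← this, ← h', Omega, Omega, div_eq_div_iff (hU0 _) (hU0 _), shift_comm k j]
    linear_combination h
  · have h := (key n j k).2.1
    have := Omega_eq_om D u U n j k
    simp only [om] at this
    rw [← this, Omega, laxG, laxG, ← sub_div, div_mul_div_comm,
      div_eq_iff (mul_ne_zero (hU0 _) (hU0 _))]
    linear_combination h
  · have h := (key n j k).2.2
    simp only [laxG, laxH]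
    rw [shift_comm k j, ← sub_div, ← sub_div, div_eq_div_iff (hU0 _) (hU0 _)]
    linear_combination h

namespace LaxCoeff

variable {p : Fin N → ℝ} {g h : Fin N → (Fin N → ℤ) → ℝ}

theorem om_symm (L : LaxCoeff p g h) (n : Fin N → ℤ) (j k : Fin N) : om g h n j k = om g h n k j :=
  L.symm n j k

/-- In a difference of two Ω at the same point with the same first direction the coefficient h
cancels. Hence the compatibility relations close on Ω alone, which is what the transport of the
potential between staircases uses. -/
theorem om_mul (L : LaxCoeff p g h) (n : Fin N → ℤ) (j r k : Fin N) :
    om g h (shift j n) r k * (om g h n j r - om g h n j k) = p r ^ 2 - p k ^ 2 := by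
  rw [← L.mul (shift j n) r k]
  simp only [om]; ring

theorem om_cross (L : LaxCoeff p g h) (n : Fin N → ℤ) (j r s k : Fin N) :
    om g h (shift s (shift j n)) r k - om g h (shift r (shift j n)) s k
      = om g h n j r - om g h n j s := by
  have := L.cross (shift j n) s r
  simp only [om]
  rw [shift_comm s r]
  linarith

/-- The coefficients of the lattice reflected in the origin. -/
theorem reflect (L : LaxCoeff p g h) :
    LaxCoeff p (fun k n => h k (-shift k n)) (fun k n => g k (-shift k n)) := by
  have e : ∀ (k j : Fin N) (n : Fin N → ℤ), shift j (-shift k (shift j n)) = -shift k n := by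
    intro k j n; simp only [shift]; abel
  refine ⟨fun n j k => ?_, fun n j k => ?_, fun n j k => ?_⟩
  · have := L.symm (-shift k (shift j n)) j k
    rw [e, shift_comm j k, e, ← shift_comm j k] at this
    simp only [shift_comm k j] at *
    linarith
  · have h1 := L.mul (-shift k (shift j n)) j k
    have h2 := L.cross (-shift k (shift j n)) j k
    have h3 := L.symm (-shift k (shift j n)) j k
    have e1 := e k j n
    have e2 := e j k n
    rw [shift_comm k j] at e2
    rw [e1, e2] at h2 h3
    rw [e1] at h1
    rw [← h1]
    linear_combination (h k (-shift k n) - h j (-shift j n)) * h3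
      - (g k (-shift k n) + h j (-shift k (shift j n))) * h2
  · have := L.cross (-shift k (shift j n)) j k
    rw [e, shift_comm j k, e, ← shift_comm j k] at this
    simp only [shift_comm k j] at *
    linarith

end LaxCoeff
end Q3

/-! ### Half-plane estimates and the free Green function. -/

open Filter Topology
namespace Q3

/-- The closed right half-plane. -/
def rhp : Set ℂ := {ζ | 0 ≤ ζ.re}

/-- The open right half-plane. -/
def orhp : Set ℂ := {ζ | 0 < ζ.re}

theorem isOpen_orhp : IsOpen orhp := isOpen_lt continuous_const Complex.continuous_re

theorem orhp_subset : orhp ⊆ rhp := fun _ h => le_of_lt (a := (0 : ℝ)) h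

theorem le_norm_add {p : ℝ} {ζ : ℂ} (h : ζ ∈ rhp) : p ≤ ‖(p : ℂ) + ζ‖ := by
  have h1 := Complex.re_le_norm ((p : ℂ) + ζ)
  have h2 : 0 ≤ ζ.re := h
  simp at h1
  linarith

theorem add_ne_zero_of_pos {p : ℝ} (hp : 0 < p) {ζ : ℂ} (h : ζ ∈ rhp) : (p : ℂ) + ζ ≠ 0 := by
  rw [← norm_pos_iff]
  exact hp.trans_le (le_norm_add h)

/-- A point of the right half-plane is at least as near to p as to -p; this makes every factor `tau`
a contraction. -/
theorem norm_sub_le_norm_add {p : ℝ} (hp : 0 < p) {ζ : ℂ} (h : ζ ∈ rhp) :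
    ‖(p : ℂ) - ζ‖ ≤ ‖(p : ℂ) + ζ‖ := by
  have h2 : 0 ≤ ζ.re := h
  apply le_of_sq_le_sq _ (norm_nonneg _)
  rw [← Complex.normSq_eq_norm_sq, ← Complex.normSq_eq_norm_sq, Complex.normSq_apply,
    Complex.normSq_apply]
  simp
  nlinarith

theorem norm_le_norm_add {p : ℝ} (hp : 0 < p) {ζ : ℂ} (h : ζ ∈ rhp) :
    ‖ζ‖ ≤ ‖(p : ℂ) + ζ‖ := by
  have h2 : 0 ≤ ζ.re := h
  apply le_of_sq_le_sq _ (norm_nonneg _)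
  rw [← Complex.normSq_eq_norm_sq, ← Complex.normSq_eq_norm_sq, Complex.normSq_apply,
    Complex.normSq_apply]
  simp
  nlinarith

section DoubleSum

/-- There are c + 1 pairs of naturals with sum c. A double sum of tails is therefore a first moment,
and this is where the weight 1 + |i| in the hypothesis on the potential comes from. -/
theorem summable_prod_add {v : ℕ → ℝ} (hv : ∀ c, 0 ≤ v c)
    (hs : Summable fun c : ℕ => ((c : ℝ) + 1) * v c) :
    Summable (fun x : ℕ × ℕ => v (x.1 + x.2)) ∧
      ∑' x : ℕ × ℕ, v (x.1 + x.2) = ∑' c : ℕ, ((c : ℝ) + 1) * v c := by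
  have hfin : ∀ n : ℕ, ∑' y : Finset.HasAntidiagonal.antidiagonal n, v (y.1.1 + y.1.2) = ((n : ℝ) + 1) * v n := by
    intro n
    rw [tsum_fintype]
    rw [Finset.sum_congr rfl (g := fun _ => v n)]
    · simp
    · intro y _
      rw [Finset.HasAntidiagonal.mem_antidiagonal.1 y.2]
  have h1 : Summable fun x : (Σ n : ℕ, Finset.HasAntidiagonal.antidiagonal n) => v (x.2.1.1 + x.2.1.2) := by
    rw [summable_sigma_of_nonneg (fun _ => hv _)]
    refine ⟨fun n => (hasSum_fintype _).summable, ?_⟩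
    simpa only [hfin] using hs
  have h2 := (Finset.HasAntidiagonal.sigmaAntidiagonalEquivProd (A := ℕ)).summable_iff
    (f := fun x : ℕ × ℕ => v (x.1 + x.2))
  refine ⟨h2.1 h1, ?_⟩
  rw [← (Finset.HasAntidiagonal.sigmaAntidiagonalEquivProd (A := ℕ)).tsum_eq]
  refine (h1.tsum_sigma' fun n => (hasSum_fintype _).summable).trans ?_
  exact tsum_congr hfin

theorem summable_tail {v : ℕ → ℝ} (hv : ∀ c, 0 ≤ v c)
    (hs : Summable fun c : ℕ => ((c : ℝ) + 1) * v c) :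
    Summable (fun a : ℕ => ∑' b : ℕ, v (a + b)) ∧
      ∑' a : ℕ, ∑' b : ℕ, v (a + b) = ∑' c : ℕ, ((c : ℝ) + 1) * v c := by
  obtain ⟨h1, h2⟩ := summable_prod_add hv hs
  exact ⟨h1.prod, by rw [← h2, h1.tsum_prod]⟩

end DoubleSum

section OneDim

variable (p υ : ℤ → ℝ)

/-- The factor `(p_i - ζ) / (p_i + ζ)`. -/
noncomputable def tau (i : ℤ) (ζ : ℂ) : ℂ := (p i - ζ) / (p i + ζ)

/-- The product of `r` consecutive factors `tau`, starting at `l`. -/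
noncomputable def prodTau (l : ℤ) (r : ℕ) (ζ : ℂ) : ℂ := ∏ s ∈ Finset.range r, tau p (l + s) ζ

/-- The Green function of the free equation. -/
noncomputable def kern (l : ℤ) (r : ℕ) (ζ : ℂ) : ℂ :=
  ∑ s ∈ Finset.range r, prodTau p l s ζ / (p (l + s) + ζ)

variable {p υ}

theorem norm_tau_le {i : ℤ} (hp : 0 < p i) {ζ : ℂ} (h : ζ ∈ rhp) : ‖tau p i ζ‖ ≤ 1 := by
  rw [tau, norm_div]
  exact div_le_one_of_le₀ (norm_sub_le_norm_add hp h) (norm_nonneg _)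

theorem norm_prodTau_le (hp : ∀ i, 0 < p i) (l : ℤ) (r : ℕ) {ζ : ℂ} (h : ζ ∈ rhp) :
    ‖prodTau p l r ζ‖ ≤ 1 := by
  rw [prodTau, norm_prod]
  exact Finset.prod_le_one (fun _ _ => norm_nonneg _) fun _ _ => norm_tau_le (hp _) h

theorem prodTau_succ (l : ℤ) (r : ℕ) (ζ : ℂ) :
    prodTau p l (r + 1) ζ = prodTau p l r ζ * tau p (l + r) ζ := Finset.prod_range_succ _ _

theorem kern_succ (l : ℤ) (r : ℕ) (ζ : ℂ) :
    kern p l (r + 1) ζ = kern p l r ζ + prodTau p l r ζ / (p (l + r) + ζ) :=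
  Finset.sum_range_succ _ _

/-- Telescoping of 1 - τ = 2ζ / (p + ζ). The Green function is (1 - ∏ τ) / (2ζ); its definition as a
sum has no singularity at ζ = 0, while this form shows the decay in ζ. -/
theorem two_mul_kern (hp : ∀ i, 0 < p i) (l : ℤ) (r : ℕ) {ζ : ℂ} (h : ζ ∈ rhp) :
    2 * ζ * kern p l r ζ = 1 - prodTau p l r ζ := by
  induction r with
  | zero => simp [kern, prodTau]
  | succ r ih =>
    rw [kern_succ, prodTau_succ, mul_add, ih, tau]
    have := add_ne_zero_of_pos (hp (l + r)) h
    field_simp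
    ring

theorem norm_kern_mul_le (hp : ∀ i, 0 < p i) (l : ℤ) (r : ℕ) {ζ : ℂ} (h : ζ ∈ rhp) :
    ‖kern p l r ζ‖ * ‖ζ‖ ≤ 1 := by
  have h1 := congrArg norm (two_mul_kern hp l r h)
  rw [norm_mul, norm_mul, Complex.norm_ofNat] at h1
  have h2 := norm_sub_le (1 : ℂ) (prodTau p l r ζ)
  have h3 := norm_prodTau_le hp l r h
  rw [norm_one] at h2
  nlinarith

/-- Uniform up to ζ = 0, at the price of linear growth in the distance r; the first moment of the
potential pays for that growth. -/
theorem norm_kern_le {pm : ℝ} (hpm : 0 < pm) (hp : ∀ i, pm ≤ p i) (l : ℤ) (r : ℕ) {ζ : ℂ}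
    (h : ζ ∈ rhp) : ‖kern p l r ζ‖ ≤ r / pm := by
  have hp' : ∀ i, 0 < p i := fun i => hpm.trans_le (hp i)
  refine (norm_sum_le _ _).trans ?_
  refine (Finset.sum_le_card_nsmul _ _ (1 / pm) fun s _ => ?_).trans ?_
  · rw [norm_div]
    exact div_le_div₀ zero_le_one (norm_prodTau_le hp' _ _ h) hpm ((hp _).trans (le_norm_add h))
  · rw [Finset.card_range, nsmul_eq_mul, mul_one_div]

theorem continuousOn_prodTau (hp : ∀ i, 0 < p i) (l : ℤ) (r : ℕ) :
    ContinuousOn (prodTau p l r) rhp :=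
  continuousOn_finsetProd _ fun _ _ => (continuousOn_const.sub continuousOn_id).div
    (continuousOn_const.add continuousOn_id) fun _ h => add_ne_zero_of_pos (hp _) h

theorem differentiableOn_prodTau (hp : ∀ i, 0 < p i) (l : ℤ) (r : ℕ) :
    DifferentiableOn ℂ (prodTau p l r) orhp :=
  DifferentiableOn.fun_finsetProd fun _ _ => ((differentiableOn_const _).sub differentiableOn_id).div
    ((differentiableOn_const _).add differentiableOn_id)
    fun _ h => add_ne_zero_of_pos (hp _) (orhp_subset h)

theorem continuousOn_kern (hp : ∀ i, 0 < p i) (l : ℤ) (r : ℕ) :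
    ContinuousOn (kern p l r) rhp :=
  continuousOn_finsetSum _ fun _ _ => (continuousOn_prodTau hp _ _).div
    (continuousOn_const.add continuousOn_id) fun _ h => add_ne_zero_of_pos (hp _) h

theorem differentiableOn_kern (hp : ∀ i, 0 < p i) (l : ℤ) (r : ℕ) :
    DifferentiableOn ℂ (kern p l r) orhp :=
  DifferentiableOn.fun_sum fun _ _ => (differentiableOn_prodTau hp _ _).div
    ((differentiableOn_const _).add differentiableOn_id)
    fun _ h => add_ne_zero_of_pos (hp _) (orhp_subset h)

end OneDim
end Q3

/-! ### Iteration of the Volterra equation near the left end. -/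

namespace Q3

/-- The data of the three-point equation along a staircase. -/
structure OneDim (p υ : ℤ → ℝ) (pm pM : ℝ) : Prop where
  pm_pos : 0 < pm
  pm_le : ∀ i, pm ≤ p i
  le_pM : ∀ i, p i ≤ pM
  summable : Summable fun i : ℤ => |υ i| * (1 + |(i : ℝ)|)

/-- The successive approximations to the solution of the Volterra equation. -/
noncomputable def picard (p υ : ℤ → ℝ) : ℕ → ℤ → ℂ → ℂ
  | 0 => fun _ _ => 1
  | k + 1 => fun i ζ => ∑' b : ℕ, kern p (i - b) b ζ * υ (i - b) * picard p υ k (i - b) ζ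

/-- The three-point equation for the left-normalised function along a staircase. -/
def IsSol (p υ : ℤ → ℝ) (ζ : ℂ) (f : ℤ → ℂ) (i : ℤ) : Prop :=
  (p i + ζ) * f (i + 1) - (p (i - 1) + p i + υ i : ℝ) * f i + (p (i - 1) - ζ) * f (i - 1) = 0

namespace OneDim

variable {p υ : ℤ → ℝ} {pm pM : ℝ}

theorem pos (H : OneDim p υ pm pM) (i : ℤ) : 0 < p i := H.pm_pos.trans_le (H.pm_le i)

theorem summable_left (H : OneDim p υ pm pM) (i : ℤ) :
    Summable fun b : ℕ => ((b : ℝ) + 1) * |υ (i - b)| := by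
  have inj : Function.Injective fun b : ℕ => i - (b : ℤ) := by
    intro a b h; simpa using h
  have h1 := (H.summable.comp_injective inj).mul_left (1 + |(i : ℝ)|)
  refine Summable.of_nonneg_of_le (fun b => by positivity) (fun b => ?_) h1
  simp only [Function.comp]
  have h2 : (b : ℝ) ≤ |(i : ℝ)| + |((i - b : ℤ) : ℝ)| := by
    push_cast
    have := abs_sub (i : ℝ) ((i : ℝ) - b)
    rw [show (i : ℝ) - (i - b) = b by ring, abs_of_nonneg (Nat.cast_nonneg b)] at this
    exact this
  have h3 : (b : ℝ) + 1 ≤ (1 + |(i : ℝ)|) * (1 + |((i - b : ℤ) : ℝ)|) := by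
    nlinarith [abs_nonneg (i : ℝ), abs_nonneg ((i - b : ℤ) : ℝ),
      mul_nonneg (abs_nonneg (i : ℝ)) (abs_nonneg ((i - b : ℤ) : ℝ))]
  calc ((b : ℝ) + 1) * |υ (i - b)|
      ≤ (1 + |(i : ℝ)|) * (1 + |((i - b : ℤ) : ℝ)|) * |υ (i - b)| := by gcongr
    _ = _ := by ring

theorem summable_mul_left (H : OneDim p υ pm pM) (i : ℤ) :
    Summable fun b : ℕ => (b : ℝ) * |υ (i - b)| :=
  Summable.of_nonneg_of_le (fun b => by positivity) (fun b => by gcongr; linarith)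
    (H.summable_left i)

theorem summable_abs_left (H : OneDim p υ pm pM) (i : ℤ) :
    Summable fun b : ℕ => |υ (i - b)| :=
  Summable.of_nonneg_of_le (fun b => by positivity)
    (fun b => le_mul_of_one_le_left (abs_nonneg _) (by linarith [Nat.cast_nonneg (α := ℝ) b]))
    (H.summable_left i)

/-- For i ≤ 0 the site i - b has distance at least b from the origin, so the sum is at most a tail
of the moment series. -/
theorem tendsto_left (H : OneDim p υ pm pM) :
    Tendsto (fun i : ℤ => ∑' b : ℕ, (b : ℝ) * |υ (i - b)|) atBot (𝓝 0) := by
  set w : ℕ → ℝ := fun b => (1 + |((-b : ℤ) : ℝ)|) * |υ (-b)| with hw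
  have hws : Summable w := by
    have inj : Function.Injective fun b : ℕ => -(b : ℤ) := by
      intro a b h; simpa using h
    refine (H.summable.comp_injective inj).congr fun b => ?_
    simp [hw, mul_comm]
  have h1 := (tendsto_sum_nat_add w).comp
    (tendsto_atTop_atTop.2 fun k : ℕ => ⟨(k : ℤ), fun i hi => by omega⟩ :
      Tendsto Int.toNat atTop atTop)
  refine squeeze_zero' (Eventually.of_forall fun i => tsum_nonneg fun b => by positivity) ?_
    (h1.comp tendsto_neg_atBot_atTop)
  filter_upwards [eventually_le_atBot (0 : ℤ)] with i hi
  simp only [Function.comp]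
  obtain ⟨k, rfl⟩ : ∃ k : ℕ, i = -(k : ℤ) := ⟨(-i).toNat, by omega⟩
  rw [neg_neg, Int.toNat_natCast]
  refine Summable.tsum_le_tsum (fun b => ?_) (H.summable_mul_left _)
    ((summable_nat_add_iff k).2 hws)
  simp only [hw]
  have e : (-(k : ℤ) - b) = -((b + k : ℕ) : ℤ) := by push_cast; ring
  rw [e]
  gcongr
  push_cast
  rw [abs_neg, abs_of_nonneg (by positivity)]
  linarith [Nat.cast_nonneg (α := ℝ) k]

/-- Left of i₀ the bound r / pm on the kernel makes the Volterra operator a contraction with factor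
1/2, uniformly in ζ. -/
theorem exists_small (H : OneDim p υ pm pM) :
    ∃ i₀ : ℤ, ∀ i ≤ i₀, ∑' b : ℕ, (b : ℝ) * |υ (i - b)| ≤ pm / 2 :=
  (H.tendsto_left.eventually (ge_mem_nhds (half_pos H.pm_pos))).exists_forall_of_atBot

variable {i₀ : ℤ}

theorem norm_term_le (H : OneDim p υ pm pM) {ζ : ℂ} (hζ : ζ ∈ rhp) (i : ℤ) (b : ℕ) {x : ℂ} {M : ℝ}
    (hx : ‖x‖ ≤ M) : ‖kern p (i - b) b ζ * υ (i - b) * x‖ ≤ (b * |υ (i - b)|) * (M / pm) := by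
  rw [norm_mul, norm_mul, Complex.norm_real, Real.norm_eq_abs]
  have h1 := norm_kern_le H.pm_pos H.pm_le (i - b) b hζ
  have h2 := H.pm_pos
  calc _ ≤ (b / pm) * |υ (i - b)| * M := by gcongr
    _ = _ := by ring

theorem norm_picard_le (H : OneDim p υ pm pM)
    (hi₀ : ∀ i ≤ i₀, ∑' b : ℕ, (b : ℝ) * |υ (i - b)| ≤ pm / 2) (k : ℕ) {i : ℤ} (hi : i ≤ i₀)
    {ζ : ℂ} (hζ : ζ ∈ rhp) : ‖picard p υ k i ζ‖ ≤ (1 / 2) ^ k := by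
  induction k generalizing i with
  | zero => simp [picard]
  | succ k ih =>
    have hsum := (H.summable_mul_left i).hasSum.mul_right ((1 / 2) ^ k / pm)
    refine (tsum_of_norm_bounded hsum fun b => H.norm_term_le hζ i b (ih (by omega))).trans ?_
    have h := hi₀ i hi
    have hpm := H.pm_pos
    calc _ ≤ pm / 2 * ((1 / 2) ^ k / pm) := by gcongr
      _ = _ := by field_simp; ring

theorem picard_reg (H : OneDim p υ pm pM)
    (hi₀ : ∀ i ≤ i₀, ∑' b : ℕ, (b : ℝ) * |υ (i - b)| ≤ pm / 2) (k : ℕ) {i : ℤ} (hi : i ≤ i₀) :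
    ContinuousOn (picard p υ k i) rhp ∧ DifferentiableOn ℂ (picard p υ k i) orhp := by
  induction k generalizing i with
  | zero => exact ⟨continuousOn_const, differentiableOn_const _⟩
  | succ k ih =>
    have hsum := (H.summable_mul_left i).mul_right ((1 / 2) ^ k / pm)
    have hle : ∀ (b : ℕ), ∀ ζ ∈ rhp,
        ‖kern p (i - b) b ζ * υ (i - b) * picard p υ k (i - b) ζ‖
          ≤ (b * |υ (i - b)|) * ((1 / 2) ^ k / pm) := fun b ζ hζ =>
      H.norm_term_le hζ i b (H.norm_picard_le hi₀ k (by omega) hζ)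
    constructor
    · refine continuousOn_tsum (fun b => ?_) hsum hle
      exact ((continuousOn_kern H.pos _ _).mul continuousOn_const).mul (ih (by omega)).1
    · refine Complex.differentiableOn_tsum_of_summable_norm hsum (fun b => ?_) isOpen_orhp
        fun b ζ hζ => hle b ζ (orhp_subset hζ)
      exact ((differentiableOn_kern H.pos _ _).mul (differentiableOn_const _)).mul
        (ih (by omega)).2

/-- The solution of the Volterra equation on the left half-line. -/
theorem exists_volterra (H : OneDim p υ pm pM)
    (hi₀ : ∀ i ≤ i₀, ∑' b : ℕ, (b : ℝ) * |υ (i - b)| ≤ pm / 2) :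
    ∃ f : ℤ → ℂ → ℂ, ∀ i ≤ i₀, ContinuousOn (f i) rhp ∧ DifferentiableOn ℂ (f i) orhp ∧
      ∀ ζ ∈ rhp, ‖f i ζ‖ ≤ 2 ∧ f i ζ = 1 + ∑' b : ℕ, kern p (i - b) b ζ * υ (i - b) * f (i - b) ζ := by
  have hgeo : HasSum (fun k : ℕ => (1 / 2 : ℝ) ^ k) 2 := hasSum_geometric_two
  refine ⟨fun i ζ => ∑' k, picard p υ k i ζ, fun i hi => ⟨?_, ?_, fun ζ hζ => ⟨?_, ?_⟩⟩⟩
  · exact continuousOn_tsum (fun k => (H.picard_reg hi₀ k hi).1) hgeo.summable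
      fun k ζ hζ => H.norm_picard_le hi₀ k hi hζ
  · exact Complex.differentiableOn_tsum_of_summable_norm hgeo.summable
      (fun k => (H.picard_reg hi₀ k hi).2) isOpen_orhp
      fun k ζ hζ => H.norm_picard_le hi₀ k hi (orhp_subset hζ)
  · exact tsum_of_norm_bounded hgeo fun k => H.norm_picard_le hi₀ k hi hζ
  · have hs : ∀ i ≤ i₀, Summable fun k => picard p υ k i ζ := fun i hi =>
      Summable.of_norm_bounded hgeo.summable fun k => H.norm_picard_le hi₀ k hi hζ
    simp only
    rw [(hs i hi).tsum_eq_zero_add]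
    -- Absolute convergence of the double series over sites and iterations allows the two sums to be
    -- interchanged, which turns the recursion of the iterates into the fixed-point equation.
    have h2 : Summable (Function.uncurry fun (b : ℕ) (k : ℕ) =>
        kern p (i - b) b ζ * υ (i - b) * picard p υ k (i - b) ζ) := by
      have := (H.summable_mul_left i).mul_of_nonneg (hgeo.summable.mul_right (1 / pm))
        (fun b => by simp only [Pi.zero_apply]; positivity)
        (fun b => by have := H.pm_pos; simp only [Pi.zero_apply]; positivity)
      refine Summable.of_norm_bounded this fun x => ?_
      refine (H.norm_term_le hζ i x.1 (H.norm_picard_le hi₀ x.2 (by omega) hζ)).trans (le_of_eq ?_)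
      ring
    have h3 := h2.tsum_comm
    simp only [picard]
    rw [h3]
    congr 1
    exact tsum_congr fun b => tsum_mul_left

end OneDim
end Q3

/-! ### The three-point equation and uniqueness of the normalised solution. -/

namespace Q3
namespace OneDim

variable {p υ : ℤ → ℝ} {pm pM : ℝ} {i₀ : ℤ}

/-- Lengthening the Green function by one step adds a product of factors τ divided by p + ζ. The
increment of f is thus a sum `d` over the potential, and `d` satisfies a first-order recursion;
together these are the three-point equation. The decay in ζ uses the bound |kern| |ζ| ≤ 1, and the
increments only need |∏ τ| ≤ 1. -/
theorem volterra_props (H : OneDim p υ pm pM) {ζ : ℂ} (hζ : ζ ∈ rhp) {f : ℤ → ℂ}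
    (hf : ∀ i ≤ i₀, ‖f i‖ ≤ 2 ∧ f i = 1 + ∑' b : ℕ, kern p (i - b) b ζ * υ (i - b) * f (i - b)) :
    (∀ i < i₀, IsSol p υ ζ f i) ∧ Tendsto f atBot (𝓝 1) ∧
      (∀ i ≤ i₀, ‖f i - 1‖ * ‖ζ‖ ≤ 2 * ∑' b : ℕ, |υ (i - b)|) ∧
      ∀ i < i₀, ‖f (i + 1) - f i‖ ≤ 2 / pm * ∑' b : ℕ, |υ (i - b)| := by
  have hpm := H.pm_pos
  have hterm : ∀ i ≤ i₀, ∀ b : ℕ, ‖kern p (i - b) b ζ * υ (i - b) * f (i - b)‖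
      ≤ (b * |υ (i - b)|) * (2 / pm) := fun i hi b =>
    H.norm_term_le hζ i b (hf (i - b) (by omega)).1
  have hsumm : ∀ i ≤ i₀, Summable fun b : ℕ => kern p (i - b) b ζ * υ (i - b) * f (i - b) :=
    fun i hi => Summable.of_norm_bounded ((H.summable_mul_left i).mul_right _) (hterm i hi)
  set d : ℤ → ℂ := fun i => ∑' b : ℕ, prodTau p (i - b) b ζ * υ (i - b) * f (i - b) with hd
  have hdterm : ∀ i ≤ i₀, ∀ b : ℕ, ‖prodTau p (i - b) b ζ * υ (i - b) * f (i - b)‖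
      ≤ |υ (i - b)| * 2 := by
    intro i hi b
    rw [norm_mul, norm_mul, Complex.norm_real, Real.norm_eq_abs]
    have h1 := norm_prodTau_le H.pos (i - b) b hζ
    have h2 := (hf (i - b) (by omega)).1
    calc _ ≤ 1 * |υ (i - b)| * 2 := by gcongr
      _ = _ := by ring
  have hdsumm : ∀ i ≤ i₀, Summable fun b : ℕ => prodTau p (i - b) b ζ * υ (i - b) * f (i - b) :=
    fun i hi => Summable.of_norm_bounded ((H.summable_abs_left i).mul_right _) (hdterm i hi)
  have hne : ∀ i, (p i : ℂ) + ζ ≠ 0 := fun i => add_ne_zero_of_pos (H.pos i) hζ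
  have hdiff : ∀ i < i₀, f (i + 1) - f i = d i / (p i + ζ) := by
    intro i hi
    rw [(hf (i + 1) (by omega)).2, (hf i hi.le).2, (hsumm (i + 1) (by omega)).tsum_eq_zero_add]
    have e : ∀ b : ℕ, (i + 1 - ((b + 1 : ℕ) : ℤ)) = i - b := fun b => by push_cast; ring
    have hs2 : Summable fun b : ℕ => kern p (i - b) (b + 1) ζ * υ (i - b) * f (i - b) := by
      refine ((summable_nat_add_iff 1).2 (hsumm (i + 1) (by omega))).congr fun b => ?_
      simp only [e]
    simp only [e]
    -- The term b = 0 carries an empty Green function. After it is dropped, the sums for i + 1 and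
    -- for i run over the same sites.
    rw [show kern p (i + 1 - ((0 : ℕ) : ℤ)) 0 ζ = 0 by simp [kern]]
    rw [zero_mul, zero_mul, zero_add, add_sub_add_left_eq_sub, ← hs2.tsum_sub (hsumm i hi.le), hd,
      ← tsum_div_const]
    refine tsum_congr fun b => ?_
    rw [kern_succ, sub_add_cancel]
    ring
  have hdrec : ∀ i ≤ i₀, d i = υ i * f i + tau p (i - 1) ζ * d (i - 1) := by
    intro i hi
    simp only [hd]
    rw [(hdsumm i hi).tsum_eq_zero_add, ← tsum_mul_left]
    congr 1
    · simp [prodTau]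
    · refine tsum_congr fun b => ?_
      have e : (i - ((b + 1 : ℕ) : ℤ)) = i - 1 - b := by push_cast; ring
      rw [e, prodTau_succ, sub_add_cancel]
      ring
  refine ⟨fun i hi => ?_, ?_, fun i hi => ?_, fun i hi => ?_⟩
  · have h1 := hdiff i hi
    have h2 := hdiff (i - 1) (by omega)
    have h3 := hdrec i hi.le
    rw [eq_div_iff (hne _)] at h1 h2
    rw [sub_add_cancel] at h2
    rw [tau, div_mul_eq_mul_div, ← sub_eq_iff_eq_add', eq_div_iff (hne _)] at h3
    have h4 : (d i - υ i * f i) = (p (i - 1) - ζ) * (f i - f (i - 1)) := by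
      apply mul_right_cancel₀ (hne (i - 1))
      rw [h3, ← h2]; ring
    rw [IsSol]
    push_cast
    linear_combination h1 + h4
  · rw [tendsto_iff_norm_sub_tendsto_zero]
    have h1 := H.tendsto_left.mul_const (2 / pm)
    rw [zero_mul] at h1
    refine squeeze_zero' (Eventually.of_forall fun i => norm_nonneg _) ?_ h1
    filter_upwards [eventually_le_atBot i₀] with i hi
    rw [(hf i hi).2, add_sub_cancel_left]
    exact tsum_of_norm_bounded ((H.summable_mul_left i).hasSum.mul_right _) (hterm i hi)
  · rw [(hf i hi).2, add_sub_cancel_left, ← norm_mul, ← tsum_mul_right, mul_comm]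
    refine tsum_of_norm_bounded ((H.summable_abs_left i).hasSum.mul_right _) fun b => ?_
    rw [norm_mul, norm_mul, norm_mul, Complex.norm_real, Real.norm_eq_abs]
    have h1 := norm_kern_mul_le H.pos (i - b) b hζ
    have h2 := (hf (i - b) (by omega)).1
    calc _ = (‖kern p (i - b) b ζ‖ * ‖ζ‖) * |υ (i - b)| * ‖f (i - b)‖ := by ring
      _ ≤ 1 * |υ (i - b)| * 2 := by gcongr
      _ = _ := by ring
  · rw [hdiff i hi, norm_div]
    have h1 : ‖d i‖ ≤ (∑' b : ℕ, |υ (i - b)|) * 2 :=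
      tsum_of_norm_bounded ((H.summable_abs_left i).hasSum.mul_right _) (hdterm i hi.le)
    have h2 : 0 ≤ ∑' b : ℕ, |υ (i - b)| := tsum_nonneg fun _ => abs_nonneg _
    calc _ ≤ (∑' b : ℕ, |υ (i - b)|) * 2 / pm := by
          gcongr
          exact (H.pm_le i).trans (le_norm_add hζ)
      _ = _ := by ring

/-- A solution of the homogeneous problem that vanishes at the left end is zero. -/
theorem eq_zero_of_tendsto (H : OneDim p υ pm pM) {ζ : ℂ} (hζ : ζ ∈ rhp) {e : ℤ → ℂ}
    (he : ∀ i, IsSol p υ ζ e i) (hlim : Tendsto e atBot (𝓝 0)) (i : ℤ) : e i = 0 := by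
  have hpm := H.pm_pos
  have hne : ∀ i, (p i : ℂ) + ζ ≠ 0 := fun i => add_ne_zero_of_pos (H.pos i) hζ
  obtain ⟨i₀, hi₀⟩ := H.exists_small
  -- The three-point equation reads d_i = υ_i e_i + τ_{i-1} d_{i-1}, so d is controlled from the
  -- left by the potential.
  set d : ℤ → ℂ := fun i => (p i + ζ) * (e (i + 1) - e i) with hd
  have hdlim : Tendsto (fun i => ‖d i‖) atBot (𝓝 0) := by
    have h1 : Tendsto (fun i => (pM + ‖ζ‖) * ‖e (i + 1) - e i‖) atBot (𝓝 0) := by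
      have h2 : Tendsto (fun i : ℤ => e (i + 1)) atBot (𝓝 0) :=
        hlim.comp (tendsto_atBot_add_const_right _ 1 tendsto_id)
      simpa using ((h2.sub hlim).norm.const_mul (pM + ‖ζ‖))
    refine squeeze_zero (fun _ => norm_nonneg _) (fun i => ?_) h1
    rw [hd, norm_mul]
    gcongr
    refine (norm_add_le _ _).trans ?_
    rw [Complex.norm_real, Real.norm_eq_abs, abs_of_pos (H.pos i)]
    linarith [H.le_pM i]
  have hdrec : ∀ i, ‖d i‖ ≤ |υ i| * ‖e i‖ + ‖d (i - 1)‖ := by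
    intro i
    have h1 : d i = υ i * e i + tau p (i - 1) ζ * d (i - 1) := by
      have := he i
      rw [IsSol] at this
      push_cast at this
      have h2 := hne (i - 1)
      simp only [hd, tau, sub_add_cancel]
      rw [div_mul_eq_mul_div, mul_left_comm, mul_div_cancel_left₀ _ h2]
      linear_combination this
    rw [h1]
    refine (norm_add_le _ _).trans ?_
    rw [norm_mul, norm_mul, Complex.norm_real, Real.norm_eq_abs]
    have := norm_tau_le (H.pos (i - 1)) hζ
    gcongr
    exact mul_le_of_le_one_left (norm_nonneg _) this
  obtain ⟨M, hM⟩ : ∃ M, ∀ i ≤ i₀, ‖e i‖ ≤ M := by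
    obtain ⟨i₁, h1⟩ := (hlim.norm.eventually (ge_mem_nhds
      (by simp : ‖(0 : ℂ)‖ < 1))).exists_forall_of_atBot
    obtain ⟨M, hM⟩ := ((Set.finite_Icc i₁ i₀).image fun i => ‖e i‖).bddAbove
    refine ⟨max 1 M, fun i hi => ?_⟩
    rcases le_total i i₁ with h | h
    · exact (h1 i h).trans (le_max_left _ _)
    · exact (hM ⟨i, ⟨h, hi⟩, rfl⟩).trans (le_max_right _ _)
  -- Summing the recursion for d from the left end, where both d and e vanish, and then summing the
  -- increments of e gives the same first moment that made the iteration contract. Any bound M may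
  -- therefore be halved.
  have hcontr : ∀ M, (∀ i ≤ i₀, ‖e i‖ ≤ M) → ∀ i ≤ i₀, ‖e i‖ ≤ M / 2 := by
    intro M hM
    have hM0 : 0 ≤ M := (norm_nonneg _).trans (hM i₀ le_rfl)
    have hdb : ∀ i ≤ i₀, ‖d i‖ ≤ M * ∑' b : ℕ, |υ (i - b)| := by
      intro i hi
      have h1 : ∀ K : ℕ, ‖d i‖ ≤ M * (∑ b ∈ Finset.range K, |υ (i - b)|) + ‖d (i - K)‖ := by
        intro K
        induction K with
        | zero => simp
        | succ K ih =>
          have h2 := hdrec (i - K)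
          have h3 := hM (i - K) (by omega)
          rw [Finset.sum_range_succ]
          have e1 : (i - ((K + 1 : ℕ) : ℤ)) = i - K - 1 := by push_cast; ring
          rw [e1]
          nlinarith [abs_nonneg (υ (i - K))]
      have h2 : Tendsto (fun K : ℕ => M * (∑' b : ℕ, |υ (i - b)|) + ‖d (i - K)‖) atTop
          (𝓝 (M * (∑' b : ℕ, |υ (i - b)|) + 0)) := by
        refine tendsto_const_nhds.add (hdlim.comp ?_)
        exact tendsto_atBot_add_const_left _ i (tendsto_neg_atTop_atBot.comp
          (tendsto_natCast_atTop_atTop (R := ℤ)))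
      rw [add_zero] at h2
      refine ge_of_tendsto' h2 fun K => (h1 K).trans ?_
      gcongr
      exact (H.summable_abs_left i).sum_le_tsum _ fun _ _ => abs_nonneg _
    intro i hi
    set v : ℕ → ℝ := fun c => |υ (i - 1 - c)| with hv
    obtain ⟨hs1, hs2⟩ := summable_tail (v := v) (fun _ => abs_nonneg _) (H.summable_left (i - 1))
    have h1 : ∀ K : ℕ, ‖e i‖ ≤ M / pm * (∑ a ∈ Finset.range K, ∑' b : ℕ, v (a + b))
        + ‖e (i - K)‖ := by
      intro K
      induction K with
      | zero => simp
      | succ K ih =>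
        rw [Finset.sum_range_succ]
        have h2 := hdb (i - 1 - K) (by omega)
        have e1 : (i - ((K + 1 : ℕ) : ℤ)) = i - 1 - K := by push_cast; ring
        have e2 : ∑' b : ℕ, |υ (i - 1 - K - b)| = ∑' b : ℕ, v (K + b) := by
          refine tsum_congr fun b => ?_
          simp only [hv]
          congr 2; push_cast; ring
        rw [e2] at h2
        have h3 : ‖e (i - K)‖ ≤ ‖e (i - 1 - K)‖ + ‖d (i - 1 - K)‖ / pm := by
          have e3 : e (i - K) = e (i - 1 - K) + d (i - 1 - K) / (p (i - 1 - K) + ζ) := by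
            simp only [hd]
            rw [mul_div_cancel_left₀ _ (hne _)]
            rw [show i - 1 - (K : ℤ) + 1 = i - K by ring]; ring
          rw [e3]
          refine (norm_add_le _ _).trans ?_
          rw [norm_div]
          gcongr
          exact (H.pm_le _).trans (le_norm_add hζ)
        have h4 : ‖d (i - 1 - K)‖ / pm ≤ M / pm * ∑' b : ℕ, v (K + b) := by
          rw [div_mul_eq_mul_div]; gcongr
        rw [e1, mul_add]
        linarith
    have h2 : Tendsto (fun K : ℕ => M / pm * (∑' a : ℕ, ∑' b : ℕ, v (a + b)) + ‖e (i - K)‖) atTop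
        (𝓝 (M / pm * (∑' a : ℕ, ∑' b : ℕ, v (a + b)) + ‖(0 : ℂ)‖)) := by
      refine tendsto_const_nhds.add (hlim.norm.comp ?_)
      exact tendsto_atBot_add_const_left _ i (tendsto_neg_atTop_atBot.comp
        (tendsto_natCast_atTop_atTop (R := ℤ)))
    rw [norm_zero, add_zero, hs2] at h2
    have h3 : ‖e i‖ ≤ M / pm * ∑' c : ℕ, ((c : ℝ) + 1) * v c := by
      refine ge_of_tendsto' h2 fun K => (h1 K).trans ?_
      rw [← hs2]
      gcongr
      exact hs1.sum_le_tsum _ fun _ _ => tsum_nonneg fun _ => abs_nonneg _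
    have h4 : ∑' c : ℕ, ((c : ℝ) + 1) * v c = ∑' b : ℕ, (b : ℝ) * |υ (i - b)| := by
      rw [(H.summable_mul_left i).tsum_eq_zero_add]
      simp only [Nat.cast_zero, zero_mul, zero_add]
      refine tsum_congr fun b => ?_
      simp only [hv]
      push_cast
      rw [show i - ((b : ℤ) + 1) = i - 1 - b by ring]
    rw [h4] at h3
    calc ‖e i‖ ≤ M / pm * (pm / 2) := h3.trans (by gcongr; exact hi₀ i hi)
      _ = M / 2 := by field_simp
  have hzero : ∀ i ≤ i₀, e i = 0 := by
    intro i hi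
    have h1 : ∀ k : ℕ, ∀ i ≤ i₀, ‖e i‖ ≤ M * (1 / 2) ^ k := by
      intro k
      induction k with
      | zero => simpa using hM
      | succ k ih =>
        intro i hi
        exact (hcontr _ ih i hi).trans (le_of_eq (by rw [pow_succ]; ring))
    have h2 : Tendsto (fun k : ℕ => M * (1 / 2 : ℝ) ^ k) atTop (𝓝 (M * 0)) :=
      (tendsto_pow_atTop_nhds_zero_of_lt_one (by norm_num) (by norm_num)).const_mul M
    rw [mul_zero] at h2
    exact norm_le_zero_iff.1 (ge_of_tendsto' h2 fun k => h1 k i hi)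
  -- Beyond i₀ the recurrence determines each new value, since p_i + ζ ≠ 0.
  have hup : ∀ k : ℕ, ∀ i ≤ i₀ + k, e i = 0 := by
    intro k
    induction k with
    | zero => simpa using hzero
    | succ k ih =>
      intro i hi
      rcases lt_or_eq_of_le hi with h | h
      · exact ih i (by push_cast at h; omega)
      · have h1 := he (i - 1)
        rw [IsSol, ih (i - 1) (by push_cast at h; omega), ih (i - 1 - 1) (by push_cast at h; omega),
          sub_add_cancel, mul_zero, mul_zero, sub_zero, add_zero] at h1
        exact (mul_eq_zero.1 h1).resolve_left (hne _)
  exact hup (i - i₀).toNat i (by omega)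

theorem eq_of_tendsto (H : OneDim p υ pm pM) {ζ : ℂ} (hζ : ζ ∈ rhp) {f g : ℤ → ℂ}
    (hf : ∀ i, IsSol p υ ζ f i) (hg : ∀ i, IsSol p υ ζ g i) (hf1 : Tendsto f atBot (𝓝 1))
    (hg1 : Tendsto g atBot (𝓝 1)) (i : ℤ) : f i = g i := by
  rw [← sub_eq_zero]
  refine H.eq_zero_of_tendsto hζ (e := fun i => f i - g i) (fun i => ?_) ?_ i
  · have h1 := hf i
    have h2 := hg i
    rw [IsSol] at *
    linear_combination h1 - h2
  · simpa using hf1.sub hg1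

end OneDim
end Q3

/-! ### Continuation to the whole staircase and regularity in ζ. -/

namespace Q3

/-- Continuation of a solution of the three-point equation to the right of `i₀`: the values at
`i₀ + k` and `i₀ + k - 1`. -/
noncomputable def extendRight (p υ : ℤ → ℝ) (f : ℤ → ℂ → ℂ) (i₀ : ℤ) : ℕ → (ℂ → ℂ) × (ℂ → ℂ)
  | 0 => (f i₀, f (i₀ - 1))
  | k + 1 => (fun ζ => (((p (i₀ + k - 1) + p (i₀ + k) + υ (i₀ + k) : ℝ) : ℂ)
        * (extendRight p υ f i₀ k).1 ζ
      - (p (i₀ + k - 1) - ζ) * (extendRight p υ f i₀ k).2 ζ) / (p (i₀ + k) + ζ),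
      (extendRight p υ f i₀ k).1)

/-- Regularity of a function on the right half-plane, with the normalisation at infinity. -/
structure HalfReg (f : ℂ → ℂ) : Prop where
  cont : ContinuousOn f rhp
  diff : DifferentiableOn ℂ f orhp
  bound : ∃ C : ℝ, ∀ ζ ∈ rhp, ‖f ζ - 1‖ * ‖ζ‖ ≤ C

theorem HalfReg.congr {f g : ℂ → ℂ} (hf : HalfReg f) (h : ∀ ζ ∈ rhp, g ζ = f ζ) : HalfReg g := by
  obtain ⟨C, hC⟩ := hf.bound
  exact ⟨hf.cont.congr h, hf.diff.congr fun ζ hζ => h ζ (orhp_subset hζ),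
    C, fun ζ hζ => by rw [h ζ hζ]; exact hC ζ hζ⟩

namespace OneDim

variable {p υ : ℤ → ℝ} {pm pM : ℝ}

/-- At infinity the coefficient of f is O(1/ζ) and that of g tends to 1. For f = g = 1 the deviation
from 1 is υ_i / (p_i + ζ), so the normalisation and its rate survive the recurrence. -/
theorem halfReg_step (H : OneDim p υ pm pM) (i : ℤ) {f g : ℂ → ℂ} (hf : HalfReg f)
    (hg : HalfReg g) :
    HalfReg fun ζ => (((p (i - 1) + p i + υ i : ℝ) : ℂ) * f ζ - (p (i - 1) - ζ) * g ζ)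
      / (p i + ζ) := by
  have hne : ∀ ζ ∈ rhp, (p i : ℂ) + ζ ≠ 0 := fun ζ h => add_ne_zero_of_pos (H.pos i) h
  refine ⟨?_, ?_, ?_⟩
  · exact ((continuousOn_const.mul hf.cont).sub
      ((continuousOn_const.sub continuousOn_id).mul hg.cont)).div
      (continuousOn_const.add continuousOn_id) hne
  · exact (((differentiableOn_const _).mul hf.diff).sub
      (((differentiableOn_const _).sub differentiableOn_id).mul hg.diff)).div
      ((differentiableOn_const _).add differentiableOn_id) fun ζ h => hne ζ (orhp_subset h)
  · obtain ⟨C, hC⟩ := hf.bound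
    obtain ⟨C', hC'⟩ := hg.bound
    have hC0 : 0 ≤ C := (mul_nonneg (norm_nonneg _) (norm_nonneg _)).trans (hC 0 (by simp [rhp]))
    have hC0' : 0 ≤ C' := (mul_nonneg (norm_nonneg _) (norm_nonneg _)).trans (hC' 0 (by simp [rhp]))
    refine ⟨|p (i - 1) + p i + υ i| * C / p i + (p (i - 1) / p i + 1) * C' + |υ i|,
      fun ζ hζ => ?_⟩
    have hpi := H.pos i
    have hn := hne ζ hζ
    have e : (((p (i - 1) + p i + υ i : ℝ) : ℂ) * f ζ - (p (i - 1) - ζ) * g ζ) / (p i + ζ) - 1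
        = ((p (i - 1) + p i + υ i : ℝ) : ℂ) * (f ζ - 1) / (p i + ζ)
          - (p (i - 1) - ζ) / (p i + ζ) * (g ζ - 1) + υ i / (p i + ζ) := by
      field_simp
      push_cast
      ring
    have h1 : p i ≤ ‖(p i : ℂ) + ζ‖ := le_norm_add hζ
    have h2 : ‖ζ‖ ≤ ‖(p i : ℂ) + ζ‖ := norm_le_norm_add hpi hζ
    have h3 : ‖(p (i - 1) : ℂ) - ζ‖ / ‖(p i : ℂ) + ζ‖ ≤ p (i - 1) / p i + 1 := by
      refine (div_le_div_of_nonneg_right (norm_sub_le _ _) (norm_nonneg _)).trans ?_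
      rw [add_div, Complex.norm_real, Real.norm_eq_abs, abs_of_pos (H.pos _)]
      have := H.pos (i - 1)
      gcongr
      exact div_le_one_of_le₀ h2 (norm_nonneg _)
    have hz := norm_nonneg ζ
    have hpos : 0 < ‖(p i : ℂ) + ζ‖ := norm_pos_iff.2 hn
    rw [e]
    have t1 : ‖((p (i - 1) + p i + υ i : ℝ) : ℂ) * (f ζ - 1) / (p i + ζ)‖ * ‖ζ‖
        ≤ |p (i - 1) + p i + υ i| * C / p i := by
      rw [norm_div, norm_mul, Complex.norm_real, Real.norm_eq_abs]
      calc _ = |p (i - 1) + p i + υ i| * (‖f ζ - 1‖ * ‖ζ‖) / ‖(p i : ℂ) + ζ‖ := by ring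
        _ ≤ _ := by gcongr; exact hC ζ hζ
    have t2 : ‖(p (i - 1) - ζ) / (p i + ζ) * (g ζ - 1)‖ * ‖ζ‖ ≤ (p (i - 1) / p i + 1) * C' := by
      rw [norm_mul, norm_div, mul_assoc]
      have := H.pos (i - 1)
      gcongr
      exact hC' ζ hζ
    have t3 : ‖(υ i : ℂ) / (p i + ζ)‖ * ‖ζ‖ ≤ |υ i| := by
      rw [norm_div, Complex.norm_real, Real.norm_eq_abs, div_mul_eq_mul_div]
      exact div_le_of_le_mul₀ hpos.le (abs_nonneg _) (by gcongr)
    calc _ ≤ (‖((p (i - 1) + p i + υ i : ℝ) : ℂ) * (f ζ - 1) / (p i + ζ)‖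
            + ‖(p (i - 1) - ζ) / (p i + ζ) * (g ζ - 1)‖ + ‖(υ i : ℂ) / (p i + ζ)‖) * ‖ζ‖ := by
          gcongr
          exact (norm_add_le _ _).trans (add_le_add_left (norm_sub_le _ _) _)
      _ ≤ _ := by rw [add_mul, add_mul]; linarith

/-- Existence of the solution normalised at the left end of a staircase. -/
theorem exists_jost (H : OneDim p υ pm pM) :
    ∃ f : ℤ → ℂ → ℂ, (∀ ζ ∈ rhp, (∀ i, IsSol p υ ζ (f · ζ) i) ∧
        Tendsto (f · ζ) atBot (𝓝 1)) ∧
      (∀ i, HalfReg (f i)) ∧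
      ∃ (i₀ : ℤ) (w : ℕ → ℝ), Summable w ∧ ∀ ζ ∈ rhp, ∀ a : ℕ,
        ‖f (i₀ - a) ζ‖ ≤ 2 ∧ ‖f (i₀ - a) ζ - f (i₀ - a - 1) ζ‖ ≤ w a := by
  obtain ⟨i₀, hi₀⟩ := H.exists_small
  obtain ⟨f₀, hf₀⟩ := H.exists_volterra hi₀
  have hprops := fun ζ (hζ : ζ ∈ rhp) => H.volterra_props hζ (f := (f₀ · ζ))
    fun i hi => (hf₀ i hi).2.2 ζ hζ
  set E := extendRight p υ f₀ i₀ with hE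
  set f : ℤ → ℂ → ℂ := fun i => if i ≤ i₀ then f₀ i else (E (i - i₀).toNat).1 with hf
  have hfl : ∀ i ≤ i₀, f i = f₀ i := fun i hi => by simp [hf, hi]
  have hE2 : ∀ k : ℕ, f (i₀ + k) = (E k).1 ∧ f (i₀ + k - 1) = (E k).2 := by
    have h1 : ∀ k : ℕ, f (i₀ + k) = (E k).1 := by
      intro k
      rcases Nat.eq_zero_or_pos k with rfl | hk
      · simp [hfl, hE, extendRight]
      · have h1 : ¬ i₀ + (k : ℤ) ≤ i₀ := by omega
        simp [hf, h1]
    intro k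
    refine ⟨h1 k, ?_⟩
    cases k with
    | zero => rw [hfl _ (by simp)]; simp [hE, extendRight]
    | succ k =>
      rw [show i₀ + ((k + 1 : ℕ) : ℤ) - 1 = i₀ + k by push_cast; ring, h1 k]
      simp [hE, extendRight]
  have hstep : ∀ k : ℕ, f (i₀ + k + 1) = fun ζ =>
      (((p (i₀ + k - 1) + p (i₀ + k) + υ (i₀ + k) : ℝ) : ℂ) * f (i₀ + k) ζ
        - (p (i₀ + k - 1) - ζ) * f (i₀ + k - 1) ζ) / (p (i₀ + k) + ζ) := by
    intro k
    have := (hE2 (k + 1)).1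
    push_cast at this
    rw [add_assoc, this, (hE2 k).1, (hE2 k).2]
    rfl
  have hreg : ∀ k : ℕ, HalfReg (f (i₀ + k)) ∧ HalfReg (f (i₀ + k - 1)) := by
    have hbase : ∀ i ≤ i₀, HalfReg (f i) := by
      intro i hi
      rw [hfl i hi]
      exact ⟨(hf₀ i hi).1, (hf₀ i hi).2.1, _, fun ζ hζ => (hprops ζ hζ).2.2.1 i hi⟩
    intro k
    induction k with
    | zero => exact ⟨hbase _ (by simp), hbase _ (by simp)⟩
    | succ k ih =>
      have e : i₀ + ((k + 1 : ℕ) : ℤ) = i₀ + k + 1 := by push_cast; ring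
      rw [e, add_sub_cancel_right]
      refine ⟨?_, ih.1⟩
      rw [hstep k]
      exact H.halfReg_step _ ih.1 ih.2
  refine ⟨f, fun ζ hζ => ⟨fun i => ?_, ?_⟩, fun i => ?_, i₀, ?_⟩
  · rcases lt_or_ge i i₀ with h | h
    · have := (hprops ζ hζ).1 i h
      rw [IsSol] at *
      rwa [hfl _ (by omega), hfl _ (by omega), hfl _ (by omega)]
    · obtain ⟨k, rfl⟩ : ∃ k : ℕ, i = i₀ + k := ⟨(i - i₀).toNat, by omega⟩
      rw [IsSol, hstep k]
      have := add_ne_zero_of_pos (H.pos (i₀ + k)) hζ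
      field_simp
      ring
  · refine (hprops ζ hζ).2.1.congr' ?_
    filter_upwards [eventually_le_atBot i₀] with i hi
    rw [hfl i hi]
  · rcases le_or_gt i i₀ with h | h
    · rw [hfl i h]
      exact ⟨(hf₀ i h).1, (hf₀ i h).2.1, _, fun ζ hζ => (hprops ζ hζ).2.2.1 i h⟩
    · have := (hreg (i - i₀).toNat).1
      rwa [show i₀ + ((i - i₀).toNat : ℤ) = i by omega] at this
  -- The increments are bounded by tails of the potential; these are summable because of the first
  -- moment, and the bound does not involve ζ. Such a majorant is needed for the limit ζ → 0.
  · have hs := (summable_tail (v := fun c => |υ (i₀ - 1 - c)|) (fun _ => abs_nonneg _)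
      (H.summable_left (i₀ - 1))).1
    refine ⟨_, hs.mul_left (2 / pm), fun ζ hζ a => ⟨?_, ?_⟩⟩
    · rw [hfl _ (by omega)]
      exact ((hf₀ (i₀ - a) (by omega)).2.2 ζ hζ).1
    · have h1 := (hprops ζ hζ).2.2.2 (i₀ - a - 1) (by omega)
      rw [sub_add_cancel] at h1
      rw [hfl _ (by omega), hfl _ (by omega)]
      refine h1.trans (le_of_eq ?_)
      congr 1
      refine tsum_congr fun b => ?_
      congr 2; push_cast; ring

end OneDim
end Q3

/-! ### The Wronskian of the solutions at ζ and at 0. -/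

namespace Q3

namespace OneDim

variable {p υ : ℤ → ℝ} {pm pM : ℝ}

/-- The behaviour, as `ζ → 0`, of the Wronskian of the solutions at `ζ` and at `0`. -/
theorem tendsto_wronskian_div (H : OneDim p υ pm pM) {f : ℤ → ℂ → ℂ}
    (hf : ∀ ζ ∈ rhp, (∀ i, IsSol p υ ζ (f · ζ) i) ∧ Tendsto (f · ζ) atBot (𝓝 1))
    (hc : ∀ i, ContinuousOn (f i) rhp) {i₀ : ℤ} {w : ℕ → ℝ} (hw : Summable w)
    (hb : ∀ ζ ∈ rhp, ∀ a : ℕ,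
        ‖f (i₀ - a) ζ‖ ≤ 2 ∧ ‖f (i₀ - a) ζ - f (i₀ - a - 1) ζ‖ ≤ w a) (i : ℤ) :
    Tendsto (fun ζ => ((p i + ζ) * f (i + 1) ζ * f i 0 - p i * f i ζ * f (i + 1) 0) / ζ)
      (𝓝[rhp \ {0}] 0) (𝓝 1) := by
  have h0 : (0 : ℂ) ∈ rhp := by simp [rhp]
  -- J is the Wronskian of the solutions at ζ and at 0. It is not constant: each step adds ζ X, and
  -- it tends to ζ at the left end. This replaces a derivative of f at ζ = 0, which is not available
  -- from the regularity proved for f.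
  set J : ℤ → ℂ → ℂ := fun i ζ => (p i + ζ) * f (i + 1) ζ * f i 0 - p i * f i ζ * f (i + 1) 0
    with hJ
  set X : ℤ → ℂ → ℂ := fun i ζ => f (i - 1) ζ * f i 0 - f i ζ * f (i - 1) 0 with hX
  have hrec : ∀ ζ ∈ rhp, ∀ i, J i ζ = J (i - 1) ζ + ζ * X i ζ := by
    intro ζ hζ i
    have h1 := (hf ζ hζ).1 i
    have h2 := (hf 0 h0).1 i
    simp only [IsSol, add_zero, sub_zero] at h1 h2
    simp only [hJ, hX, sub_add_cancel]
    linear_combination f i 0 * h1 - f i ζ * h2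
  have hle : 𝓝[rhp \ {0}] (0 : ℂ) ≤ 𝓝[rhp] 0 := nhdsWithin_mono _ Set.sdiff_subset
  have hXlim : ∀ i, Tendsto (X i) (𝓝[rhp \ {0}] 0) (𝓝 0) := by
    intro i
    have h1 : Tendsto (X i) (𝓝[rhp] 0) (𝓝 (f (i - 1) 0 * f i 0 - f i 0 * f (i - 1) 0)) :=
      ((hc (i - 1) 0 h0).mul tendsto_const_nhds).sub ((hc i 0 h0).mul tendsto_const_nhds)
    rw [mul_comm, sub_self] at h1
    exact h1.mono_left hle
  -- X is antisymmetric in the two solutions, hence bilinear in values and increments. This gives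
  -- the summable majorant under which the termwise limit X → 0 passes to the sum.
  have hXb : ∀ ζ ∈ rhp, ∀ a : ℕ, ‖X (i₀ - a) ζ‖ ≤ 4 * w a := by
    intro ζ hζ a
    have e : X (i₀ - a) ζ = f (i₀ - a - 1) ζ * (f (i₀ - a) 0 - f (i₀ - a - 1) 0)
        - (f (i₀ - a) ζ - f (i₀ - a - 1) ζ) * f (i₀ - a - 1) 0 := by simp only [hX]; ring
    have e1 : i₀ - (a : ℤ) - 1 = i₀ - ((a + 1 : ℕ) : ℤ) := by push_cast; ring
    have h1 := (hb ζ hζ a).2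
    have h2 := (hb 0 h0 a).2
    have h3 := (hb ζ hζ (a + 1)).1
    have h4 := (hb 0 h0 (a + 1)).1
    rw [← e1] at h3 h4
    have hw0 : 0 ≤ w a := (norm_nonneg _).trans h1
    rw [e]
    refine (norm_sub_le _ _).trans ?_
    rw [norm_mul, norm_mul]
    calc _ ≤ 2 * w a + w a * 2 := by gcongr
      _ = _ := by ring
  have hJ0 : ∀ ζ ∈ rhp, J i₀ ζ = ζ * (1 + ∑' a : ℕ, X (i₀ - a) ζ) := by
    intro ζ hζ
    have hsum : Summable fun a : ℕ => X (i₀ - a) ζ :=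
      Summable.of_norm_bounded (hw.mul_left 4) (hXb ζ hζ)
    have h1 : ∀ K : ℕ, J i₀ ζ - ζ * ∑ a ∈ Finset.range K, X (i₀ - a) ζ = J (i₀ - K) ζ := by
      intro K
      induction K with
      | zero => simp
      | succ K ih =>
        have := hrec ζ hζ (i₀ - K)
        rw [Finset.sum_range_succ]
        rw [show i₀ - ((K + 1 : ℕ) : ℤ) = i₀ - K - 1 by push_cast; ring]
        linear_combination ih + this
    have hbot : Tendsto (fun K : ℕ => i₀ - (K : ℤ)) atTop atBot :=
      tendsto_atBot_add_const_left _ i₀ (tendsto_neg_atTop_atBot.comp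
        (tendsto_natCast_atTop_atTop (R := ℤ)))
    have h2 : Tendsto (fun j => J j ζ) atBot (𝓝 ζ) := by
      have s1 : ∀ ξ ∈ rhp, Tendsto (fun j : ℤ => f (j + 1) ξ) atBot (𝓝 1) := fun ξ hξ =>
        (hf ξ hξ).2.comp (tendsto_atBot_add_const_right _ 1 tendsto_id)
      have a1 : Tendsto (fun j : ℤ => f (j + 1) ζ * f j 0 - f j ζ * f (j + 1) 0) atBot (𝓝 0) := by
        simpa using ((s1 ζ hζ).mul (hf 0 h0).2).sub ((hf ζ hζ).2.mul (s1 0 h0))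
      have a2 : Tendsto (fun j : ℤ => (p j : ℂ) * (f (j + 1) ζ * f j 0 - f j ζ * f (j + 1) 0))
          atBot (𝓝 0) := by
        refine squeeze_zero_norm (a := fun j => pM * ‖f (j + 1) ζ * f j 0 - f j ζ * f (j + 1) 0‖)
          (fun j => ?_) (by simpa using a1.norm.const_mul pM)
        rw [norm_mul, Complex.norm_real, Real.norm_eq_abs, abs_of_pos (H.pos j)]
        gcongr
        exact H.le_pM j
      have a3 : Tendsto (fun j : ℤ => ζ * (f (j + 1) ζ * f j 0)) atBot (𝓝 (ζ * (1 * 1))) :=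
        ((s1 ζ hζ).mul (hf 0 h0).2).const_mul ζ
      have := a2.add a3
      rw [mul_one, mul_one, zero_add] at this
      refine this.congr fun j => ?_
      simp only [hJ]; ring
    have h3 := (hsum.hasSum.tendsto_sum_nat.const_mul ζ).const_sub (J i₀ ζ)
    have h4 := tendsto_nhds_unique (h3.congr h1) (h2.comp hbot)
    linear_combination h4
  have hstart : Tendsto (fun ζ => J i₀ ζ / ζ) (𝓝[rhp \ {0}] 0) (𝓝 1) := by
    have h1 : Tendsto (fun ζ => 1 + ∑' a : ℕ, X (i₀ - a) ζ) (𝓝[rhp \ {0}] 0)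
        (𝓝 (1 + ∑' _ : ℕ, 0)) := by
      refine tendsto_const_nhds.add (tendsto_tsum_of_dominated_convergence (hw.mul_left 4)
        (fun a => hXlim _) ?_)
      filter_upwards [self_mem_nhdsWithin] with ζ hζ a using hXb ζ hζ.1 a
    rw [tsum_zero, add_zero] at h1
    refine h1.congr' ?_
    filter_upwards [self_mem_nhdsWithin] with ζ hζ
    rw [hJ0 ζ hζ.1, mul_div_cancel_left₀ _ hζ.2]
  -- One step changes J / ζ by X, which tends to 0, so the limit at i₀ holds at every i.
  have hmove : ∀ i, Tendsto (fun ζ => J i ζ / ζ) (𝓝[rhp \ {0}] 0) (𝓝 1)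
      ↔ Tendsto (fun ζ => J (i - 1) ζ / ζ) (𝓝[rhp \ {0}] 0) (𝓝 1) := by
    intro i
    have e : ∀ᶠ ζ in 𝓝[rhp \ {0}] (0 : ℂ), J i ζ / ζ = J (i - 1) ζ / ζ + X i ζ := by
      filter_upwards [self_mem_nhdsWithin] with ζ hζ
      rw [hrec ζ hζ.1 i, add_div, mul_div_cancel_left₀ _ hζ.2]
    constructor <;> intro h
    · have := h.sub (hXlim i)
      rw [sub_zero] at this
      refine this.congr' ?_
      filter_upwards [e] with ζ hζ
      rw [hζ]; ring
    · have := h.add (hXlim i)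
      rw [add_zero] at this
      refine this.congr' ?_
      filter_upwards [e] with ζ hζ
      rw [hζ]
  have hall : ∀ c : ℤ, Tendsto (fun ζ => J (i₀ + c) ζ / ζ) (𝓝[rhp \ {0}] 0) (𝓝 1) := by
    intro c
    induction c using Int.induction_on with
    | zero => simpa using hstart
    | succ c ih =>
      rw [hmove, ← add_assoc, add_sub_cancel_right]; exact ih
    | pred c ih =>
      rw [hmove, add_sub_assoc] at ih; exact ih
  have := hall (i - i₀)
  rwa [add_sub_cancel] at this

end OneDim

/-! ### Staircases and their reflection in the origin. -/

section Staircase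

variable {N : ℕ} (Γ : Staircase N)

theorem Staircase.point_zero : Γ.point 0 = 0 := by simp [Staircase.point]

theorem Staircase.point_succ (i : ℤ) : Γ.point (i + 1) = shift (Γ.dir i) (Γ.point i) := by
  simp only [Staircase.point, shift]
  rcases lt_or_ge i 0 with h | h
  · have e1 : Finset.Ico (0 : ℤ) (i + 1) = ∅ := Finset.Ico_eq_empty (by omega)
    have e2 : Finset.Ico (0 : ℤ) i = ∅ := Finset.Ico_eq_empty (by omega)
    have e3 : Finset.Ico i 0 = insert i (Finset.Ico (i + 1) 0) := by
      ext x; simp only [Finset.mem_insert, Finset.mem_Ico]; omega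
    rw [e1, e2, e3, Finset.sum_insert (by simp)]
    simp only [Finset.sum_empty]; abel
  · have e1 : Finset.Ico (i + 1) (0 : ℤ) = ∅ := Finset.Ico_eq_empty (by omega)
    have e2 : Finset.Ico i (0 : ℤ) = ∅ := Finset.Ico_eq_empty (by omega)
    have e3 : Finset.Ico 0 (i + 1) = insert i (Finset.Ico 0 i) := by
      ext x; simp only [Finset.mem_insert, Finset.mem_Ico]; omega
    rw [e1, e2, e3, Finset.sum_insert (by simp)]
    simp only [Finset.sum_empty]; abel

theorem Staircase.add_point_succ (m : Fin N → ℤ) (i : ℤ) :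
    m + Γ.point (i + 1) = shift (Γ.dir i) (m + Γ.point i) := by
  rw [Γ.point_succ, shift_add]

theorem Staircase.add_point_pred (m : Fin N → ℤ) (i : ℤ) :
    shift (Γ.dir (i - 1)) (m + Γ.point (i - 1)) = m + Γ.point i := by
  rw [← Γ.add_point_succ, sub_add_cancel]

theorem Staircase.point_one : Γ.point 1 = shift (Γ.dir 0) 0 := by
  have := Γ.point_succ 0
  rwa [Γ.point_zero, zero_add] at this

/-- The staircase reflected in the origin. -/
def Staircase.reflect : Staircase N where
  dir i := Γ.dir (-1 - i)
  periodic := by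
    obtain ⟨T, hT, h⟩ := Γ.periodic
    refine ⟨T, hT, fun i => ?_⟩
    rw [← h (-1 - (i + T))]
    congr 1; ring

theorem Staircase.reflect_point (i : ℤ) : Γ.reflect.point i = -Γ.point (-i) := by
  have step : ∀ i, Γ.reflect.point i = -Γ.point (-i)
      ↔ Γ.reflect.point (i + 1) = -Γ.point (-(i + 1)) := by
    intro i
    have h1 := Γ.reflect.point_succ i
    have h2 := Γ.point_succ (-(i + 1))
    rw [show -(i + 1) + 1 = -i by ring] at h2
    have h3 : Γ.reflect.dir i = Γ.dir (-(i + 1)) := by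
      simp only [Staircase.reflect]; congr 1; ring
    rw [h1, h2, h3]
    simp only [shift]
    constructor <;> intro h
    · rw [h]; abel
    · have := congrArg (· - Pi.single (Γ.dir (-(i + 1))) (1 : ℤ)) h
      simp only [add_sub_cancel_right] at this
      rw [this]; abel
  induction i using Int.induction_on with
  | zero => simp [Staircase.point_zero]
  | succ i ih => exact (step _).1 ih
  | pred i ih =>
    have := (step (-(i : ℤ) - 1)).2
    rw [sub_add_cancel] at this
    exact this ih

end Staircase
end Q3

/-! ### Propagation of the first moment to all translates of the staircase. -/

namespace Q3

/-- Summability with a first moment. -/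
def MomentSummable (v : ℤ → ℝ) : Prop := Summable fun i : ℤ => |v i| * (1 + |(i : ℝ)|)

namespace MomentSummable

variable {v w : ℤ → ℝ}

theorem mono' (hw : MomentSummable w) (h : ∀ᶠ i in cofinite, |v i| ≤ |w i|) :
    MomentSummable v := by
  refine Summable.of_norm_bounded_eventually hw ?_
  filter_upwards [h] with i hi
  rw [Real.norm_eq_abs, abs_mul, abs_abs, abs_of_pos (by positivity : 0 < 1 + |(i : ℝ)|)]
  gcongr

theorem add (hv : MomentSummable v) (hw : MomentSummable w) :
    MomentSummable fun i => v i + w i := by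
  refine Summable.of_nonneg_of_le (fun i => by positivity) (fun i => ?_) (Summable.add hv hw)
  rw [← add_mul]
  gcongr
  exact abs_add_le _ _

theorem neg (hv : MomentSummable v) : MomentSummable fun i => -v i := by
  simpa [MomentSummable] using hv

theorem sub (hv : MomentSummable v) (hw : MomentSummable w) :
    MomentSummable fun i => v i - w i := by
  simpa only [sub_eq_add_neg] using hv.add hw.neg

theorem shift (hv : MomentSummable v) (c : ℤ) : MomentSummable fun i => v (i + c) := by
  have h1 := (Summable.comp_injective hv (add_left_injective c)).mul_left (1 + |(c : ℝ)|)
  refine Summable.of_nonneg_of_le (fun i => by positivity) (fun i => ?_) h1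
  simp only [Function.comp]
  have h2 : |(i : ℝ)| ≤ |((i + c : ℤ) : ℝ)| + |(c : ℝ)| := by
    push_cast
    have := abs_sub ((i : ℝ) + c) c
    rwa [add_sub_cancel_right] at this
  have h3 : 1 + |(i : ℝ)| ≤ (1 + |(c : ℝ)|) * (1 + |((i + c : ℤ) : ℝ)|) := by
    nlinarith [abs_nonneg (c : ℝ), abs_nonneg ((i + c : ℤ) : ℝ),
      mul_nonneg (abs_nonneg (c : ℝ)) (abs_nonneg ((i + c : ℤ) : ℝ))]
  calc _ ≤ |v (i + c)| * ((1 + |(c : ℝ)|) * (1 + |((i + c : ℤ) : ℝ)|)) := by gcongr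
    _ = _ := by ring

theorem comp_neg (hv : MomentSummable v) : MomentSummable fun i => v (-i) := by
  have := Summable.comp_injective hv neg_injective
  refine this.congr fun i => ?_
  simp [Function.comp]

theorem tendsto (hv : MomentSummable v) : Tendsto v cofinite (𝓝 0) := by
  have h1 : Summable fun i => |v i| :=
    Summable.of_nonneg_of_le (fun i => abs_nonneg _)
      (fun i => le_mul_of_one_le_right (abs_nonneg _) (by linarith [abs_nonneg (i : ℝ)])) hv
  exact (summable_abs_iff.1 h1).tendsto_cofinite_zero

/-- A sequence that is contracted backwards up to a summable error is summable. -/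
theorem of_contraction (hv : MomentSummable v) {q : ℤ → ℝ} (hq : Tendsto q cofinite (𝓝 0))
    {θ : ℝ} (hθ0 : 0 ≤ θ) (hθ : θ < 1)
    (h : ∀ᶠ i in cofinite, |q i| ≤ θ * |q (i + 1)| + |v i|) : MomentSummable q := by
  -- The excess over the contraction absorbs the finitely many exceptional indices, so the
  -- inequality holds at every i with an error that is still moment-summable.
  set e : ℤ → ℝ := fun i => max 0 (|q i| - θ * |q (i + 1)|) with he
  have he0 : ∀ i, 0 ≤ e i := fun i => le_max_left _ _
  have hes : MomentSummable e := by
    refine hv.mono' ?_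
    filter_upwards [h] with i hi
    rw [abs_of_nonneg (he0 i)]
    exact max_le (abs_nonneg _) (by linarith)
  have hqe : ∀ i, |q i| ≤ θ * |q (i + 1)| + e i := fun i => by
    have := le_max_right 0 (|q i| - θ * |q (i + 1)|)
    simp only [he]; linarith
  obtain ⟨M, hM⟩ := hq.abs.bddAbove_range_of_cofinite
  have hM' : ∀ i, |q i| ≤ M := fun i => hM ⟨i, rfl⟩
  have hgeo : Summable fun k : ℕ => θ ^ k * ((k : ℝ) + 1) := by
    have h1 := summable_pow_mul_geometric_of_norm_lt_one (R := ℝ) 1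
      (r := θ) (by rwa [Real.norm_eq_abs, abs_of_nonneg hθ0])
    have h2 := summable_geometric_of_lt_one hθ0 hθ
    refine (h1.add h2).congr fun k => ?_
    rw [pow_one]; ring
  have hprod : Summable fun x : ℤ × ℕ => (e x.1 * (1 + |(x.1 : ℝ)|)) * (θ ^ x.2 * ((x.2 : ℝ) + 1)) := by
    have hes' : Summable fun i : ℤ => e i * (1 + |(i : ℝ)|) := by
      refine Summable.congr hes fun i => ?_
      rw [abs_of_nonneg (he0 i)]
    exact hes'.mul_of_nonneg hgeo (fun i => mul_nonneg (he0 i) (by positivity))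
      (fun k => by simp only [Pi.zero_apply]; positivity)
  -- Iteration bounds q_i by the sum of θ^k e_{i+k}. In the coordinates (i + k, k) this double
  -- series is dominated by a product of two summable series, with the weight split as 1 + |i| ≤ (k
  -- + 1)(1 + |i + k|).
  have hinj : Function.Injective fun x : ℤ × ℕ => ((x.1 + x.2, x.2) : ℤ × ℕ) := by
    rintro ⟨a, b⟩ ⟨c, d⟩ hx
    simp only [Prod.mk.injEq] at hx
    obtain ⟨h1, rfl⟩ := hx
    simpa using h1
  have hF : Summable fun x : ℤ × ℕ => θ ^ x.2 * e (x.1 + x.2) * (1 + |(x.1 : ℝ)|) := by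
    refine Summable.of_nonneg_of_le (fun x => mul_nonneg (mul_nonneg (by positivity) (he0 _))
      (by positivity)) (fun x => ?_) (hprod.comp_injective hinj)
    simp only [Function.comp]
    have h2 : |(x.1 : ℝ)| ≤ |((x.1 + x.2 : ℤ) : ℝ)| + x.2 := by
      push_cast
      have := abs_sub ((x.1 : ℝ) + x.2) x.2
      rwa [add_sub_cancel_right, Nat.abs_cast] at this
    have h3 : 1 + |(x.1 : ℝ)| ≤ ((x.2 : ℝ) + 1) * (1 + |((x.1 + x.2 : ℤ) : ℝ)|) := by
      nlinarith [Nat.cast_nonneg (α := ℝ) x.2, abs_nonneg ((x.1 + x.2 : ℤ) : ℝ),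
        mul_nonneg (Nat.cast_nonneg (α := ℝ) x.2) (abs_nonneg ((x.1 + x.2 : ℤ) : ℝ))]
    have h4 := he0 (x.1 + x.2)
    calc _ ≤ θ ^ x.2 * e (x.1 + x.2) * (((x.2 : ℝ) + 1) * (1 + |((x.1 + x.2 : ℤ) : ℝ)|)) := by
          gcongr
      _ = _ := by ring
  refine Summable.of_nonneg_of_le (fun i => by positivity) (fun i => ?_) hF.prod
  have hsi : Summable fun k : ℕ => θ ^ k * e (i + k) * (1 + |(i : ℝ)|) := hF.prod_factor i
  have h1 : ∀ K : ℕ, |q i| ≤ (∑ k ∈ Finset.range K, θ ^ k * e (i + k)) + θ ^ K * |q (i + K)| := by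
    intro K
    induction K with
    | zero => simp
    | succ K ih =>
      have h2 := hqe (i + K)
      rw [Finset.sum_range_succ, pow_succ]
      have h3 : 0 ≤ θ ^ K := by positivity
      have e1 : i + ((K + 1 : ℕ) : ℤ) = i + K + 1 := by push_cast; ring
      rw [e1]
      nlinarith
  have hpos : 0 < 1 + |(i : ℝ)| := by positivity
  have hsi' : Summable fun k : ℕ => θ ^ k * e (i + k) := (summable_mul_right_iff hpos.ne').1 hsi
  have h2 : |q i| ≤ ∑' k : ℕ, θ ^ k * e (i + k) := by
    have h3 : Tendsto (fun K : ℕ => (∑' k : ℕ, θ ^ k * e (i + k)) + θ ^ K * M) atTop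
        (𝓝 ((∑' k : ℕ, θ ^ k * e (i + k)) + 0 * M)) :=
      tendsto_const_nhds.add ((tendsto_pow_atTop_nhds_zero_of_lt_one hθ0 hθ).mul_const M)
    rw [zero_mul, add_zero] at h3
    refine ge_of_tendsto' h3 fun K => (h1 K).trans ?_
    gcongr
    · exact hsi'.sum_le_tsum _ fun k _ => mul_nonneg (by positivity) (he0 _)
    · exact hM' _
  calc |q i| * (1 + |(i : ℝ)|) ≤ (∑' k : ℕ, θ ^ k * e (i + k)) * (1 + |(i : ℝ)|) := by gcongr
    _ = _ := tsum_mul_right.symm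

end MomentSummable

theorem tendsto_cofinite_add {q : ℤ → ℝ} {a : ℝ} (h : Tendsto q cofinite (𝓝 a)) (c : ℤ) :
    Tendsto (fun i => q (i + c)) cofinite (𝓝 a) :=
  h.comp (add_left_injective c).tendsto_cofinite

variable {N : ℕ}

/-- The potential along the translate of the staircase by `m`. -/
noncomputable def pot (p : Fin N → ℝ) (Γ : Staircase N) (g h : Fin N → (Fin N → ℤ) → ℝ)
    (m : Fin N → ℤ) (i : ℤ) : ℝ :=
  om g h (m + Γ.point (i - 1)) (Γ.dir (i - 1)) (Γ.dir i) - p (Γ.dir (i - 1)) - p (Γ.dir i)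

/-- The potential across the strip between the translates by `m` and by `m + e_r`. -/
noncomputable def mix (p : Fin N → ℝ) (Γ : Staircase N) (g h : Fin N → (Fin N → ℤ) → ℝ)
    (m : Fin N → ℤ) (r : Fin N) (i : ℤ) : ℝ :=
  om g h (m + Γ.point i) r (Γ.dir i) - p r - p (Γ.dir i)

/-- Lax coefficients with a summable potential along the staircase, which tend to their free values
at both ends of the staircase and of its translates in the directions in which it does not step. -/
structure ScatData (p : Fin N → ℝ) (Γ : Staircase N) (g h : Fin N → (Fin N → ℤ) → ℝ) : Prop where
  p_pos : ∀ k, 0 < p k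
  lax : LaxCoeff p g h
  summable : MomentSummable (pot p Γ g h 0)
  tendsto : ∀ m : Fin N → ℤ, (∀ i, m (Γ.dir i) = 0) → ∀ r, (∀ i, Γ.dir i ≠ r) →
    Tendsto (mix p Γ g h m r) cofinite (𝓝 0)

namespace ScatData

variable {p : Fin N → ℝ} {Γ : Staircase N} {g h : Fin N → (Fin N → ℤ) → ℝ}

/-- A discrete Riccati equation for the strip quantity, driven by the potential on the lower
staircase. It has the form (s + Q)(d + x) = s d with s, d the sum and difference of two lattice
parameters. -/
theorem mix_mul (S : ScatData p Γ g h) (m : Fin N → ℤ) (r : Fin N) (i : ℤ) :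
    (p r + p (Γ.dir i) + mix p Γ g h m r i)
      * (p r - p (Γ.dir i) + mix p Γ g h m r (i - 1) - pot p Γ g h m i)
      = p r ^ 2 - p (Γ.dir i) ^ 2 := by
  rw [← S.lax.om_mul (m + Γ.point (i - 1)) (Γ.dir (i - 1)) r (Γ.dir i), Γ.add_point_pred,
    S.lax.om_symm _ (Γ.dir (i - 1)) r]
  simp only [mix, pot]; ring

/-- Expresses the new potential through the old one and the strip quantity, so only the latter has
to be shown summable. -/
theorem pot_shift (S : ScatData p Γ g h) (m : Fin N → ℤ) (r : Fin N) (i : ℤ) :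
    pot p Γ g h (shift r m) i
      = mix p Γ g h m r i - mix p Γ g h m r (i - 2) + pot p Γ g h m (i - 1) := by
  have h1 := S.lax.om_cross (m + Γ.point (i - 2)) (Γ.dir (i - 2)) (Γ.dir (i - 1)) r (Γ.dir i)
  have e1 : shift (Γ.dir (i - 2)) (m + Γ.point (i - 2)) = m + Γ.point (i - 1) := by
    have := Γ.add_point_pred m (i - 1)
    rwa [show i - 1 - 1 = i - 2 by ring] at this
  rw [e1, Γ.add_point_pred] at h1
  rw [S.lax.om_symm _ (Γ.dir (i - 2)) r] at h1
  simp only [pot, mix]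
  rw [← shift_add', show i - 1 - 1 = i - 2 by ring]
  linarith

theorem mix_shift (S : ScatData p Γ g h) (m : Fin N → ℤ) (r s : Fin N) (i : ℤ) :
    mix p Γ g h (shift s m) r i
      = mix p Γ g h (shift r m) s i + mix p Γ g h m r (i - 1) - mix p Γ g h m s (i - 1) := by
  have h1 := S.lax.om_cross (m + Γ.point (i - 1)) (Γ.dir (i - 1)) r s (Γ.dir i)
  rw [Γ.add_point_pred, S.lax.om_symm _ (Γ.dir (i - 1)) r, S.lax.om_symm _ (Γ.dir (i - 1)) s] at h1
  simp only [mix]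
  rw [← shift_add', ← shift_add']
  linarith

theorem mix_eq_pot (S : ScatData p Γ g h) (m : Fin N → ℤ) (i : ℤ) :
    mix p Γ g h m (Γ.dir i) (i - 1) = pot p Γ g h m i := by
  simp only [mix, pot]
  rw [S.lax.om_symm]; ring

theorem exists_bounds (S : ScatData p Γ g h) :
    ∃ pm pM : ℝ, 0 < pm ∧ (∀ k, pm ≤ p k) ∧ ∀ k, p k ≤ pM := by
  have : Nonempty (Fin N) := ⟨Γ.dir 0⟩
  obtain ⟨k, hk⟩ := Finite.exists_min p
  obtain ⟨l, hl⟩ := Finite.exists_max p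
  exact ⟨p k, p l, S.p_pos k, hk, hl⟩

/-- Solving for x gives x = -Q d / (s + Q). Positivity of the lattice parameters makes |d| smaller
than s, so the Riccati map contracts backwards. -/
theorem contraction {s d Q x θ pm : ℝ} (hpm : 0 < pm) (hQ : |Q| ≤ pm) (hs : 2 * pm ≤ s)
    (h1 : |d| ≤ θ * (s - |Q|)) (h : (s + Q) * (d + x) = s * d) : |x| ≤ θ * |Q| := by
  have h2 : (s + Q) * x = -(Q * d) := by linear_combination h
  have h3 : 0 < s - |Q| := by linarith
  have h4 : s - |Q| ≤ |s + Q| := by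
    have := neg_abs_le Q
    have := le_abs_self (s + Q)
    linarith
  have h5 : |s + Q| * |x| = |Q| * |d| := by rw [← abs_mul, h2, abs_neg, abs_mul]
  have h6 : (s - |Q|) * |x| ≤ (s - |Q|) * (θ * |Q|) := by
    calc (s - |Q|) * |x| ≤ |s + Q| * |x| := by gcongr
      _ = |Q| * |d| := h5
      _ ≤ |Q| * (θ * (s - |Q|)) := by gcongr
      _ = _ := by ring
  exact le_of_mul_le_mul_left h6 h3

/-- Once |mix| < pm, the Riccati equation is a backward contraction up to the potential. Since mix
tends to zero, it is moment-summable, and so is the next potential. -/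
theorem pot_step (S : ScatData p Γ g h) {m : Fin N → ℤ} {r : Fin N}
    (hm : MomentSummable (pot p Γ g h m)) (hr : Tendsto (mix p Γ g h m r) cofinite (𝓝 0)) :
    MomentSummable (pot p Γ g h (shift r m)) := by
  obtain ⟨pm, pM, hpm, hle, hge⟩ := S.exists_bounds
  have hpM : 0 < pM := hpm.trans_le ((hle r).trans (hge r))
  have hmM : pm ≤ pM := (hle r).trans (hge r)
  have hq : MomentSummable (mix p Γ g h m r) := by
    have hε : pm / (2 * pM) < 1 := by rw [div_lt_one (by positivity)]; linarith
    -- With s ≤ 2 pM, |d| ≤ s - 2 pm and |Q| < pm, the product θ (s - |Q|) loses at most pm from s -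
    -- |Q|, hence still dominates |d|.
    refine MomentSummable.of_contraction (hm.shift 1) hr (θ := 1 - pm / (2 * pM)) (by linarith)
      (by have : 0 < pm / (2 * pM) := by positivity
          linarith) ?_
    have hr1 := tendsto_cofinite_add hr 1
    have hev : ∀ᶠ i in cofinite, |mix p Γ g h m r (i + 1)| < pm := by
      have h2 := hr1.abs
      rw [abs_zero] at h2
      exact h2.eventually (gt_mem_nhds hpm)
    filter_upwards [hev] with i hi
    have h1 := S.mix_mul m r (i + 1)
    rw [add_sub_cancel_right] at h1
    have h2 := contraction (s := p r + p (Γ.dir (i + 1))) (d := p r - p (Γ.dir (i + 1)))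
      (Q := mix p Γ g h m r (i + 1)) (x := mix p Γ g h m r i - pot p Γ g h m (i + 1))
      (θ := 1 - pm / (2 * pM)) hpm hi.le (by linarith [hle r, hle (Γ.dir (i + 1))]) ?_
      (by linear_combination h1)
    · have := abs_sub_abs_le_abs_sub (mix p Γ g h m r i) (pot p Γ g h m (i + 1))
      linarith
    · have h3 : |p r - p (Γ.dir (i + 1))| ≤ p r + p (Γ.dir (i + 1)) - 2 * pm := by
        rw [abs_le]
        constructor <;> linarith [hle r, hle (Γ.dir (i + 1))]
      have h4 : pm / (2 * pM) * (p r + p (Γ.dir (i + 1)) - |mix p Γ g h m r (i + 1)|) ≤ pm := by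
        calc _ ≤ pm / (2 * pM) * (2 * pM) := by
              gcongr
              linarith [hge r, hge (Γ.dir (i + 1)), abs_nonneg (mix p Γ g h m r (i + 1))]
          _ = pm := by field_simp
      rw [sub_mul, one_mul]
      linarith
  refine (((hq.sub (hq.shift (-2))).add (hm.shift (-1)))).mono' (Eventually.of_forall fun i => ?_)
  rw [S.pot_shift]
  rfl

/-- Every window of one period contains a step in the direction r, where mix equals the potential
and is small. The Riccati equation carries this smallness back over at most T steps, each adding one
more value of the potential; no asymptotic assumption on the strip is needed. -/
theorem mix_tendsto_of_mem (S : ScatData p Γ g h) {m : Fin N → ℤ}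
    (hm : MomentSummable (pot p Γ g h m)) (j₀ : ℤ) :
    Tendsto (mix p Γ g h m (Γ.dir j₀)) cofinite (𝓝 0) := by
  obtain ⟨pm, pM, hpm, hle, hge⟩ := S.exists_bounds
  obtain ⟨T, hT, hper⟩ := Γ.periodic
  set r := Γ.dir j₀ with hr
  have hper' : ∀ (c : ℕ) (i : ℤ), Γ.dir (i + c * T) = Γ.dir i := by
    intro c
    induction c with
    | zero => simp
    | succ c ih =>
      intro i
      rw [show i + ((c + 1 : ℕ) : ℤ) * T = i + c * T + T by push_cast; ring, hper, ih]
  have hperZ : ∀ (c : ℤ) (i : ℤ), Γ.dir (i + c * T) = Γ.dir i := by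
    intro c i
    obtain ⟨n, rfl | rfl⟩ := c.eq_nat_or_neg
    · exact hper' n i
    · rw [← hper' n (i + -(n : ℤ) * T)]
      congr 1; ring
  have hwin : ∀ i : ℤ, ∃ t : ℕ, t < T ∧ Γ.dir (i + 1 + t) = r := by
    intro i
    have hT' : (0 : ℤ) < T := by exact_mod_cast hT
    refine ⟨((j₀ - i - 1) % T).toNat, ?_, ?_⟩
    · have := Int.emod_lt_of_pos (j₀ - i - 1) hT'
      have := Int.emod_nonneg (j₀ - i - 1) hT'.ne'
      omega
    · rw [Int.toNat_of_nonneg (Int.emod_nonneg _ hT'.ne'), hr,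
        ← hperZ ((j₀ - i - 1) / T) (i + 1 + (j₀ - i - 1) % T)]
      congr 1
      have := Int.emod_add_mul_ediv (j₀ - i - 1) T
      linear_combination this
  rw [Metric.tendsto_nhds]
  intro ε hε
  -- T errors of size η must stay below ε, and below pm so that `contraction` applies throughout the
  -- window.
  set η : ℝ := min ε pm / (T + 1) with hη
  have hη0 : 0 < η := by positivity
  have hηT : (T : ℝ) * η < min ε pm := by
    rw [hη, mul_div_assoc', div_lt_iff₀ (by positivity)]
    nlinarith [lt_min hε hpm]
  have hev : ∀ᶠ i in cofinite, ∀ t ∈ Finset.range T, |pot p Γ g h m (i + (1 + t))| < η := by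
    rw [eventually_all_finset]
    intro t _
    have := (tendsto_cofinite_add hm.tendsto (1 + t)).abs
    rw [abs_zero] at this
    exact this.eventually (gt_mem_nhds hη0)
  filter_upwards [hev] with i hi
  obtain ⟨t₀, ht₀, hdir⟩ := hwin i
  have key : ∀ s : ℕ, s ≤ t₀ → |mix p Γ g h m r (i + t₀ - s)| ≤ (s + 1) * η := by
    intro s
    induction s with
    | zero =>
      intro _
      have h1 := S.mix_eq_pot m (i + 1 + t₀)
      rw [hdir, show i + 1 + (t₀ : ℤ) - 1 = i + t₀ by ring] at h1
      have h2 := hi t₀ (Finset.mem_range.2 ht₀)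
      rw [← add_assoc, ← h1] at h2
      simpa using h2.le
    | succ s ih =>
      intro hs
      have h1 := ih (by omega)
      have hpr : |mix p Γ g h m r (i + t₀ - s)| ≤ pm := by
        refine h1.trans ?_
        have : ((s : ℝ) + 1) ≤ T := by exact_mod_cast (by omega : s + 1 ≤ T)
        have h3 := min_le_right ε pm
        nlinarith
      have h2 := S.mix_mul m r (i + t₀ - s)
      set k := Γ.dir (i + t₀ - s)
      have h3 := contraction (s := p r + p k) (d := p r - p k)
        (Q := mix p Γ g h m r (i + t₀ - s))
        (x := mix p Γ g h m r (i + t₀ - s - 1) - pot p Γ g h m (i + t₀ - s))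
        (θ := 1) hpm hpr (by linarith [hle r, hle k]) (by
          rw [one_mul, abs_le]
          constructor <;> linarith [hle r, hle k]) (by linear_combination h2)
      have h4 := hi (t₀ - s - 1) (Finset.mem_range.2 (by omega))
      rw [show i + (1 + ((t₀ - s - 1 : ℕ) : ℤ)) = i + t₀ - s by omega] at h4
      rw [show i + (t₀ : ℤ) - ((s + 1 : ℕ) : ℤ) = i + t₀ - s - 1 by push_cast; ring]
      have h5 := abs_sub_abs_le_abs_sub (mix p Γ g h m r (i + t₀ - s - 1))
        (pot p Γ g h m (i + t₀ - s))
      push_cast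
      linarith
  have h1 := key t₀ le_rfl
  rw [add_sub_cancel_right] at h1
  rw [Real.dist_0_eq_abs]
  have h2 : ((t₀ : ℝ) + 1) ≤ T := by exact_mod_cast ht₀
  have h3 := min_le_left ε pm
  nlinarith

theorem om_reflect (n : Fin N → ℤ) (j k : Fin N) :
    om (fun k n => h k (-shift k n)) (fun k n => g k (-shift k n)) n j k
      = om g h (-shift k (shift j n)) k j := by
  simp only [om]
  rw [show shift k (-shift k (shift j n)) = -shift j n by simp only [shift]; abel]
  ring

theorem pot_reflect (m : Fin N → ℤ) (i : ℤ) :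
    pot p Γ.reflect (fun k n => h k (-shift k n)) (fun k n => g k (-shift k n)) m i
      = pot p Γ g h (-m) (-i) := by
  have e1 : Γ.reflect.dir (i - 1) = Γ.dir (-i) := by
    simp only [Staircase.reflect]; congr 1; ring
  have e2 : Γ.reflect.dir i = Γ.dir (-i - 1) := by
    simp only [Staircase.reflect]; congr 1; ring
  have e3 : -shift (Γ.dir (-i - 1)) (shift (Γ.dir (-i)) (m + Γ.reflect.point (i - 1)))
      = -m + Γ.point (-i - 1) := by
    rw [Γ.reflect_point]
    have h1 := Γ.point_succ (-i)
    have h2 := Γ.point_succ (-i - 1)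
    rw [sub_add_cancel] at h2
    rw [show -(i - 1) = -i + 1 by ring, h1, h2]
    simp only [shift]; abel
  simp only [pot]
  rw [e1, e2, om_reflect, e3]; ring

theorem mix_reflect (S : ScatData p Γ g h) (m : Fin N → ℤ) (r : Fin N) (i : ℤ) :
    mix p Γ.reflect (fun k n => h k (-shift k n)) (fun k n => g k (-shift k n)) m r i
      = mix p Γ g h (-shift r m) r (-i - 1) := by
  have e2 : Γ.reflect.dir i = Γ.dir (-i - 1) := by
    simp only [Staircase.reflect]; congr 1; ring
  have e3 : -shift (Γ.dir (-i - 1)) (shift r (m + Γ.reflect.point i))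
      = -shift r m + Γ.point (-i - 1) := by
    rw [Γ.reflect_point]
    have h2 := Γ.point_succ (-i - 1)
    rw [sub_add_cancel] at h2
    rw [h2]
    simp only [shift]; abel
  simp only [mix]
  rw [e2, om_reflect, e3, S.lax.om_symm]

/-- The data reflected in the origin. -/
theorem reflect (S : ScatData p Γ g h) :
    ScatData p Γ.reflect (fun k n => h k (-shift k n)) (fun k n => g k (-shift k n)) where
  p_pos := S.p_pos
  lax := S.lax.reflect
  summable := by
    have := S.summable.comp_neg
    rwa [show (fun i => pot p Γ g h 0 (-i)) = pot p Γ.reflect (fun k n => h k (-shift k n))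
      (fun k n => g k (-shift k n)) 0 from funext fun i => by rw [pot_reflect, neg_zero]] at this
  tendsto m hm r hr := by
    have hr' : ∀ i, Γ.dir i ≠ r := fun i => by
      have := hr (-1 - i)
      simpa [Staircase.reflect] using this
    have h1 := S.tendsto (-shift r m) (fun i => by
      have := hm (-1 - i)
      simp only [Staircase.reflect, sub_sub_cancel] at this
      simp [shift, this, hr' i]) r hr'
    have inj : Function.Injective fun i : ℤ => -i - 1 := fun a b hab => by
      simpa using hab
    refine (h1.comp inj.tendsto_cofinite).congr fun i => ?_
    rw [S.mix_reflect]; rfl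

theorem reflect_pot_iff (m : Fin N → ℤ) :
    MomentSummable (pot p Γ.reflect (fun k n => h k (-shift k n)) (fun k n => g k (-shift k n)) m)
      ↔ MomentSummable (pot p Γ g h (-m)) := by
  constructor <;> intro H
  · have := H.comp_neg
    simpa only [pot_reflect, neg_neg] using this
  · have := H.comp_neg
    rwa [show (fun i => pot p Γ g h (-m) (-i)) = pot p Γ.reflect (fun k n => h k (-shift k n))
      (fun k n => g k (-shift k n)) m from funext fun i => (pot_reflect m i).symm] at this

/-- The step downwards is the step upwards for the data reflected in the origin. -/
theorem pot_step_iff (S : ScatData p Γ g h) (m : Fin N → ℤ) {r : Fin N}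
    (hr : MomentSummable (pot p Γ g h m) → Tendsto (mix p Γ g h m r) cofinite (𝓝 0))
    (hr' : MomentSummable (pot p Γ g h (shift r m)) →
      Tendsto (mix p Γ.reflect (fun k n => h k (-shift k n)) (fun k n => g k (-shift k n))
        (-shift r m) r) cofinite (𝓝 0)) :
    MomentSummable (pot p Γ g h m) ↔ MomentSummable (pot p Γ g h (shift r m)) := by
  refine ⟨fun H => S.pot_step H (hr H), fun H => ?_⟩
  have h1 := (reflect_pot_iff (p := p) (Γ := Γ) (g := g) (h := h) (-shift r m)).2
    (by rwa [neg_neg])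
  have h2 := S.reflect.pot_step h1 (hr' H)
  rw [reflect_pot_iff] at h2
  convert h2 using 2
  simp only [shift]; abel

/-- The potential is summable along every translate of the staircase. -/
theorem pot_summable (S : ScatData p Γ g h) (m : Fin N → ℤ) :
    MomentSummable (pot p Γ g h m) := by
  classical
  -- The order of the moves matters: the asymptotic hypothesis covers only translates whose
  -- coordinates in the staircase directions are zero. The other coordinates are moved first; the
  -- staircase directions follow, and need no hypothesis.
  set off : (Fin N → ℤ) → Fin N → ℤ := fun n k => if ∃ i, Γ.dir i = k then 0 else n k with hoff
  have hoff0 : ∀ n i, off n (Γ.dir i) = 0 := fun n i => by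
    simp only [hoff]; rw [if_pos ⟨i, rfl⟩]
  have h1 : ∀ n, MomentSummable (pot p Γ g h (off n)) := by
    refine lattice_induction 0 ?_ ?_
    · convert S.summable using 2
      funext k; simp [hoff]
    · intro n k
      by_cases hk : ∃ i, Γ.dir i = k
      · have : off (shift k n) = off n := by
          funext l
          by_cases hl : l = k
          · subst hl; simp [hoff, hk]
          · simp [hoff, shift, hl]
        rw [this]
      · have e : off (shift k n) = shift k (off n) := by
          funext l
          by_cases hl : l = k
          · subst hl; simp [hoff, hk, shift]
          · simp [hoff, shift, hl]
        rw [e]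
        push Not at hk
        refine S.pot_step_iff _ (fun _ => S.tendsto _ (hoff0 n) k hk) fun _ => ?_
        refine S.reflect.tendsto _ (fun i => ?_) k fun i => hk _
        have := hoff0 n (-1 - i)
        simp [shift, Staircase.reflect, this, hk (-1 - i)]
  set inn : (Fin N → ℤ) → Fin N → ℤ := fun n k => if ∃ i, Γ.dir i = k then n k else 0 with hinn
  have h2 : ∀ o n, MomentSummable (pot p Γ g h (off o + inn n)) := by
    intro o
    refine lattice_induction 0 ?_ ?_
    · convert h1 o using 2
      funext k; simp [hinn]
    · intro n k
      by_cases hk : ∃ i, Γ.dir i = k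
      · have e : inn (shift k n) = shift k (inn n) := by
          funext l
          by_cases hl : l = k
          · subst hl; simp [hinn, hk, shift]
          · simp [hinn, shift, hl]
        rw [e, ← shift_add]
        obtain ⟨i, rfl⟩ := hk
        refine S.pot_step_iff _ (fun H => S.mix_tendsto_of_mem H i) fun H => ?_
        have := S.reflect.mix_tendsto_of_mem ((reflect_pot_iff _).2 (by rwa [neg_neg])) (-1 - i)
          (m := -shift (Γ.dir i) (off o + inn n))
        simpa [Staircase.reflect] using this
      · have : inn (shift k n) = inn n := by
          funext l
          by_cases hl : l = k
          · subst hl; simp [hinn, hk]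
          · simp [hinn, shift, hl]
        rw [this]
  convert h2 m m using 2
  funext k
  by_cases hk : ∃ i, Γ.dir i = k <;> simp [hoff, hinn, hk]

/-- The Lax coefficients tend to their free values at the ends of every translate. -/
theorem mix_tendsto (S : ScatData p Γ g h) (m : Fin N → ℤ) (r : Fin N) :
    Tendsto (mix p Γ g h m r) cofinite (𝓝 0) := by
  classical
  by_cases hr : ∃ i, Γ.dir i = r
  · obtain ⟨i, rfl⟩ := hr
    exact S.mix_tendsto_of_mem (S.pot_summable m) i
  set off : (Fin N → ℤ) → Fin N → ℤ := fun n k => if ∃ i, Γ.dir i = k then 0 else n k with hoff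
  have hoff0 : ∀ n i, off n (Γ.dir i) = 0 := fun n i => by
    simp only [hoff]; rw [if_pos ⟨i, rfl⟩]
  set inn : (Fin N → ℤ) → Fin N → ℤ := fun n k => if ∃ i, Γ.dir i = k then n k else 0 with hinn
  have hr' : ∀ i, Γ.dir i ≠ r := by push Not at hr; exact hr
  have h2 : ∀ n, Tendsto (mix p Γ g h (off m + inn n) r) cofinite (𝓝 0) := by
    refine lattice_induction 0 ?_ ?_
    · convert S.tendsto (off m) (hoff0 m) r hr' using 2
      funext k; simp [hinn]
    · intro n k
      by_cases hk : ∃ i, Γ.dir i = k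
      · have e : inn (shift k n) = shift k (inn n) := by
          funext l
          by_cases hl : l = k
          · subst hl; simp [hinn, hk, shift]
          · simp [hinn, shift, hl]
        rw [e, ← shift_add]
        obtain ⟨i, rfl⟩ := hk
        set M := off m + inn n
        -- In `mix_shift` two of the four terms belong to a staircase direction and tend to zero
        -- already. The remaining two, which belong to r on neighbouring translates, therefore tend
        -- to zero together.
        have t1 := S.mix_tendsto_of_mem (S.pot_summable (shift r M)) i
        have t2 := tendsto_cofinite_add (S.mix_tendsto_of_mem (S.pot_summable M) i) (-1)
        constructor <;> intro H
        · have := (t1.add (tendsto_cofinite_add H (-1))).sub t2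
          rw [add_zero, sub_zero] at this
          exact this.congr fun j => (S.mix_shift M r _ j).symm
        · have := tendsto_cofinite_add ((H.sub t1).add t2) 1
          rw [sub_zero, add_zero] at this
          refine this.congr fun j => ?_
          rw [S.mix_shift M r]
          simp only [add_sub_cancel_right, add_neg_cancel_right]
          ring
      · have : inn (shift k n) = inn n := by
          funext l
          by_cases hl : l = k
          · subst hl; simp [hinn, hk]
          · simp [hinn, shift, hl]
        rw [this]
  convert h2 m using 2
  funext k
  by_cases hk : ∃ i, Γ.dir i = k <;> simp [hoff, hinn, hk]

end ScatData
end Q3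

/-! ### From staircases to the lattice: existence and uniqueness of the Jost functions. -/

namespace Q3

variable {N : ℕ}

/-- The three-point equations on the lattice with spectral parameter `ζ`. -/
def LatEq (p : Fin N → ℝ) (g h : Fin N → (Fin N → ℤ) → ℝ) (ζ : ℂ) (x : (Fin N → ℤ) → ℂ) : Prop :=
  ∀ (n : Fin N → ℤ) (j k : Fin N),
    (p k + ζ) * x (shift k (shift j n)) - (om g h n j k : ℂ) * x (shift j n) + (p j - ζ) * x n = 0

/-- The Jost function normalised at the left end. -/
def LeftJost (p : Fin N → ℝ) (Γ : Staircase N) (g h : Fin N → (Fin N → ℤ) → ℝ)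
    (Λ : (Fin N → ℤ) → ℂ → ℂ) : Prop :=
  ∀ ζ ∈ rhp, LatEq p g h ζ (Λ · ζ) ∧
    ∀ m : Fin N → ℤ, Tendsto (fun i : ℤ => Λ (m + Γ.point i) ζ) atBot (𝓝 1)

/-- The Jost function normalised at the right end. -/
def RightJost (p : Fin N → ℝ) (Γ : Staircase N) (g h : Fin N → (Fin N → ℤ) → ℝ)
    (Υ : (Fin N → ℤ) → ℂ → ℂ) : Prop :=
  ∀ ζ ∈ rhp, LatEq p g h (-ζ) (Υ · ζ) ∧
    ∀ m : Fin N → ℤ, Tendsto (fun i : ℤ => Υ (m + Γ.point i) ζ) atTop (𝓝 1)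

theorem isLeftJost_iff (D : Params N) (Γ : Staircase N) (u U : (Fin N → ℤ) → ℝ)
    (Λ : (Fin N → ℤ) → ℂ → ℂ) :
    IsLeftJost D Γ u U Λ ↔ LeftJost D.p Γ (laxG D u U) (laxH D u U) Λ := by
  simp only [IsLeftJost, LeftJost, LatEq, Omega_eq_om]; rfl

theorem isRightJost_iff (D : Params N) (Γ : Staircase N) (u U : (Fin N → ℤ) → ℝ)
    (Υ : (Fin N → ℤ) → ℂ → ℂ) :
    IsRightJost D Γ u U Υ ↔ RightJost D.p Γ (laxG D u U) (laxH D u U) Υ := by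
  simp only [IsRightJost, RightJost, LatEq, Omega_eq_om, ← sub_eq_add_neg, sub_neg_eq_add]; rfl

/-- Commutativity of the Lax steps in the directions `j` and `r`. -/
theorem LaxCoeff.comm {p : Fin N → ℝ} {g h : Fin N → (Fin N → ℤ) → ℝ} (L : LaxCoeff p g h)
    {ζ : ℂ} (n : Fin N → ℤ) (j r : Fin N) (hj : (p j : ℂ) + ζ ≠ 0) (hr : (p r : ℂ) + ζ ≠ 0)
    {x ψ x₁ ψ₁ y₀ y₁ : ℂ} (a1 : (p j + ζ) * x₁ = ψ + g j n * x)
    (a2 : ψ₁ = h j n * x₁ - (p j - ζ) * x) (b1 : (p r + ζ) * y₀ = ψ + g r n * x)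
    (c1 : (p r + ζ) * y₁ = ψ₁ + g r (shift j n) * x₁) :
    (p j + ζ) * y₁ = (h r n * y₀ - (p r - ζ) * x) + g j (shift r n) * y₀ ∧
      h r (shift j n) * y₁ - (p r - ζ) * x₁ = h j (shift r n) * y₁ - (p j - ζ) * y₀ := by
  have s1 : (g r (shift j n) : ℂ) + h j n = g j (shift r n) + h r n := by
    exact_mod_cast L.symm n j r
  have s2 : ((g r (shift j n) : ℂ) + h j n) * (g j n - g r n) = p j ^ 2 - p r ^ 2 := by
    exact_mod_cast L.mul n j r
  have s3 : (h r (shift j n) : ℂ) - h j (shift r n) = g r n - g j n := by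
    exact_mod_cast L.cross n j r
  subst a2
  have k1 : (p r + ζ) * (p j + ζ) * y₁
      = (g r (shift j n) + h j n) * (ψ + g j n * x) - (p j ^ 2 - ζ ^ 2) * x := by
    linear_combination (p j + ζ) * c1 + (g r (shift j n) + h j n) * a1
  constructor
  · apply mul_left_cancel₀ hr
    linear_combination k1 + s2 * x - (g r (shift j n) + h j n) * b1 +
      s1 * ((p r + ζ) * y₀)
  · apply mul_left_cancel₀ hr
    apply mul_left_cancel₀ hj
    linear_combination s3 * ((p r + ζ) * (p j + ζ) * y₁) + (g r n - g j n) * k1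
      - (p r ^ 2 - ζ ^ 2) * a1 + (p j ^ 2 - ζ ^ 2) * b1 - s2 * (ψ + g j n * x)

namespace ScatData

variable {p : Fin N → ℝ} {Γ : Staircase N} {g h : Fin N → (Fin N → ℤ) → ℝ}

theorem oneDim (S : ScatData p Γ g h) (m : Fin N → ℤ) :
    ∃ pm pM, OneDim (fun i => p (Γ.dir i)) (pot p Γ g h m) pm pM := by
  obtain ⟨pm, pM, h0, h1, h2⟩ := S.exists_bounds
  exact ⟨pm, pM, h0, fun i => h1 _, fun i => h2 _, S.pot_summable m⟩

theorem isSol_iff (m : Fin N → ℤ) (ζ : ℂ) (f : ℤ → ℂ) (i : ℤ) :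
    IsSol (fun i => p (Γ.dir i)) (pot p Γ g h m) ζ f i ↔
      (p (Γ.dir i) + ζ) * f (i + 1)
        - (om g h (m + Γ.point (i - 1)) (Γ.dir (i - 1)) (Γ.dir i) : ℂ) * f i
        + (p (Γ.dir (i - 1)) - ζ) * f (i - 1) = 0 := by
  rw [IsSol, pot, show p (Γ.dir (i - 1)) + p (Γ.dir i)
    + (om g h (m + Γ.point (i - 1)) (Γ.dir (i - 1)) (Γ.dir i) - p (Γ.dir (i - 1)) - p (Γ.dir i))
    = om g h (m + Γ.point (i - 1)) (Γ.dir (i - 1)) (Γ.dir i) by ring]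

theorem isSol_of_latEq {ζ : ℂ} {x : (Fin N → ℤ) → ℂ} (hx : LatEq p g h ζ x) (m : Fin N → ℤ)
    (i : ℤ) : IsSol (fun i => p (Γ.dir i)) (pot p Γ g h m) ζ (fun i => x (m + Γ.point i)) i := by
  rw [isSol_iff]
  have := hx (m + Γ.point (i - 1)) (Γ.dir (i - 1)) (Γ.dir i)
  rwa [Γ.add_point_pred, ← Γ.add_point_succ] at this

/-- Transport of the normalised solutions from a translate of the staircase to the next one. -/
theorem transport (S : ScatData p Γ g h) {ζ : ℂ} (hζ : ζ ∈ rhp) {f : (Fin N → ℤ) → ℤ → ℂ}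
    (hf : ∀ m, (∀ i, IsSol (fun i => p (Γ.dir i)) (pot p Γ g h m) ζ (f m) i) ∧
      Tendsto (f m) atBot (𝓝 1)) (m : Fin N → ℤ) (r : Fin N) (i : ℤ) :
    (p r + ζ) * f (shift r m) i = (p (Γ.dir i) + ζ) * f m (i + 1)
        - g (Γ.dir i) (m + Γ.point i) * f m i + g r (m + Γ.point i) * f m i := by
  have hne : ∀ k, (p k : ℂ) + ζ ≠ 0 := fun k => add_ne_zero_of_pos (S.p_pos k) hζ
  set ψ : ℤ → ℂ := fun i => (p (Γ.dir i) + ζ) * f m (i + 1)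
    - g (Γ.dir i) (m + Γ.point i) * f m i with hψ
  -- y is the image of the normalised solution under the Lax step in the direction r. Commutativity
  -- makes it a solution on the next translate; if it also tends to 1, uniqueness identifies it with
  -- `f (shift r m)`.
  set y : ℤ → ℂ := fun i => (ψ i + g r (m + Γ.point i) * f m i) / (p r + ζ) with hy
  have ha : ∀ i, (p (Γ.dir i) + ζ) * f m (i + 1) = ψ i + g (Γ.dir i) (m + Γ.point i) * f m i :=
    fun i => by simp only [hψ]; ring
  have hb : ∀ i, ψ (i + 1) = h (Γ.dir i) (m + Γ.point i) * f m (i + 1)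
      - (p (Γ.dir i) - ζ) * f m i := by
    intro i
    have h1 := ((isSol_iff m ζ (f m) (i + 1)).1 ((hf m).1 (i + 1)))
    rw [add_sub_cancel_right, om, ← Γ.add_point_succ] at h1
    push_cast at h1
    simp only [hψ]
    linear_combination h1
  have hy' : ∀ i, (p r + ζ) * y i = ψ i + g r (m + Γ.point i) * f m i := fun i => by
    simp only [hy]; rw [mul_div_cancel₀ _ (hne r)]
  have hcomm := fun i => S.lax.comm (m + Γ.point i) (Γ.dir i) r (hne _) (hne r) (ha i) (hb i)
    (hy' i) (y₁ := y (i + 1)) (by rw [hy' (i + 1), ← Γ.add_point_succ])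
  have hysol : ∀ i, IsSol (fun i => p (Γ.dir i)) (pot p Γ g h (shift r m)) ζ y i := by
    intro i
    rw [isSol_iff, ← shift_add', om, shift_comm, Γ.add_point_pred]
    have h1 := (hcomm i).1
    have h2 := (hcomm (i - 1)).2
    rw [Γ.add_point_pred, sub_add_cancel] at h2
    push_cast
    linear_combination h1 + h2
  have hylim : Tendsto y atBot (𝓝 1) := by
    -- The deviation of y from `f m` consists of mix and of an increment of `f m`, both vanishing at
    -- the left end. This is where the decay of mix on every strip is needed.
    have e : ∀ i, y i = (mix p Γ g h m r (i - 1) * f m i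
        + (p r + p (Γ.dir (i - 1)) : ℝ) * (f m i - f m (i - 1))) / (p r + ζ) + f m (i - 1) := by
      intro i
      have h1 := hy' i
      have h2 := hb (i - 1)
      rw [sub_add_cancel] at h2
      have h3 : (om g h (m + Γ.point (i - 1)) r (Γ.dir (i - 1)) : ℂ)
          = g r (m + Γ.point i) + h (Γ.dir (i - 1)) (m + Γ.point (i - 1)) := by
        rw [S.lax.om_symm, om, Γ.add_point_pred]; push_cast; rfl
      have hr := hne r
      simp only [mix]
      apply mul_left_cancel₀ hr
      rw [h1, h2, mul_add, mul_div_cancel₀ _ hr]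
      push_cast
      rw [h3]
      ring
    have hprev : Tendsto (fun i => f m (i - 1)) atBot (𝓝 1) :=
      (hf m).2.comp (tendsto_atBot_add_const_right _ (-1) tendsto_id)
    have hmix : Tendsto (fun i => (mix p Γ g h m r (i - 1) : ℂ)) atBot (𝓝 0) := by
      have h1 : Tendsto (mix p Γ g h m r) atBot (𝓝 0) :=
        (S.mix_tendsto m r).mono_left (by rw [Int.cofinite_eq]; exact le_sup_left)
      have h2 := h1.comp (tendsto_atBot_add_const_right _ (-1) tendsto_id)
      have h3 := (Complex.continuous_ofReal.tendsto 0).comp h2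
      simpa [Function.comp_def, ← sub_eq_add_neg] using h3
    obtain ⟨pm, pM, h0, h1, h2⟩ := S.exists_bounds
    have hdiff : Tendsto (fun i => ((p r + p (Γ.dir (i - 1)) : ℝ) : ℂ) * (f m i - f m (i - 1)))
        atBot (𝓝 0) := by
      have h3 := ((hf m).2.sub hprev).norm.const_mul (2 * pM)
      rw [sub_self, norm_zero, mul_zero] at h3
      refine squeeze_zero_norm (fun i => ?_) h3
      have hpos : 0 < p r + p (Γ.dir (i - 1)) := add_pos (S.p_pos _) (S.p_pos _)
      rw [norm_mul, Complex.norm_real, Real.norm_eq_abs, abs_of_pos hpos]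
      gcongr
      linarith [h2 r, h2 (Γ.dir (i - 1))]
    have := (((hmix.mul (hf m).2).add hdiff).div_const (p r + ζ)).add hprev
    simp only [zero_mul, add_zero, zero_div, zero_add] at this
    exact this.congr fun i => (e i).symm
  obtain ⟨pm, pM, H⟩ := S.oneDim (shift r m)
  rw [H.eq_of_tendsto hζ (hf (shift r m)).1 hysol (hf (shift r m)).2 hylim i, hy' i]

/-- Transport in the direction of the i-th step shows that f depends on m and i only through m +
γ(i). The family is then a single function on the lattice, and two consecutive Lax steps give its
three-point equation in all pairs of directions. -/
theorem latEq_of_family (S : ScatData p Γ g h) {ζ : ℂ} (hζ : ζ ∈ rhp) {f : (Fin N → ℤ) → ℤ → ℂ}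
    (hf : ∀ m, (∀ i, IsSol (fun i => p (Γ.dir i)) (pot p Γ g h m) ζ (f m) i) ∧
      Tendsto (f m) atBot (𝓝 1)) :
    LatEq p g h ζ (fun n => f n 0) ∧ ∀ m i, f m i = f (m + Γ.point i) 0 := by
  have hne : ∀ k, (p k : ℂ) + ζ ≠ 0 := fun k => add_ne_zero_of_pos (S.p_pos k) hζ
  have T := S.transport hζ hf
  have hstep : ∀ m i, f m (i + 1) = f (shift (Γ.dir i) m) i := by
    intro m i
    apply mul_left_cancel₀ (hne (Γ.dir i))
    rw [T]; ring
  constructor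
  · intro n j k
    have h1 := T n j 0
    have h2 := T (shift j n) k 0
    have h3 := T n j 1
    have h4 := ((isSol_iff n ζ (f n) 1).1 ((hf n).1 1))
    rw [Γ.point_zero, add_zero] at h1 h2
    rw [sub_self, Γ.point_zero, add_zero, om] at h4
    have e1 : n + Γ.point 1 = shift (Γ.dir 0) n := by rw [Γ.point_one]; simp [shift]
    rw [e1] at h3
    rw [zero_add] at h1 h2
    have hc := S.lax.comm n (Γ.dir 0) j (hne _) (hne j) (x := f n 0)
      (ψ := (p (Γ.dir 0) + ζ) * f n 1 - g (Γ.dir 0) n * f n 0) (x₁ := f n 1)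
      (y₀ := f (shift j n) 0) (y₁ := f (shift j n) 1) (by ring) rfl h1 (by
        rw [h3, one_add_one_eq_two]; push_cast at h4; linear_combination h4)
    simp only [om]
    push_cast
    linear_combination h2 + hc.1
  · intro m i
    have key : ∀ i : ℤ, ∀ m, f m i = f (m + Γ.point i) 0 := by
      intro i
      induction i using Int.induction_on with
      | zero => intro m; rw [Γ.point_zero, add_zero]
      | succ i ih =>
        intro m
        rw [hstep, ih, Γ.add_point_succ, shift_add']
      | pred i ih =>
        intro m
        have h1 := hstep (m - Pi.single (Γ.dir (-(i : ℤ) - 1)) 1) (-(i : ℤ) - 1)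
        rw [shift_sub_single, sub_add_cancel] at h1
        rw [← h1, ih]
        congr 1
        have h2 := Γ.point_succ (-(i : ℤ) - 1)
        rw [sub_add_cancel] at h2
        rw [h2, shift]; abel
    exact key i m

/-- Existence of the left Jost function, with its regularity in the spectral parameter. -/
theorem exists_leftJost (S : ScatData p Γ g h) :
    ∃ Λ : (Fin N → ℤ) → ℂ → ℂ, LeftJost p Γ g h Λ ∧ (∀ n, HalfReg (Λ n)) ∧
      ∀ i, Tendsto (fun ζ => ((p (Γ.dir i) + ζ) * Λ (Γ.point (i + 1)) ζ * Λ (Γ.point i) 0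
        - p (Γ.dir i) * Λ (Γ.point i) ζ * Λ (Γ.point (i + 1)) 0) / ζ) (𝓝[rhp \ {0}] 0) (𝓝 1) := by
  choose pm pM H using S.oneDim
  choose f hf hreg i₀ w hw hb using fun m => (H m).exists_jost
  have hfam := fun ζ (hζ : ζ ∈ rhp) => S.latEq_of_family hζ (f := fun m i => f m i ζ)
    fun m => hf m ζ hζ
  refine ⟨fun n ζ => f n 0 ζ, fun ζ hζ => ⟨(hfam ζ hζ).1, fun m => ?_⟩, fun n => hreg n 0,
    fun i => ?_⟩
  · exact (hf m ζ hζ).2.congr fun i => (hfam ζ hζ).2 m i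
  · have h1 := (H 0).tendsto_wronskian_div (hf 0) (fun i => (hreg 0 i).cont) (hw 0) (hb 0) i
    refine h1.congr' ?_
    have h0 : (0 : ℂ) ∈ rhp := by simp [rhp]
    filter_upwards [self_mem_nhdsWithin] with ζ hζ
    have e1 := (hfam ζ hζ.1).2 0
    have e2 := (hfam 0 h0).2 0
    simp only [zero_add] at e1 e2
    rw [e1, e1, e2, e2]

theorem leftJost_unique (S : ScatData p Γ g h) {Λ Λ' : (Fin N → ℤ) → ℂ → ℂ}
    (hΛ : LeftJost p Γ g h Λ) (hΛ' : LeftJost p Γ g h Λ') (n : Fin N → ℤ) {ζ : ℂ} (hζ : ζ ∈ rhp) :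
    Λ' n ζ = Λ n ζ := by
  obtain ⟨pm, pM, H⟩ := S.oneDim n
  have := H.eq_of_tendsto hζ (isSol_of_latEq (hΛ' ζ hζ).1 n) (isSol_of_latEq (hΛ ζ hζ).1 n)
    ((hΛ' ζ hζ).2 n) ((hΛ ζ hζ).2 n) 0
  simpa [Γ.point_zero] using this

theorem leftJost_reg (S : ScatData p Γ g h) {Λ : (Fin N → ℤ) → ℂ → ℂ}
    (hΛ : LeftJost p Γ g h Λ) : (∀ n, HalfReg (Λ n)) ∧
      ∀ i, Tendsto (fun ζ => ((p (Γ.dir i) + ζ) * Λ (Γ.point (i + 1)) ζ * Λ (Γ.point i) 0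
        - p (Γ.dir i) * Λ (Γ.point i) ζ * Λ (Γ.point (i + 1)) 0) / ζ) (𝓝[rhp \ {0}] 0) (𝓝 1) := by
  obtain ⟨Λ₀, h1, h2, h3⟩ := S.exists_leftJost
  have e := fun n ζ (hζ : ζ ∈ rhp) => S.leftJost_unique h1 hΛ n hζ
  refine ⟨fun n => (h2 n).congr (e n), fun i => (h3 i).congr' ?_⟩
  have h0 : (0 : ℂ) ∈ rhp := by simp [rhp]
  filter_upwards [self_mem_nhdsWithin] with ζ hζ
  rw [e _ ζ hζ.1, e _ ζ hζ.1, e _ 0 h0, e _ 0 h0]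

theorem latEq_reflect {ζ : ℂ} {x : (Fin N → ℤ) → ℂ} :
    LatEq p (fun k n => h k (-shift k n)) (fun k n => g k (-shift k n)) ζ (fun n => x (-n)) ↔
      LatEq p g h (-ζ) x := by
  constructor
  · intro H n j k
    have h1 := H (-shift k (shift j n)) k j
    rw [om_reflect] at h1
    have e1 : -shift j (shift k (-shift k (shift j n))) = n := by simp only [shift]; abel
    have e2 : -shift k (-shift k (shift j n)) = shift j n := by simp only [shift]; abel
    simp only [e1, e2, neg_neg] at h1
    linear_combination h1
  · intro H n j k
    have h1 := H (-shift k (shift j n)) k j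
    rw [om_reflect]
    have e1 : shift j (shift k (-shift k (shift j n))) = -n := by simp only [shift]; abel
    have e2 : shift k (-shift k (shift j n)) = -shift j n := by simp only [shift]; abel
    rw [e1, e2] at h1
    linear_combination h1

/-- The map n ↦ -n exchanges the ends of the staircase and the signs of ζ, so all analytic facts
about Υ come from those about Λ. -/
theorem rightJost_iff_reflect {Υ : (Fin N → ℤ) → ℂ → ℂ} :
    LeftJost p Γ.reflect (fun k n => h k (-shift k n)) (fun k n => g k (-shift k n))
      (fun n => Υ (-n)) ↔ RightJost p Γ g h Υ := by
  refine forall₂_congr fun ζ _ => and_congr (latEq_reflect (x := (Υ · ζ))) ?_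
  have e : ∀ m, (fun i : ℤ => Υ (-(m + Γ.reflect.point i)) ζ)
      = (fun i : ℤ => Υ (-m + Γ.point i) ζ) ∘ Neg.neg := by
    intro m; funext i
    simp only [Function.comp, Γ.reflect_point]
    congr 1; abel
  constructor
  · intro H m
    have := (H (-m)).comp tendsto_neg_atTop_atBot
    rw [e, Function.comp_assoc, neg_neg] at this
    exact this.congr fun i => by simp
  · intro H m
    rw [e]
    exact (H (-m)).comp tendsto_neg_atBot_atTop

theorem exists_rightJost (S : ScatData p Γ g h) :
    ∃ Υ : (Fin N → ℤ) → ℂ → ℂ, RightJost p Γ g h Υ := by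
  obtain ⟨Λ, h1, -⟩ := S.reflect.exists_leftJost
  refine ⟨fun n => Λ (-n), rightJost_iff_reflect.1 ?_⟩
  simpa using h1

theorem rightJost_unique (S : ScatData p Γ g h) {Υ Υ' : (Fin N → ℤ) → ℂ → ℂ}
    (hΥ : RightJost p Γ g h Υ) (hΥ' : RightJost p Γ g h Υ') (n : Fin N → ℤ) {ζ : ℂ}
    (hζ : ζ ∈ rhp) : Υ' n ζ = Υ n ζ := by
  have := S.reflect.leftJost_unique (rightJost_iff_reflect.2 hΥ) (rightJost_iff_reflect.2 hΥ')
    (-n) hζ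
  simpa using this

theorem rightJost_reg (S : ScatData p Γ g h) {Υ : (Fin N → ℤ) → ℂ → ℂ}
    (hΥ : RightJost p Γ g h Υ) : (∀ n, HalfReg (Υ n)) ∧
      Tendsto (fun ζ => ((p (Γ.dir 0) + ζ) * Υ 0 ζ * Υ (Γ.point 1) 0
        - p (Γ.dir 0) * Υ (Γ.point 1) ζ * Υ 0 0) / ζ) (𝓝[rhp \ {0}] 0) (𝓝 1) := by
  obtain ⟨h1, h2⟩ := S.reflect.leftJost_reg (rightJost_iff_reflect.2 hΥ)
  refine ⟨fun n => by simpa using h1 (-n), ?_⟩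
  have := h2 (-1)
  have e : Γ.reflect.dir (-1) = Γ.dir 0 := rfl
  simp only [Γ.reflect_point, e] at this
  simpa [Γ.point_zero] using this

end ScatData
end Q3

/-! ### Cauchy's theorem in the right half-plane for functions with decay. -/

namespace Q3
open MeasureTheory Complex

/-- A function on the imaginary axis, continuous off the origin, with quadratic decay. -/
theorem integrable_of_decay {φ : ℝ → ℂ} (hc : ContinuousOn φ {0}ᶜ) {C : ℝ}
    (hb : ∀ t, t ≠ 0 → ‖φ t‖ * (1 + t ^ 2) ≤ C) : Integrable φ := by
  have hm : AEStronglyMeasurable φ volume := by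
    have := hc.aestronglyMeasurable (μ := volume) (measurableSet_singleton (0 : ℝ)).compl
    rwa [restrict_compl_singleton] at this
  refine (integrable_inv_one_add_sq.const_mul C).mono' hm ?_
  filter_upwards [compl_mem_ae_iff.2 (measure_singleton (0 : ℝ))] with t ht
  rw [← div_eq_mul_inv, le_div_iff₀ (by positivity)]
  exact hb t ht

theorem mul_I_mem_rhp (t : ℝ) : (t : ℂ) * I ∈ rhp := by simp [rhp]

theorem mul_I_ne_zero {t : ℝ} (ht : t ≠ 0) : (t : ℂ) * I ≠ 0 :=
  mul_ne_zero (by exact_mod_cast ht) I_ne_zero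

theorem norm_mul_I (t : ℝ) : ‖(t : ℂ) * I‖ = |t| := by simp

/-- The line is closed to a rectangle on its right. Quadratic decay makes the other three sides
O(1/T). -/
theorem integral_vertical_eq_zero {h : ℂ → ℂ} (hd : DifferentiableOn ℂ h orhp) {C : ℝ}
    (hb : ∀ ζ ∈ rhp \ {0}, ‖h ζ‖ * (1 + ‖ζ‖ ^ 2) ≤ C) {ε : ℝ} (hε : 0 < ε) :
    ∫ t : ℝ, h (ε + t * I) = 0 := by
  have hmem : ∀ x y : ℝ, 0 < x → (x : ℂ) + y * I ∈ orhp := fun x y hx => by simpa [orhp] using hx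
  have hne : ∀ x y : ℝ, 0 < x → (x : ℂ) + y * I ∈ rhp \ {0} := fun x y hx =>
    ⟨orhp_subset (hmem x y hx), fun h0 => by
      have := congrArg re (Set.mem_singleton_iff.1 h0); simp at this; linarith⟩
  have hsq : ∀ x y : ℝ, ‖(x : ℂ) + y * I‖ ^ 2 = x ^ 2 + y ^ 2 := fun x y => by
    rw [← normSq_eq_norm_sq, normSq_add_mul_I]
  have hC : ∀ x y : ℝ, 0 < x → ‖h (x + y * I)‖ * (1 + (x ^ 2 + y ^ 2)) ≤ C := fun x y hx => by
    rw [← hsq]; exact hb _ (hne x y hx)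
  have h_integrable : Integrable (fun t : ℝ => h (ε + t * I)) := by
    refine integrable_of_decay (C := C) ?_ fun t _ => le_trans ?_ (hC ε t hε)
    · exact (hd.continuousOn.comp (by fun_prop) fun t _ => hmem ε t hε)
    · gcongr; linarith [sq_nonneg ε]
  have h1 := intervalIntegral_tendsto_integral h_integrable tendsto_neg_atTop_atBot tendsto_id
  refine tendsto_nhds_unique h1 ?_
  have h2 : Tendsto (fun T : ℝ => C * (4 * T) / (1 + T ^ 2)) atTop (𝓝 0) := by
    have : Tendsto (fun T : ℝ => C * 4 * T⁻¹) atTop (𝓝 (C * 4 * 0)) :=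
      tendsto_inv_atTop_zero.const_mul _
    rw [mul_zero] at this
    have h3 := this.norm
    rw [norm_zero] at h3
    refine squeeze_zero_norm' ?_ h3
    filter_upwards [eventually_gt_atTop 0] with T hT
    rw [mul_div_assoc, mul_assoc, norm_mul, norm_mul C]
    refine mul_le_mul_of_nonneg_left ?_ (norm_nonneg _)
    rw [Real.norm_of_nonneg (by positivity), Real.norm_of_nonneg (by positivity),
      div_le_iff₀ (by positivity), ← div_eq_mul_inv, div_mul_eq_mul_div, le_div_iff₀ hT]
    nlinarith
  refine squeeze_zero_norm' ?_ h2
  filter_upwards [eventually_ge_atTop ε] with T hT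
  have hT0 : 0 < T := hε.trans_le hT
  have hrect := integral_boundary_rect_eq_zero_of_differentiableOn h (ε + (-T : ℝ) * I) (T + T * I)
    (hd.mono fun z hz => by
      simp only [mem_reProdIm, add_re, ofReal_re, mul_re, I_re, mul_zero, ofReal_im, I_im, mul_one,
        sub_self, add_zero] at hz
      have := hz.1
      rw [Set.uIcc_of_le hT] at this
      exact hε.trans_le this.1)
  simp only [add_re, ofReal_re, mul_re, I_re, mul_zero, ofReal_im, I_im, mul_one, sub_self,
    add_zero, add_im, mul_im, zero_add] at hrect
  have hpos : 0 < 1 + T ^ 2 := by positivity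
  have bd : ∀ x y : ℝ, 0 < x → T ^ 2 ≤ x ^ 2 + y ^ 2 → ‖h (x + y * I)‖ ≤ C / (1 + T ^ 2) := by
    intro x y hx hxy
    rw [le_div_iff₀ hpos]
    exact le_trans (by gcongr) (hC x y hx)
  have hb1 : ∀ y : ℝ, y ^ 2 = T ^ 2 →
      ‖∫ x in ε..T, h (x + y * I)‖ ≤ C / (1 + T ^ 2) * |T - ε| := fun y hy =>
    intervalIntegral.norm_integral_le_of_norm_le_const fun x hx => by
      rw [Set.uIoc_of_le hT] at hx
      exact bd x y (hε.trans hx.1) (by rw [hy]; linarith [sq_nonneg x])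
  have hb2 : ‖∫ y in -T..T, h (T + y * I)‖ ≤ C / (1 + T ^ 2) * |T - -T| :=
    intervalIntegral.norm_integral_le_of_norm_le_const fun y hy =>
      bd T y hT0 (by linarith [sq_nonneg y])
  have hb3 := hb1 (-T) (by ring)
  have hb4 := hb1 T rfl
  rw [abs_of_nonneg (by linarith)] at hb2 hb3 hb4
  have e : I • ∫ y in -T..T, h (ε + y * I) = ((∫ x in ε..T, h (x + (-T : ℝ) * I))
      - ∫ x in ε..T, h (x + T * I)) + I • ∫ y in -T..T, h (T + y * I) := by
    linear_combination -hrect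
  have hn : ‖∫ y in -T..T, h (ε + y * I)‖ = ‖I • ∫ y in -T..T, h (ε + y * I)‖ := by
    rw [norm_smul, norm_I, one_mul]
  have hC0 : 0 ≤ C / (1 + T ^ 2) := le_trans (norm_nonneg _) (bd T 0 hT0 (by simp))
  simp only [id]
  rw [hn, e]
  refine (norm_add_le _ _).trans ?_
  rw [norm_smul, norm_I, one_mul]
  refine (add_le_add (norm_sub_le _ _) le_rfl).trans ?_
  rw [mul_div_right_comm]
  nlinarith

/-- The line of integration moves to the axis by dominated convergence. Continuity at the origin is
not needed, only boundedness, because one point has measure zero. -/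
theorem integral_axis_eq_zero {h : ℂ → ℂ} (hd : DifferentiableOn ℂ h orhp)
    (hc : ContinuousOn h (rhp \ {0})) {C : ℝ}
    (hb : ∀ ζ ∈ rhp \ {0}, ‖h ζ‖ * (1 + ‖ζ‖ ^ 2) ≤ C) :
    Integrable (fun t : ℝ => h (t * I)) ∧ ∫ t : ℝ, h (t * I) = 0 := by
  have hmem : ∀ t : ℝ, t ≠ 0 → (t : ℂ) * I ∈ rhp \ {0} := fun t ht =>
    ⟨mul_I_mem_rhp t, mul_I_ne_zero ht⟩
  constructor
  · refine integrable_of_decay (C := C) (hc.comp (by fun_prop) fun t ht => hmem t ht) fun t ht => ?_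
    have := hb _ (hmem t ht)
    rwa [norm_mul_I, sq_abs] at this
  have hae : ∀ᵐ t : ℝ, t ≠ 0 := compl_mem_ae_iff.2 (measure_singleton (0 : ℝ))
  have hlim : Tendsto (fun ε : ℝ => ∫ t : ℝ, h (ε + t * I)) (𝓝[>] 0) (𝓝 (∫ t : ℝ, h (t * I))) := by
    refine tendsto_integral_filter_of_dominated_convergence (fun t => C * (1 + t ^ 2)⁻¹) ?_ ?_
      (integrable_inv_one_add_sq.const_mul C) ?_
    · filter_upwards [self_mem_nhdsWithin] with ε hε
      refine Continuous.aestronglyMeasurable ?_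
      exact hd.continuousOn.comp_continuous (by fun_prop) fun t => by simpa [orhp] using hε
    · filter_upwards [self_mem_nhdsWithin] with ε hε
      filter_upwards [hae] with t ht
      have h1 : (ε : ℂ) + t * I ∈ rhp \ {0} := by
        refine ⟨by simpa [rhp] using le_of_lt hε, fun h0 => ?_⟩
        have := congrArg im (Set.mem_singleton_iff.1 h0); simp at this; exact ht this
      rw [← div_eq_mul_inv, le_div_iff₀ (by positivity)]
      refine le_trans ?_ (hb _ h1)
      rw [← normSq_eq_norm_sq, normSq_add_mul_I]
      gcongr; linarith [sq_nonneg ε]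
    · filter_upwards [hae] with t ht
      have h1 := hc _ (hmem t ht)
      have h2 : Tendsto (fun ε : ℝ => (ε : ℂ) + t * I) (𝓝[>] 0) (𝓝[rhp \ {0}] (t * I)) := by
        refine tendsto_nhdsWithin_iff.2 ⟨?_, ?_⟩
        · have : Tendsto (fun ε : ℝ => (ε : ℂ) + t * I) (𝓝 0) (𝓝 ((0 : ℝ) + t * I)) :=
            Continuous.tendsto (by fun_prop) 0
          rw [ofReal_zero, zero_add] at this
          exact this.mono_left nhdsWithin_le_nhds
        · filter_upwards [self_mem_nhdsWithin] with ε hε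
          refine ⟨by simpa [rhp] using le_of_lt hε, fun h0 => ?_⟩
          have := congrArg im (Set.mem_singleton_iff.1 h0); simp at this; exact ht this
      exact h1.tendsto.comp h2
  refine tendsto_nhds_unique hlim (tendsto_const_nhds.congr' ?_)
  filter_upwards [self_mem_nhdsWithin] with ε hε
  exact (integral_vertical_eq_zero hd hb hε).symm

/-- Functions holomorphic on the open right half-plane, continuous up to the imaginary axis except
possibly at the origin, bounded near the origin and `O(1 / ζ)` at infinity. -/
structure Decays (h : ℂ → ℂ) : Prop where
  diff : DifferentiableOn ℂ h orhp
  cont : ContinuousOn h (rhp \ {0})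
  bound : ∃ C, ∀ ζ ∈ rhp \ {0}, ‖h ζ‖ * (1 + ‖ζ‖) ≤ C

theorem mul_bound {x y r C C' : ℝ} (hx : 0 ≤ x) (hy : 0 ≤ y) (hr : 0 ≤ r) (h1 : x * (1 + r) ≤ C)
    (h2 : y * (1 + r) ≤ C') : x * y * (1 + r ^ 2) ≤ C * C' := by
  have h3 : x * (1 + r) * (y * (1 + r)) ≤ C * C' :=
    mul_le_mul h1 h2 (by positivity) (le_trans (by positivity) h1)
  nlinarith [mul_nonneg (mul_nonneg hx hy) hr]

namespace Decays
variable {f h : ℂ → ℂ}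

theorem integral_mul (hf : Decays f) (hh : Decays h) :
    Integrable (fun t : ℝ => f (t * I) * h (t * I)) ∧ ∫ t : ℝ, f (t * I) * h (t * I) = 0 := by
  obtain ⟨C, hC⟩ := hf.bound
  obtain ⟨C', hC'⟩ := hh.bound
  refine integral_axis_eq_zero (h := fun ζ => f ζ * h ζ) (hf.diff.mul hh.diff)
    (hf.cont.mul hh.cont) (C := C * C') fun ζ hζ => ?_
  rw [norm_mul]
  exact mul_bound (norm_nonneg _) (norm_nonneg _) (norm_nonneg _) (hC ζ hζ) (hC' ζ hζ)

/-- Integrability of products with independent reflections of the variable. -/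
theorem integrable_mul {s t : ℝ → ℝ} (hs : s = id ∨ s = Neg.neg) (ht : t = id ∨ t = Neg.neg)
    (hf : Decays f) (hh : Decays h) :
    Integrable (fun x : ℝ => f (s x * I) * h (t x * I)) := by
  obtain ⟨C, hC⟩ := hf.bound
  obtain ⟨C', hC'⟩ := hh.bound
  have key : ∀ s : ℝ → ℝ, (s = id ∨ s = Neg.neg) → Continuous s ∧ (∀ x, |s x| = |x|) := by
    rintro s (rfl | rfl)
    · exact ⟨continuous_id, fun _ => rfl⟩
    · exact ⟨continuous_neg, fun _ => abs_neg _⟩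
  have hmem : ∀ s : ℝ → ℝ, (s = id ∨ s = Neg.neg) → ∀ x, x ≠ 0 → (s x : ℂ) * I ∈ rhp \ {0} := by
    intro s hs x hx
    refine ⟨mul_I_mem_rhp _, mul_I_ne_zero ?_⟩
    rw [← abs_ne_zero, (key s hs).2]; exact abs_ne_zero.2 hx
  refine integrable_of_decay (C := C * C') ?_ fun x hx => ?_
  · have h1 := (key s hs).1
    have h2 := (key t ht).1
    exact (hf.cont.comp (by fun_prop) fun x hx => hmem s hs x hx).mul
      (hh.cont.comp (by fun_prop) fun x hx => hmem t ht x hx)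
  · have h1 := hC _ (hmem s hs x hx)
    have h2 := hC' _ (hmem t ht x hx)
    rw [norm_mul_I, (key _ ‹_›).2] at h1 h2
    rw [norm_mul, ← sq_abs x]
    exact mul_bound (norm_nonneg _) (norm_nonneg _) (abs_nonneg _) h1 h2

theorem inv_add {w : ℂ} (hw : w ∈ orhp) : Decays fun ζ => (ζ + w)⁻¹ := by
  have hre : 0 < w.re := hw
  have hge : ∀ ζ ∈ rhp, w.re ≤ ‖ζ + w‖ := fun ζ hζ => by
    have h1 := Complex.re_le_norm (ζ + w)
    have h2 : 0 ≤ ζ.re := hζ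
    simp at h1; linarith
  have hne : ∀ ζ ∈ rhp, ζ + w ≠ 0 := fun ζ hζ => norm_pos_iff.1 (hre.trans_le (hge ζ hζ))
  have hd : DifferentiableOn ℂ (fun ζ : ℂ => ζ + w) Set.univ := by fun_prop
  refine ⟨fun ζ hζ => ?_, fun ζ hζ => ?_, (1 + ‖w‖) / w.re + 1, fun ζ hζ => ?_⟩
  · exact (DifferentiableAt.fun_inv (h := fun ζ => ζ + w) (by fun_prop)
      (hne ζ (orhp_subset hζ))).differentiableWithinAt
  · exact (ContinuousAt.inv₀ (f := fun ζ => ζ + w) (by fun_prop) (hne ζ hζ.1)).continuousWithinAt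
  · have h1 := hge ζ hζ.1
    have h2 := norm_pos_iff.2 (hne ζ hζ.1)
    have h3 : ‖ζ‖ ≤ ‖ζ + w‖ + ‖w‖ := by simpa using norm_sub_le (ζ + w) w
    rw [norm_inv, inv_mul_eq_div, div_le_iff₀ h2, add_mul, div_mul_eq_mul_div, one_mul]
    have h4 : 1 + ‖w‖ ≤ (1 + ‖w‖) * ‖ζ + w‖ / w.re := by
      rw [le_div_iff₀ hre]; gcongr
    linarith

theorem congr (hf : Decays f) (he : ∀ ζ ∈ rhp \ {0}, h ζ = f ζ) : Decays h := by
  refine ⟨hf.diff.congr fun ζ hζ => he ζ ⟨orhp_subset hζ, ?_⟩, hf.cont.congr he, ?_⟩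
  · rintro rfl; simp [orhp] at hζ
  · obtain ⟨C, hC⟩ := hf.bound
    exact ⟨C, fun ζ hζ => by rw [he ζ hζ]; exact hC ζ hζ⟩

theorem add (hf : Decays f) (hh : Decays h) : Decays fun ζ => f ζ + h ζ := by
  obtain ⟨C, hC⟩ := hf.bound
  obtain ⟨C', hC'⟩ := hh.bound
  refine ⟨hf.diff.add hh.diff, hf.cont.add hh.cont, C + C', fun ζ hζ => ?_⟩
  refine le_trans (mul_le_mul_of_nonneg_right (norm_add_le _ _) (by positivity)) ?_
  rw [add_mul]; exact add_le_add (hC ζ hζ) (hC' ζ hζ)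

theorem const_mul (hf : Decays f) (c : ℂ) : Decays fun ζ => c * f ζ := by
  obtain ⟨C, hC⟩ := hf.bound
  refine ⟨hf.diff.const_mul c, continuousOn_const.mul hf.cont, ‖c‖ * C, fun ζ hζ => ?_⟩
  rw [norm_mul, mul_assoc]
  exact mul_le_mul_of_nonneg_left (hC ζ hζ) (norm_nonneg _)

theorem sub (hf : Decays f) (hh : Decays h) : Decays fun ζ => f ζ - h ζ :=
  (hf.add (hh.const_mul (-1))).congr fun ζ _ => by ring

/-- Local bounds at the origin and at infinity suffice. -/
theorem of_eventually (hd : DifferentiableOn ℂ h orhp) (hc : ContinuousOn h (rhp \ {0}))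
    {C₀ C₁ : ℝ} (h0 : ∀ᶠ ζ in 𝓝[rhp \ {0}] 0, ‖h ζ‖ ≤ C₀)
    (h1 : ∀ᶠ ζ in Bornology.cobounded ℂ ⊓ 𝓟 rhp, ‖h ζ‖ * ‖ζ‖ ≤ C₁) : Decays h := by
  refine ⟨hd, hc, ?_⟩
  obtain ⟨ε, hε, H0⟩ := Metric.mem_nhdsWithin_iff.1 h0
  obtain ⟨R, -, H1⟩ := ((Metric.hasBasis_cobounded_compl_closedBall (0 : ℂ)).inf_principal
    rhp).mem_iff.1 h1
  have hK : IsCompact (Metric.closedBall (0 : ℂ) (max R 1) ∩ (rhp ∩ (Metric.ball 0 ε)ᶜ)) :=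
    (isCompact_closedBall 0 _).inter_right ((isClosed_le continuous_const continuous_re).inter
      Metric.isOpen_ball.isClosed_compl)
  obtain ⟨C₂, H2⟩ := hK.exists_bound_of_continuousOn (hc.mono fun ζ hζ => ⟨hζ.2.1, fun h => by
    rw [Set.mem_singleton_iff.1 h] at hζ
    exact hζ.2.2 (Metric.mem_ball_self hε)⟩)
  refine ⟨|C₀| * (1 + ε) + 2 * |C₁| + |C₂| * (1 + max R 1), fun ζ hζ => ?_⟩
  have p1 : 0 ≤ |C₀| * (1 + ε) := by positivity
  have p2 : 0 ≤ |C₂| * (1 + max R 1) := by positivity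
  by_cases hs : ζ ∈ Metric.ball (0 : ℂ) ε
  · have h2 : ‖h ζ‖ ≤ |C₀| := le_trans (H0 ⟨hs, hζ⟩) (le_abs_self _)
    have h3 : ‖ζ‖ ≤ ε := (mem_ball_zero_iff.1 hs).le
    have : ‖h ζ‖ * (1 + ‖ζ‖) ≤ |C₀| * (1 + ε) := by gcongr
    linarith [abs_nonneg C₁]
  by_cases hl : ζ ∈ Metric.closedBall (0 : ℂ) (max R 1)
  · have h2 : ‖h ζ‖ ≤ |C₂| := le_trans (H2 ζ ⟨hl, hζ.1, hs⟩) (le_abs_self _)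
    have h3 : ‖ζ‖ ≤ max R 1 := by simpa using hl
    have : ‖h ζ‖ * (1 + ‖ζ‖) ≤ |C₂| * (1 + max R 1) := by gcongr
    linarith [abs_nonneg C₁]
  · have hl' : max R 1 < ‖ζ‖ := by simpa using hl
    have h2 : ‖h ζ‖ * ‖ζ‖ ≤ C₁ := H1 ⟨by
      simpa using (le_max_left R 1).trans_lt hl', hζ.1⟩
    have h3 : 1 ≤ ‖ζ‖ := (le_max_right R 1).trans hl'.le
    nlinarith [le_abs_self C₁, norm_nonneg (h ζ)]

theorem _root_.Q3.HalfReg.decays (hf : HalfReg f) : Decays fun ζ => f ζ - 1 := by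
  obtain ⟨C, hC⟩ := hf.bound
  have h0 : (0 : ℂ) ∈ rhp := by simp [rhp]
  refine of_eventually (C₀ := ‖f 0 - 1‖ + 1) (C₁ := C) (hf.diff.sub_const 1)
    ((hf.cont.sub continuousOn_const).mono Set.sdiff_subset) ?_
    (mem_inf_of_right fun ζ hζ => hC ζ hζ)
  have := ((hf.cont 0 h0).sub (continuousWithinAt_const (b := (1 : ℂ)))).norm
  have h2 := this.eventually_lt (tendsto_const_nhds (x := ‖f 0 - 1‖ + 1)) (by simp)
  filter_upwards [h2.filter_mono (nhdsWithin_mono 0 Set.sdiff_subset)] with ζ hζ using hζ.le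

end Decays
end Q3

/-! ### Poles, Cauchy's formula and the jump relation. -/

namespace Q3
open MeasureTheory Complex

/-- Subtraction of finitely many simple poles. -/
theorem exists_decays_of_poles {ι : Type*} [Fintype ι] {z r : ι → ℂ} (hz : Function.Injective z)
    (hzo : ∀ k, z k ∈ orhp) {h : ℂ → ℂ} (hd : DifferentiableOn ℂ h (orhp \ Set.range z))
    (hc : ContinuousOn h (rhp \ ({0} ∪ Set.range z)))
    (hr : ∀ k, Tendsto (fun σ => (σ - z k) * h σ) (𝓝[≠] z k) (𝓝 (r k))) {C₀ C₁ : ℝ}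
    (h0 : ∀ᶠ ζ in 𝓝[rhp \ {0}] 0, ‖h ζ‖ ≤ C₀)
    (h1 : ∀ᶠ ζ in Bornology.cobounded ℂ ⊓ 𝓟 rhp, ‖h ζ‖ * ‖ζ‖ ≤ C₁) :
    ∃ f, Decays f ∧ ∀ σ ∈ rhp \ {0}, σ ∉ Set.range z → h σ = f σ + ∑ k, r k * (σ - z k)⁻¹ := by
  classical
  set q : ℂ → ℂ := fun σ => h σ - ∑ k, r k * (σ - z k)⁻¹ with hq
  -- After subtraction of the principal parts the singularities are removable; the value at each
  -- former pole is the limit.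
  set f : ℂ → ℂ := fun σ => if σ ∈ Set.range z then (𝓝[≠] σ).limUnder q else q σ with hf
  have hclosed : IsClosed (Set.range z) := (Set.finite_range z).isClosed
  have hfq : ∀ σ, σ ∉ Set.range z → f =ᶠ[𝓝 σ] q := fun σ hσ => by
    filter_upwards [hclosed.isOpen_compl.mem_nhds hσ] with τ hτ
    simp only [hf, if_neg hτ]
  have hpd : ∀ σ, ∀ k, σ ≠ z k → DifferentiableAt ℂ (fun τ => r k * (τ - z k)⁻¹) σ :=
    fun σ k hσ => (DifferentiableAt.fun_inv (h := fun τ => τ - z k) (by fun_prop)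
      (sub_ne_zero.2 hσ)).const_mul _
  have hsd : ∀ σ, σ ∉ Set.range z → DifferentiableAt ℂ (fun τ => ∑ k, r k * (τ - z k)⁻¹) σ :=
    fun σ hσ => DifferentiableAt.fun_sum fun k _ => hpd σ k fun h => hσ ⟨k, h.symm⟩
  have hopen : IsOpen (orhp \ Set.range z) := isOpen_orhp.sdiff hclosed
  have hqd : ∀ σ ∈ orhp \ Set.range z, DifferentiableAt ℂ q σ := fun σ hσ =>
    ((hd σ hσ).differentiableAt (hopen.mem_nhds hσ)).sub (hsd σ hσ.2)
  have hfd : DifferentiableOn ℂ f orhp := by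
    intro σ hσ
    refine DifferentiableAt.differentiableWithinAt ?_
    by_cases hm : σ ∈ Set.range z
    · obtain ⟨k, rfl⟩ := hm
      have hcl : IsClosed (z '' {j | j ≠ k}) := ((Set.toFinite _).image z).isClosed
      have hk : z k ∉ z '' {j | j ≠ k} := by
        rintro ⟨j, hj, e⟩; exact hj (hz e)
      have hs : orhp \ (z '' {j | j ≠ k}) ∈ 𝓝 (z k) :=
        (isOpen_orhp.sdiff hcl).mem_nhds ⟨hzo k, hk⟩
      have hsub : ∀ τ ∈ (orhp \ (z '' {j | j ≠ k})) \ {z k}, τ ∈ orhp \ Set.range z := by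
        rintro τ ⟨⟨h1, h2⟩, h3⟩
        refine ⟨h1, ?_⟩
        rintro ⟨j, rfl⟩
        by_cases hj : j = k
        · exact h3 (by rw [hj]; rfl)
        · exact h2 ⟨j, hj, rfl⟩
      -- The criterion for removability: (τ - z_k) q(τ) → 0, because the subtracted term has exactly
      -- the residue of h at z_k.
      have ho : (fun τ => q τ - q (z k)) =o[𝓝[≠] z k] fun τ => (τ - z k)⁻¹ := by
        rw [Asymptotics.isLittleO_iff_tendsto' (by
          filter_upwards [self_mem_nhdsWithin] with τ hτ h
          exact absurd (inv_eq_zero.1 h) (sub_ne_zero.2 hτ))]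
        have hid : Tendsto (fun τ => τ - z k) (𝓝[≠] z k) (𝓝 0) := by
          have : Tendsto (fun τ => τ - z k) (𝓝 (z k)) (𝓝 (z k - z k)) :=
            Continuous.tendsto (by fun_prop) _
          rw [sub_self] at this
          exact this.mono_left nhdsWithin_le_nhds
        have hother : Tendsto (fun τ => ∑ j ∈ Finset.univ.erase k, r j * (τ - z j)⁻¹)
            (𝓝[≠] z k) (𝓝 (∑ j ∈ Finset.univ.erase k, r j * (z k - z j)⁻¹)) := by
          refine Tendsto.mono_left ?_ nhdsWithin_le_nhds
          exact (DifferentiableAt.fun_sum fun j hj => hpd (z k) j fun h =>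
            (Finset.mem_erase.1 hj).1 (hz h).symm).continuousAt
        have := ((hr k).sub_const (r k)).sub (hid.mul (hother.add_const (q (z k))))
        rw [sub_self, zero_mul, sub_zero] at this
        refine this.congr' ?_
        filter_upwards [self_mem_nhdsWithin] with τ hτ
        have hτ' : τ - z k ≠ 0 := sub_ne_zero.2 hτ
        have hqτ : q τ = h τ - ∑ k, r k * (τ - z k)⁻¹ := rfl
        rw [hqτ]
        have hsum := Finset.add_sum_erase Finset.univ (fun j => r j * (τ - z j)⁻¹)
          (Finset.mem_univ k)
        rw [← hsum, div_inv_eq_mul]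
        have : r k * (τ - z k)⁻¹ * (τ - z k) = r k := by
          rw [mul_assoc, inv_mul_cancel₀ hτ', mul_one]
        linear_combination this
      have hu := differentiableOn_update_limUnder_of_isLittleO hs
        (fun τ hτ => (hqd τ (hsub τ hτ)).differentiableWithinAt) ho
      refine ((hu _ (mem_of_mem_nhds hs)).differentiableAt hs).congr_of_eventuallyEq ?_
      filter_upwards [hs] with τ hτ
      by_cases hτk : τ = z k
      · subst hτk
        simp only [hf, if_pos (Set.mem_range_self k), Function.update_self]
      · rw [Function.update_of_ne hτk]
        simp only [hf, if_neg (hsub τ ⟨hτ, hτk⟩).2]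
    · exact (hqd σ ⟨hσ, hm⟩).congr_of_eventuallyEq (hfq σ hm)
  have h0r : (0 : ℂ) ∉ Set.range z := by
    rintro ⟨k, hk⟩; have := hzo k; simp [hk, orhp] at this
  have hfc : ContinuousOn f (rhp \ {0}) := by
    intro σ hσ
    by_cases hm : σ ∈ orhp
    · exact ((hfd σ hm).differentiableAt (isOpen_orhp.mem_nhds hm)).continuousAt.continuousWithinAt
    · have hσr : σ ∉ Set.range z := by rintro ⟨k, rfl⟩; exact hm (hzo k)
      have e := hfq σ hσr
      refine ContinuousWithinAt.congr_of_eventuallyEq ?_ (e.filter_mono nhdsWithin_le_nhds)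
        e.self_of_nhds
      refine ContinuousWithinAt.sub ?_ (hsd σ hσr).continuousAt.continuousWithinAt
      have h2 := hc σ ⟨hσ.1, by rintro (h | h); exacts [hσ.2 h, hσr h]⟩
      refine h2.mono_of_mem_nhdsWithin ?_
      filter_upwards [self_mem_nhdsWithin,
        mem_nhdsWithin_of_mem_nhds (hclosed.isOpen_compl.mem_nhds hσr)] with τ h3 h4
      exact ⟨h3.1, by rintro (h | h); exacts [h3.2 h, h4 h]⟩
  have e0 := (hfq 0 h0r).filter_mono (nhdsWithin_le_nhds (s := rhp \ {0}))
  have hs0 : ∀ᶠ ζ in 𝓝[rhp \ {0}] (0 : ℂ), ‖∑ k, r k * (ζ - z k)⁻¹‖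
      < ‖∑ k, r k * (0 - z k)⁻¹‖ + 1 :=
    ((hsd 0 h0r).continuousAt.norm.continuousWithinAt.tendsto).eventually_lt
      (tendsto_const_nhds) (by simp)
  have hinf : ∀ᶠ ζ in Bornology.cobounded ℂ ⊓ 𝓟 rhp, ∀ k, ‖ζ - z k‖ ≥ ‖ζ‖ / 2 ∧ 0 < ‖ζ‖ := by
    refine eventually_all.2 fun k => ?_
    refine Eventually.filter_mono inf_le_left ?_
    filter_upwards [tendsto_norm_cobounded_atTop.eventually_ge_atTop (2 * ‖z k‖ + 1)] with ζ hζ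
    have := norm_sub_norm_le ζ (z k)
    have := norm_nonneg (z k)
    constructor <;> linarith
  refine ⟨f, Decays.of_eventually (C₀ := C₀ + (‖∑ k, r k * (0 - z k)⁻¹‖ + 1))
    (C₁ := C₁ + ∑ k, 2 * ‖r k‖) hfd hfc ?_ ?_, ?_⟩
  · filter_upwards [e0, hs0, h0] with ζ h2 h3 h4
    rw [h2]
    exact (norm_sub_le _ _).trans (add_le_add h4 h3.le)
  · have hcl : ∀ᶠ ζ in Bornology.cobounded ℂ ⊓ 𝓟 rhp, ζ ∉ Set.range z := by
      filter_upwards [hinf] with ζ h2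
      rintro ⟨k, rfl⟩
      have := h2 k
      simp at this
      have := norm_pos_iff.2 this.2
      linarith
    filter_upwards [h1, hinf, hcl] with ζ h2 h3 h4
    simp only [hf, if_neg h4]
    refine (mul_le_mul_of_nonneg_right (norm_sub_le _ _) (norm_nonneg _)).trans ?_
    rw [add_mul]
    refine add_le_add h2 ?_
    refine (mul_le_mul_of_nonneg_right (norm_sum_le _ _) (norm_nonneg _)).trans ?_
    rw [Finset.sum_mul]
    refine Finset.sum_le_sum fun k _ => ?_
    obtain ⟨h5, h6⟩ := h3 k
    rw [norm_mul, norm_inv, mul_assoc, mul_comm (2 : ℝ)]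
    refine mul_le_mul_of_nonneg_left ?_ (norm_nonneg _)
    rw [inv_mul_le_iff₀ (by linarith)]; linarith
  · intro σ _ hσ
    simp only [hf, if_neg hσ, hq]; ring

theorem integral_inv_add_one_mul_inv_sub_one :
    ∫ t : ℝ, ((t : ℂ) * I + 1)⁻¹ * ((t : ℂ) * I - 1)⁻¹ = -Real.pi := by
  have : ∀ t : ℝ, ((t : ℂ) * I + 1)⁻¹ * ((t : ℂ) * I - 1)⁻¹ = ((-(1 + t ^ 2)⁻¹ : ℝ) : ℂ) := by
    intro t
    rw [← mul_inv, show ((t : ℂ) * I + 1) * (t * I - 1) = t ^ 2 * (I ^ 2) - 1 by ring, I_sq,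
      ofReal_neg, ofReal_inv, ← inv_neg]
    push_cast; congr 1; ring
  simp_rw [this]
  rw [integral_complex_ofReal, integral_neg, integral_univ_inv_one_add_sq]
  simp

theorem sub_mul_I_eq (t : ℝ) (ζ : ℂ) : ((t : ℂ) * I - ζ)⁻¹ = -(((-t : ℝ) : ℂ) * I + ζ)⁻¹ := by
  rw [← inv_neg]; congr 1; push_cast; ring

theorem one_mem_orhp : (1 : ℂ) ∈ orhp := by simp [orhp]

theorem mul_I_add_ne_zero {ζ : ℂ} (hζ : ζ ∈ orhp) (t : ℝ) : (t : ℂ) * I + ζ ≠ 0 := by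
  intro h; have := congrArg re h; have h2 : 0 < ζ.re := hζ; simp at this; linarith

theorem mul_I_sub_ne_zero {ζ : ℂ} (hζ : ζ ∈ orhp) (t : ℝ) : (t : ℂ) * I - ζ ≠ 0 := by
  intro h; have := congrArg re h; have h2 : 0 < ζ.re := hζ; simp at this; linarith

theorem integrable_mul_inv_sub {f : ℂ → ℂ} (hf : Decays f) {ζ : ℂ} (hζ : ζ ∈ orhp) :
    Integrable fun t : ℝ => f (t * I) * ((t : ℂ) * I - ζ)⁻¹ := by
  refine (Decays.integrable_mul (Or.inl rfl) (Or.inr rfl) hf (Decays.inv_add hζ)).neg.congr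
    (Eventually.of_forall fun t => ?_)
  simp only [sub_mul_I_eq t ζ, Pi.neg_apply, id, mul_neg]

/-- Partial fractions reduce to ζ = 1, which is the arctangent integral; the other term has both
poles in the right half-plane and integrates to zero. This is the only explicit integral behind
Cauchy's formula. -/
theorem integral_inv_add_one_mul_inv_sub {ζ : ℂ} (hζ : ζ ∈ orhp) :
    ∫ t : ℝ, ((t : ℂ) * I + 1)⁻¹ * ((t : ℂ) * I - ζ)⁻¹ = -(2 * Real.pi) * (1 + ζ)⁻¹ := by
  have hne : 1 + ζ ≠ 0 := by
    intro h; have := congrArg re h; have h2 : 0 < ζ.re := hζ; simp at this; linarith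
  have h1 := (Decays.inv_add hζ).integral_mul (Decays.inv_add one_mem_orhp)
  have h2 : ∫ t : ℝ, ((t : ℂ) * I - ζ)⁻¹ * ((t : ℂ) * I - 1)⁻¹ = 0 := by
    rw [← h1.2, ← integral_neg_eq_self]
    refine integral_congr_ae (Eventually.of_forall fun t => ?_)
    simp only [sub_mul_I_eq _ ζ, sub_mul_I_eq _ 1, neg_mul_neg, neg_neg]
  have h2i : Integrable fun t : ℝ => ((t : ℂ) * I - ζ)⁻¹ * ((t : ℂ) * I - 1)⁻¹ := by
    refine h1.1.comp_neg.congr (Eventually.of_forall fun t => ?_)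
    simp only [sub_mul_I_eq _ ζ, sub_mul_I_eq _ 1, neg_mul_neg]
  have h3 : Integrable fun t : ℝ => ((t : ℂ) * I + 1)⁻¹ * ((t : ℂ) * I - 1)⁻¹ :=
    integrable_mul_inv_sub (f := fun σ => (σ + 1)⁻¹) (Decays.inv_add one_mem_orhp) one_mem_orhp
  have e : ∀ t : ℝ, ((t : ℂ) * I + 1)⁻¹ * ((t : ℂ) * I - ζ)⁻¹
      = (1 + ζ)⁻¹ * ((ζ - 1) * (((t : ℂ) * I - ζ)⁻¹ * ((t : ℂ) * I - 1)⁻¹)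
        + 2 * (((t : ℂ) * I + 1)⁻¹ * ((t : ℂ) * I - 1)⁻¹)) := by
    intro t
    have a1 := mul_I_add_ne_zero one_mem_orhp t
    have a2 := mul_I_sub_ne_zero one_mem_orhp t
    have a3 := mul_I_sub_ne_zero hζ t
    field_simp
    ring
  simp_rw [e]
  rw [integral_const_mul, integral_add (h2i.const_mul _) (h3.const_mul _), integral_const_mul,
    integral_const_mul, h2, integral_inv_add_one_mul_inv_sub_one]
  ring

theorem eventually_of_norm_gt {P : ℂ → Prop} (R : ℝ) (h : ∀ ζ ∈ rhp, R < ‖ζ‖ → P ζ) :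
    ∀ᶠ ζ in Bornology.cobounded ℂ ⊓ 𝓟 rhp, P ζ := by
  rw [eventually_inf_principal]
  filter_upwards [tendsto_norm_cobounded_atTop.eventually_gt_atTop R] with ζ h1 h2 using h ζ h2 h1

/-- Cauchy's formula for the right half-plane. -/
theorem Decays.integral_mul_inv_sub {f : ℂ → ℂ} (hf : Decays f) {ζ : ℂ} (hζ : ζ ∈ orhp) :
    ∫ t : ℝ, f (t * I) * ((t : ℂ) * I - ζ)⁻¹ = -(2 * Real.pi) * f ζ := by
  have hne1 : ∀ σ ∈ rhp, σ + 1 ≠ 0 := by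
    intro σ h1 h; have := congrArg re h; have h2 : 0 ≤ σ.re := h1; simp at this; linarith
  have hζ0 : ζ ≠ 0 := by rintro rfl; simp [orhp] at hζ
  have hbd : ∀ σ, ‖ζ‖ / 2 ≤ ‖σ - ζ‖ → ‖(σ + 1) * (σ - ζ)⁻¹‖ ≤ 1 + ‖1 + ζ‖ / (‖ζ‖ / 2) := by
    intro σ h
    have hp : 0 < ‖ζ‖ / 2 := by positivity
    have h0 : σ - ζ ≠ 0 := norm_pos_iff.1 (hp.trans_le h)
    have : (σ + 1) * (σ - ζ)⁻¹ = 1 + (1 + ζ) * (σ - ζ)⁻¹ := by field_simp; ring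
    rw [this]
    refine (norm_add_le _ _).trans ?_
    rw [norm_one, norm_mul, norm_inv, ← div_eq_mul_inv]
    gcongr
  obtain ⟨C, hC⟩ := hf.bound
  have hCf : ∀ σ ∈ rhp \ {0}, ‖f σ‖ ≤ C ∧ ‖f σ‖ * ‖σ‖ ≤ C := fun σ hσ => by
    have := hC σ hσ
    have h1 := mul_nonneg (norm_nonneg (f σ)) (norm_nonneg σ)
    have h2 := norm_nonneg (f σ)
    constructor <;> linarith
  -- The factor σ + 1 leaves f(σ)(σ + 1)/(σ - ζ) with first-order decay, so that
  -- `exists_decays_of_poles` applies. Its inverse is restored afterwards as the second decaying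
  -- factor of the integrand.
  obtain ⟨f₀, h1, h2⟩ := exists_decays_of_poles (ι := Unit) (z := fun _ => ζ)
    (r := fun _ => f ζ * (ζ + 1)) (h := fun σ => f σ * ((σ + 1) * (σ - ζ)⁻¹))
    (C₀ := C * (1 + ‖1 + ζ‖ / (‖ζ‖ / 2))) (C₁ := C * (1 + ‖1 + ζ‖ / (‖ζ‖ / 2)))
    (fun _ _ _ => rfl) (fun _ => hζ)
    (by
      intro σ hσ
      have hne : σ - ζ ≠ 0 := sub_ne_zero.2 fun h => hσ.2 ⟨(), h.symm⟩
      refine ((hf.diff σ hσ.1).mono Set.sdiff_subset).mul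
        (DifferentiableAt.differentiableWithinAt ?_)
      exact DifferentiableAt.fun_mul (by fun_prop)
        (DifferentiableAt.fun_inv (h := fun σ => σ - ζ) (by fun_prop) hne))
    (by
      intro σ hσ
      have hne : σ - ζ ≠ 0 := sub_ne_zero.2 fun h => hσ.2 (Or.inr ⟨(), h.symm⟩)
      refine ((hf.cont σ ⟨hσ.1, fun h => hσ.2 (Or.inl h)⟩).mono fun τ hτ =>
        ⟨hτ.1, fun h => hτ.2 (Or.inl h)⟩).mul (ContinuousAt.continuousWithinAt ?_)
      exact ContinuousAt.fun_mul (by fun_prop)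
        (ContinuousAt.inv₀ (f := fun σ => σ - ζ) (by fun_prop) hne))
    (by
      intro _
      have h3 : ContinuousAt (fun σ => f σ * (σ + 1)) ζ :=
        ((hf.diff ζ hζ).differentiableAt (isOpen_orhp.mem_nhds hζ)).continuousAt.mul (by fun_prop)
      refine (h3.tendsto.mono_left nhdsWithin_le_nhds).congr' ?_
      filter_upwards [self_mem_nhdsWithin] with σ hσ
      have hne : σ - ζ ≠ 0 := sub_ne_zero.2 hσ
      field_simp)
    (by
      have h3 : ∀ᶠ σ in 𝓝[rhp \ {0}] (0 : ℂ), ‖ζ‖ / 2 < ‖σ - ζ‖ := by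
        refine (Tendsto.eventually_const_lt ?_ ((Continuous.tendsto (by fun_prop) (0 : ℂ) :
          Tendsto (fun σ : ℂ => ‖σ - ζ‖) (𝓝 0) (𝓝 ‖(0 : ℂ) - ζ‖)).mono_left nhdsWithin_le_nhds))
        rw [zero_sub, norm_neg]; linarith [norm_pos_iff.2 hζ0]
      filter_upwards [h3, self_mem_nhdsWithin] with σ h4 h5
      rw [norm_mul]
      exact mul_le_mul (hCf σ h5).1 (hbd σ h4.le) (norm_nonneg _)
        ((norm_nonneg _).trans (hCf σ h5).1))
    (by
      refine eventually_of_norm_gt (2 * ‖ζ‖) fun σ hσ h3 => ?_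
      have h5 : σ ∈ rhp \ {0} := ⟨hσ, fun h => by
        rw [Set.mem_singleton_iff.1 h, norm_zero] at h3; linarith [norm_nonneg ζ]⟩
      have h4 := norm_sub_norm_le σ ζ
      rw [norm_mul, mul_right_comm]
      exact mul_le_mul (hCf σ h5).2 (hbd σ (by linarith [norm_nonneg ζ])) (norm_nonneg _)
        ((norm_nonneg _).trans (hCf σ h5).1))
  have h3 := h1.integral_mul (Decays.inv_add one_mem_orhp)
  have h4 : Integrable fun t : ℝ => ((t : ℂ) * I + 1)⁻¹ * ((t : ℂ) * I - ζ)⁻¹ :=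
    integrable_mul_inv_sub (f := fun σ => (σ + 1)⁻¹) (Decays.inv_add one_mem_orhp) hζ
  have e : ∀ᵐ t : ℝ, f (t * I) * ((t : ℂ) * I - ζ)⁻¹ = f₀ (t * I) * ((t : ℂ) * I + 1)⁻¹
      + f ζ * (ζ + 1) * (((t : ℂ) * I + 1)⁻¹ * ((t : ℂ) * I - ζ)⁻¹) := by
    filter_upwards [compl_mem_ae_iff.2 (measure_singleton (0 : ℝ))] with t ht
    have h5 := h2 (t * I) ⟨mul_I_mem_rhp t, mul_I_ne_zero ht⟩ (by
      rintro ⟨_, h6⟩; exact mul_I_sub_ne_zero hζ t (by rw [← h6]; simp))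
    simp only [Finset.univ_unique, Finset.sum_singleton] at h5
    have a1 := mul_I_add_ne_zero one_mem_orhp t
    have : f (t * I) * ((t : ℂ) * I - ζ)⁻¹
        = (f (t * I) * (((t : ℂ) * I + 1) * ((t : ℂ) * I - ζ)⁻¹)) * ((t : ℂ) * I + 1)⁻¹ := by
      field_simp
    rw [this, h5]; ring
  rw [integral_congr_ae e, integral_add h3.1 (h4.const_mul _), h3.2, integral_const_mul,
    integral_inv_add_one_mul_inv_sub hζ, zero_add]
  have : 1 + ζ ≠ 0 := by rw [add_comm]; exact hne1 ζ (orhp_subset hζ)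
  rw [add_comm ζ 1]
  field_simp

/-- The singular integral equation satisfied by the left member `f` of a pair related on the
imaginary axis by `h(σ) - f(-σ) = G(σ)`, where `h` has simple poles in the right half-plane. -/
theorem Decays.eq_of_jump {ι : Type*} [Fintype ι] {z r : ι → ℂ} (hz : Function.Injective z)
    (hzo : ∀ k, z k ∈ orhp) {f h : ℂ → ℂ} (hf : Decays f)
    (hd : DifferentiableOn ℂ h (orhp \ Set.range z))
    (hc : ContinuousOn h (rhp \ ({0} ∪ Set.range z)))
    (hr : ∀ k, Tendsto (fun σ => (σ - z k) * h σ) (𝓝[≠] z k) (𝓝 (r k))) {C₀ C₁ : ℝ}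
    (h0 : ∀ᶠ ζ in 𝓝[rhp \ {0}] 0, ‖h ζ‖ ≤ C₀)
    (h1 : ∀ᶠ ζ in Bornology.cobounded ℂ ⊓ 𝓟 rhp, ‖h ζ‖ * ‖ζ‖ ≤ C₁)
    {G : ℝ → ℂ} (hG : ∀ t : ℝ, t ≠ 0 → G t = h (t * I) - f (-(t * I))) {ζ : ℂ} (hζ : ζ ∈ orhp) :
    Integrable (fun t : ℝ => G t * ((t : ℂ) * I + ζ)⁻¹) ∧
      f ζ = -∑ k, r k / (ζ + z k) - 1 / (2 * Real.pi) * ∫ t : ℝ, G t * ((t : ℂ) * I + ζ)⁻¹ := by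
  obtain ⟨f₀, hf₀, hfh⟩ := exists_decays_of_poles hz hzo hd hc hr h0 h1
  have hinv := Decays.inv_add hζ
  have i1 := hf₀.integral_mul hinv
  have i2 : ∀ k, Integrable (fun t : ℝ => ((t : ℂ) * I + ζ)⁻¹ * ((t : ℂ) * I - z k)⁻¹) :=
    fun k => integrable_mul_inv_sub hinv (hzo k)
  have i2' := fun k => hinv.integral_mul_inv_sub (hzo k)
  have i3 : Integrable fun t : ℝ => f (-(t * I)) * ((t : ℂ) * I + ζ)⁻¹ := by
    have := Decays.integrable_mul (Or.inr rfl) (Or.inl rfl) hf hinv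
    simpa using this
  -- The substitution t ↦ -t turns the reflected term into Cauchy's formula for f at ζ. The
  -- holomorphic part of h contributes nothing, its poles contribute the sum.
  have i3' : ∫ t : ℝ, f (-(t * I)) * ((t : ℂ) * I + ζ)⁻¹ = 2 * Real.pi * f ζ := by
    rw [← integral_neg_eq_self]
    have := hf.integral_mul_inv_sub hζ
    have e : ∀ t : ℝ, f (-(((-t : ℝ) : ℂ) * I)) * (((-t : ℝ) : ℂ) * I + ζ)⁻¹
        = -(f (t * I) * ((t : ℂ) * I - ζ)⁻¹) := by
      intro t
      rw [sub_mul_I_eq]; push_cast; simp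
    simp_rw [e]
    rw [integral_neg, this]; ring
  have e : ∀ᵐ t : ℝ, G t * ((t : ℂ) * I + ζ)⁻¹ = f₀ (t * I) * ((t : ℂ) * I + ζ)⁻¹
      + ∑ k, r k * (((t : ℂ) * I + ζ)⁻¹ * ((t : ℂ) * I - z k)⁻¹)
      - f (-(t * I)) * ((t : ℂ) * I + ζ)⁻¹ := by
    filter_upwards [compl_mem_ae_iff.2 (measure_singleton (0 : ℝ))] with t ht
    rw [hG t ht, hfh (t * I) ⟨mul_I_mem_rhp t, mul_I_ne_zero ht⟩ (by
      rintro ⟨k, h6⟩; exact mul_I_sub_ne_zero (hzo k) t (by rw [← h6]; simp)), sub_mul, add_mul,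
      Finset.sum_mul]
    congr 2
    exact Finset.sum_congr rfl fun k _ => by ring
  have i4 : Integrable (fun t : ℝ => ∑ k, r k * (((t : ℂ) * I + ζ)⁻¹ * ((t : ℂ) * I - z k)⁻¹)) :=
    integrable_finsetSum _ fun k _ => (i2 k).const_mul _
  have i5 : Integrable (fun t : ℝ => f₀ (t * I) * ((t : ℂ) * I + ζ)⁻¹
      + ∑ k, r k * (((t : ℂ) * I + ζ)⁻¹ * ((t : ℂ) * I - z k)⁻¹)) := i1.1.add i4
  refine ⟨(i5.sub i3).congr (e.mono fun t ht => ht.symm), ?_⟩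
  rw [integral_congr_ae e, integral_sub i5 i3, integral_add i1.1 i4, i1.2, i3',
    integral_finsetSum _ fun k _ => (i2 k).const_mul _]
  simp_rw [integral_const_mul, i2']
  have hpi : (Real.pi : ℂ) ≠ 0 := by exact_mod_cast Real.pi_ne_zero
  have : ∀ k, r k * (-(2 * Real.pi) * (z k + ζ)⁻¹) = -(2 * Real.pi) * (r k / (ζ + z k)) :=
    fun k => by rw [add_comm, div_eq_mul_inv]; ring
  simp_rw [this]
  rw [← Finset.mul_sum]
  field_simp
  ring

end Q3

/-! ### Lax solutions, conserved Wronskians and the scattering relation. -/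

namespace Q3
open Complex ComplexConjugate

variable {N : ℕ}

/-- Both components of a solution of the Lax equations with spectral parameter `ζ`. -/
structure LaxState (p : Fin N → ℝ) (g h : Fin N → (Fin N → ℤ) → ℝ) (ζ : ℂ)
    (x ψ : (Fin N → ℤ) → ℂ) : Prop where
  fst : ∀ n k, (p k + ζ) * x (shift k n) = ψ n + g k n * x n
  snd : ∀ n k, ψ (shift k n) = h k n * x (shift k n) - (p k - ζ) * x n

/-- The second component, computed from the direction of the first step of the staircase. -/
noncomputable def psi (p : Fin N → ℝ) (Γ : Staircase N) (g : Fin N → (Fin N → ℤ) → ℝ) (ζ : ℂ)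
    (x : (Fin N → ℤ) → ℂ) (n : Fin N → ℤ) : ℂ :=
  (p (Γ.dir 0) + ζ) * x (shift (Γ.dir 0) n) - g (Γ.dir 0) n * x n

theorem LatEq.laxState {p : Fin N → ℝ} {Γ : Staircase N} {g h : Fin N → (Fin N → ℤ) → ℝ} {ζ : ℂ}
    {x : (Fin N → ℤ) → ℂ} (hx : LatEq p g h ζ x) : LaxState p g h ζ x (psi p Γ g ζ x) := by
  have key : ∀ n j k, (p k + ζ) * x (shift k (shift j n)) - g k (shift j n) * x (shift j n)
      = h j n * x (shift j n) - (p j - ζ) * x n := by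
    intro n j k
    have := hx n j k
    rw [om] at this
    push_cast at this
    linear_combination this
  refine ⟨fun n k => ?_, fun n k => key n k _⟩
  -- The three-point equation based at n - e_k has a right side that does not involve the second
  -- direction, so ψ is the same for every direction.
  have e : ∀ k, (p k + ζ) * x (shift k n) - g k n * x n
      = (p (Γ.dir 0) + ζ) * x (shift (Γ.dir 0) n) - g (Γ.dir 0) n * x n := by
    intro k
    have h1 := key (n - Pi.single k 1) k k
    have h2 := key (n - Pi.single k 1) k (Γ.dir 0)
    rw [shift_sub_single] at h1 h2
    rw [h1, h2]
  rw [psi]; linear_combination e k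

/-- The plane wave in one step. -/
theorem prod_zpow_shift {K : Type*} [Field K] (w : Fin N → K) (hw : ∀ k, w k ≠ 0) (k : Fin N) (n : Fin N → ℤ) :
    ∏ r, w r ^ (shift k n r) = (∏ r, w r ^ n r) * w k := by
  have : ∀ r, w r ^ (shift k n r) = w r ^ n r * (if r = k then w k else 1) := by
    intro r
    simp only [shift, Pi.add_apply]
    rw [zpow_add₀ (hw r)]
    by_cases h : r = k
    · subst h; simp
    · simp [h]
  simp_rw [this]
  rw [Finset.prod_mul_distrib, Finset.prod_ite_eq' Finset.univ k]
  simp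

theorem rho_shift (D : Params N) {ζ : ℂ} (h1 : ∀ k, (D.p k : ℂ) + ζ ≠ 0)
    (h2 : ∀ k, (D.p k : ℂ) - ζ ≠ 0) (k : Fin N) (n : Fin N → ℤ) :
    (D.p k - ζ) * rho D (shift k n) ζ = (D.p k + ζ) * rho D n ζ := by
  rw [rho, prod_zpow_shift _ (fun r => div_ne_zero (h1 r) (h2 r)), ← rho]
  have := h2 k
  field_simp

theorem rho_ne_zero (D : Params N) {ζ : ℂ} (h1 : ∀ k, (D.p k : ℂ) + ζ ≠ 0)
    (h2 : ∀ k, (D.p k : ℂ) - ζ ≠ 0) (n : Fin N → ℤ) : rho D n ζ ≠ 0 :=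
  Finset.prod_ne_zero_iff.2 fun k _ => zpow_ne_zero _ (div_ne_zero (h1 k) (h2 k))

theorem rho_neg (D : Params N) (ζ : ℂ) (n : Fin N → ℤ) : rho D n (-ζ) = (rho D n ζ)⁻¹ := by
  rw [rho, rho, ← Finset.prod_inv_distrib]
  refine Finset.prod_congr rfl fun k _ => ?_
  rw [← inv_zpow, inv_div, sub_neg_eq_add, ← sub_eq_add_neg]

theorem rho_zero (D : Params N) (ζ : ℂ) : rho D 0 ζ = 1 := by simp [rho]

namespace LaxState
variable {p : Fin N → ℝ} {g h : Fin N → (Fin N → ℤ) → ℝ} {ζ : ℂ} {x ψ y φ : (Fin N → ℤ) → ℂ}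

/-- The Wronskian of solutions with opposite spectral parameters is constant. -/
theorem wronskian (X : LaxState p g h ζ x ψ) (Y : LaxState p g h (-ζ) y φ) (n : Fin N → ℤ) :
    ψ n * y n - x n * φ n = ψ 0 * y 0 - x 0 * φ 0 := by
  refine lattice_induction (Q := fun n => ψ n * y n - x n * φ n = ψ 0 * y 0 - x 0 * φ 0) 0 rfl
    (fun n k => ?_) n
  have e : ψ (shift k n) * y (shift k n) - x (shift k n) * φ (shift k n)
      = ψ n * y n - x n * φ n := by
    rw [X.snd, Y.snd]
    linear_combination y n * X.fst n k - x n * Y.fst n k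
  rw [e]

theorem wronskian_eq (X : LaxState p g h ζ x ψ) (Y : LaxState p g h (-ζ) y φ) (n : Fin N → ℤ)
    (k : Fin N) : (p k + ζ) * x (shift k n) * y n - (p k - ζ) * x n * y (shift k n)
      = ψ 0 * y 0 - x 0 * φ 0 := by
  rw [← X.wronskian Y n]
  linear_combination y n * X.fst n k - x n * Y.fst n k

theorem add (X : LaxState p g h ζ x ψ) (Y : LaxState p g h ζ y φ) :
    LaxState p g h ζ (fun n => x n + y n) (fun n => ψ n + φ n) :=
  ⟨fun n k => by linear_combination X.fst n k + Y.fst n k,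
    fun n k => by linear_combination X.snd n k + Y.snd n k⟩

theorem const_mul (X : LaxState p g h ζ x ψ) (c : ℂ) :
    LaxState p g h ζ (fun n => c * x n) (fun n => c * ψ n) :=
  ⟨fun n k => by linear_combination c * X.fst n k, fun n k => by linear_combination c * X.snd n k⟩

/-- A solution that vanishes at one point vanishes identically. -/
theorem eq_zero (X : LaxState p g h ζ x ψ) (h1 : ∀ k, (p k : ℂ) + ζ ≠ 0)
    (h2 : ∀ k, (p k : ℂ) - ζ ≠ 0) {n₀ : Fin N → ℤ} (hx : x n₀ = 0) (hψ : ψ n₀ = 0)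
    (n : Fin N → ℤ) : x n = 0 ∧ ψ n = 0 := by
  refine lattice_induction (Q := fun n => x n = 0 ∧ ψ n = 0) n₀ ⟨hx, hψ⟩ (fun n k => ?_) n
  have e1 := X.fst n k
  have e2 := X.snd n k
  constructor
  · rintro ⟨a, b⟩
    rw [a, b] at e1
    have : x (shift k n) = 0 := by
      simpa [h1 k] using e1
    rw [this, a] at e2
    exact ⟨this, by simpa using e2⟩
  · rintro ⟨a, b⟩
    rw [a, b] at e2
    have : x n = 0 := by simpa [h2 k] using e2
    rw [this, a] at e1
    exact ⟨this, by simpa using e1.symm⟩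

/-- The factor ρ exchanges p + ζ and p - ζ in each step, so solutions for ζ and for -ζ can be
compared. -/
theorem mul_rho {D : Params N} (X : LaxState D.p g h ζ x ψ) (h1 : ∀ k, (D.p k : ℂ) + ζ ≠ 0)
    (h2 : ∀ k, (D.p k : ℂ) - ζ ≠ 0) :
    LaxState D.p g h (-ζ) (fun n => x n * rho D n ζ) (fun n => ψ n * rho D n ζ) := by
  refine ⟨fun n k => ?_, fun n k => ?_⟩
  · linear_combination x (shift k n) * rho_shift D h1 h2 k n + rho D n ζ * X.fst n k
  · linear_combination rho D (shift k n) ζ * X.snd n k - x n * rho_shift D h1 h2 k n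

end LaxState

/-- Jost functions have real coefficients: conjugation symmetry. -/
theorem ScatData.leftJost_conj {p : Fin N → ℝ} {Γ : Staircase N} {g h : Fin N → (Fin N → ℤ) → ℝ}
    (S : ScatData p Γ g h) {Λ : (Fin N → ℤ) → ℂ → ℂ} (hΛ : LeftJost p Γ g h Λ) (n : Fin N → ℤ)
    {ζ : ℂ} (hζ : ζ ∈ rhp) : Λ n (conj ζ) = conj (Λ n ζ) := by
  have hr : ∀ ζ ∈ rhp, conj ζ ∈ rhp := fun ζ hζ => by simpa [rhp] using hζ
  have h1 : LeftJost p Γ g h fun n ζ => conj (Λ n (conj ζ)) := by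
    intro ζ hζ
    obtain ⟨h2, h3⟩ := hΛ _ (hr ζ hζ)
    refine ⟨fun n j k => ?_, fun m => ?_⟩
    · have := congrArg conj (h2 n j k)
      simpa using this
    · have := (continuous_conj.tendsto _).comp (h3 m)
      simpa [Function.comp_def] using this
  have := S.leftJost_unique hΛ h1 n (hr ζ hζ)
  simp only [conj_conj] at this
  exact this.symm

theorem ScatData.rightJost_conj {p : Fin N → ℝ} {Γ : Staircase N} {g h : Fin N → (Fin N → ℤ) → ℝ}
    (S : ScatData p Γ g h) {Υ : (Fin N → ℤ) → ℂ → ℂ} (hΥ : RightJost p Γ g h Υ) (n : Fin N → ℤ)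
    {ζ : ℂ} (hζ : ζ ∈ rhp) : Υ n (conj ζ) = conj (Υ n ζ) := by
  have := S.reflect.leftJost_conj (ScatData.rightJost_iff_reflect.2 hΥ) (-n) hζ
  simpa using this

/-- The left and right Jost functions of scattering data on the lattice. -/
structure Jost (D : Params N) (Γ : Staircase N) (g h : Fin N → (Fin N → ℤ) → ℝ)
    (Λ Υ : (Fin N → ℤ) → ℂ → ℂ) : Prop where
  data : ScatData D.p Γ g h
  left : LeftJost D.p Γ g h Λ
  right : RightJost D.p Γ g h Υ

namespace Jost
variable {D : Params N} {Γ : Staircase N} {g h : Fin N → (Fin N → ℤ) → ℝ}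
  {Λ Υ : (Fin N → ℤ) → ℂ → ℂ}

theorem leftState (J : Jost D Γ g h Λ Υ) {ζ : ℂ} (hζ : ζ ∈ rhp) :
    LaxState D.p g h ζ (Λ · ζ) (psi D.p Γ g ζ (Λ · ζ)) := (J.left ζ hζ).1.laxState

theorem rightState (J : Jost D Γ g h Λ Υ) {ζ : ℂ} (hζ : ζ ∈ rhp) :
    LaxState D.p g h (-ζ) (Υ · ζ) (psi D.p Γ g (-ζ) (Υ · ζ)) := (J.right ζ hζ).1.laxState

theorem wronskian_specA (J : Jost D Γ g h Λ Υ) {ζ : ℂ} (hζ : ζ ∈ rhp) (h0 : ζ ≠ 0)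
    (n : Fin N → ℤ) : psi D.p Γ g ζ (Λ · ζ) n * Υ n ζ - Λ n ζ * psi D.p Γ g (-ζ) (Υ · ζ) n
      = 2 * ζ * specA D Γ Λ Υ ζ := by
  rw [(J.leftState hζ).wronskian (J.rightState hζ),
    ← (J.leftState hζ).wronskian_eq (J.rightState hζ) 0 (Γ.dir 0), specA, Γ.point_zero, Γ.point_one]
  field_simp

theorem wronskian_specA_shift (J : Jost D Γ g h Λ Υ) {ζ : ℂ} (hζ : ζ ∈ rhp) (h0 : ζ ≠ 0)
    (n : Fin N → ℤ) (k : Fin N) :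
    (D.p k + ζ) * Λ (shift k n) ζ * Υ n ζ - (D.p k - ζ) * Λ n ζ * Υ (shift k n) ζ
      = 2 * ζ * specA D Γ Λ Υ ζ := by
  rw [(J.leftState hζ).wronskian_eq (J.rightState hζ) n k, ← J.wronskian_specA hζ h0 0]

theorem neg_mem_rhp {ζ : ℂ} (h : ζ.re = 0) : -ζ ∈ rhp := by simp [rhp, h]

/-- Wronskian of the left Jost functions at opposite imaginary points. -/
theorem wronskian_left (J : Jost D Γ g h Λ Υ) {ζ : ℂ} (hζ : ζ.re = 0) (n : Fin N → ℤ) :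
    psi D.p Γ g ζ (Λ · ζ) n * Λ n (-ζ) - Λ n ζ * psi D.p Γ g (-ζ) (Λ · (-ζ)) n = 2 * ζ := by
  have hr : ζ ∈ rhp := by simp [rhp, hζ]
  have hr' : -ζ ∈ rhp := neg_mem_rhp hζ
  have X := J.leftState hr
  have Y := J.leftState hr'
  rw [X.wronskian Y n]
  have h1 := (J.left ζ hr).2
  have h2 := (J.left _ hr').2
  -- The Wronskian is written with one fixed direction. The shifted values then lie on a translate
  -- of the staircase, where Λ tends to 1 as well, and the limit is (p + ζ) - (p - ζ) = 2ζ.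
  have hlim : Tendsto (fun i : ℤ => (D.p (Γ.dir 0) + ζ) * Λ (shift (Γ.dir 0) 0 + Γ.point i) ζ
      * Λ (0 + Γ.point i) (-ζ) - (D.p (Γ.dir 0) - ζ) * Λ (0 + Γ.point i) ζ
      * Λ (shift (Γ.dir 0) 0 + Γ.point i) (-ζ)) atBot
      (𝓝 ((D.p (Γ.dir 0) + ζ) * 1 * 1 - (D.p (Γ.dir 0) - ζ) * 1 * 1)) :=
    (((h1 _).const_mul _).mul (h2 _)).sub (((h1 _).const_mul _).mul (h2 _))
  refine tendsto_nhds_unique (tendsto_const_nhds.congr fun i => ?_)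
    (hlim.trans (by rw [show (D.p (Γ.dir 0) + ζ) * 1 * 1 - (D.p (Γ.dir 0) - ζ) * 1 * 1 = 2 * ζ
      by ring]))
  rw [← shift_add']
  exact (X.wronskian_eq Y (0 + Γ.point i) (Γ.dir 0)).symm

theorem wronskian_right (J : Jost D Γ g h Λ Υ) {ζ : ℂ} (hζ : ζ.re = 0) (n : Fin N → ℤ) :
    psi D.p Γ g ζ (Υ · (-ζ)) n * Υ n ζ - Υ n (-ζ) * psi D.p Γ g (-ζ) (Υ · ζ) n = 2 * ζ := by
  have hr : ζ ∈ rhp := by simp [rhp, hζ]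
  have hr' : -ζ ∈ rhp := neg_mem_rhp hζ
  have X := J.rightState hr'
  rw [neg_neg] at X
  have Y := J.rightState hr
  rw [X.wronskian Y n]
  have h1 := (J.right ζ hr).2
  have h2 := (J.right _ hr').2
  have hlim : Tendsto (fun i : ℤ => (D.p (Γ.dir 0) + ζ) * Υ (shift (Γ.dir 0) 0 + Γ.point i) (-ζ)
      * Υ (0 + Γ.point i) ζ - (D.p (Γ.dir 0) - ζ) * Υ (0 + Γ.point i) (-ζ)
      * Υ (shift (Γ.dir 0) 0 + Γ.point i) ζ) atTop
      (𝓝 ((D.p (Γ.dir 0) + ζ) * 1 * 1 - (D.p (Γ.dir 0) - ζ) * 1 * 1)) :=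
    (((h2 _).const_mul _).mul (h1 _)).sub (((h2 _).const_mul _).mul (h1 _))
  refine tendsto_nhds_unique (tendsto_const_nhds.congr fun i => ?_)
    (hlim.trans (by rw [show (D.p (Γ.dir 0) + ζ) * 1 * 1 - (D.p (Γ.dir 0) - ζ) * 1 * 1 = 2 * ζ
      by ring]))
  rw [← shift_add']
  exact (X.wronskian_eq Y (0 + Γ.point i) (Γ.dir 0)).symm

theorem p_add_ne_zero (D : Params N) {ζ : ℂ} (hζ : ζ ∈ rhp) (k : Fin N) : (D.p k : ℂ) + ζ ≠ 0 :=
  add_ne_zero_of_pos (D.p_pos k) hζ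

theorem p_sub_ne_zero (D : Params N) {ζ : ℂ} (hζ : ζ.re = 0) (k : Fin N) : (D.p k : ℂ) - ζ ≠ 0 := by
  have := p_add_ne_zero D (neg_mem_rhp hζ) k
  rwa [← sub_eq_add_neg] at this

/-- The second spectral function on the imaginary axis. -/
noncomputable def specB (D : Params N) (Γ : Staircase N) (g : Fin N → (Fin N → ℤ) → ℝ)
    (Λ Υ : (Fin N → ℤ) → ℂ → ℂ) (ζ : ℂ) : ℂ :=
  (Λ 0 (-ζ) * psi D.p Γ g (-ζ) (Υ · ζ) 0 - psi D.p Γ g (-ζ) (Λ · (-ζ)) 0 * Υ 0 ζ) / (2 * ζ)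

/-- Λ(-ζ) and Υ(ζ) belong to the same spectral parameter -ζ, so one of them is multiplied by ρ
before the Wronskian is conserved. This is the origin of the factor ρ beside B. -/
theorem specB_eq (J : Jost D Γ g h Λ Υ) {ζ : ℂ} (hζ : ζ.re = 0) (h0 : ζ ≠ 0) (n : Fin N → ℤ) :
    Λ n (-ζ) * psi D.p Γ g (-ζ) (Υ · ζ) n - psi D.p Γ g (-ζ) (Λ · (-ζ)) n * Υ n ζ
      = 2 * ζ * specB D Γ g Λ Υ ζ * rho D n ζ := by
  have hr : ζ ∈ rhp := by simp [rhp, hζ]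
  have hr' : -ζ ∈ rhp := neg_mem_rhp hζ
  have h1 := p_add_ne_zero D hr
  have h2 := p_sub_ne_zero D hζ
  have X := (J.leftState hr').mul_rho (p_add_ne_zero D hr')
    (fun k => by rw [sub_neg_eq_add]; exact h1 k)
  rw [neg_neg] at X
  have e := X.wronskian (J.rightState hr) n
  have e0 := rho_zero D (-ζ)
  have e1 := rho_ne_zero D h1 h2 n
  simp only [e0, mul_one] at e
  rw [rho_neg] at e
  rw [specB]
  field_simp
  field_simp at e
  linear_combination -e

/-- The scattering relation on the imaginary axis, for both components. -/
theorem scattering (J : Jost D Γ g h Λ Υ) {ζ : ℂ} (hζ : ζ.re = 0) (h0 : ζ ≠ 0) (n : Fin N → ℤ) :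
    Υ n ζ = specA D Γ Λ Υ ζ * Λ n (-ζ) + specB D Γ g Λ Υ ζ * Λ n ζ * rho D n ζ ∧
      psi D.p Γ g (-ζ) (Υ · ζ) n = specA D Γ Λ Υ ζ * psi D.p Γ g (-ζ) (Λ · (-ζ)) n
        + specB D Γ g Λ Υ ζ * psi D.p Γ g ζ (Λ · ζ) n * rho D n ζ := by
  have hr : ζ ∈ rhp := by simp [rhp, hζ]
  have a1 := J.wronskian_left hζ n
  have a2 := J.wronskian_specA hr h0 n
  have a3 := J.specB_eq hζ h0 n
  have h2 : (2 : ℂ) * ζ ≠ 0 := mul_ne_zero two_ne_zero h0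
  constructor
  · apply mul_left_cancel₀ h2
    linear_combination -Υ n ζ * a1 + Λ n (-ζ) * a2 + Λ n ζ * a3
  · apply mul_left_cancel₀ h2
    linear_combination -psi D.p Γ g (-ζ) (Υ · ζ) n * a1 + psi D.p Γ g (-ζ) (Λ · (-ζ)) n * a2
      + psi D.p Γ g ζ (Λ · ζ) n * a3

theorem psi_conj (p : Fin N → ℝ) (Γ : Staircase N) (g : Fin N → (Fin N → ℤ) → ℝ) (ζ : ℂ)
    (x y : (Fin N → ℤ) → ℂ) (hxy : ∀ n, y n = conj (x n)) (n : Fin N → ℤ) :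
    psi p Γ g (conj ζ) y n = conj (psi p Γ g ζ x n) := by
  simp [psi, hxy]

theorem conj_eq_neg {ζ : ℂ} (hζ : ζ.re = 0) : conj ζ = -ζ := by
  apply Complex.ext <;> simp [hζ]

/-- On the axis conjugation is ζ ↦ -ζ, since the coefficients are real. Inserting the scattering
relation at n = 0 into the Wronskian of Υ(-ζ) and Υ(ζ), which is 2ζ like that of Λ, compares the two
normalisations. -/
theorem norm_sq_sub (J : Jost D Γ g h Λ Υ) {ζ : ℂ} (hζ : ζ.re = 0) (h0 : ζ ≠ 0) :
    specA D Γ Λ Υ ζ * conj (specA D Γ Λ Υ ζ)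
      - specB D Γ g Λ Υ ζ * conj (specB D Γ g Λ Υ ζ) = 1 := by
  have hr : ζ ∈ rhp := by simp [rhp, hζ]
  have hr' : -ζ ∈ rhp := neg_mem_rhp hζ
  obtain ⟨s1, s2⟩ := J.scattering hζ h0 0
  rw [rho_zero, mul_one] at s1 s2
  have hc := conj_eq_neg hζ
  have c1 : ∀ n, Λ n (-ζ) = conj (Λ n ζ) := fun n => by
    rw [← hc]; exact J.data.leftJost_conj J.left n hr
  have c2 : ∀ n, Υ n (-ζ) = conj (Υ n ζ) := fun n => by
    rw [← hc]; exact J.data.rightJost_conj J.right n hr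
  have c3 := psi_conj D.p Γ g ζ (Λ · ζ) (Λ · (-ζ)) c1 0
  have c4 := psi_conj D.p Γ g (-ζ) (Υ · ζ) (Υ · (-ζ)) c2 0
  rw [hc] at c3
  rw [map_neg, hc, neg_neg] at c4
  have w1 := J.wronskian_left hζ 0
  have w2 := J.wronskian_right hζ 0
  rw [c3, c1] at w1
  rw [c4, c2, s1, s2, c1, c3] at w2
  simp only [map_add, map_mul, conj_conj] at w2
  have h2 : (2 : ℂ) * ζ ≠ 0 := mul_ne_zero two_ne_zero h0
  apply mul_left_cancel₀ h2
  linear_combination w2 - (specA D Γ Λ Υ ζ * conj (specA D Γ Λ Υ ζ)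
    - specB D Γ g Λ Υ ζ * conj (specB D Γ g Λ Υ ζ)) * w1

theorem specA_axis_ne_zero (J : Jost D Γ g h Λ Υ) {ζ : ℂ} (hζ : ζ.re = 0) (h0 : ζ ≠ 0) :
    specA D Γ Λ Υ ζ ≠ 0 := by
  intro hA
  have := J.norm_sq_sub hζ h0
  rw [hA, zero_mul, zero_sub, mul_conj, ← ofReal_neg, ← ofReal_one] at this
  have h1 := ofReal_injective this
  linarith [normSq_nonneg (specB D Γ g Λ Υ ζ)]

/-- At a zero of `A` away from the lattice parameters the Jost functions are proportional. -/
theorem exists_proportional (J : Jost D Γ g h Λ Υ) {ζ : ℂ} (hζ : ζ ∈ orhp)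
    (hp : ∀ k, ζ ≠ D.p k) (hA : specA D Γ Λ Υ ζ = 0) :
    ∃ β : ℂ, β ≠ 0 ∧ ∀ n, Υ n ζ = β * Λ n ζ * rho D n ζ ∧
      psi D.p Γ g (-ζ) (Υ · ζ) n = β * psi D.p Γ g ζ (Λ · ζ) n * rho D n ζ := by
  have hr := orhp_subset hζ
  have h0 : ζ ≠ 0 := by rintro rfl; simp [orhp] at hζ
  have h1 := p_add_ne_zero D hr
  have h2 : ∀ k, (D.p k : ℂ) - ζ ≠ 0 := fun k => sub_ne_zero.2 (hp k).symm
  have h1' : ∀ k, (D.p k : ℂ) + -ζ ≠ 0 := fun k => by rw [← sub_eq_add_neg]; exact h2 k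
  have h2' : ∀ k, (D.p k : ℂ) - -ζ ≠ 0 := fun k => by rw [sub_neg_eq_add]; exact h1 k
  have X := J.leftState hr
  have Y := J.rightState hr
  have XR := X.mul_rho h1 h2
  have hW := J.wronskian_specA hr h0 0
  rw [hA, mul_zero] at hW
  -- A linear dependence at the origin spreads over the lattice because the Lax steps are invertible
  -- for ζ ≠ p_r. Neither coefficient vanishes, since Λ and Υ each tend to 1 at one end.
  have key : ∀ c d : ℂ, (c ≠ 0 ∨ d ≠ 0) → c * Λ 0 ζ + d * Υ 0 ζ = 0 →
      c * psi D.p Γ g ζ (Λ · ζ) 0 + d * psi D.p Γ g (-ζ) (Υ · ζ) 0 = 0 →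
      ∃ β : ℂ, β ≠ 0 ∧ ∀ n, Υ n ζ = β * Λ n ζ * rho D n ζ ∧
      psi D.p Γ g (-ζ) (Υ · ζ) n = β * psi D.p Γ g ζ (Λ · ζ) n * rho D n ζ := by
    intro c d hcd e1 e2
    have Z := (XR.const_mul c).add (Y.const_mul d)
    have hz := Z.eq_zero h1' h2' (n₀ := 0) (by simpa [rho_zero] using e1)
      (by simpa [rho_zero] using e2)
    have hl := (J.left ζ hr).2 0
    have hu := (J.right ζ hr).2 0
    have hd : d ≠ 0 := by
      rintro rfl
      have hc : c ≠ 0 := by tauto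
      have : ∀ n, Λ n ζ = 0 := fun n => by
        have := (hz n).1
        simpa [hc, rho_ne_zero D h1 h2 n] using this
      simp only [this] at hl
      exact zero_ne_one (tendsto_nhds_unique tendsto_const_nhds hl)
    have hc : c ≠ 0 := by
      rintro rfl
      have : ∀ n, Υ n ζ = 0 := fun n => by
        have := (hz n).1
        simpa [hd] using this
      simp only [this] at hu
      exact zero_ne_one (tendsto_nhds_unique tendsto_const_nhds hu)
    refine ⟨-c / d, div_ne_zero (neg_ne_zero.2 hc) hd, fun n => ⟨?_, ?_⟩⟩
    · have := (hz n).1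
      field_simp
      linear_combination this
    · have := (hz n).2
      field_simp
      linear_combination this
  -- The vanishing 2 × 2 determinant gives the coefficients (Υ, -Λ) of a dependence. If both first
  -- components vanish at the origin, the second components supply them instead.
  by_cases hΥ : Υ 0 ζ = 0 ∧ Λ 0 ζ = 0
  · by_cases hψ : psi D.p Γ g ζ (Λ · ζ) 0 = 0
    · exact key 1 0 (by simp) (by simp [hΥ.2]) (by simp [hψ])
    · exact key (psi D.p Γ g (-ζ) (Υ · ζ) 0) (-psi D.p Γ g ζ (Λ · ζ) 0)
        (Or.inr (neg_ne_zero.2 hψ)) (by simp [hΥ.1, hΥ.2]) (by ring)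
  · refine key (Υ 0 ζ) (-Λ 0 ζ) ?_ (by ring) (by linear_combination hW)
    by_contra hcon
    push Not at hcon
    exact hΥ ⟨hcon.1, by simpa using hcon.2⟩

end Jost
end Q3

/-! ### The spectral function A: limits, behaviour at 0 and infinity, zeros. -/

namespace Q3
open Complex ComplexConjugate

variable {N : ℕ}

theorem tendsto_zero_of_contraction {a η : ℤ → ℝ} {θ : ℝ} (h0 : 0 ≤ θ) (h1 : θ < 1)
    (ha : ∀ i, 0 ≤ a i) (hη : Tendsto η atTop (𝓝 0))
    (hstep : ∀ᶠ i in atTop, a (i + 1) ≤ θ * a i + η i) : Tendsto a atTop (𝓝 0) := by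
  rw [Metric.tendsto_atTop]
  intro ε hε
  have hε' : 0 < ε * (1 - θ) / 2 := by have := sub_pos.2 h1; positivity
  obtain ⟨i₀, hi₀⟩ := eventually_atTop.1 (hstep.and (hη.eventually_lt_const hε'))
  have key : ∀ n : ℕ, a (i₀ + n) ≤ θ ^ n * a i₀ + ε / 2 := by
    intro n
    induction n with
    | zero => simp; linarith
    | succ n ih =>
      obtain ⟨h3, h4⟩ := hi₀ (i₀ + n) (by omega)
      have h5 := mul_le_mul_of_nonneg_left ih h0
      push_cast
      rw [← add_assoc, pow_succ]
      nlinarith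
  have hpow : Tendsto (fun n : ℕ => θ ^ n * a i₀) atTop (𝓝 0) := by
    simpa using (tendsto_pow_atTop_nhds_zero_of_lt_one h0 h1).mul_const (a i₀)
  obtain ⟨n₀, hn₀⟩ := eventually_atTop.1 (hpow.eventually_lt_const (half_pos hε))
  refine ⟨i₀ + n₀, fun i hi => ?_⟩
  obtain ⟨n, rfl⟩ : ∃ n : ℕ, i = i₀ + n := ⟨(i - i₀).toNat, by omega⟩
  have := hn₀ n (by omega)
  rw [Real.dist_eq, sub_zero, abs_of_nonneg (ha _)]
  linarith [key n]

/-- A solution whose Wronskian with a normalised solution is `2ζA` tends to `A`. -/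
theorem tendsto_of_wronskian {x y : ℤ → ℂ} {P : ℤ → ℝ} {ζ A : ℂ} {θ : ℝ} (h1 : θ < 1)
    (hne : ∀ i, (P i : ℂ) + ζ ≠ 0) (hτ : ∀ i, ‖((P i : ℂ) - ζ) / (P i + ζ)‖ ≤ θ)
    (hW : ∀ i, (P i + ζ) * x (i + 1) * y i - (P i - ζ) * x i * y (i + 1) = 2 * ζ * A)
    (hy : Tendsto y atTop (𝓝 1)) : Tendsto x atTop (𝓝 A) := by
  have hy1 : Tendsto (fun i => y (i + 1)) atTop (𝓝 1) :=
    hy.comp (tendsto_atTop_add_const_right _ 1 tendsto_id)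
  have hy0 := hy.eventually_ne one_ne_zero
  have hy10 := hy1.eventually_ne one_ne_zero
  have h0 : 0 ≤ θ := (norm_nonneg _).trans (hτ 0)
  have hη : Tendsto (fun i => 2 * ‖A‖ * ‖(y i * y (i + 1))⁻¹ - 1‖) atTop (𝓝 0) := by
    have := (((hy.mul hy1).inv₀ (by simp)).sub_const 1).norm.const_mul (2 * ‖A‖)
    simpa using this
  have hlim : Tendsto (fun i => ‖x i / y i - A‖) atTop (𝓝 0) := by
    refine tendsto_zero_of_contraction h0 h1 (fun _ => norm_nonneg _) hη ?_
    filter_upwards [hy0, hy10] with i h2 h3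
    have h4 := hne i
    -- Division of the Wronskian identity by y_i y_{i+1} gives a first-order recursion for x / y.
    -- Its fixed point is A, its multiplier has modulus at most θ < 1, and its error tends to zero
    -- since y → 1.
    have e : x (i + 1) / y (i + 1) - A = ((P i : ℂ) - ζ) / (P i + ζ) * (x i / y i - A)
        + (1 - ((P i : ℂ) - ζ) / (P i + ζ)) * A * ((y i * y (i + 1))⁻¹ - 1) := by
      field_simp
      linear_combination hW i
    rw [e]
    refine (norm_add_le _ _).trans (add_le_add ?_ ?_)
    · rw [norm_mul]; exact mul_le_mul_of_nonneg_right (hτ i) (norm_nonneg _)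
    · rw [norm_mul, norm_mul]
      refine mul_le_mul_of_nonneg_right (mul_le_mul_of_nonneg_right ?_ (norm_nonneg _))
        (norm_nonneg _)
      refine (norm_sub_le _ _).trans ?_
      rw [norm_one]; linarith [hτ i]
  have h2 := ((tendsto_zero_iff_norm_tendsto_zero.2 hlim).add_const A).mul hy
  rw [zero_add, mul_one] at h2
  refine h2.congr' ?_
  filter_upwards [hy0] with i h3
  field_simp
  ring

theorem norm_sub_lt_norm_add {p : ℝ} (hp : 0 < p) {ζ : ℂ} (h : ζ ∈ orhp) :
    ‖(p : ℂ) - ζ‖ < ‖(p : ℂ) + ζ‖ := by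
  have h2 : 0 < ζ.re := h
  apply lt_of_pow_lt_pow_left₀ 2 (norm_nonneg _)
  rw [← normSq_eq_norm_sq, ← normSq_eq_norm_sq, normSq_apply, normSq_apply]
  simp
  nlinarith [mul_pos hp h2]

theorem exists_contraction (D : Params N) (Γ : Staircase N) {ζ : ℂ} (hζ : ζ ∈ orhp) :
    ∃ θ < 1, ∀ k, ‖((D.p k : ℂ) - ζ) / (D.p k + ζ)‖ ≤ θ := by
  have : Nonempty (Fin N) := ⟨Γ.dir 0⟩
  obtain ⟨k₀, hk⟩ := Finite.exists_max fun k : Fin N => ‖((D.p k : ℂ) - ζ) / (D.p k + ζ)‖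
  refine ⟨_, ?_, hk⟩
  rw [norm_div, div_lt_one]
  · exact norm_sub_lt_norm_add (D.p_pos _) hζ
  · exact norm_pos_iff.2 (add_ne_zero_of_pos (D.p_pos _) (orhp_subset hζ))

theorem HalfReg.exists_norm_le {f : ℂ → ℂ} (hf : HalfReg f) : ∃ C, ∀ ζ ∈ rhp, ‖f ζ‖ ≤ C := by
  obtain ⟨C, hC⟩ := hf.decays.bound
  refine ⟨max (C + 1) ‖f 0‖, fun ζ hζ => ?_⟩
  by_cases h0 : ζ = 0
  · rw [h0]; exact le_max_right _ _
  · refine le_trans ?_ (le_max_left _ _)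
    have h1 := hC ζ ⟨hζ, h0⟩
    have h2 : ‖f ζ‖ ≤ ‖f ζ - 1‖ + 1 := by simpa using norm_add_le (f ζ - 1) 1
    nlinarith [mul_nonneg (norm_nonneg (f ζ - 1)) (norm_nonneg ζ)]

theorem HalfReg.mul {f k : ℂ → ℂ} (hf : HalfReg f) (hk : HalfReg k) :
    HalfReg fun ζ => f ζ * k ζ := by
  obtain ⟨C, hC⟩ := hf.bound
  obtain ⟨C', hC'⟩ := hk.bound
  obtain ⟨K, hK⟩ := hk.exists_norm_le
  refine ⟨hf.cont.mul hk.cont, hf.diff.mul hk.diff, C * K + C', fun ζ hζ => ?_⟩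
  have e : f ζ * k ζ - 1 = (f ζ - 1) * k ζ + (k ζ - 1) := by ring
  rw [e]
  refine (mul_le_mul_of_nonneg_right (norm_add_le _ _) (norm_nonneg _)).trans ?_
  rw [add_mul, norm_mul]
  refine add_le_add ?_ (hC' ζ hζ)
  rw [mul_right_comm]
  exact mul_le_mul (hC ζ hζ) (hK ζ hζ) (norm_nonneg _) (le_trans (by positivity) (hC ζ hζ))

namespace Jost
variable {D : Params N} {Γ : Staircase N} {g h : Fin N → (Fin N → ℤ) → ℝ}
  {Λ Υ : (Fin N → ℤ) → ℂ → ℂ}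

theorem left_reg (J : Jost D Γ g h Λ Υ) (n : Fin N → ℤ) : HalfReg (Λ n) :=
  (J.data.leftJost_reg J.left).1 n

theorem right_reg (J : Jost D Γ g h Λ Υ) (n : Fin N → ℤ) : HalfReg (Υ n) :=
  (J.data.rightJost_reg J.right).1 n

theorem ne_zero_of_orhp {ζ : ℂ} (hζ : ζ ∈ orhp) : ζ ≠ 0 := by rintro rfl; simp [orhp] at hζ

/-- Inside the half-plane A is the transmission limit of Λ at the far end. At ζ = a, b these limits
supply the constants in the asymptotics of the dual function. -/
theorem tendsto_left_atTop (J : Jost D Γ g h Λ Υ) {ζ : ℂ} (hζ : ζ ∈ orhp) (m : Fin N → ℤ) :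
    Tendsto (fun i : ℤ => Λ (m + Γ.point i) ζ) atTop (𝓝 (specA D Γ Λ Υ ζ)) := by
  obtain ⟨θ, h1, h2⟩ := exists_contraction D Γ hζ
  refine tendsto_of_wronskian (y := fun i => Υ (m + Γ.point i) ζ) (P := fun i => D.p (Γ.dir i)) h1
    (fun i => p_add_ne_zero D (orhp_subset hζ) _) (fun i => h2 _) (fun i => ?_)
    ((J.right ζ (orhp_subset hζ)).2 m)
  rw [Γ.add_point_succ]
  exact J.wronskian_specA_shift (orhp_subset hζ) (ne_zero_of_orhp hζ) _ _

theorem tendsto_right_atBot (J : Jost D Γ g h Λ Υ) {ζ : ℂ} (hζ : ζ ∈ orhp) (m : Fin N → ℤ) :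
    Tendsto (fun i : ℤ => Υ (m + Γ.point i) ζ) atBot (𝓝 (specA D Γ Λ Υ ζ)) := by
  obtain ⟨θ, h1, h2⟩ := exists_contraction D Γ hζ
  have key : Tendsto (fun i : ℤ => Υ (m + Γ.point (-i)) ζ) atTop (𝓝 (specA D Γ Λ Υ ζ)) := by
    refine tendsto_of_wronskian (y := fun i => Λ (m + Γ.point (-i)) ζ)
      (P := fun i => D.p (Γ.dir (-i - 1))) h1
      (fun i => p_add_ne_zero D (orhp_subset hζ) _) (fun i => h2 _) (fun i => ?_)
      (((J.left ζ (orhp_subset hζ)).2 m).comp tendsto_neg_atTop_atBot)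
    have e2 : -i - 1 = -(i + 1) := by ring
    have e : m + Γ.point (-i) = shift (Γ.dir (-(i + 1))) (m + Γ.point (-(i + 1))) := by
      rw [← Γ.add_point_succ]; congr 2; ring
    rw [e, e2]
    have := J.wronskian_specA_shift (orhp_subset hζ) (ne_zero_of_orhp hζ)
      (m + Γ.point (-(i + 1))) (Γ.dir (-(i + 1)))
    linear_combination this
  simpa [Function.comp_def] using key.comp tendsto_neg_atBot_atTop

theorem specA_differentiableOn (J : Jost D Γ g h Λ Υ) :
    DifferentiableOn ℂ (specA D Γ Λ Υ) orhp := by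
  intro ζ hζ
  have h1 := fun n => (J.left_reg n).diff ζ hζ
  have h2 := fun n => (J.right_reg n).diff ζ hζ
  have h3 : (2 : ℂ) * ζ ≠ 0 := mul_ne_zero two_ne_zero (ne_zero_of_orhp hζ)
  have h4 : ∀ c : ℂ, DifferentiableWithinAt ℂ (fun ζ => c + ζ) orhp ζ := fun c => by fun_prop
  have h5 : ∀ c : ℂ, DifferentiableWithinAt ℂ (fun ζ => c - ζ) orhp ζ := fun c => by fun_prop
  exact DifferentiableWithinAt.fun_div ((((h4 _).fun_mul (h1 _)).fun_mul (h2 _)).fun_sub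
    (((h5 _).fun_mul (h1 _)).fun_mul (h2 _))) (by fun_prop) h3

theorem specA_continuousOn (J : Jost D Γ g h Λ Υ) :
    ContinuousOn (specA D Γ Λ Υ) (rhp \ {0}) := by
  have h1 := fun n => (J.left_reg n).cont.mono (Set.sdiff_subset (s := rhp) (t := {0}))
  have h2 := fun n => (J.right_reg n).cont.mono (Set.sdiff_subset (s := rhp) (t := {0}))
  have h4 : ∀ c : ℂ, ContinuousOn (fun ζ => c + ζ) (rhp \ {0}) := fun c => by fun_prop
  have h5 : ∀ c : ℂ, ContinuousOn (fun ζ => c - ζ) (rhp \ {0}) := fun c => by fun_prop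
  exact ContinuousOn.div ((((h4 _).mul (h1 _)).mul (h2 _)).sub
    (((h5 _).mul (h1 _)).mul (h2 _))) (by fun_prop) fun ζ hζ => mul_ne_zero two_ne_zero hζ.2

theorem specA_bound (J : Jost D Γ g h Λ Υ) :
    ∃ C, ∀ ζ ∈ rhp, ζ ≠ 0 → ‖specA D Γ Λ Υ ζ - 1‖ * ‖ζ‖ ≤ C := by
  set p := D.p (Γ.dir 0)
  have r1 := (J.left_reg (Γ.point 1)).mul (J.right_reg (Γ.point 0))
  have r2 := (J.left_reg (Γ.point 0)).mul (J.right_reg (Γ.point 1))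
  obtain ⟨C1, h1⟩ := r1.bound
  obtain ⟨C2, h2⟩ := r2.bound
  obtain ⟨K1, k1⟩ := r1.exists_norm_le
  obtain ⟨K2, k2⟩ := r2.exists_norm_le
  refine ⟨p * (K1 + K2) / 2 + (C1 + C2) / 2, fun ζ hζ h0 => ?_⟩
  -- The ζ-linear parts of the Wronskian add up to 2ζ at leading order. The part proportional to p
  -- and the deviations of the two products from 1 stay bounded after multiplication by ζ.
  have e : (specA D Γ Λ Υ ζ - 1) * ζ = p / 2 * (Λ (Γ.point 1) ζ * Υ (Γ.point 0) ζ
      - Λ (Γ.point 0) ζ * Υ (Γ.point 1) ζ) + 1 / 2 * ((Λ (Γ.point 1) ζ * Υ (Γ.point 0) ζ - 1) * ζ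
      + (Λ (Γ.point 0) ζ * Υ (Γ.point 1) ζ - 1) * ζ) := by
    rw [specA]; field_simp; ring
  have hp : ‖(p : ℂ) / 2‖ = p / 2 := by
    rw [norm_div, norm_real, Real.norm_of_nonneg (D.p_pos _).le]; norm_num [p]
  have hh : ‖(1 / 2 : ℂ)‖ = 1 / 2 := by norm_num
  have hpp : 0 < p := D.p_pos _
  rw [← norm_mul, e]
  refine (norm_add_le _ _).trans ?_
  rw [norm_mul, norm_mul, hp, hh]
  have b1 := norm_sub_le (Λ (Γ.point 1) ζ * Υ (Γ.point 0) ζ) (Λ (Γ.point 0) ζ * Υ (Γ.point 1) ζ)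
  have b2 := norm_add_le ((Λ (Γ.point 1) ζ * Υ (Γ.point 0) ζ - 1) * ζ)
    ((Λ (Γ.point 0) ζ * Υ (Γ.point 1) ζ - 1) * ζ)
  rw [norm_mul (_ - 1), norm_mul (_ - 1)] at b2
  have b3 := k1 ζ hζ
  have b4 := k2 ζ hζ
  have b5 := h1 ζ hζ
  have b6 := h2 ζ hζ
  have b7 : p / 2 * ‖Λ (Γ.point 1) ζ * Υ (Γ.point 0) ζ - Λ (Γ.point 0) ζ * Υ (Γ.point 1) ζ‖
      ≤ p / 2 * (K1 + K2) := by
    gcongr; exact b1.trans (add_le_add b3 b4)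
  linarith

theorem left_zero_ne (J : Jost D Γ g h Λ Υ) : ¬(Λ 0 0 = 0 ∧ Λ (Γ.point 1) 0 = 0) := by
  rintro ⟨h1, h2⟩
  have h0 : (0 : ℂ) ∈ rhp := by simp [rhp]
  have hp : ∀ k, (D.p k : ℂ) ≠ 0 := fun k => by exact_mod_cast (D.p_pos k).ne'
  have := (J.leftState h0).eq_zero (by simpa using hp) (by simpa using hp) h1
    (by rw [psi, ← Γ.point_one, h1, h2]; simp)
  have hl := (J.left 0 h0).2 0
  simp only [this] at hl
  exact zero_ne_one (tendsto_nhds_unique tendsto_const_nhds hl)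

theorem right_zero_ne (J : Jost D Γ g h Λ Υ) : ¬(Υ 0 0 = 0 ∧ Υ (Γ.point 1) 0 = 0) := by
  rintro ⟨h1, h2⟩
  have h0 : (0 : ℂ) ∈ rhp := by simp [rhp]
  have hp : ∀ k, (D.p k : ℂ) ≠ 0 := fun k => by exact_mod_cast (D.p_pos k).ne'
  have := (J.rightState h0).eq_zero (by simpa using hp) (by simpa using hp) h1
    (by rw [psi, ← Γ.point_one, h1, h2]; simp)
  have hl := (J.right 0 h0).2 0
  simp only [this] at hl
  exact zero_ne_one (tendsto_nhds_unique tendsto_const_nhds hl)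

/-- Used for the values of the Jost functions at ζ = 0, which are real; reality is what prevents the
limit of A at 0 from vanishing. -/
theorem sq_add_sq_ne_zero {x y : ℂ} (hx : conj x = x) (hy : conj y = y) (h : x ≠ 0) :
    x ^ 2 + y ^ 2 ≠ 0 := by
  obtain ⟨r, rfl⟩ := conj_eq_iff_real.1 hx
  obtain ⟨s, rfl⟩ := conj_eq_iff_real.1 hy
  have hr : r ≠ 0 := by exact_mod_cast h
  have : r ^ 2 + s ^ 2 ≠ 0 := by positivity
  exact_mod_cast this

/-- The spectral function `A` is bounded away from zero near the origin. -/
theorem specA_near_zero (J : Jost D Γ g h Λ Υ) :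
    ∃ ε > 0, ∀ᶠ ζ in 𝓝[rhp \ {0}] (0 : ℂ), ε ≤ ‖specA D Γ Λ Υ ζ‖ := by
  have h0 : (0 : ℂ) ∈ rhp := by simp [rhp]
  have hpp : (D.p (Γ.dir 0) : ℂ) ≠ 0 := by exact_mod_cast (D.p_pos _).ne'
  have cl : ∀ n, Tendsto (Λ n) (𝓝[rhp \ {0}] 0) (𝓝 (Λ n 0)) := fun n =>
    ((J.left_reg n).cont 0 h0).tendsto.mono_left (nhdsWithin_mono 0 Set.sdiff_subset)
  have cr : ∀ n, Tendsto (Υ n) (𝓝[rhp \ {0}] 0) (𝓝 (Υ n 0)) := fun n =>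
    ((J.right_reg n).cont 0 h0).tendsto.mono_left (nhdsWithin_mono 0 Set.sdiff_subset)
  have cid : Tendsto (fun ζ : ℂ => ζ) (𝓝[rhp \ {0}] 0) (𝓝 0) :=
    tendsto_id.mono_left nhdsWithin_le_nhds
  have jl := (J.data.leftJost_reg J.left).2 0
  have jr := (J.data.rightJost_reg J.right).2
  rw [zero_add, Γ.point_zero] at jl
  have rl : ∀ n, conj (Λ n 0) = Λ n 0 := fun n => by
    rw [← J.data.leftJost_conj J.left n h0, map_zero]
  have rr : ∀ n, conj (Υ n 0) = Υ n 0 := fun n => by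
    rw [← J.data.rightJost_conj J.right n h0, map_zero]
  have of_lim : ∀ L : ℂ, L ≠ 0 → Tendsto (specA D Γ Λ Υ) (𝓝[rhp \ {0}] 0) (𝓝 L) →
      ∃ ε > 0, ∀ᶠ ζ in 𝓝[rhp \ {0}] (0 : ℂ), ε ≤ ‖specA D Γ Λ Υ ζ‖ := by
    intro L hL hlim
    have hn := norm_pos_iff.2 hL
    refine ⟨‖L‖ / 2, by positivity, ?_⟩
    filter_upwards [hlim.norm.eventually_const_lt (half_lt_self hn)] with ζ hζ using hζ.le
  have key := J.left_zero_ne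
  have key' := J.right_zero_ne
  set p := D.p (Γ.dir 0)
  have hA : ∀ ζ, specA D Γ Λ Υ ζ = ((p + ζ) * Λ (Γ.point 1) ζ * Υ 0 ζ
    - (p - ζ) * Λ 0 ζ * Υ (Γ.point 1) ζ) / (2 * ζ) := fun ζ => by rw [specA, Γ.point_zero]
  -- If the Wronskian vanishes at ζ = 0, the Jost functions are proportional there on the first
  -- step. Their Wronskians with their own values at 0, divided by ζ, both tend to 1; combining
  -- these gives A → (Υ² + Λ²) / (2 Λ Υ), evaluated at whichever end of the first step has nonzero
  -- values.
  by_cases hW : Λ (Γ.point 1) 0 * Υ 0 0 = Λ 0 0 * Υ (Γ.point 1) 0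
  · by_cases hl : Λ 0 0 = 0
    · have hl1 : Λ (Γ.point 1) 0 ≠ 0 := fun h => key ⟨hl, h⟩
      have hr : Υ 0 0 = 0 := by
        rw [hl, zero_mul] at hW; exact (mul_eq_zero.1 hW).resolve_left hl1
      have hr1 : Υ (Γ.point 1) 0 ≠ 0 := fun h => key' ⟨hr, h⟩
      refine of_lim _ (div_ne_zero (sq_add_sq_ne_zero (rl _) (rr (Γ.point 1)) hl1)
        (mul_ne_zero two_ne_zero (mul_ne_zero hl1 hr1))) ?_
      have hlim := (((((cl (Γ.point 1)).mul_const (Λ (Γ.point 1) 0)).mul jr).add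
        ((((cid.const_sub (p : ℂ)).div_const (p : ℂ)).mul jl).mul
          ((cr (Γ.point 1)).mul_const (Υ (Γ.point 1) 0)))).div_const
            (2 * (Λ (Γ.point 1) 0 * Υ (Γ.point 1) 0)))
      refine (hlim.congr' ?_).trans (by
        rw [sub_zero, div_self hpp, mul_one, mul_one, one_mul, sq, sq])
      filter_upwards [self_mem_nhdsWithin] with ζ hζ
      have hζ0 : ζ ≠ 0 := hζ.2
      rw [hA, hl, hr]
      field_simp
      ring
    · have hr : Υ 0 0 ≠ 0 := by
        intro h
        rw [h, mul_zero] at hW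
        exact key' ⟨h, (mul_eq_zero.1 hW.symm).resolve_left hl⟩
      refine of_lim _ (div_ne_zero (sq_add_sq_ne_zero (rr _) (rl 0) hr)
        (mul_ne_zero two_ne_zero (mul_ne_zero hl hr))) ?_
      have hlim := ((((jl.mul ((cr 0).mul_const (Υ 0 0))).add
        (((cl 0).mul_const (Λ 0 0)).mul jr)).add
        (((cl 0).mul_const (Λ 0 0)).mul (((cr (Γ.point 1)).mul_const (Υ 0 0)).sub
          ((cr 0).mul_const (Υ (Γ.point 1) 0))))).div_const (2 * (Λ 0 0 * Υ 0 0)))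
      refine (hlim.congr' ?_).trans (by
        rw [show 1 * (Υ 0 0 * Υ 0 0) + Λ 0 0 * Λ 0 0 * 1 + Λ 0 0 * Λ 0 0 *
          (Υ (Γ.point 1) 0 * Υ 0 0 - Υ 0 0 * Υ (Γ.point 1) 0) = Υ 0 0 ^ 2 + Λ 0 0 ^ 2 by ring])
      filter_upwards [self_mem_nhdsWithin] with ζ hζ
      have hζ0 : ζ ≠ 0 := hζ.2
      rw [hA]
      field_simp
      linear_combination (-(p : ℂ) * Λ 0 ζ * Υ 0 ζ) * hW
  -- Otherwise A = W / (2ζ) with W bounded away from zero, and A is large near the origin.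
  · set W : ℂ → ℂ := fun ζ => (p + ζ) * Λ (Γ.point 1) ζ * Υ 0 ζ
      - (p - ζ) * Λ 0 ζ * Υ (Γ.point 1) ζ with hWd
    have hlim : Tendsto W (𝓝[rhp \ {0}] 0) (𝓝 (((p : ℂ) + 0) * Λ (Γ.point 1) 0 * Υ 0 0
        - (p - 0) * Λ 0 0 * Υ (Γ.point 1) 0)) :=
      (((cid.const_add _).mul (cl _)).mul (cr _)).sub (((cid.const_sub _).mul (cl _)).mul (cr _))
    set L : ℂ := ((p : ℂ) + 0) * Λ (Γ.point 1) 0 * Υ 0 0 - (p - 0) * Λ 0 0 * Υ (Γ.point 1) 0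
    have hL : L ≠ 0 := by
      intro h
      apply hW
      apply mul_left_cancel₀ hpp
      simp only [L] at h
      linear_combination h
    have hn := norm_pos_iff.2 hL
    refine ⟨1, one_pos, ?_⟩
    have hc : Tendsto (fun ζ : ℂ => ‖ζ‖) (𝓝[rhp \ {0}] 0) (𝓝 0) := by simpa using cid.norm
    filter_upwards [hlim.norm.eventually_const_lt (half_lt_self hn),
      hc.eventually_lt_const (show 0 < ‖L‖ / 4 by positivity), self_mem_nhdsWithin] with ζ h1 h2 h3
    have h4 : 0 < ‖ζ‖ := norm_pos_iff.2 h3.2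
    rw [hA, norm_div, norm_mul, le_div_iff₀ (by simpa using h4)]
    have : ‖(2 : ℂ)‖ = 2 := by norm_num
    rw [this]
    simp only [hWd] at h1
    linarith

/-- If the zeros of `A` in the right half-plane are simple, there are finitely many. -/
theorem finite_zeros (J : Jost D Γ g h Λ Υ)
    (hs : ∀ ζ : ℂ, 0 < ζ.re → specA D Γ Λ Υ ζ = 0 → deriv (specA D Γ Λ Υ) ζ ≠ 0) :
    {ζ : ℂ | 0 < ζ.re ∧ specA D Γ Λ Υ ζ = 0}.Finite := by
  by_contra hinf
  obtain ⟨ε, hε, h1⟩ := J.specA_near_zero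
  obtain ⟨δ, hδ, h2⟩ := Metric.mem_nhdsWithin_iff.1 h1
  obtain ⟨C, hC⟩ := J.specA_bound
  have hK : IsCompact (Metric.closedBall (0 : ℂ) C ∩ (rhp ∩ (Metric.ball 0 δ)ᶜ)) :=
    (isCompact_closedBall 0 _).inter_right ((isClosed_le continuous_const continuous_re).inter
      Metric.isOpen_ball.isClosed_compl)
  -- The bounds at 0 and infinity confine the zeros to a compact set. An accumulation point is again
  -- a zero; it is not on the axis, where A ≠ 0, and not inside, where a zero with A' ≠ 0 is
  -- isolated.
  obtain ⟨z, hz, hacc⟩ := Set.Infinite.exists_accPt_of_subset_isCompact hinf hK (by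
    rintro ζ ⟨h3, h4⟩
    have hr : ζ ∈ rhp := le_of_lt (α := ℝ) h3
    have h0 : ζ ≠ 0 := ne_zero_of_orhp h3
    refine ⟨?_, hr, fun h5 => ?_⟩
    · have := hC ζ hr h0
      rw [h4] at this
      simpa using this
    · have : ε ≤ ‖specA D Γ Λ Υ ζ‖ := h2 ⟨h5, hr, h0⟩
      rw [h4, norm_zero] at this; linarith)
  have hz0 : z ≠ 0 := by
    rintro rfl; exact hz.2.2 (Metric.mem_ball_self hδ)
  have hzr : z ∈ rhp \ {0} := ⟨hz.2.1, hz0⟩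
  rw [accPt_iff_frequently] at hacc
  have hzA : specA D Γ Λ Υ z = 0 := by
    by_contra hne
    have h3 := (J.specA_continuousOn z hzr).tendsto.eventually_ne hne
    rw [eventually_nhdsWithin_iff] at h3
    obtain ⟨w, hw, hw2⟩ := (hacc.and_eventually h3).exists
    exact hw2 ⟨le_of_lt (α := ℝ) hw.2.1, ne_zero_of_orhp hw.2.1⟩ hw.2.2
  have hzo : 0 < z.re := by
    rcases (show 0 ≤ z.re from hz.2.1).lt_or_eq with h3 | h3
    · exact h3
    · exact absurd hzA (J.specA_axis_ne_zero h3.symm hz0)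
  have hd := ((J.specA_differentiableOn z hzo).differentiableAt
    (isOpen_orhp.mem_nhds hzo)).hasDerivAt
  have h3 := hd.eventually_ne (c := 0) (hs z hzo hzA)
  rw [eventually_nhdsWithin_iff] at h3
  obtain ⟨w, hw, hw2⟩ := (hacc.and_eventually h3).exists
  exact hw2 hw.1 hw.2.2

end Jost
end Q3

/-! ### Scattering data and the integral equations for the Jost functions. -/

namespace Q3
open Complex ComplexConjugate MeasureTheory

variable {N : ℕ}

/-- Bounded functions on the closed right half-plane, holomorphic in the interior. -/
structure Bdd (f : ℂ → ℂ) : Prop where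
  cont : ContinuousOn f rhp
  diff : DifferentiableOn ℂ f orhp
  bound : ∃ C, ∀ ζ ∈ rhp, ‖f ζ‖ ≤ C

namespace Bdd
variable {f k : ℂ → ℂ}

theorem add (hf : Bdd f) (hk : Bdd k) : Bdd fun ζ => f ζ + k ζ := by
  obtain ⟨C, hC⟩ := hf.bound
  obtain ⟨C', hC'⟩ := hk.bound
  exact ⟨hf.cont.add hk.cont, hf.diff.add hk.diff, C + C', fun ζ hζ =>
    (norm_add_le _ _).trans (add_le_add (hC ζ hζ) (hC' ζ hζ))⟩

theorem mul (hf : Bdd f) (hk : Bdd k) : Bdd fun ζ => f ζ * k ζ := by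
  obtain ⟨C, hC⟩ := hf.bound
  obtain ⟨C', hC'⟩ := hk.bound
  refine ⟨hf.cont.mul hk.cont, hf.diff.mul hk.diff, C * C', fun ζ hζ => ?_⟩
  rw [norm_mul]
  exact mul_le_mul (hC ζ hζ) (hC' ζ hζ) (norm_nonneg _) ((norm_nonneg _).trans (hC ζ hζ))

theorem const (c : ℂ) : Bdd fun _ => c :=
  ⟨continuousOn_const, differentiableOn_const c, ‖c‖, fun _ _ => le_rfl⟩

theorem congr (hf : Bdd f) (h : ∀ ζ ∈ rhp, k ζ = f ζ) : Bdd k := by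
  obtain ⟨C, hC⟩ := hf.bound
  exact ⟨hf.cont.congr h, hf.diff.congr fun ζ hζ => h ζ (orhp_subset hζ), C,
    fun ζ hζ => by rw [h ζ hζ]; exact hC ζ hζ⟩

theorem inv_add {c : ℝ} (hc : 0 < c) : Bdd fun ζ => (ζ + c)⁻¹ := by
  have hne : ∀ ζ ∈ rhp, ζ + c ≠ 0 := fun ζ hζ => by
    rw [add_comm]; exact add_ne_zero_of_pos hc hζ
  refine ⟨fun ζ hζ => ?_, fun ζ hζ => ?_, c⁻¹, fun ζ hζ => ?_⟩
  · exact (ContinuousAt.inv₀ (f := fun ζ => ζ + (c : ℂ)) (by fun_prop)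
      (hne ζ hζ)).continuousWithinAt
  · exact (DifferentiableAt.fun_inv (h := fun ζ => ζ + (c : ℂ)) (by fun_prop)
      (hne ζ (orhp_subset hζ))).differentiableWithinAt
  · rw [norm_inv, add_comm]
    exact inv_anti₀ hc (le_norm_add hζ)

theorem of_halfReg (hf : HalfReg f) : Bdd f := ⟨hf.cont, hf.diff, hf.exists_norm_le⟩

theorem linear_div {c : ℝ} (hc : 0 < c) (p s : ℂ) : Bdd fun ζ => (p + s * ζ) * (ζ + c)⁻¹ := by
  refine ((const s).add ((const (p - s * c)).mul (inv_add hc))).congr fun ζ hζ => ?_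
  have hne : ζ + c ≠ 0 := by rw [add_comm]; exact add_ne_zero_of_pos hc hζ
  field_simp
  ring

end Bdd

theorem dslope_eq {F : ℂ → ℂ} {c ζ : ℂ} (hF : F c = 0) (h : ζ ≠ c) :
    dslope F c ζ = F ζ / (ζ - c) := by
  rw [dslope_of_ne _ h, slope_def_field, hF, sub_zero]

theorem dslope_near_zero {F : ℂ → ℂ} {c : ℂ} (hc : c ∈ orhp) (hF : F c = 0) :
    ∀ᶠ ζ in 𝓝[rhp \ {0}] (0 : ℂ), ‖dslope F c ζ‖ ≤ 2 / ‖c‖ * ‖F ζ‖ := by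
  have hc0 : 0 < ‖c‖ := norm_pos_iff.2 (Jost.ne_zero_of_orhp hc)
  have h3 : ∀ᶠ σ in 𝓝[rhp \ {0}] (0 : ℂ), ‖c‖ / 2 < ‖σ - c‖ := by
    refine (Tendsto.eventually_const_lt ?_ ((Continuous.tendsto (by fun_prop) (0 : ℂ) :
      Tendsto (fun σ : ℂ => ‖σ - c‖) (𝓝 0) (𝓝 ‖(0 : ℂ) - c‖)).mono_left nhdsWithin_le_nhds))
    rw [zero_sub, norm_neg]; linarith
  filter_upwards [h3] with ζ h4
  have hne : ζ ≠ c := by rintro rfl; simp at h4; linarith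
  rw [dslope_eq hF hne, norm_div, div_le_iff₀ (by linarith), div_mul_eq_mul_div,
    div_mul_eq_mul_div, le_div_iff₀ hc0]
  nlinarith [norm_nonneg (F ζ)]

theorem dslope_near_infty {F : ℂ → ℂ} {c : ℂ} (hF : F c = 0) :
    ∀ᶠ ζ in Bornology.cobounded ℂ ⊓ 𝓟 rhp, ‖dslope F c ζ‖ * ‖ζ‖ ≤ 2 * ‖F ζ‖ := by
  refine eventually_of_norm_gt (2 * ‖c‖) fun ζ _ h => ?_
  have h1 := norm_sub_norm_le ζ c
  have h2 := norm_nonneg c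
  have hne : ζ ≠ c := by rintro rfl; linarith
  rw [dslope_eq hF hne, norm_div, div_mul_eq_mul_div, div_le_iff₀ (by linarith)]
  nlinarith [norm_nonneg (F ζ)]

theorem rhp_mem_nhds {c : ℂ} (hc : c ∈ orhp) : rhp ∈ 𝓝 c :=
  mem_of_superset (isOpen_orhp.mem_nhds hc) orhp_subset

theorem dslope_differentiableOn {F : ℂ → ℂ} {c : ℂ} (hc : c ∈ orhp)
    (hd : DifferentiableOn ℂ F orhp) : DifferentiableOn ℂ (dslope F c) orhp :=
  (differentiableOn_dslope (isOpen_orhp.mem_nhds hc)).2 hd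

theorem dslope_continuousOn {F : ℂ → ℂ} {c : ℂ} (hc : c ∈ orhp) {s : Set ℂ} (hs : s ∈ 𝓝 c)
    (hF : ContinuousOn F s) (hd : DifferentiableOn ℂ F orhp) : ContinuousOn (dslope F c) s :=
  (continuousOn_dslope hs).2 ⟨hF, (hd c hc).differentiableAt (isOpen_orhp.mem_nhds hc)⟩

theorem rhp_diff_mem_nhds {c : ℂ} (hc : c ∈ orhp) : rhp \ {0} ∈ 𝓝 c :=
  mem_of_superset (isOpen_orhp.mem_nhds hc) fun _ h => ⟨orhp_subset h, Jost.ne_zero_of_orhp h⟩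

theorem Bdd.dslope_decays {F : ℂ → ℂ} {c : ℂ} (hc : c ∈ orhp) (hF : F c = 0) (hB : Bdd F) :
    Decays (dslope F c) := by
  obtain ⟨C, hC⟩ := hB.bound
  refine Decays.of_eventually (C₀ := 2 / ‖c‖ * C) (C₁ := 2 * C)
    (dslope_differentiableOn hc hB.diff)
    (dslope_continuousOn hc (rhp_diff_mem_nhds hc) (hB.cont.mono Set.sdiff_subset) hB.diff) ?_ ?_
  · filter_upwards [dslope_near_zero hc hF, self_mem_nhdsWithin] with ζ h1 h2
    exact h1.trans (mul_le_mul_of_nonneg_left (hC ζ h2.1) (by positivity))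
  · filter_upwards [dslope_near_infty hF, mem_inf_of_right (mem_principal_self _)] with ζ h1 h2
    exact h1.trans (mul_le_mul_of_nonneg_left (hC ζ h2) (by positivity))

/-- The second component of the left Jost function. -/
noncomputable abbrev leftPsi (D : Params N) (Γ : Staircase N) (g : Fin N → (Fin N → ℤ) → ℝ)
    (Λ : (Fin N → ℤ) → ℂ → ℂ) (n : Fin N → ℤ) (ζ : ℂ) : ℂ := psi D.p Γ g ζ (Λ · ζ) n

/-- The second component of the right Jost function. -/
noncomputable abbrev rightPsi (D : Params N) (Γ : Staircase N) (g : Fin N → (Fin N → ℤ) → ℝ)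
    (Υ : (Fin N → ℤ) → ℂ → ℂ) (n : Fin N → ℤ) (ζ : ℂ) : ℂ := psi D.p Γ g (-ζ) (Υ · ζ) n

/-- The scattering data: the zeros `z` of `A` and the function `B`. -/
structure SpecData (D : Params N) (Γ : Staircase N) (g : Fin N → (Fin N → ℤ) → ℝ)
    (Λ Υ : (Fin N → ℤ) → ℂ → ℂ) {M : ℕ} (z : Fin M → ℂ) (B : ℂ → ℂ) : Prop where
  inj : Function.Injective z
  range : Set.range z = {ζ : ℂ | 0 < ζ.re ∧ specA D Γ Λ Υ ζ = 0}
  deriv_ne : ∀ k, deriv (specA D Γ Λ Υ) (z k) ≠ 0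
  ne_p : ∀ k r, z k ≠ D.p r
  axis : ∀ ζ : ℂ, ζ.re = 0 → ζ ≠ 0 → B ζ = Jost.specB D Γ g Λ Υ ζ
  ne_zero : ∀ k, B (z k) ≠ 0
  proportional : ∀ k n, Υ n (z k) = B (z k) * Λ n (z k) * rho D n (z k) ∧
    rightPsi D Γ g Υ n (z k) = B (z k) * leftPsi D Γ g Λ n (z k) * rho D n (z k)

namespace Jost
variable {D : Params N} {Γ : Staircase N} {g h : Fin N → (Fin N → ℤ) → ℝ}
  {Λ Υ : (Fin N → ℤ) → ℂ → ℂ}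

theorem exists_specData (J : Jost D Γ g h Λ Υ)
    (hs : ∀ ζ : ℂ, 0 < ζ.re → specA D Γ Λ Υ ζ = 0 → deriv (specA D Γ Λ Υ) ζ ≠ 0)
    (hp : ∀ r, specA D Γ Λ Υ (D.p r) ≠ 0) :
    ∃ (B : ℂ → ℂ) (M : ℕ) (z : Fin M → ℂ), SpecData D Γ g Λ Υ z B := by
  classical
  have hfin := J.finite_zeros hs
  set Z := {ζ : ℂ | 0 < ζ.re ∧ specA D Γ Λ Υ ζ = 0}
  have hne : ∀ ζ ∈ Z, ∀ r, ζ ≠ D.p r := fun ζ hζ r h => hp r (h ▸ hζ.2)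
  choose! β hβ using fun ζ (hζ : ζ ∈ Z) => J.exists_proportional hζ.1 (hne ζ hζ) hζ.2
  have : Fintype Z := hfin.fintype
  let e := (Fintype.equivFin Z).symm
  -- B combines two unrelated data: the proportionality constants at the zeros of A and the
  -- coefficient of the scattering relation on the axis. They do not interfere because the zeros
  -- have positive real part.
  refine ⟨fun ζ => if ζ ∈ Z then β ζ else specB D Γ g Λ Υ ζ, Fintype.card Z,
    fun k => (e k : ℂ), ?_⟩
  refine ⟨Subtype.val_injective.comp e.injective, ?_, fun k => hs _ (e k).2.1 (e k).2.2,
    fun k => hne _ (e k).2, fun ζ h1 h2 => if_neg fun h => ?_, fun k => ?_, fun k n => ?_⟩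
  · ext ζ
    constructor
    · rintro ⟨k, rfl⟩; exact (e k).2
    · intro hζ; exact ⟨e.symm ⟨ζ, hζ⟩, by simp⟩
  · exact absurd h.1 (by rw [h1]; exact lt_irrefl _)
  · simp only [if_pos (e k).2]; exact (hβ _ (e k).2).1
  · simp only [if_pos (e k).2]; exact (hβ _ (e k).2).2 n

theorem specA_conj (J : Jost D Γ g h Λ Υ) {ζ : ℂ} (hζ : ζ ∈ rhp) :
    specA D Γ Λ Υ (conj ζ) = conj (specA D Γ Λ Υ ζ) := by
  simp only [specA, J.data.leftJost_conj J.left _ hζ, J.data.rightJost_conj J.right _ hζ]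
  simp [map_ofNat (starRingEnd ℂ) 2]

theorem specB_conj (J : Jost D Γ g h Λ Υ) {ζ : ℂ} (hζ : ζ.re = 0) :
    specB D Γ g Λ Υ (-ζ) = conj (specB D Γ g Λ Υ ζ) := by
  have hr : ζ ∈ rhp := by simp [rhp, hζ]
  have hr' : -ζ ∈ rhp := neg_mem_rhp hζ
  have hc := conj_eq_neg hζ
  have c1 : ∀ n, Λ n (-ζ) = conj (Λ n ζ) := fun n => by
    rw [← hc]; exact J.data.leftJost_conj J.left n hr
  have c2 : ∀ n, Υ n (-ζ) = conj (Υ n ζ) := fun n => by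
    rw [← hc]; exact J.data.rightJost_conj J.right n hr
  have c3 := psi_conj D.p Γ g ζ (Λ · ζ) (Λ · (-ζ)) c1 0
  have c4 := psi_conj D.p Γ g (-ζ) (Υ · ζ) (Υ · (-ζ)) c2 0
  rw [hc] at c3
  rw [map_neg, hc, neg_neg] at c4
  simp only [specB, neg_neg]
  rw [c4, c3, c2 0, c1 0]
  simp only [map_div₀, map_sub, map_mul, conj_conj, map_ofNat, hc]

/-- Unitarity in the form used for the right Jost function. -/
theorem scattering_inverse (J : Jost D Γ g h Λ Υ) {ζ : ℂ} (hζ : ζ.re = 0) (h0 : ζ ≠ 0)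
    (n : Fin N → ℤ) : specA D Γ Λ Υ ζ * Υ n (-ζ)
      = Λ n ζ + specB D Γ g Λ Υ (-ζ) * Υ n ζ * rho D n (-ζ) := by
  have hr : ζ ∈ rhp := by simp [rhp, hζ]
  have s1 := (J.scattering hζ h0 n).1
  have s2 := (J.scattering (ζ := -ζ) (by simp [hζ]) (neg_ne_zero.2 h0) n).1
  have hu := J.norm_sq_sub hζ h0
  rw [← J.specA_conj hr, conj_eq_neg hζ, ← J.specB_conj hζ] at hu
  rw [neg_neg] at s2
  have hρ : rho D n ζ * rho D n (-ζ) = 1 := by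
    rw [rho_neg, mul_inv_cancel₀ (rho_ne_zero D (p_add_ne_zero D hr) (p_sub_ne_zero D hζ) n)]
  linear_combination specA D Γ Λ Υ ζ * s2 - specB D Γ g Λ Υ (-ζ) * rho D n (-ζ) * s1 + Λ n ζ * hu
    - specB D Γ g Λ Υ (-ζ) * specB D Γ g Λ Υ ζ * Λ n ζ * hρ

/-- Common template for all the integral equations: f₀ is the unknown without its inhomogeneity, and
q its companion numerator, so that h = q / A is meromorphic with residue q(z_k) / A'(z_k). It is
enough that q = O(A) at the origin, since A may be unbounded there, and that q = O(1/ζ) at infinity,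
where |A| ≥ 1/2 eventually. -/
theorem solvesSIE (J : Jost D Γ g h Λ Υ) {M : ℕ} {z : Fin M → ℂ} {B : ℂ → ℂ}
    (H : SpecData D Γ g Λ Υ z B) {R w f f₀ q G : ℂ → ℂ} {c : Fin M → ℂ} {E : Set ℂ}
    (hfc : ContinuousOn f (rhp \ E)) (hf₀ : Decays f₀)
    (hf : ∀ ζ ∈ orhp, ζ ∉ E → f ζ = G ζ + f₀ ζ)
    (hqd : DifferentiableOn ℂ q orhp) (hqc : ContinuousOn q (rhp \ {0})) {C₀ C₁ : ℝ}
    (h0 : ∀ᶠ ζ in 𝓝[rhp \ {0}] 0, ‖q ζ‖ ≤ C₀ * ‖specA D Γ Λ Υ ζ‖)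
    (h1 : ∀ᶠ ζ in Bornology.cobounded ℂ ⊓ 𝓟 rhp, ‖q ζ‖ * ‖ζ‖ ≤ C₁)
    (hjump : ∀ σ : ℂ, σ.re = 0 → σ ≠ 0 → q σ / specA D Γ Λ Υ σ - f₀ (-σ) = R σ * f σ * w σ)
    (hres : ∀ k, q (z k) / deriv (specA D Γ Λ Υ) (z k) = c k * f (z k) * w (z k)) :
    SolvesSIE z c R w G E f := by
  set A := specA D Γ Λ Υ
  have hzo : ∀ k, z k ∈ orhp := fun k => by
    have : z k ∈ Set.range z := ⟨k, rfl⟩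
    rw [H.range] at this; exact this.1
  have hzA : ∀ k, A (z k) = 0 := fun k => by
    have : z k ∈ Set.range z := ⟨k, rfl⟩
    rw [H.range] at this; exact this.2
  have hAne : ∀ ζ ∈ rhp \ ({0} ∪ Set.range z), A ζ ≠ 0 := by
    rintro ζ ⟨h2, h3⟩ h4
    rcases (show 0 ≤ ζ.re from h2).lt_or_eq with h5 | h5
    · exact h3 (Or.inr (by rw [H.range]; exact ⟨h5, h4⟩))
    · exact J.specA_axis_ne_zero h5.symm (fun h => h3 (Or.inl h)) h4
  obtain ⟨ε, hε, hA0⟩ := J.specA_near_zero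
  obtain ⟨K, hK⟩ := J.specA_bound
  have hAinf : ∀ᶠ ζ in Bornology.cobounded ℂ ⊓ 𝓟 rhp, 1 / 2 ≤ ‖A ζ‖ := by
    refine eventually_of_norm_gt (max 1 (2 * K)) fun ζ hζ hR => ?_
    have h2 : 1 < ‖ζ‖ := (le_max_left _ _).trans_lt hR
    have h3 : 2 * K < ‖ζ‖ := (le_max_right _ _).trans_lt hR
    have h4 := hK ζ hζ (norm_pos_iff.1 (by linarith))
    have h5 : ‖A ζ - 1‖ ≤ 1 / 2 := by
      by_contra h6
      push Not at h6
      nlinarith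
    have h6 := norm_sub_norm_le (1 : ℂ) (A ζ)
    rw [norm_one, norm_sub_rev] at h6
    linarith
  refine ⟨hfc, fun ζ hζ hE => ?_⟩
  have key := hf₀.eq_of_jump H.inj hzo (h := fun σ => q σ / A σ)
    (r := fun k => c k * f (z k) * w (z k)) (C₀ := |C₀|) (C₁ := 2 * C₁)
    ((hqd.mono Set.sdiff_subset).div (J.specA_differentiableOn.mono Set.sdiff_subset)
      fun σ hσ => hAne σ ⟨orhp_subset hσ.1, by
        rintro (h | h); exacts [ne_zero_of_orhp hσ.1 h, hσ.2 h]⟩)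
    ((hqc.mono fun σ hσ => ⟨hσ.1, fun h => hσ.2 (Or.inl h)⟩).div
      (J.specA_continuousOn.mono fun σ hσ => ⟨hσ.1, fun h => hσ.2 (Or.inl h)⟩) hAne)
    (by
      intro k
      have hqk := ((hqd (z k) (hzo k)).differentiableAt (isOpen_orhp.mem_nhds (hzo k))).continuousAt
      have hd := ((J.specA_differentiableOn (z k) (hzo k)).differentiableAt
        (isOpen_orhp.mem_nhds (hzo k))).hasDerivAt
      have h2 := hasDerivAt_iff_tendsto_slope.1 hd
      have h3 := (hqk.tendsto.mono_left nhdsWithin_le_nhds).div h2 (H.deriv_ne k)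
      rw [hres k] at h3
      refine h3.congr fun σ => ?_
      have e : slope (specA D Γ Λ Υ) (z k) σ = A σ / (σ - z k) := by
        rw [slope_def_field]; change (A σ - A (z k)) / _ = _; rw [hzA, sub_zero]
      simp only [Pi.div_apply, e]
      rw [div_div_eq_mul_div]; ring)
    (by
      filter_upwards [h0, hA0] with σ h2 h3
      rw [norm_div, div_le_iff₀ (hε.trans_le h3)]
      exact h2.trans (mul_le_mul_of_nonneg_right (le_abs_self _) (norm_nonneg _)))
    (by
      filter_upwards [h1, hAinf] with σ h2 h3
      rw [norm_div, div_mul_eq_mul_div, div_le_iff₀ (by linarith)]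
      have h4 : 0 ≤ C₁ := le_trans (by positivity) h2
      nlinarith)
    (G := fun t => R (t * I) * f (t * I) * w (t * I))
    (fun t ht => (hjump (t * I) (by simp) (mul_I_ne_zero ht)).symm) hζ
  have e : ∀ t : ℝ, R (t * I) * f (t * I) / (t * I + ζ) * w (t * I)
      = R (t * I) * f (t * I) * w (t * I) * ((t : ℂ) * I + ζ)⁻¹ := fun t => by ring
  simp_rw [e]
  refine ⟨key.1, ?_⟩
  rw [hf ζ hζ hE, key.2, integral_mul_const]
  have hpi : (Real.pi : ℂ) ≠ 0 := by exact_mod_cast Real.pi_ne_zero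
  have e2 : ∀ k, c k * f (z k) / (ζ + z k) * w (z k) = c k * f (z k) * w (z k) / (ζ + z k) :=
    fun k => by ring
  simp_rw [e2]
  have hI := I_ne_zero
  generalize (∫ t : ℝ, R (t * I) * f (t * I) * w (t * I) * ((t : ℂ) * I + ζ)⁻¹) = X
  generalize (∑ k, c k * f (z k) * w (z k) / (ζ + z k)) = Y
  field_simp
  ring

/-- A bounded function is O(A) at the origin because A is bounded away from zero there. -/
theorem near_zero_of_bdd (J : Jost D Γ g h Λ Υ) {f k : ℂ → ℂ} (hf : Bdd f) (hk : Bdd k) :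
    ∃ C, ∀ᶠ ζ in 𝓝[rhp \ {0}] (0 : ℂ), ‖f ζ + k ζ * specA D Γ Λ Υ ζ‖
      ≤ C * ‖specA D Γ Λ Υ ζ‖ := by
  obtain ⟨ε, hε, hA0⟩ := J.specA_near_zero
  obtain ⟨C, hC⟩ := hf.bound
  obtain ⟨C', hC'⟩ := hk.bound
  refine ⟨C / ε + C', ?_⟩
  filter_upwards [hA0, self_mem_nhdsWithin] with ζ h1 h2
  refine (norm_add_le _ _).trans ?_
  rw [norm_mul, add_mul]
  refine add_le_add ?_ (mul_le_mul_of_nonneg_right (hC' ζ h2.1) (norm_nonneg _))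
  refine (hC ζ h2.1).trans ?_
  rw [div_mul_eq_mul_div, le_div_iff₀ hε]
  exact mul_le_mul_of_nonneg_left h1 ((norm_nonneg _).trans (hC ζ h2.1))

theorem near_infty_of_halfReg (J : Jost D Γ g h Λ Υ) {f : ℂ → ℂ} (hf : HalfReg f) :
    ∃ C, ∀ᶠ ζ in Bornology.cobounded ℂ ⊓ 𝓟 rhp, ‖f ζ - specA D Γ Λ Υ ζ‖ * ‖ζ‖ ≤ C := by
  obtain ⟨K, hK⟩ := J.specA_bound
  obtain ⟨C, hC⟩ := hf.bound
  refine ⟨C + K, eventually_of_norm_gt 0 fun ζ hζ h => ?_⟩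
  have e : f ζ - specA D Γ Λ Υ ζ = (f ζ - 1) - (specA D Γ Λ Υ ζ - 1) := by ring
  rw [e]
  refine (mul_le_mul_of_nonneg_right (norm_sub_le _ _) (norm_nonneg _)).trans ?_
  rw [add_mul]
  exact add_le_add (hC ζ hζ) (hK ζ hζ (norm_pos_iff.1 h))

/-- The scattering relation divided by A has the jump form for f₀ = Λ - 1 and h = Υ / A - 1: the two
constants cancel in the jump. -/
theorem left_solvesSIE (J : Jost D Γ g h Λ Υ) {M : ℕ} {z : Fin M → ℂ} {B : ℂ → ℂ}
    (H : SpecData D Γ g Λ Υ z B) (n : Fin N → ℤ) :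
    SolvesSIE z (fun k => B (z k) / deriv (specA D Γ Λ Υ) (z k))
      (fun σ => B σ / specA D Γ Λ Υ σ) (rho D n) (fun _ => 1) ∅ (Λ n) := by
  obtain ⟨C₀, h0⟩ := J.near_zero_of_bdd (Bdd.of_halfReg (J.right_reg n)) (Bdd.const (-1))
  obtain ⟨C₁, h1⟩ := J.near_infty_of_halfReg (J.right_reg n)
  refine J.solvesSIE H (f₀ := fun ζ => Λ n ζ - 1) (q := fun ζ => Υ n ζ - specA D Γ Λ Υ ζ)
    (C₀ := C₀) (C₁ := C₁) ((J.left_reg n).cont.mono Set.sdiff_subset) (J.left_reg n).decays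
    (fun ζ _ _ => by ring) ((J.right_reg n).diff.sub J.specA_differentiableOn)
    (((J.right_reg n).cont.mono Set.sdiff_subset).sub J.specA_continuousOn)
    (by simpa [← sub_eq_add_neg] using h0) h1 (fun σ h2 h3 => ?_) fun k => ?_
  · have hA := J.specA_axis_ne_zero h2 h3
    have := (J.scattering h2 h3 n).1
    rw [H.axis σ h2 h3]
    field_simp
    linear_combination this
  · have hz : specA D Γ Λ Υ (z k) = 0 := by
      have : z k ∈ Set.range z := ⟨k, rfl⟩
      rw [H.range] at this; exact this.2
    simp only [hz, sub_zero, (H.proportional k n).1]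
    ring

/-- Roles exchanged: Λ / A jumps to Υ(-ζ) by `scattering_inverse`, with coefficient -B(-σ) / A(σ).
At a zero of A the proportionality is inverted, which uses B(z_k) ≠ 0. -/
theorem right_solvesSIE (J : Jost D Γ g h Λ Υ) {M : ℕ} {z : Fin M → ℂ} {B : ℂ → ℂ}
    (H : SpecData D Γ g Λ Υ z B) (n : Fin N → ℤ) :
    SolvesSIE z (fun k => 1 / (deriv (specA D Γ Λ Υ) (z k) * B (z k)))
      (fun σ => -(B (-σ) / specA D Γ Λ Υ σ)) (fun σ => rho D n (-σ)) (fun _ => 1) ∅ (Υ n) := by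
  obtain ⟨C₀, h0⟩ := J.near_zero_of_bdd (Bdd.of_halfReg (J.left_reg n)) (Bdd.const (-1))
  obtain ⟨C₁, h1⟩ := J.near_infty_of_halfReg (J.left_reg n)
  refine J.solvesSIE H (f₀ := fun ζ => Υ n ζ - 1) (q := fun ζ => Λ n ζ - specA D Γ Λ Υ ζ)
    (C₀ := C₀) (C₁ := C₁) ((J.right_reg n).cont.mono Set.sdiff_subset) (J.right_reg n).decays
    (fun ζ _ _ => by ring) ((J.left_reg n).diff.sub J.specA_differentiableOn)
    (((J.left_reg n).cont.mono Set.sdiff_subset).sub J.specA_continuousOn)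
    (by simpa [← sub_eq_add_neg] using h0) h1 (fun σ h2 h3 => ?_) fun k => ?_
  · have hA := J.specA_axis_ne_zero h2 h3
    have := J.scattering_inverse h2 h3 n
    rw [H.axis (-σ) (by simp [h2]) (neg_ne_zero.2 h3)]
    field_simp
    linear_combination -this
  · have hz : 0 < (z k).re ∧ specA D Γ Λ Υ (z k) = 0 := by
      have : z k ∈ Set.range z := ⟨k, rfl⟩
      rwa [H.range] at this
    have hρ := rho_ne_zero D (p_add_ne_zero D (orhp_subset hz.1))
      (fun r => sub_ne_zero.2 (H.ne_p k r).symm) n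
    have hB := H.ne_zero k
    have hd := H.deriv_ne k
    simp only [hz.2, sub_zero, (H.proportional k n).1, rho_neg]
    field_simp

end Jost
end Q3

/-! ### The functions ξ and their integral equations. -/

namespace Q3
open Complex ComplexConjugate MeasureTheory

variable {N : ℕ}

/-- The numerator of `ξ` with pole at `-c`. -/
noncomputable def xiNum (D : Params N) (Γ : Staircase N) (g : Fin N → (Fin N → ℤ) → ℝ)
    (Λ : (Fin N → ℤ) → ℂ → ℂ) (c : ℝ) (n : Fin N → ℤ) (ζ : ℂ) : ℂ :=
  (Λ n c * leftPsi D Γ g Λ n ζ - leftPsi D Γ g Λ n c * Λ n ζ) * (ζ + c)⁻¹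

/-- The function `ξ` with pole at `-c`. -/
noncomputable def xiPos (D : Params N) (Γ : Staircase N) (g : Fin N → (Fin N → ℤ) → ℝ)
    (Λ : (Fin N → ℤ) → ℂ → ℂ) (c : ℝ) (n : Fin N → ℤ) : ℂ → ℂ :=
  dslope (xiNum D Γ g Λ c n) c

/-- The function `ξ` with pole at `c`. -/
noncomputable def xiNeg (D : Params N) (Γ : Staircase N) (g : Fin N → (Fin N → ℤ) → ℝ)
    (Λ Υ : (Fin N → ℤ) → ℂ → ℂ) (c : ℝ) (n : Fin N → ℤ) (ζ : ℂ) : ℂ :=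
  (Υ n c * leftPsi D Γ g Λ n ζ - rightPsi D Γ g Υ n c * Λ n ζ)
    / (specA D Γ Λ Υ c * (ζ ^ 2 - c ^ 2))

theorem xiPos_eq (D : Params N) (Γ : Staircase N) (g : Fin N → (Fin N → ℤ) → ℝ)
    (Λ : (Fin N → ℤ) → ℂ → ℂ) {c : ℝ} (n : Fin N → ℤ) {ζ : ℂ} (h1 : ζ ≠ c) (h2 : ζ + c ≠ 0) :
    xiPos D Γ g Λ c n ζ = (Λ n c * leftPsi D Γ g Λ n ζ - leftPsi D Γ g Λ n c * Λ n ζ)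
      / (ζ ^ 2 - c ^ 2) := by
  have h3 : ζ - c ≠ 0 := sub_ne_zero.2 h1
  have h4 : ζ ^ 2 - (c : ℂ) ^ 2 = (ζ + c) * (ζ - c) := by ring
  rw [xiPos, dslope_eq (by simp [xiNum]; left; ring) h1, xiNum, h4]
  field_simp

theorem ofReal_mem_orhp {c : ℝ} (hc : 0 < c) : (c : ℂ) ∈ orhp := by simpa [orhp] using hc

theorem ne_ofReal_of_axis {σ : ℂ} (h : σ.re = 0) {c : ℝ} (hc : 0 < c) : σ ≠ c := by
  rintro rfl; simp at h; linarith

namespace Jost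
variable {D : Params N} {Γ : Staircase N} {g h : Fin N → (Fin N → ℤ) → ℝ}
  {Λ Υ : (Fin N → ℤ) → ℂ → ℂ}

theorem leftPsi_bdd (J : Jost D Γ g h Λ Υ) {c : ℝ} (hc : 0 < c) (n : Fin N → ℤ) :
    Bdd fun ζ => leftPsi D Γ g Λ n ζ * (ζ + c)⁻¹ := by
  refine (((Bdd.linear_div hc (D.p (Γ.dir 0)) 1).mul
    (Bdd.of_halfReg (J.left_reg (shift (Γ.dir 0) n)))).add
    ((Bdd.const (-g (Γ.dir 0) n)).mul
      ((Bdd.inv_add hc).mul (Bdd.of_halfReg (J.left_reg n))))).congr fun ζ _ => ?_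
  simp only [leftPsi, psi]; ring

theorem rightPsi_bdd (J : Jost D Γ g h Λ Υ) {c : ℝ} (hc : 0 < c) (n : Fin N → ℤ) :
    Bdd fun ζ => rightPsi D Γ g Υ n ζ * (ζ + c)⁻¹ := by
  refine (((Bdd.linear_div hc (D.p (Γ.dir 0)) (-1)).mul
    (Bdd.of_halfReg (J.right_reg (shift (Γ.dir 0) n)))).add
    ((Bdd.const (-g (Γ.dir 0) n)).mul
      ((Bdd.inv_add hc).mul (Bdd.of_halfReg (J.right_reg n))))).congr fun ζ _ => ?_
  simp only [rightPsi, psi]; ring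

theorem left_comb_bdd (J : Jost D Γ g h Λ Υ) {c : ℝ} (hc : 0 < c) (n : Fin N → ℤ) (α β : ℂ) :
    Bdd fun ζ => (α * leftPsi D Γ g Λ n ζ - β * Λ n ζ) * (ζ + c)⁻¹ := by
  refine (((Bdd.const α).mul (J.leftPsi_bdd hc n)).add ((Bdd.const (-β)).mul
    ((Bdd.inv_add hc).mul (Bdd.of_halfReg (J.left_reg n))))).congr fun ζ _ => ?_
  ring

theorem right_comb_bdd (J : Jost D Γ g h Λ Υ) {c : ℝ} (hc : 0 < c) (n : Fin N → ℤ) (α β : ℂ) :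
    Bdd fun ζ => (α * rightPsi D Γ g Υ n ζ - β * Υ n ζ) * (ζ + c)⁻¹ := by
  refine (((Bdd.const α).mul (J.rightPsi_bdd hc n)).add ((Bdd.const (-β)).mul
    ((Bdd.inv_add hc).mul (Bdd.of_halfReg (J.right_reg n))))).congr fun ζ _ => ?_
  ring

theorem specA_norm_infty (J : Jost D Γ g h Λ Υ) :
    ∃ C, ∀ᶠ ζ in Bornology.cobounded ℂ ⊓ 𝓟 rhp, ‖specA D Γ Λ Υ ζ‖ ≤ C := by
  obtain ⟨K, hK⟩ := J.specA_bound
  refine ⟨K + 1, eventually_of_norm_gt 1 fun ζ hζ h => ?_⟩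
  have h1 := hK ζ hζ (norm_pos_iff.1 (by linarith))
  have h2 : ‖specA D Γ Λ Υ ζ‖ ≤ ‖specA D Γ Λ Υ ζ - 1‖ + 1 := by
    simpa using norm_add_le (specA D Γ Λ Υ ζ - 1) 1
  nlinarith [norm_nonneg (specA D Γ Λ Υ ζ - 1)]

theorem zero_re_pos {M : ℕ} {z : Fin M → ℂ} {B : ℂ → ℂ} (H : SpecData D Γ g Λ Υ z B) (k : Fin M) :
    0 < (z k).re ∧ specA D Γ Λ Υ (z k) = 0 := by
  have : z k ∈ Set.range z := ⟨k, rfl⟩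
  rwa [H.range] at this

theorem add_c_ne_zero {ζ : ℂ} (hζ : ζ ∈ rhp) {c : ℝ} (hc : 0 < c) : ζ + c ≠ 0 := by
  rw [add_comm]; exact add_ne_zero_of_pos hc hζ

theorem xiPos_continuousOn (J : Jost D Γ g h Λ Υ) {c : ℝ} (hc : 0 < c) (n : Fin N → ℤ) :
    ContinuousOn (xiPos D Γ g Λ c n) rhp :=
  dslope_continuousOn (ofReal_mem_orhp hc) (rhp_mem_nhds (ofReal_mem_orhp hc))
    (J.left_comb_bdd hc n _ _).cont (J.left_comb_bdd hc n _ _).diff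

/-- ξ is linear in the pair (Λ, ψ) at ζ, and both components obey the same scattering relation, so ξ
inherits the jump with the same R. The companion is the same expression in Υ. The condition A(c) ≠ 0
keeps the zeros of A away from c. -/
theorem xiPos_solvesSIE (J : Jost D Γ g h Λ Υ) {M : ℕ} {z : Fin M → ℂ} {B : ℂ → ℂ}
    (H : SpecData D Γ g Λ Υ z B) {c : ℝ} (hc : 0 < c) (hA : specA D Γ Λ Υ c ≠ 0)
    (n : Fin N → ℤ) :
    SolvesSIE z (fun k => B (z k) / deriv (specA D Γ Λ Υ) (z k))
      (fun σ => B σ / specA D Γ Λ Υ σ) (rho D n) (fun ζ => 1 / (ζ + c)) {-(c : ℂ)}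
      (xiPos D Γ g Λ c n) := by
  have hco := ofReal_mem_orhp hc
  have hcr := orhp_subset hco
  have hM := J.left_comb_bdd hc n (Λ n c) (leftPsi D Γ g Λ n c)
  have hM0 : xiNum D Γ g Λ c n c = 0 := by simp [xiNum]; left; ring
  have hN := J.right_comb_bdd hc n (Λ n c) (leftPsi D Γ g Λ n c)
  have hcc : (c : ℂ) + c ≠ 0 := add_c_ne_zero hcr hc
  -- By the Wronskian the first summand equals -A(c) at c; adding A makes the quotient by σ - c
  -- regular. The extra term A / (σ - c) of q cancels the reflected inhomogeneity 1 / (ζ + c) in the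
  -- jump.
  set F : ℂ → ℂ := fun σ => (Λ n c * rightPsi D Γ g Υ n σ - leftPsi D Γ g Λ n c * Υ n σ)
    * (σ + c)⁻¹ + 1 * specA D Γ Λ Υ σ with hF
  have hF0 : F c = 0 := by
    have := J.wronskian_specA hcr (ne_zero_of_orhp hco) n
    have hc0 := ne_zero_of_orhp hco
    simp only [hF, ← two_mul]
    field_simp
    linear_combination -this
  have hFd : DifferentiableOn ℂ F orhp := hN.diff.add (J.specA_differentiableOn.const_mul 1)
  have hFc : ContinuousOn F (rhp \ {0}) := (hN.cont.mono Set.sdiff_subset).add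
    (continuousOn_const.mul J.specA_continuousOn)
  obtain ⟨C₀, h0⟩ := J.near_zero_of_bdd hN (Bdd.const 1)
  obtain ⟨CA, hCA⟩ := J.specA_norm_infty
  obtain ⟨CN, hCN⟩ := hN.bound
  have hdec : Decays fun ζ => xiPos D Γ g Λ c n ζ - (ζ + c)⁻¹ :=
    (hM.dslope_decays hco hM0).sub (Decays.inv_add hco)
  refine J.solvesSIE H (f₀ := fun ζ => xiPos D Γ g Λ c n ζ - (ζ + c)⁻¹) (q := dslope F c)
    (C₀ := 2 / ‖(c : ℂ)‖ * C₀) (C₁ := 2 * (CN + CA))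
    ((J.xiPos_continuousOn hc n).mono Set.sdiff_subset) hdec (fun ζ _ _ => by ring)
    (dslope_differentiableOn hco hFd) (dslope_continuousOn hco (rhp_diff_mem_nhds hco) hFc hFd)
    ?_ ?_ (fun σ h2 h3 => ?_) fun k => ?_
  · filter_upwards [dslope_near_zero hco hF0, h0] with ζ h1 h2
    rw [mul_assoc]
    exact h1.trans (mul_le_mul_of_nonneg_left h2 (by positivity))
  · filter_upwards [dslope_near_infty hF0, hCA, mem_inf_of_right (mem_principal_self _)]
      with ζ h1 h2 h3
    refine h1.trans (mul_le_mul_of_nonneg_left ?_ two_pos.le)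
    simp only [hF, one_mul]
    exact (norm_add_le _ _).trans (add_le_add (hCN ζ h3) h2)
  · have hσ : σ ∈ rhp := by simp [rhp, h2]
    have hσ' : -σ ∈ rhp := neg_mem_rhp h2
    have e1 := add_c_ne_zero hσ hc
    have e2 : σ - c ≠ 0 := sub_ne_zero.2 (ne_ofReal_of_axis h2 hc)
    have e3 : -σ + c ≠ 0 := add_c_ne_zero hσ' hc
    have e4 : -σ ≠ c := ne_ofReal_of_axis (by simp [h2]) hc
    have e5 : σ ^ 2 - (c : ℂ) ^ 2 ≠ 0 := by
      rw [show σ ^ 2 - (c : ℂ) ^ 2 = (σ + c) * (σ - c) by ring]; exact mul_ne_zero e1 e2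
    have hA' := J.specA_axis_ne_zero h2 h3
    obtain ⟨s1, s2⟩ := J.scattering h2 h3 n
    rw [dslope_eq hF0 (sub_ne_zero.1 e2), xiPos_eq D Γ g Λ n e4 e3,
      xiPos_eq D Γ g Λ n (sub_ne_zero.1 e2) e1, H.axis σ h2 h3]
    simp only [hF, rightPsi, s1, s2, neg_sq]
    rw [show -σ + (c : ℂ) = -(σ - c) by ring, show σ ^ 2 - (c : ℂ) ^ 2 = (σ + c) * (σ - c) by ring]
    field_simp
    ring
  · obtain ⟨hz1, hz2⟩ := zero_re_pos H k
    have hr := orhp_subset hz1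
    have e1 := add_c_ne_zero hr hc
    have e2 : z k - c ≠ 0 := sub_ne_zero.2 fun h => hA (h ▸ hz2)
    obtain ⟨s1, s2⟩ := H.proportional k n
    have hd := H.deriv_ne k
    rw [dslope_eq hF0 (sub_ne_zero.1 e2), xiPos_eq D Γ g Λ n (sub_ne_zero.1 e2) e1]
    simp only [hF, s1, s2, hz2]
    rw [show z k ^ 2 - (c : ℂ) ^ 2 = (z k + c) * (z k - c) by ring]
    field_simp
    ring

/-- Here the pole c lies inside the half-plane. Division by A(c) normalises its residue to one, so
that subtraction of 1 / (ζ - c) leaves a holomorphic function. -/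
theorem xiNeg_solvesSIE (J : Jost D Γ g h Λ Υ) {M : ℕ} {z : Fin M → ℂ} {B : ℂ → ℂ}
    (H : SpecData D Γ g Λ Υ z B) {c : ℝ} (hc : 0 < c) (hA : specA D Γ Λ Υ c ≠ 0)
    (n : Fin N → ℤ) :
    SolvesSIE z (fun k => B (z k) / deriv (specA D Γ Λ Υ) (z k))
      (fun σ => B σ / specA D Γ Λ Υ σ) (rho D n) (fun ζ => 1 / (ζ + (-c : ℝ))) {-((-c : ℝ) : ℂ)}
      (xiNeg D Γ g Λ Υ c n) := by
  have hco := ofReal_mem_orhp hc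
  have hcr := orhp_subset hco
  have hcc : (c : ℂ) + c ≠ 0 := add_c_ne_zero hcr hc
  have hM : Bdd fun ζ => (specA D Γ Λ Υ c)⁻¹ * ((Υ n c * leftPsi D Γ g Λ n ζ
      - rightPsi D Γ g Υ n c * Λ n ζ) * (ζ + c)⁻¹) + (-1) :=
    ((Bdd.const _).mul (J.left_comb_bdd hc n _ _)).add (Bdd.const (-1))
  set F : ℂ → ℂ := fun ζ => (specA D Γ Λ Υ c)⁻¹ * ((Υ n c * leftPsi D Γ g Λ n ζ
      - rightPsi D Γ g Υ n c * Λ n ζ) * (ζ + c)⁻¹) + (-1) with hF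
  have hF0 : F c = 0 := by
    have := J.wronskian_specA hcr (ne_zero_of_orhp hco) n
    have hc0 := ne_zero_of_orhp hco
    simp only [hF, ← two_mul]
    field_simp
    linear_combination this
  have hN : Bdd fun ζ => (specA D Γ Λ Υ c)⁻¹ * ((Υ n c * rightPsi D Γ g Υ n ζ
      - rightPsi D Γ g Υ n c * Υ n ζ) * (ζ + c)⁻¹) :=
    (Bdd.const _).mul (J.right_comb_bdd hc n _ _)
  -- The companion in Υ vanishes at c by antisymmetry, so its quotient by ζ - c needs no correction.
  -- The term A / (ζ + c) is added to q only to cancel the reflected inhomogeneity in the jump.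
  set K : ℂ → ℂ := fun ζ => (specA D Γ Λ Υ c)⁻¹ * ((Υ n c * rightPsi D Γ g Υ n ζ
      - rightPsi D Γ g Υ n c * Υ n ζ) * (ζ + c)⁻¹) with hK
  have hK0 : K c = 0 := by simp only [hK]; ring
  have hKdec := hN.dslope_decays hco hK0
  have hKB : ∃ C, ∀ ζ ∈ rhp \ {0}, ‖dslope K c ζ‖ ≤ C ∧ ‖dslope K c ζ‖ * ‖ζ‖ ≤ C := by
    obtain ⟨C, hC⟩ := hKdec.bound
    refine ⟨C, fun σ hσ => ?_⟩
    have := hC σ hσ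
    have h1 := mul_nonneg (norm_nonneg (dslope K c σ)) (norm_nonneg σ)
    have h2 := norm_nonneg (dslope K c σ)
    constructor <;> linarith
  obtain ⟨CK, hCK⟩ := hKB
  obtain ⟨ε, hε, hA0⟩ := J.specA_near_zero
  obtain ⟨CA, hCA⟩ := J.specA_norm_infty
  obtain ⟨CI, hCI⟩ := (Bdd.inv_add hc).bound
  obtain ⟨CJ, hCJ⟩ := (Bdd.linear_div hc 0 1).bound
  have hsq : ∀ ζ : ℂ, ζ ^ 2 - (c : ℂ) ^ 2 = (ζ + c) * (ζ - c) := fun ζ => by ring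
  have hcont : ContinuousOn (xiNeg D Γ g Λ Υ c n) (rhp \ {(c : ℂ)}) := by
    have h1 : ContinuousOn (fun ζ => (Υ n c * leftPsi D Γ g Λ n ζ - rightPsi D Γ g Υ n c * Λ n ζ)
        * (ζ + c)⁻¹ * ((specA D Γ Λ Υ c)⁻¹ * (ζ - c)⁻¹)) (rhp \ {(c : ℂ)}) := by
      refine ((J.left_comb_bdd hc n _ _).cont.mono Set.sdiff_subset).mul
        (continuousOn_const.mul (ContinuousOn.inv₀ (by fun_prop) fun ζ hζ => ?_))
      exact sub_ne_zero.2 hζ.2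
    refine h1.congr fun ζ hζ => ?_
    have e1 := add_c_ne_zero hζ.1 hc
    have e2 : ζ - c ≠ 0 := sub_ne_zero.2 hζ.2
    rw [xiNeg, hsq]
    field_simp
  have hE : -((-c : ℝ) : ℂ) = c := by push_cast; ring
  rw [hE]
  have hfeq : ∀ ζ ∈ rhp, ζ ≠ c → xiNeg D Γ g Λ Υ c n ζ = 1 / (ζ - c) + dslope F c ζ := by
    intro ζ h1 h2
    have e1 := add_c_ne_zero h1 hc
    have e2 : ζ - c ≠ 0 := sub_ne_zero.2 h2
    rw [dslope_eq hF0 h2, xiNeg, hsq]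
    simp only [hF]
    field_simp
    ring
  refine J.solvesSIE H (f₀ := dslope F c)
    (q := fun ζ => dslope K c ζ + specA D Γ Λ Υ ζ * (ζ + c)⁻¹)
    (C₀ := CK / ε + CI) (C₁ := CK + CA * CJ) hcont (hM.dslope_decays hco hF0)
    (fun ζ h1 h2 => ?_) (hKdec.diff.add (J.specA_differentiableOn.mul (Bdd.inv_add hc).diff))
    (hKdec.cont.add (J.specA_continuousOn.mul ((Bdd.inv_add hc).cont.mono Set.sdiff_subset)))
    ?_ ?_ (fun σ h2 h3 => ?_) fun k => ?_
  · rw [hfeq ζ (orhp_subset h1) h2]; push_cast; rw [← sub_eq_add_neg]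
  · filter_upwards [hA0, self_mem_nhdsWithin] with ζ h1 h2
    refine (norm_add_le _ _).trans ?_
    rw [norm_mul, add_mul]
    refine add_le_add ?_ ?_
    · refine (hCK ζ h2).1.trans ?_
      rw [div_mul_eq_mul_div, le_div_iff₀ hε]
      exact mul_le_mul_of_nonneg_left h1 ((norm_nonneg _).trans (hCK ζ h2).1)
    · rw [mul_comm]
      exact mul_le_mul_of_nonneg_right (hCI ζ h2.1) (norm_nonneg _)
  · have hne : ∀ᶠ ζ in Bornology.cobounded ℂ ⊓ 𝓟 rhp, ζ ∈ rhp \ {0} :=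
      eventually_of_norm_gt 0 fun ζ h1 h2 => ⟨h1, norm_pos_iff.1 h2⟩
    filter_upwards [hCA, hne] with ζ h1 h2
    refine (mul_le_mul_of_nonneg_right (norm_add_le _ _) (norm_nonneg _)).trans ?_
    rw [add_mul]
    refine add_le_add (hCK ζ h2).2 ?_
    have h3 := hCJ ζ h2.1
    rw [zero_add, one_mul, norm_mul, mul_comm] at h3
    rw [norm_mul, mul_assoc]
    exact mul_le_mul h1 h3 (by positivity) ((norm_nonneg _).trans h1)
  · have hσ : σ ∈ rhp := by simp [rhp, h2]
    have hσ' : -σ ∈ rhp := neg_mem_rhp h2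
    have e1 := add_c_ne_zero hσ hc
    have e2 : σ - c ≠ 0 := sub_ne_zero.2 (ne_ofReal_of_axis h2 hc)
    have e3 : -σ + c ≠ 0 := add_c_ne_zero hσ' hc
    have e4 : -σ ≠ c := ne_ofReal_of_axis (by simp [h2]) hc
    have hA' := J.specA_axis_ne_zero h2 h3
    obtain ⟨s1, s2⟩ := J.scattering h2 h3 n
    rw [dslope_eq hF0 e4, dslope_eq hK0 (sub_ne_zero.1 e2), H.axis σ h2 h3, xiNeg, hsq]
    simp only [hF, hK, rightPsi, s1, s2]
    rw [show -σ + (c : ℂ) = -(σ - c) by ring, show -σ - (c : ℂ) = -(σ + c) by ring]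
    field_simp
    ring
  · obtain ⟨hz1, hz2⟩ := zero_re_pos H k
    have hr := orhp_subset hz1
    have e1 := add_c_ne_zero hr hc
    have e2 : z k - c ≠ 0 := sub_ne_zero.2 fun h => hA (h ▸ hz2)
    obtain ⟨s1, s2⟩ := H.proportional k n
    have hd := H.deriv_ne k
    rw [dslope_eq hK0 (sub_ne_zero.1 e2), xiNeg, hsq]
    simp only [hK, s1, s2, hz2]
    field_simp
    ring

end Jost
end Q3

/-! ### Plane waves and the bilinear pairing at the parameters a and b. -/

namespace Q3
open Complex ComplexConjugate

variable {N : ℕ}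

theorem Params.p_sq_sub_ne (D : Params N) (k : Fin N) :
    D.p k ^ 2 - D.a ^ 2 ≠ 0 ∧ D.p k ^ 2 - D.b ^ 2 ≠ 0 := by
  have h := pow_ne_zero 2 (D.P_ne_zero k)
  rw [D.P_sq] at h
  exact ⟨left_ne_zero_of_mul h, right_ne_zero_of_mul h⟩

theorem Params.p_add_ne (D : Params N) (k : Fin N) {x : ℝ} (hx : x ^ 2 = D.a ^ 2 ∨ x ^ 2 = D.b ^ 2) :
    D.p k + x ≠ 0 := by
  intro h
  have : D.p k ^ 2 - x ^ 2 = 0 := by linear_combination (D.p k - x) * h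
  rcases hx with e | e <;> rw [e] at this
  exacts [(D.p_sq_sub_ne k).1 this, (D.p_sq_sub_ne k).2 this]

theorem planeF_shift (D : Params N) {x y : ℝ} (hx : x ^ 2 = D.a ^ 2) (hy : y ^ 2 = D.b ^ 2)
    (k : Fin N) (n : Fin N → ℤ) :
    planeF D (shift k n) x y = planeF D n x y * ((D.p k + x) * (D.p k + y) / D.P k) :=
  prod_zpow_shift _ (fun r => div_ne_zero (mul_ne_zero (D.p_add_ne r (Or.inl hx))
    (D.p_add_ne r (Or.inr hy))) (D.P_ne_zero r)) k n

theorem planeF_ne_zero (D : Params N) {x y : ℝ} (hx : x ^ 2 = D.a ^ 2) (hy : y ^ 2 = D.b ^ 2)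
    (n : Fin N → ℤ) : planeF D n x y ≠ 0 :=
  Finset.prod_ne_zero_iff.2 fun r _ => zpow_ne_zero _ (div_ne_zero (mul_ne_zero
    (D.p_add_ne r (Or.inl hx)) (D.p_add_ne r (Or.inr hy))) (D.P_ne_zero r))

theorem planeF_zero (D : Params N) (x y : ℝ) : planeF D 0 x y = 1 := by simp [planeF]

/-- The numerator of the second component. -/
noncomputable def theta (u U : (Fin N → ℤ) → ℝ) (c : ℝ) (f ψ : (Fin N → ℤ) → ℂ)
    (n : Fin N → ℤ) : ℂ := U n * ψ n - c ^ 2 * u n * f n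

/-- The bilinear pairing of solutions at the spectral parameters `±b` and `±a`. -/
noncomputable def pairing (D : Params N) (u U : (Fin N → ℤ) → ℝ) (f ψ g φ : (Fin N → ℤ) → ℂ)
    (n : Fin N → ℤ) : ℂ :=
  (theta u U D.b f ψ n * theta u U D.a g φ n + (D.δ : ℂ) ^ 2 / 4 * (f n * g n)) / U n

section algebra
variable {D : Params N} {u U : (Fin N → ℤ) → ℝ}

/-- At ζ² = c² the pair (f, θ) evolves by a 2 × 2 system. The dual relation removes U at the shifted
point, and the factorisation of P_k² removes the product of the two values of u. -/
theorem theta_step (hU : IsDual D u U) (hU0 : ∀ n, U n ≠ 0)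
    {c c' : ℝ} (hc : c ^ 2 + c' ^ 2 = D.a ^ 2 + D.b ^ 2) (k : Fin N)
    (hq : D.P k ^ 2 = (D.p k ^ 2 - c ^ 2) * (D.p k ^ 2 - c' ^ 2)) {ζ : ℂ} (hζ : ζ ^ 2 = c ^ 2)
    {f ψ : (Fin N → ℤ) → ℂ} (X : LaxState D.p (laxG D u U) (laxH D u U) ζ f ψ) (n : Fin N → ℤ) :
    U n * (D.p k + ζ) * f (shift k n) = theta u U c f ψ n
        + (D.P k * u (shift k n) - (D.p k ^ 2 - c ^ 2) * u n) * f n ∧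
      D.P k * U n * (D.p k + ζ) * theta u U c f ψ (shift k n)
        = D.P k * ((D.p k ^ 2 - c ^ 2) * u (shift k n) - D.P k * u n) * theta u U c f ψ n
          - (D.p k ^ 2 - c ^ 2) * (D.δ ^ 2 / 4) * f n := by
  have hUn : (U n : ℂ) ≠ 0 := by exact_mod_cast hU0 n
  have hUk : (U (shift k n) : ℂ) ≠ 0 := by exact_mod_cast hU0 _
  have hP : (D.P k : ℂ) ≠ 0 := by exact_mod_cast D.P_ne_zero k
  have e1 : U n * (D.p k + ζ) * f (shift k n) = theta u U c f ψ n
        + (D.P k * u (shift k n) - (D.p k ^ 2 - c ^ 2) * u n) * f n := by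
    have hg : (U n : ℂ) * (laxG D u U k n : ℝ) = D.P k * u (shift k n) - D.p k ^ 2 * u n := by
      rw [laxG]; push_cast; field_simp
    rw [theta]
    linear_combination (U n : ℂ) * X.fst n k + f n * hg
  refine ⟨e1, ?_⟩
  have hh : (U (shift k n) : ℂ) * (laxH D u U k n : ℝ)
      = D.p k ^ 2 * u (shift k n) - D.P k * u n := by
    rw [laxH]; push_cast; field_simp
  have hd : (U n : ℂ) * U (shift k n) * D.P k = D.P k ^ 2 * (u n ^ 2 + u (shift k n) ^ 2)
      - D.P k * (2 * D.p k ^ 2 - c ^ 2 - c' ^ 2) * u n * u (shift k n) + D.δ ^ 2 / 4 := by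
    have h1 : U n * U (shift k n) * D.P k = D.P k ^ 2 * (u n ^ 2 + u (shift k n) ^ 2)
      - D.P k * (2 * D.p k ^ 2 - c ^ 2 - c' ^ 2) * u n * u (shift k n) + D.δ ^ 2 / 4 := by
      rw [hU n k]
      have := D.P_ne_zero k
      field_simp
      linear_combination (-4 * D.P k * u n * u (shift k n)) * hc
    exact_mod_cast h1
  have hq' : (D.P k : ℂ) ^ 2 = (D.p k ^ 2 - c ^ 2) * (D.p k ^ 2 - c' ^ 2) := by exact_mod_cast hq
  have e2 : theta u U c f ψ (shift k n) = ((D.p k ^ 2 - c ^ 2) * u (shift k n) - D.P k * u n)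
      * f (shift k n) - (D.p k - ζ) * U (shift k n) * f n := by
    rw [theta]
    linear_combination (U (shift k n) : ℂ) * X.snd n k + f (shift k n) * hh
  rw [e2]
  linear_combination (D.P k : ℂ) * ((D.p k ^ 2 - c ^ 2) * u (shift k n) - D.P k * u n) * e1
    - (D.p k ^ 2 - c ^ 2) * f n * hd + (D.P k * U n * U (shift k n) * f n) * hζ
    - (D.P k * u n * u (shift k n) * f n) * hq'

/-- The 2 × 2 systems at b and at a preserve the form θθ' + (δ²/4) f g up to a scalar. The reason is
P_k² = (p_k² - a²)(p_k² - b²), the relation `hq` in the proof, which also cancels the mixed terms.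
-/
theorem pairing_shift (hU : IsDual D u U) (hU0 : ∀ n, U n ≠ 0) {ζ η : ℂ} (hζ : ζ ^ 2 = D.b ^ 2)
    (hη : η ^ 2 = D.a ^ 2) {f ψ g φ : (Fin N → ℤ) → ℂ}
    (X : LaxState D.p (laxG D u U) (laxH D u U) ζ f ψ)
    (Y : LaxState D.p (laxG D u U) (laxH D u U) η g φ) (n : Fin N → ℤ) (k : Fin N) :
    (D.p k + ζ) * (D.p k + η) * pairing D u U f ψ g φ (shift k n)
      = D.P k * pairing D u U f ψ g φ n := by
  obtain ⟨f1, f2⟩ := theta_step hU hU0 (c := D.b) (c' := D.a) (by ring) k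
    (by rw [D.P_sq]; ring) hζ X n
  obtain ⟨g1, g2⟩ := theta_step hU hU0 (c := D.a) (c' := D.b) (by ring) k (D.P_sq k) hη Y n
  have hUn : (U n : ℂ) ≠ 0 := by exact_mod_cast hU0 n
  have hUk : (U (shift k n) : ℂ) ≠ 0 := by exact_mod_cast hU0 _
  have hP : (D.P k : ℂ) ≠ 0 := by exact_mod_cast D.P_ne_zero k
  have hd : (U n : ℂ) * U (shift k n) * D.P k = D.P k ^ 2 * (u n ^ 2 + u (shift k n) ^ 2)
      - D.P k * (2 * D.p k ^ 2 - D.a ^ 2 - D.b ^ 2) * u n * u (shift k n) + D.δ ^ 2 / 4 := by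
    have h1 : U n * U (shift k n) * D.P k = D.P k ^ 2 * (u n ^ 2 + u (shift k n) ^ 2)
      - D.P k * (2 * D.p k ^ 2 - D.a ^ 2 - D.b ^ 2) * u n * u (shift k n) + D.δ ^ 2 / 4 := by
      rw [hU n k]
      have := D.P_ne_zero k
      field_simp
    exact_mod_cast h1
  have hq : (D.p k ^ 2 - D.b ^ 2 : ℂ) * (D.p k ^ 2 - D.a ^ 2) - (D.P k : ℂ) ^ 2 = 0 := by
    have : (D.p k ^ 2 - D.b ^ 2) * (D.p k ^ 2 - D.a ^ 2) - D.P k ^ 2 = 0 := by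
      rw [D.P_sq]; ring
    exact_mod_cast this
  rw [pairing, pairing]
  set θ := theta u U D.b f ψ n
  set θ' := theta u U D.a g φ n
  set θ₁ := theta u U D.b f ψ (shift k n)
  set θ₁' := theta u U D.a g φ (shift k n)
  have key : (D.P k : ℂ) ^ 2 * U n ^ 2 * ((D.p k + ζ) * (D.p k + η))
      * (θ₁ * θ₁' + (D.δ : ℂ) ^ 2 / 4 * (f (shift k n) * g (shift k n)))
      = D.P k ^ 2 * (U n * U (shift k n) * D.P k)
        * (θ * θ' + (D.δ : ℂ) ^ 2 / 4 * (f n * g n)) := by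
    have e1 : (D.P k : ℂ) ^ 2 * U n ^ 2 * ((D.p k + ζ) * (D.p k + η))
      * (θ₁ * θ₁' + (D.δ : ℂ) ^ 2 / 4 * (f (shift k n) * g (shift k n)))
      = (D.P k * U n * (D.p k + ζ) * θ₁) * (D.P k * U n * (D.p k + η) * θ₁')
        + D.P k ^ 2 * (D.δ : ℂ) ^ 2 / 4 * ((U n * (D.p k + ζ) * f (shift k n))
          * (U n * (D.p k + η) * g (shift k n))) := by ring
    rw [e1, f1, f2, g1, g2, hd]
    linear_combination (D.P k ^ 2 * u (shift k n) ^ 2 * θ * θ'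
      - (D.δ : ℂ) ^ 2 / 4 * D.P k * u (shift k n) * (g n * θ + f n * θ')
      + (((D.δ : ℂ) ^ 2 / 4) ^ 2 + (D.δ : ℂ) ^ 2 / 4 * D.P k ^ 2 * u n ^ 2) * (f n * g n)) * hq
  have hne : (D.P k : ℂ) ^ 2 * U n ≠ 0 := mul_ne_zero (pow_ne_zero 2 hP) hUn
  rw [mul_div_assoc', mul_div_assoc', div_eq_div_iff hUk hUn]
  apply mul_left_cancel₀ hne
  linear_combination key

/-- The step factor P / ((p - y)(p - x)) equals (p + x)(p + y) / P, the step factor of the plane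
wave; hence the signs -y, -x of the spectral parameters. -/
theorem pairing_eq (hU : IsDual D u U) (hU0 : ∀ n, U n ≠ 0) {x y : ℝ} (hy : y ^ 2 = D.b ^ 2)
    (hx : x ^ 2 = D.a ^ 2) {f ψ g φ : (Fin N → ℤ) → ℂ}
    (X : LaxState D.p (laxG D u U) (laxH D u U) (-y) f ψ)
    (Y : LaxState D.p (laxG D u U) (laxH D u U) (-x) g φ) (n : Fin N → ℤ) :
    pairing D u U f ψ g φ n = pairing D u U f ψ g φ 0 * planeF D n x y := by
  have hs := pairing_shift hU hU0 (ζ := -y) (η := -x)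
    (by rw [neg_sq]; exact_mod_cast hy) (by rw [neg_sq]; exact_mod_cast hx) X Y
  refine lattice_induction (Q := fun n => pairing D u U f ψ g φ n
    = pairing D u U f ψ g φ 0 * planeF D n x y) 0 (by simp [planeF_zero]) (fun n k => ?_) n
  have hP : (D.P k : ℂ) ≠ 0 := by exact_mod_cast D.P_ne_zero k
  have h1 : (D.p k : ℂ) + x ≠ 0 := by exact_mod_cast D.p_add_ne k (Or.inl hx)
  have h2 : (D.p k : ℂ) + y ≠ 0 := by exact_mod_cast D.p_add_ne k (Or.inr hy)
  have hPs : (D.P k : ℂ) ^ 2 = (D.p k + x) * (D.p k + -x) * ((D.p k + y) * (D.p k + -y)) := by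
    have : D.P k ^ 2 = (D.p k + x) * (D.p k + -x) * ((D.p k + y) * (D.p k + -y)) := by
      rw [D.P_sq, ← hx, ← hy]; ring
    exact_mod_cast this
  have e : pairing D u U f ψ g φ (shift k n)
      = pairing D u U f ψ g φ n * ((D.p k + x) * (D.p k + y) / D.P k) := by
    have h3 := hs n k
    have h4 : ((D.p k : ℂ) + -y) * (D.p k + -x) ≠ 0 := by
      intro h0
      apply pow_ne_zero 2 hP
      linear_combination hPs + (D.p k + x) * (D.p k + y) * h0
    apply mul_left_cancel₀ h4
    rw [h3]
    field_simp
    linear_combination pairing D u U f ψ g φ n * hPs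
  rw [e, planeF_shift D hx hy]
  push_cast
  rw [← mul_assoc]
  have h5 : ((D.p k : ℂ) + x) * (D.p k + y) / D.P k ≠ 0 := div_ne_zero (mul_ne_zero h1 h2) hP
  exact ⟨fun h => by rw [h], fun h => mul_right_cancel₀ h5 h⟩

/-- The second Lax component does not depend on the direction, so neither does Λ₂. -/
theorem second_eq (hU0 : ∀ n, U n ≠ 0) {Γ : Staircase N} {Λ Υ : (Fin N → ℤ) → ℂ → ℂ}
    (J : Jost D Γ (laxG D u U) (laxH D u U) Λ Υ) {ζ : ℂ} (hζ : ζ ∈ rhp) (c : ℝ) (k : Fin N)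
    (n : Fin N → ℤ) : second D u U Λ c k n ζ
      = (U n * leftPsi D Γ (laxG D u U) Λ n ζ - c ^ 2 * u n * Λ n ζ) / (ζ ^ 2 - c ^ 2) := by
  have hUn : (U n : ℂ) ≠ 0 := by exact_mod_cast hU0 n
  have hg : (U n : ℂ) * (laxG D u U k n : ℝ) = D.P k * u (shift k n) - D.p k ^ 2 * u n := by
    rw [laxG]; push_cast; field_simp
  rw [second]
  congr 1
  push_cast
  linear_combination (U n : ℂ) * (J.leftState hζ).fst n k + Λ n ζ * hg

end algebra
end Q3

/-! ### The constants, and the second components in terms of ξ. -/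

namespace Q3
open Complex ComplexConjugate

variable {N : ℕ} {D : Params N} {Γ : Staircase N} {u U : (Fin N → ℤ) → ℝ}
  {Λ Υ : (Fin N → ℤ) → ℂ → ℂ}

namespace Jost
variable {g h : Fin N → (Fin N → ℤ) → ℝ}

theorem left_real (J : Jost D Γ g h Λ Υ) {c : ℝ} (hc : 0 < c) (n : Fin N → ℤ) :
    conj (Λ n c) = Λ n c ∧ conj (leftPsi D Γ g Λ n c) = leftPsi D Γ g Λ n c := by
  have hr := orhp_subset (ofReal_mem_orhp hc)
  have h1 : ∀ n, Λ n c = conj (Λ n c) := fun n => by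
    have := J.data.leftJost_conj J.left n hr
    rwa [conj_ofReal] at this
  have h2 := psi_conj D.p Γ g c (Λ · c) (Λ · c) h1 n
  rw [conj_ofReal] at h2
  exact ⟨(h1 n).symm, h2.symm⟩

theorem right_real (J : Jost D Γ g h Λ Υ) {c : ℝ} (hc : 0 < c) (n : Fin N → ℤ) :
    conj (Υ n c) = Υ n c ∧ conj (rightPsi D Γ g Υ n c) = rightPsi D Γ g Υ n c := by
  have hr := orhp_subset (ofReal_mem_orhp hc)
  have h1 : ∀ n, Υ n c = conj (Υ n c) := fun n => by
    have := J.data.rightJost_conj J.right n hr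
    rwa [conj_ofReal] at this
  have h2 := psi_conj D.p Γ g (-c) (Υ · c) (Υ · c) h1 n
  rw [map_neg, conj_ofReal] at h2
  exact ⟨(h1 n).symm, h2.symm⟩

theorem specA_real (J : Jost D Γ g h Λ Υ) {c : ℝ} (hc : 0 < c) :
    conj (specA D Γ Λ Υ c) = specA D Γ Λ Υ c := by
  rw [← J.specA_conj (orhp_subset (ofReal_mem_orhp hc)), conj_ofReal]

end Jost

theorem pairing_real {f ψ g φ : (Fin N → ℤ) → ℂ} {n : Fin N → ℤ}
    (hf : conj (f n) = f n ∧ conj (ψ n) = ψ n) (hg : conj (g n) = g n ∧ conj (φ n) = φ n) :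
    conj (pairing D u U f ψ g φ n) = pairing D u U f ψ g φ n := by
  simp only [pairing, theta, map_div₀, map_add, map_mul, map_sub, map_pow, conj_ofReal, hf.1, hf.2,
    hg.1, hg.2, map_ofNat]

theorem Params.a_pos (D : Params N) : 0 < D.a := D.b_pos.trans D.b_lt_a

/-- The four linear relations that determine the constants of the boundary conditions. -/
structure CoeffRel (D : Params N) (Γ : Staircase N) (u U : (Fin N → ℤ) → ℝ)
    (Λ Υ : (Fin N → ℤ) → ℂ → ℂ) (κ : Coeffs) : Prop where
  quad : κ.A * κ.D * (D.a + D.b) ^ 2 - κ.B * κ.C * (D.a - D.b) ^ 2 = -D.δ ^ 2 / (16 * D.a * D.b)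
  K₀ : (κ.K₀ : ℂ) = specA D Γ Λ Υ D.a * specA D Γ Λ Υ D.b
  K₁ : (κ.K₁ : ℂ) = specA D Γ Λ Υ D.a / specA D Γ Λ Υ D.b
  rel₁ : ∀ n, (D.a + D.b) * κ.A * planeF D n D.a D.b * Λ n D.a
      - (D.a - D.b) * κ.C * planeF D n (-D.a) D.b * (Υ n D.a / specA D Γ Λ Υ D.a)
    = -theta u U D.b (Υ · D.b) (rightPsi D Γ (laxG D u U) Υ · D.b) n
      / (2 * D.b * specA D Γ Λ Υ D.b)
  rel₂ : ∀ n, (D.a - D.b) * κ.B * planeF D n D.a (-D.b) * Λ n D.a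
      - (D.a + D.b) * κ.D * planeF D n (-D.a) (-D.b) * (Υ n D.a / specA D Γ Λ Υ D.a)
    = theta u U D.b (Λ · D.b) (leftPsi D Γ (laxG D u U) Λ · D.b) n / (2 * D.b)
  rel₃ : ∀ n, (D.a + D.b) * κ.A * planeF D n D.a D.b * Λ n D.b
      + (D.a - D.b) * κ.B * planeF D n D.a (-D.b) * (Υ n D.b / specA D Γ Λ Υ D.b)
    = -theta u U D.a (Υ · D.a) (rightPsi D Γ (laxG D u U) Υ · D.a) n
      / (2 * D.a * specA D Γ Λ Υ D.a)
  rel₄ : ∀ n, (D.a - D.b) * κ.C * planeF D n (-D.a) D.b * Λ n D.b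
      + (D.a + D.b) * κ.D * planeF D n (-D.a) (-D.b) * (Υ n D.b / specA D Γ Λ Υ D.b)
    = -theta u U D.a (Λ · D.a) (leftPsi D Γ (laxG D u U) Λ · D.a) n / (2 * D.a)

/-- The four pairings of Λ, Υ at b with Λ, Υ at a are constants times the four plane waves.
Eliminating one of the solutions with the Wronskian at a or at b isolates a single θ, which is each
of the four linear relations. -/
theorem exists_coeffRel (hU : IsDual D u U) (hU0 : ∀ n, U n ≠ 0)
    (J : Jost D Γ (laxG D u U) (laxH D u U) Λ Υ) (ha : specA D Γ Λ Υ D.a ≠ 0)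
    (hb : specA D Γ Λ Υ D.b ≠ 0) : ∃ κ, CoeffRel D Γ u U Λ Υ κ := by
  have a0 := D.a_pos
  have b0 := D.b_pos
  have ab := D.b_lt_a
  have hao := ofReal_mem_orhp a0
  have hbo := ofReal_mem_orhp b0
  set g := laxG D u U
  have wa := J.wronskian_specA (orhp_subset hao) (Jost.ne_zero_of_orhp hao)
  have wb := J.wronskian_specA (orhp_subset hbo) (Jost.ne_zero_of_orhp hbo)
  obtain ⟨α, hα⟩ := conj_eq_iff_real.1 (J.specA_real a0)
  obtain ⟨β, hβ⟩ := conj_eq_iff_real.1 (J.specA_real b0)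
  have sLa := J.leftState (orhp_subset hao)
  have sLb := J.leftState (orhp_subset hbo)
  have sRa := J.rightState (orhp_subset hao)
  have sRb := J.rightState (orhp_subset hbo)
  have eL : ∀ c : ℝ, (c : ℂ) = -((-c : ℝ) : ℂ) := fun c => by push_cast; ring
  have sLa' : LaxState D.p (laxG D u U) (laxH D u U) (-((-D.a : ℝ) : ℂ)) (Λ · D.a)
      (leftPsi D Γ g Λ · D.a) := by rw [← eL]; exact sLa
  have sLb' : LaxState D.p (laxG D u U) (laxH D u U) (-((-D.b : ℝ) : ℂ)) (Λ · D.b)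
      (leftPsi D Γ g Λ · D.b) := by rw [← eL]; exact sLb
  obtain ⟨r₁, h₁⟩ := conj_eq_iff_real.1 (pairing_real (D := D) (u := u) (U := U) (n := 0)
    (f := (Λ · D.b)) (ψ := (leftPsi D Γ g Λ · D.b)) (g := (Λ · D.a))
    (φ := (leftPsi D Γ g Λ · D.a)) (J.left_real b0 0) (J.left_real a0 0))
  obtain ⟨r₂, h₂⟩ := conj_eq_iff_real.1 (pairing_real (D := D) (u := u) (U := U) (n := 0)
    (f := (Λ · D.b)) (ψ := (leftPsi D Γ g Λ · D.b)) (g := (Υ · D.a))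
    (φ := (rightPsi D Γ g Υ · D.a)) (J.left_real b0 0) (J.right_real a0 0))
  obtain ⟨r₃, h₃⟩ := conj_eq_iff_real.1 (pairing_real (D := D) (u := u) (U := U) (n := 0)
    (f := (Υ · D.b)) (ψ := (rightPsi D Γ g Υ · D.b)) (g := (Λ · D.a))
    (φ := (leftPsi D Γ g Λ · D.a)) (J.right_real b0 0) (J.left_real a0 0))
  obtain ⟨r₄, h₄⟩ := conj_eq_iff_real.1 (pairing_real (D := D) (u := u) (U := U) (n := 0)
    (f := (Υ · D.b)) (ψ := (rightPsi D Γ g Υ · D.b)) (g := (Υ · D.a))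
    (φ := (rightPsi D Γ g Υ · D.a)) (J.right_real b0 0) (J.right_real a0 0))
  have q₁ := pairing_eq hU hU0 (x := -D.a) (y := -D.b) (by ring) (by ring) sLb' sLa'
  have q₂ := pairing_eq hU hU0 (x := D.a) (y := -D.b) (by ring) (by ring) sLb' sRa
  have q₃ := pairing_eq hU hU0 (x := -D.a) (y := D.b) (by ring) (by ring) sRb sLa'
  have q₄ := pairing_eq hU hU0 (x := D.a) (y := D.b) (by ring) (by ring) sRb sRa
  have hα0 : (α : ℂ) ≠ 0 := by rw [← hα]; exact ha
  have hβ0 : (β : ℂ) ≠ 0 := by rw [← hβ]; exact hb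
  have ha' : (D.a : ℂ) ≠ 0 := by exact_mod_cast a0.ne'
  have hb' : (D.b : ℂ) ≠ 0 := by exact_mod_cast b0.ne'
  have hs : (D.a : ℂ) + D.b ≠ 0 := by exact_mod_cast (add_pos a0 b0).ne'
  have hd : (D.a : ℂ) - D.b ≠ 0 := by exact_mod_cast (sub_pos.2 ab).ne'
  -- The denominators collect the Wronskians 2aα and 2bβ, with α = A(a) and β = A(b), and the
  -- prefactors a ± b of the relations.
  refine ⟨⟨r₄ / (4 * D.a * D.b * α * β * (D.a + D.b)), -r₂ / (4 * D.a * D.b * α * (D.a - D.b)),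
    r₃ / (4 * D.a * D.b * β * (D.a - D.b)), -r₁ / (4 * D.a * D.b * (D.a + D.b)), α * β, α / β⟩,
    ?_, ?_, ?_, fun n => ?_, fun n => ?_, fun n => ?_, fun n => ?_⟩
  · have hU00 : (U 0 : ℂ) ≠ 0 := by exact_mod_cast hU0 0
    -- The matrix of pairings is a product of matrices with the form diag(1, δ²/4) in the middle.
    -- Its determinant is δ²/4 times the two Wronskians 2aα and 2bβ.
    have key : (r₁ : ℂ) * r₄ - r₂ * r₃ = D.a * D.b * D.δ ^ 2 * α * β := by
      rw [← h₁, ← h₂, ← h₃, ← h₄, ← hα, ← hβ]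
      have e1 := wa 0
      have e2 := wb 0
      simp only [pairing, theta]
      field_simp
      linear_combination (4 * U 0 ^ 2 * D.δ ^ 2 * (psi D.p Γ g D.b (Λ · D.b) 0 * Υ 0 D.b
        - Λ 0 D.b * psi D.p Γ g (-D.b) (Υ · D.b) 0)) * e1
        + (4 * U 0 ^ 2 * D.δ ^ 2 * (2 * D.a * specA D Γ Λ Υ D.a)) * e2
    have key' : r₁ * r₄ - r₂ * r₃ = D.a * D.b * D.δ ^ 2 * α * β := by exact_mod_cast key
    have hα1 : α ≠ 0 := by exact_mod_cast hα0
    have hβ1 : β ≠ 0 := by exact_mod_cast hβ0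
    have hs1 : D.a + D.b ≠ 0 := (add_pos a0 b0).ne'
    have hd1 : D.a - D.b ≠ 0 := (sub_pos.2 ab).ne'
    have ha1 := a0.ne'
    have hb1 := b0.ne'
    simp only
    field_simp
    linear_combination -16 * key'
  · push_cast; rw [hα, hβ]
  · push_cast; rw [hα, hβ]
  · have hUn : (U n : ℂ) ≠ 0 := by exact_mod_cast hU0 n
    -- With the waves replaced by pairings at n, the δ² terms cancel in the difference and the
    -- common factor θ multiplies the Wronskian at a. The other three relations follow the same
    -- pattern.
    have e1 : (r₄ : ℂ) * planeF D n D.a D.b = pairing D u U (Υ · D.b) (rightPsi D Γ g Υ · D.b)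
        (Υ · D.a) (rightPsi D Γ g Υ · D.a) n := by
      rw [← h₄]; exact (q₄ n).symm
    have e2 : (r₃ : ℂ) * planeF D n (-D.a) D.b = pairing D u U (Υ · D.b) (rightPsi D Γ g Υ · D.b)
        (Λ · D.a) (leftPsi D Γ g Λ · D.a) n := by
      rw [← h₃]; exact (q₃ n).symm
    have e3 := wa n
    have hl : ((D.a : ℂ) + D.b) * ((r₄ / (4 * D.a * D.b * α * β * (D.a + D.b)) : ℝ) : ℂ)
        * planeF D n D.a D.b * Λ n D.a - (D.a - D.b)
        * ((r₃ / (4 * D.a * D.b * β * (D.a - D.b)) : ℝ) : ℂ) * planeF D n (-D.a) D.b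
          * (Υ n D.a / α) = ((r₄ * planeF D n D.a D.b) * Λ n D.a
          - (r₃ * planeF D n (-D.a) D.b) * Υ n D.a) / (4 * D.a * D.b * α * β) := by
      push_cast; field_simp
    rw [hα] at e3
    rw [hα, hβ]
    refine hl.trans ?_
    rw [e1, e2]
    simp only [pairing]
    generalize theta u U D.b (Υ · D.b) (rightPsi D Γ (laxG D u U) Υ · D.b) n = t
    simp only [theta]
    field_simp
    linear_combination (-8 * U n * t) * e3
  · have hUn : (U n : ℂ) ≠ 0 := by exact_mod_cast hU0 n
    have e1 : (r₂ : ℂ) * planeF D n D.a (-D.b) = pairing D u U (Λ · D.b) (leftPsi D Γ g Λ · D.b)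
        (Υ · D.a) (rightPsi D Γ g Υ · D.a) n := by
      rw [← h₂]; exact (q₂ n).symm
    have e2 : (r₁ : ℂ) * planeF D n (-D.a) (-D.b) = pairing D u U (Λ · D.b) (leftPsi D Γ g Λ · D.b)
        (Λ · D.a) (leftPsi D Γ g Λ · D.a) n := by
      rw [← h₁]; exact (q₁ n).symm
    have e3 := wa n
    have hl : ((D.a : ℂ) - D.b) * ((-r₂ / (4 * D.a * D.b * α * (D.a - D.b)) : ℝ) : ℂ)
        * planeF D n D.a (-D.b) * Λ n D.a - (D.a + D.b)
        * ((-r₁ / (4 * D.a * D.b * (D.a + D.b)) : ℝ) : ℂ) * planeF D n (-D.a) (-D.b)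
          * (Υ n D.a / α) = ((r₁ * planeF D n (-D.a) (-D.b)) * Υ n D.a
          - (r₂ * planeF D n D.a (-D.b)) * Λ n D.a) / (4 * D.a * D.b * α) := by
      push_cast; field_simp; ring
    rw [hα] at e3
    rw [hα]
    refine hl.trans ?_
    rw [e1, e2]
    simp only [pairing]
    generalize theta u U D.b (Λ · D.b) (leftPsi D Γ (laxG D u U) Λ · D.b) n = t
    simp only [theta]
    field_simp
    linear_combination (8 * U n * t) * e3
  · have hUn : (U n : ℂ) ≠ 0 := by exact_mod_cast hU0 n
    have e1 : (r₄ : ℂ) * planeF D n D.a D.b = pairing D u U (Υ · D.b) (rightPsi D Γ g Υ · D.b)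
        (Υ · D.a) (rightPsi D Γ g Υ · D.a) n := by
      rw [← h₄]; exact (q₄ n).symm
    have e2 : (r₂ : ℂ) * planeF D n D.a (-D.b) = pairing D u U (Λ · D.b) (leftPsi D Γ g Λ · D.b)
        (Υ · D.a) (rightPsi D Γ g Υ · D.a) n := by
      rw [← h₂]; exact (q₂ n).symm
    have e3 := wb n
    have hl : ((D.a : ℂ) + D.b) * ((r₄ / (4 * D.a * D.b * α * β * (D.a + D.b)) : ℝ) : ℂ)
        * planeF D n D.a D.b * Λ n D.b + (D.a - D.b)
        * ((-r₂ / (4 * D.a * D.b * α * (D.a - D.b)) : ℝ) : ℂ) * planeF D n D.a (-D.b)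
          * (Υ n D.b / β) = ((r₄ * planeF D n D.a D.b) * Λ n D.b
          - (r₂ * planeF D n D.a (-D.b)) * Υ n D.b) / (4 * D.a * D.b * α * β) := by
      push_cast; field_simp; ring
    rw [hβ] at e3
    rw [hα, hβ]
    refine hl.trans ?_
    rw [e1, e2]
    simp only [pairing]
    generalize theta u U D.a (Υ · D.a) (rightPsi D Γ (laxG D u U) Υ · D.a) n = t
    simp only [theta]
    field_simp
    linear_combination (-8 * U n * t) * e3
  · have hUn : (U n : ℂ) ≠ 0 := by exact_mod_cast hU0 n
    have e1 : (r₃ : ℂ) * planeF D n (-D.a) D.b = pairing D u U (Υ · D.b) (rightPsi D Γ g Υ · D.b)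
        (Λ · D.a) (leftPsi D Γ g Λ · D.a) n := by
      rw [← h₃]; exact (q₃ n).symm
    have e2 : (r₁ : ℂ) * planeF D n (-D.a) (-D.b) = pairing D u U (Λ · D.b) (leftPsi D Γ g Λ · D.b)
        (Λ · D.a) (leftPsi D Γ g Λ · D.a) n := by
      rw [← h₁]; exact (q₁ n).symm
    have e3 := wb n
    have hl : ((D.a : ℂ) - D.b) * ((r₃ / (4 * D.a * D.b * β * (D.a - D.b)) : ℝ) : ℂ)
        * planeF D n (-D.a) D.b * Λ n D.b + (D.a + D.b)
        * ((-r₁ / (4 * D.a * D.b * (D.a + D.b)) : ℝ) : ℂ) * planeF D n (-D.a) (-D.b)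
          * (Υ n D.b / β) = ((r₃ * planeF D n (-D.a) D.b) * Λ n D.b
          - (r₁ * planeF D n (-D.a) (-D.b)) * Υ n D.b) / (4 * D.a * D.b * β) := by
      push_cast; field_simp; ring
    rw [hβ] at e3
    rw [hβ]
    refine hl.trans ?_
    rw [e1, e2]
    simp only [pairing]
    generalize theta u U D.a (Λ · D.a) (leftPsi D Γ (laxG D u U) Λ · D.a) n = t
    simp only [theta]
    field_simp
    linear_combination (-8 * U n * t) * e3

theorem sq_sub_sq_ne_zero {ζ : ℂ} (hζ : ζ ∈ rhp) {c : ℝ} (hc : 0 < c) (h : ζ ≠ c) :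
    ζ ^ 2 - (c : ℂ) ^ 2 ≠ 0 := by
  rw [show ζ ^ 2 - (c : ℂ) ^ 2 = (ζ + c) * (ζ - c) by ring]
  exact mul_ne_zero (Jost.add_c_ne_zero hζ hc) (sub_ne_zero.2 h)

/-- A second component as a combination of the functions `ξ`. -/
theorem second_eq_xi (hU0 : ∀ n, U n ≠ 0) (J : Jost D Γ (laxG D u U) (laxH D u U) Λ Υ) {c : ℝ}
    (hc : 0 < c) (hA : specA D Γ Λ Υ c ≠ 0) (n : Fin N → ℤ) (k : Fin N) {ζ : ℂ} (hζ : ζ ∈ rhp)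
    (hne : ζ ≠ c) : second D u U Λ c k n ζ
      = -theta u U c (Υ · c) (rightPsi D Γ (laxG D u U) Υ · c) n / (2 * c * specA D Γ Λ Υ c)
          * xiPos D Γ (laxG D u U) Λ c n ζ
        + theta u U c (Λ · c) (leftPsi D Γ (laxG D u U) Λ · c) n / (2 * c)
          * xiNeg D Γ (laxG D u U) Λ Υ c n ζ := by
  have hco := ofReal_mem_orhp hc
  have w := J.wronskian_specA (orhp_subset hco) (Jost.ne_zero_of_orhp hco) n
  have hsq := sq_sub_sq_ne_zero hζ hc hne
  have hc' : (c : ℂ) ≠ 0 := Jost.ne_zero_of_orhp hco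
  rw [second_eq hU0 J hζ, xiPos_eq D Γ _ Λ n hne (Jost.add_c_ne_zero hζ hc), xiNeg]
  simp only [theta]
  -- A Plücker relation: the pair (Λ, ψ) at ζ is expanded in the pairs of Λ and Υ at c, whose
  -- determinant is 2cA(c), and the functional (f, ψ) ↦ Uψ - c²uf is applied.
  have key : (U n * leftPsi D Γ (laxG D u U) Λ n ζ - c ^ 2 * u n * Λ n ζ)
      * (2 * c * specA D Γ Λ Υ c)
      = -(U n * rightPsi D Γ (laxG D u U) Υ n c - c ^ 2 * u n * Υ n c)
          * (Λ n c * leftPsi D Γ (laxG D u U) Λ n ζ - leftPsi D Γ (laxG D u U) Λ n c * Λ n ζ)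
        + (U n * leftPsi D Γ (laxG D u U) Λ n c - c ^ 2 * u n * Λ n c)
          * (Υ n c * leftPsi D Γ (laxG D u U) Λ n ζ - rightPsi D Γ (laxG D u U) Υ n c * Λ n ζ) := by
    linear_combination (-(U n * leftPsi D Γ (laxG D u U) Λ n ζ - c ^ 2 * u n * Λ n ζ)) * w
  generalize leftPsi D Γ (laxG D u U) Λ n ζ = a1 at *
  generalize leftPsi D Γ (laxG D u U) Λ n c = a2 at *
  generalize rightPsi D Γ (laxG D u U) Υ n c = a3 at *
  generalize specA D Γ Λ Υ c = A at *
  generalize ζ ^ 2 - (c : ℂ) ^ 2 = s at *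
  field_simp
  linear_combination key

/-- The dual function in terms of the Jost functions. -/
theorem CoeffRel.dual_eq {κ : Coeffs} (R : CoeffRel D Γ u U Λ Υ κ)
    (J : Jost D Γ (laxG D u U) (laxH D u U) Λ Υ) (hb : specA D Γ Λ Υ D.b ≠ 0) (n : Fin N → ℤ) :
    (U n : ℂ) = ((D.a + D.b) * κ.A * planeF D n D.a D.b * Λ n D.a
        - (D.a - D.b) * κ.C * planeF D n (-D.a) D.b * (Υ n D.a / specA D Γ Λ Υ D.a)) * Λ n D.b
      + ((D.a - D.b) * κ.B * planeF D n D.a (-D.b) * Λ n D.a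
        - (D.a + D.b) * κ.D * planeF D n (-D.a) (-D.b) * (Υ n D.a / specA D Γ Λ Υ D.a))
          * (Υ n D.b / specA D Γ Λ Υ D.b) := by
  have hbo := ofReal_mem_orhp D.b_pos
  have hb' : (D.b : ℂ) ≠ 0 := Jost.ne_zero_of_orhp hbo
  have w := J.wronskian_specA (orhp_subset hbo) hb' n
  rw [R.rel₁ n, R.rel₂ n]
  simp only [theta]
  field_simp
  linear_combination (-U n : ℂ) * w

end Q3

/-! ### Asymptotics at the ends of the staircase and the scattering data. -/

namespace Q3
open Asymptotics

variable {N : ℕ} {D : Params N} {Γ : Staircase N} {u U : (Fin N → ℤ) → ℝ}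

/-- The two ends of the staircase, with the sign of the exponents of the waves that grow there. -/
def IsEnd (s : ℝ) (l : Filter ℤ) : Prop := (s = 1 ∧ l = atTop) ∨ (s = -1 ∧ l = atBot)

namespace IsEnd
variable {s : ℝ} {l : Filter ℤ}

theorem neBot (h : IsEnd s l) : l.NeBot := by
  rcases h with ⟨-, rfl⟩ | ⟨-, rfl⟩ <;> infer_instance

theorem sq (h : IsEnd s l) : s ^ 2 = 1 := by rcases h with ⟨rfl, -⟩ | ⟨rfl, -⟩ <;> norm_num

theorem ne_zero (h : IsEnd s l) : s ≠ 0 := by rcases h with ⟨rfl, -⟩ | ⟨rfl, -⟩ <;> norm_num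

theorem tendsto_add (h : IsEnd s l) (c : ℤ) : Tendsto (fun i : ℤ => i + c) l l := by
  rcases h with ⟨-, rfl⟩ | ⟨-, rfl⟩
  · exact tendsto_atTop_add_const_right _ c tendsto_id
  · exact tendsto_atBot_add_const_right _ c tendsto_id

theorem mul_sq (h : IsEnd s l) (x : ℝ) : (s * x) ^ 2 = x ^ 2 := by rw [mul_pow, h.sq, one_mul]

end IsEnd

theorem Params.sub_mul_eq (D : Params N) (k : Fin N) {x y : ℝ} (hx : x ^ 2 = D.a ^ 2)
    (hy : y ^ 2 = D.b ^ 2) :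
    (D.p k + x) * (D.p k + y) * ((D.p k - x) * (D.p k - y)) = D.P k ^ 2 := by
  rw [D.P_sq, ← hx, ← hy]; ring

/-- The ratio of two plane waves decays at an end. -/
theorem planeF_ratio {s : ℝ} {l : Filter ℤ} (hl : IsEnd s l) {x y x' y' : ℝ}
    (hx : x ^ 2 = D.a ^ 2) (hy : y ^ 2 = D.b ^ 2) (hx' : x' ^ 2 = D.a ^ 2) (hy' : y' ^ 2 = D.b ^ 2)
    (hlt : ∀ k, |(D.p k + x) * (D.p k + y)| < |(D.p k + x') * (D.p k + y')|) (m : Fin N → ℤ) :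
    Tendsto (fun i => planeF D (m + Γ.point i) (s * x) (s * y)
      / planeF D (m + Γ.point i) (s * x') (s * y')) l (𝓝 0) := by
  set ρ : ℤ → ℝ := fun i => planeF D (m + Γ.point i) (s * x) (s * y)
      / planeF D (m + Γ.point i) (s * x') (s * y') with hρ
  have hstep : ∀ i, ρ (i + 1) = ρ i * (((D.p (Γ.dir i) + s * x) * (D.p (Γ.dir i) + s * y))
      / ((D.p (Γ.dir i) + s * x') * (D.p (Γ.dir i) + s * y'))) := by
    intro i
    simp only [hρ, Γ.add_point_succ]
    rw [planeF_shift D (by rw [hl.mul_sq, hx]) (by rw [hl.mul_sq, hy]),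
      planeF_shift D (by rw [hl.mul_sq, hx']) (by rw [hl.mul_sq, hy'])]
    have := D.P_ne_zero (Γ.dir i)
    have h1 := D.p_add_ne (Γ.dir i) (x := s * x') (Or.inl (by rw [hl.mul_sq, hx']))
    have h2 := D.p_add_ne (Γ.dir i) (x := s * y') (Or.inr (by rw [hl.mul_sq, hy']))
    have h3 := planeF_ne_zero D (x := s * x') (y := s * y') (by rw [hl.mul_sq, hx'])
      (by rw [hl.mul_sq, hy']) (m + Γ.point i)
    field_simp
  have : Nonempty (Fin N) := ⟨Γ.dir 0⟩
  obtain ⟨k₀, hk⟩ := Finite.exists_max fun k : Fin N =>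
    |(D.p k + x) * (D.p k + y)| / |(D.p k + x') * (D.p k + y')|
  set θ := |(D.p k₀ + x) * (D.p k₀ + y)| / |(D.p k₀ + x') * (D.p k₀ + y')|
  have hθ1 : θ < 1 := by
    rw [div_lt_one ((abs_nonneg _).trans_lt (hlt k₀))]; exact hlt k₀
  have hθ0 : 0 ≤ θ := by positivity
  rcases hl with ⟨rfl, rfl⟩ | ⟨rfl, rfl⟩
  · refine (tendsto_zero_iff_abs_tendsto_zero _).2 ?_
    refine tendsto_zero_of_contraction hθ0 hθ1 (fun _ => abs_nonneg _) tendsto_const_nhds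
      (Eventually.of_forall fun i => ?_)
    simp only [Function.comp, hstep, abs_mul, one_mul, add_zero, abs_div]
    rw [mul_comm]
    have := hk (Γ.dir i)
    simp only [abs_mul] at this
    exact mul_le_mul_of_nonneg_right this (abs_nonneg _)
  · have key : Tendsto (fun i => |ρ (-i)|) atTop (𝓝 0) := by
      refine tendsto_zero_of_contraction hθ0 hθ1 (fun _ => abs_nonneg _) tendsto_const_nhds
        (Eventually.of_forall fun i => ?_)
      have h1 := hstep (-(i + 1))
      rw [show -(i + 1) + 1 = -i by ring] at h1
      set k := Γ.dir (-(i + 1))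
      have e1 := D.sub_mul_eq k hx hy
      have e2 := D.sub_mul_eq k hx' hy'
      have hP := pow_ne_zero 2 (D.P_ne_zero k)
      have h2 : (D.p k + x') * (D.p k + y') ≠ 0 := by
        intro h0; rw [h0, zero_mul] at e2; exact hP e2.symm
      have h3 : (D.p k - x') * (D.p k - y') ≠ 0 := by
        intro h0; rw [h0, mul_zero] at e2; exact hP e2.symm
      have h4 : (D.p k - x) * (D.p k - y) ≠ 0 := by
        intro h0; rw [h0, mul_zero] at e1; exact hP e1.symm
      -- At the left end the waves carry opposite exponents and the index runs backwards. As (p +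
      -- x)(p + y)(p - x)(p - y) = P² for both pairs, the two reversals compensate and the ratio has
      -- the same multiplier as at the right end.
      have e3 : ρ (-(i + 1)) = (D.p k + x) * (D.p k + y) / ((D.p k + x') * (D.p k + y'))
          * ρ (-i) := by
        rw [h1]
        obtain ⟨t, ht⟩ : ∃ t, t = ρ (-(i + 1)) := ⟨_, rfl⟩
        rw [← ht]
        simp only [neg_one_mul, ← sub_eq_add_neg]
        rw [div_mul_eq_mul_div, eq_div_iff h2, ← mul_div_assoc, ← mul_div_assoc, eq_div_iff h3]
        linear_combination t * (e2 - e1)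
      rw [e3, abs_mul, abs_div, add_zero]
      exact mul_le_mul_of_nonneg_right (hk k) (abs_nonneg _)
    have := key.comp tendsto_neg_atBot_atTop
    simp only [Function.comp_def, neg_neg] at this
    exact (tendsto_zero_iff_abs_tendsto_zero _).2 this

theorem Params.abs_sub_lt (D : Params N) (k : Fin N) {c : ℝ} (hc : 0 < c) :
    |D.p k - c| < |D.p k + c| := by
  have hp := D.p_pos k
  rw [abs_of_pos (show 0 < D.p k + c by linarith), abs_lt]
  constructor <;> linarith

/-- The wave (a, b) dominates and (-a, -b) is subordinate. The two intermediate waves (a, -b) and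
(-a, b) are not ordered uniformly: which is larger depends on the lattice parameter. -/
theorem Params.abs_lt_ab (D : Params N) (k : Fin N) :
    |(D.p k + D.a) * (D.p k + -D.b)| < |(D.p k + D.a) * (D.p k + D.b)| ∧
    |(D.p k + -D.a) * (D.p k + D.b)| < |(D.p k + D.a) * (D.p k + D.b)| ∧
    |(D.p k + -D.a) * (D.p k + -D.b)| < |(D.p k + D.a) * (D.p k + -D.b)| ∧
    |(D.p k + -D.a) * (D.p k + -D.b)| < |(D.p k + D.a) * (D.p k + D.b)| := by
  have ha := D.abs_sub_lt k D.a_pos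
  have hb := D.abs_sub_lt k D.b_pos
  have h1 : 0 < |D.p k + D.a| := (abs_nonneg _).trans_lt ha
  have h2 : 0 < |D.p k + D.b| := (abs_nonneg _).trans_lt hb
  have h3 : 0 < |D.p k - D.b| := by
    rw [sub_eq_add_neg]; exact abs_pos.2 (D.p_add_ne k (Or.inr (by ring)))
  simp only [abs_mul, ← sub_eq_add_neg]
  exact ⟨mul_lt_mul_of_pos_left hb h1, mul_lt_mul_of_pos_right ha h2,
    mul_lt_mul_of_pos_right ha h3,
    (mul_lt_mul_of_pos_right ha h3).trans (mul_lt_mul_of_pos_left hb h1)⟩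

/-- The boundary conditions at one end. -/
def EndBC (D : Params N) (Γ : Staircase N) (u U : (Fin N → ℤ) → ℝ) (s : ℝ) (l : Filter ℤ)
    (c d : ℝ) : Prop :=
  ∀ m : Fin N → ℤ, (∀ i, m (Γ.dir i) = 0) →
    (fun i : ℤ => u (m + Γ.point i)) ~[l]
      (fun i : ℤ => c * planeF D (m + Γ.point i) (s * D.a) (s * -D.b)
        + d * planeF D (m + Γ.point i) (s * D.a) (s * D.b)) ∧
    (fun i : ℤ => U (m + Γ.point i)) ~[l]
      (fun i : ℤ => s * (D.a - D.b) * c * planeF D (m + Γ.point i) (s * D.a) (s * -D.b)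
        + s * (D.a + D.b) * d * planeF D (m + Γ.point i) (s * D.a) (s * D.b))

theorem boundaryConditions_iff {κ : Coeffs} : BoundaryConditions D Γ u U κ ↔
    κ.A * κ.D * (D.a + D.b) ^ 2 - κ.B * κ.C * (D.a - D.b) ^ 2 = -D.δ ^ 2 / (16 * D.a * D.b) ∧
    EndBC D Γ u U (-1) atBot κ.C κ.D ∧ EndBC D Γ u U 1 atTop (κ.K₁ * κ.B) (κ.K₀ * κ.A) := by
  have e1 : ∀ m : Fin N → ℤ, (fun i : ℤ => -(D.a - D.b) * κ.C * planeF D (m + Γ.point i) (-D.a) D.b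
      - (D.a + D.b) * κ.D * planeF D (m + Γ.point i) (-D.a) (-D.b))
      = fun i : ℤ => -1 * (D.a - D.b) * κ.C * planeF D (m + Γ.point i) (-1 * D.a) (-1 * -D.b)
        + -1 * (D.a + D.b) * κ.D * planeF D (m + Γ.point i) (-1 * D.a) (-1 * D.b) := by
    intro m; funext i; simp only [neg_one_mul, neg_neg]; ring
  have e2 : ∀ m : Fin N → ℤ, (fun i : ℤ => κ.K₀ * (D.a + D.b) * κ.A * planeF D (m + Γ.point i) D.a D.b
        + κ.K₁ * (D.a - D.b) * κ.B * planeF D (m + Γ.point i) D.a (-D.b))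
      = fun i : ℤ => 1 * (D.a - D.b) * (κ.K₁ * κ.B)
          * planeF D (m + Γ.point i) (1 * D.a) (1 * -D.b)
        + 1 * (D.a + D.b) * (κ.K₀ * κ.A) * planeF D (m + Γ.point i) (1 * D.a) (1 * D.b) := by
    intro m; funext i; simp only [one_mul]; ring
  have e3 : ∀ m : Fin N → ℤ, (fun i : ℤ => κ.C * planeF D (m + Γ.point i) (-D.a) D.b
      + κ.D * planeF D (m + Γ.point i) (-D.a) (-D.b))
      = fun i : ℤ => κ.C * planeF D (m + Γ.point i) (-1 * D.a) (-1 * -D.b)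
        + κ.D * planeF D (m + Γ.point i) (-1 * D.a) (-1 * D.b) := by
    intro m; funext i; simp only [neg_one_mul, neg_neg]
  have e4 : ∀ m : Fin N → ℤ, (fun i : ℤ => κ.K₀ * κ.A * planeF D (m + Γ.point i) D.a D.b
        + κ.K₁ * κ.B * planeF D (m + Γ.point i) D.a (-D.b))
      = fun i : ℤ => κ.K₁ * κ.B * planeF D (m + Γ.point i) (1 * D.a) (1 * -D.b)
        + κ.K₀ * κ.A * planeF D (m + Γ.point i) (1 * D.a) (1 * D.b) := by
    intro m; funext i; simp only [one_mul]; ring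
  simp only [BoundaryConditions, EndBC, e1, e2, e3, e4]
  constructor
  · rintro ⟨h0, h⟩
    exact ⟨h0, fun m hm => ⟨(h m hm).1, (h m hm).2.2.1⟩, fun m hm => ⟨(h m hm).2.1, (h m hm).2.2.2⟩⟩
  · rintro ⟨h0, h1, h2⟩
    exact ⟨h0, fun m hm => ⟨(h1 m hm).1, (h2 m hm).1, (h1 m hm).2, (h2 m hm).2⟩⟩

theorem tendsto_div_of_isEquivalent {l : Filter ℤ} {v w F : ℤ → ℝ} {e : ℝ} (h : v ~[l] w)
    (hw : Tendsto (fun i => w i / F i) l (𝓝 e)) : Tendsto (fun i => v i / F i) l (𝓝 e) :=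
  (h.div (IsEquivalent.refl (u := F))).symm.tendsto_nhds hw

theorem isEquivalent_of_tendsto_div {l : Filter ℤ} {v w F : ℤ → ℝ} {e : ℝ} (he : e ≠ 0)
    (hF : ∀ i, F i ≠ 0) (hv : Tendsto (fun i => v i / F i) l (𝓝 e))
    (hw : Tendsto (fun i => w i / F i) l (𝓝 e)) : v ~[l] w := by
  have key : ∀ v : ℤ → ℝ, Tendsto (fun i => v i / F i) l (𝓝 e) → v ~[l] fun i => e * F i := by
    intro v hv
    have h1 := ((isEquivalent_const_iff_tendsto he).2 hv).mul (IsEquivalent.refl (u := F))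
    refine h1.congr_left (Eventually.of_forall fun i => ?_)
    simp only [Pi.mul_apply]
    rw [div_mul_cancel₀ _ (hF i)]
  exact (key v hv).trans (key w hw).symm

theorem wave_ne_zero {s : ℝ} {l : Filter ℤ} (hl : IsEnd s l) {x y : ℝ} (hx : x ^ 2 = D.a ^ 2)
    (hy : y ^ 2 = D.b ^ 2) (n : Fin N → ℤ) : planeF D n (s * x) (s * y) ≠ 0 :=
  planeF_ne_zero D (by rw [hl.mul_sq, hx]) (by rw [hl.mul_sq, hy]) n

/-- The combination of waves at an end, relative to the dominant wave. -/
theorem tendsto_wave_div {s : ℝ} {l : Filter ℤ} (hl : IsEnd s l) (c d : ℝ) (m : Fin N → ℤ) :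
    Tendsto (fun i : ℤ => (c * planeF D (m + Γ.point i) (s * D.a) (s * -D.b)
        + d * planeF D (m + Γ.point i) (s * D.a) (s * D.b))
          / planeF D (m + Γ.point i) (s * D.a) (s * D.b)) l (𝓝 d) := by
  have h1 := (planeF_ratio (Γ := Γ) hl (x := D.a) (y := -D.b) (x' := D.a) (y' := D.b) rfl
    (by ring) rfl rfl (fun k => (D.abs_lt_ab k).1) m).const_mul c
  have h2 := h1.add_const d
  rw [mul_zero, zero_add] at h2
  refine h2.congr fun i => ?_
  have := wave_ne_zero (D := D) hl (x := D.a) (y := D.b) rfl rfl (m + Γ.point i)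
  field_simp

/-- The wave with coefficient d leads unless d = 0; then c ≠ 0, since U would otherwise vanish
eventually. In either case the same wave leads in u and U, with ratio U / u → s(a + y). -/
theorem EndBC.exists_lead {s : ℝ} {l : Filter ℤ} (hl : IsEnd s l) {c d : ℝ}
    (h : EndBC D Γ u U s l c d) (hU0 : ∀ n, U n ≠ 0) :
    ∃ y e : ℝ, y ^ 2 = D.b ^ 2 ∧ e ≠ 0 ∧ ∀ m : Fin N → ℤ, (∀ i, m (Γ.dir i) = 0) →
      Tendsto (fun i => u (m + Γ.point i) / planeF D (m + Γ.point i) (s * D.a) (s * y)) l (𝓝 e) ∧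
      Tendsto (fun i => U (m + Γ.point i) / planeF D (m + Γ.point i) (s * D.a) (s * y)) l
        (𝓝 (s * (D.a + y) * e)) := by
  have := hl.neBot
  by_cases hd : d = 0
  · subst hd
    have hc : c ≠ 0 := by
      rintro rfl
      have h1 := (h 0 (by simp)).2
      simp only [mul_zero, zero_mul, add_zero] at h1
      have h2 : (fun i : ℤ => U (0 + Γ.point i)) =ᶠ[l] 0 := isEquivalent_zero_iff_eventually_zero.1 h1
      obtain ⟨i, hi⟩ := h2.exists
      exact hU0 _ hi
    refine ⟨-D.b, c, by ring, hc, fun m hm => ⟨?_, ?_⟩⟩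
    · refine tendsto_div_of_isEquivalent (h m hm).1 (tendsto_const_nhds.congr fun i => ?_)
      have := wave_ne_zero (D := D) hl (x := D.a) (y := -D.b) rfl (by ring) (m + Γ.point i)
      rw [zero_mul, add_zero, mul_div_assoc, div_self this, mul_one]
    · refine tendsto_div_of_isEquivalent (h m hm).2 (tendsto_const_nhds.congr fun i => ?_)
      have := wave_ne_zero (D := D) hl (x := D.a) (y := -D.b) rfl (by ring) (m + Γ.point i)
      rw [mul_zero, zero_mul, add_zero, mul_div_assoc, div_self this, mul_one, sub_eq_add_neg]
  · exact ⟨D.b, d, rfl, hd, fun m hm =>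
      ⟨tendsto_div_of_isEquivalent (h m hm).1 (tendsto_wave_div hl c d m),
        tendsto_div_of_isEquivalent (h m hm).2 (tendsto_wave_div hl _ _ m)⟩⟩

theorem tendsto_along_dir {l : Filter ℤ} {e : Fin N → ℤ → ℝ} (h : ∀ k, Tendsto (e k) l (𝓝 0)) :
    Tendsto (fun i => e (Γ.dir i) i) l (𝓝 0) := by
  rw [Metric.tendsto_nhds]
  intro ε hε
  have h1 : ∀ᶠ i in l, ∀ k, dist (e k i) 0 < ε :=
    eventually_all.2 fun k => Metric.tendsto_nhds.1 (h k) ε hε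
  filter_upwards [h1] with i hi using hi _

/-- As r is never a staircase direction, the boundary conditions cover both sides of the strip. Ω
then tends to its value on a pure plane wave, which is p_r + p_k. -/
theorem EndBC.mix_tendsto {s : ℝ} {l : Filter ℤ} (hl : IsEnd s l) {c d : ℝ}
    (h : EndBC D Γ u U s l c d) (hU0 : ∀ n, U n ≠ 0) {m : Fin N → ℤ}
    (hm : ∀ i, m (Γ.dir i) = 0) {r : Fin N} (hr : ∀ i, Γ.dir i ≠ r) :
    Tendsto (mix D.p Γ (laxG D u U) (laxH D u U) m r) l (𝓝 0) := by
  obtain ⟨y, e, hy, he, hlim⟩ := h.exists_lead hl hU0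
  have hmr : ∀ i, (shift r m) (Γ.dir i) = 0 := fun i => by
    simp [shift, hm i, hr i]
  have hay : D.a + y ≠ 0 := by
    intro h0
    have h1 : y = -D.a := by linarith
    rw [h1] at hy
    have h2 := D.b_pos
    have h3 := D.b_lt_a
    nlinarith
  obtain ⟨l1, -⟩ := hlim m hm
  obtain ⟨l2, l3⟩ := hlim _ hmr
  set X := s * D.a with hX
  set Y := s * y with hY
  have hX2 : X ^ 2 = D.a ^ 2 := hl.mul_sq _
  have hY2 : Y ^ 2 = D.b ^ 2 := by rw [hY, hl.mul_sq, hy]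
  have hXY : s * (D.a + y) = X + Y := by rw [hX, hY]; ring
  have hXY0 : X + Y ≠ 0 := by rw [← hXY]; exact mul_ne_zero hl.ne_zero hay
  rw [hXY] at l3
  have l4 := l2.comp (hl.tendsto_add 1)
  set V : ℤ → ℝ := fun i => U (shift r m + Γ.point i) / planeF D (shift r m + Γ.point i) X Y
  set v : ℤ → ℝ := fun i => u (shift r m + Γ.point i) / planeF D (shift r m + Γ.point i) X Y
  set w : ℤ → ℝ := fun i => u (m + Γ.point i) / planeF D (m + Γ.point i) X Y
  have hk : ∀ k, Tendsto (fun i => ((D.p k + X) * (D.p k + Y) * v (i + 1)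
      - (D.p k ^ 2 - D.p r ^ 2) * v i - (D.p r - X) * (D.p r - Y) * w i) / V i - D.p r - D.p k)
      l (𝓝 0) := by
    intro k
    have h1 := (((((l4.const_mul ((D.p k + X) * (D.p k + Y))).sub
      (l2.const_mul (D.p k ^ 2 - D.p r ^ 2))).sub
      (l1.const_mul ((D.p r - X) * (D.p r - Y)))).div l3
        (mul_ne_zero hXY0 he)).sub_const (D.p r)).sub_const (D.p k)
    refine h1.trans (le_of_eq ?_)
    congr 1
    field_simp
    ring
  refine (tendsto_along_dir (Γ := Γ) hk).congr fun i => ?_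
  have hF := planeF_ne_zero D hX2 hY2 (m + Γ.point i)
  have hP := D.P_ne_zero r
  have hPk := D.P_ne_zero (Γ.dir i)
  have hUn := hU0 (shift r (m + Γ.point i))
  have s1 : shift r m + Γ.point i = shift r (m + Γ.point i) := (shift_add' r m _).symm
  have s2 : shift r m + Γ.point (i + 1) = shift (Γ.dir i) (shift r (m + Γ.point i)) := by
    rw [Γ.add_point_succ, s1]
  have f1 := planeF_shift D hX2 hY2 r (m + Γ.point i)
  have f2 := planeF_shift D hX2 hY2 (Γ.dir i) (shift r (m + Γ.point i))
  have hF1 := planeF_ne_zero D hX2 hY2 (shift r (m + Γ.point i))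
  have g1 := D.p_add_ne (Γ.dir i) (Or.inl hX2)
  have g2 := D.p_add_ne (Γ.dir i) (Or.inr hY2)
  have g3 := D.p_add_ne r (Or.inl hX2)
  have g4 := D.p_add_ne r (Or.inr hY2)
  have hPs := D.sub_mul_eq r hX2 hY2
  have e1 : (D.p (Γ.dir i) + X) * (D.p (Γ.dir i) + Y) * v (i + 1)
      = D.P (Γ.dir i) * u (shift (Γ.dir i) (shift r (m + Γ.point i)))
        / planeF D (shift r (m + Γ.point i)) X Y := by
    simp only [v, s2]
    rw [f2]
    field_simp
  have e2 : (D.p r - X) * (D.p r - Y) * w i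
      = D.P r * u (m + Γ.point i) / planeF D (shift r (m + Γ.point i)) X Y := by
    simp only [w]
    rw [f1]
    field_simp
    linear_combination u (m + Γ.point i) * hPs
  rw [mix, ← Omega_eq_om, Omega, e1, e2]
  simp only [v, V, s1]
  field_simp

theorem scatData (hu : IsSolution D u) (hU : IsDual D u U) (hU0 : ∀ n, U n ≠ 0) {κ : Coeffs}
    (hbc : BoundaryConditions D Γ u U κ)
    (hpot : Summable fun i : ℤ => |potential D Γ u U i| * (1 + |(i : ℝ)|)) :
    ScatData D.p Γ (laxG D u U) (laxH D u U) := by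
  obtain ⟨-, h1, h2⟩ := boundaryConditions_iff.1 hbc
  refine ⟨D.p_pos, laxCoeff D hu hU hU0, ?_, fun m hm r hr => ?_⟩
  · refine hpot.congr fun i => ?_
    rw [potential, pot, Omega_eq_om, zero_add]
  · rw [Int.cofinite_eq]
    exact (h1.mix_tendsto (Or.inr ⟨rfl, rfl⟩) hU0 hm hr).sup
      (h2.mix_tendsto (Or.inl ⟨rfl, rfl⟩) hU0 hm hr)

end Q3

/-! ### The constants of the second components satisfy the boundary conditions. -/

namespace Q3
open Asymptotics

variable {N : ℕ} {D : Params N} {Γ : Staircase N} {u U : (Fin N → ℤ) → ℝ}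

/-- A convergent ratio of the two intermediate waves at an end tends to zero. -/
theorem planeF_ratio_eq_zero {s : ℝ} {l : Filter ℤ} (hl : IsEnd s l) {ℓ : ℂ}
    (h : Tendsto (fun i => ((planeF D (Γ.point i) (s * -D.a) (s * D.b)
      / planeF D (Γ.point i) (s * D.a) (s * -D.b) : ℝ) : ℂ)) l (𝓝 ℓ)) : ℓ = 0 := by
  have := hl.neBot
  set r : ℤ → ℝ := fun i => planeF D (Γ.point i) (s * -D.a) (s * D.b)
      / planeF D (Γ.point i) (s * D.a) (s * -D.b) with hr
  set q : Fin N → ℝ := fun k => ((D.p k + s * -D.a) * (D.p k + s * D.b))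
      / ((D.p k + s * D.a) * (D.p k + s * -D.b)) with hq
  have a1 : (s * -D.a) ^ 2 = D.a ^ 2 := by rw [hl.mul_sq]; ring
  have a2 : (s * D.a) ^ 2 = D.a ^ 2 := hl.mul_sq _
  have b1 : (s * -D.b) ^ 2 = D.b ^ 2 := by rw [hl.mul_sq]; ring
  have b2 : (s * D.b) ^ 2 = D.b ^ 2 := hl.mul_sq _
  have hstep : ∀ i, r (i + 1) = r i * q (Γ.dir i) := by
    intro i
    simp only [hr, hq]
    have e : Γ.point (i + 1) = shift (Γ.dir i) (Γ.point i) := by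
      simpa using Γ.add_point_succ 0 i
    rw [e, planeF_shift D a1 b2, planeF_shift D a2 b1, mul_div_mul_comm, div_div_div_cancel_right₀
      (D.P_ne_zero _)]
  -- A convergent ratio has increments r(q - 1) tending to zero. There are finitely many
  -- multipliers, none equal to 1 because a ≠ b, so r itself tends to zero.
  have hq1 : ∀ k, q k - 1 ≠ 0 := by
    intro k h0
    have g := mul_ne_zero (D.p_add_ne k (Or.inl a2)) (D.p_add_ne k (Or.inr b1))
    have h1 := (div_eq_one_iff_eq g).1 (sub_eq_zero.1 h0)
    have h2 : D.p k * s * (D.a - D.b) = 0 := by linear_combination -h1 / 2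
    exact mul_ne_zero (mul_ne_zero (D.p_pos k).ne' hl.ne_zero) (sub_ne_zero.2 D.b_lt_a.ne') h2
  have hd : Tendsto (fun i => (r (i + 1) : ℂ) - r i) l (𝓝 0) := by
    rw [← sub_self ℓ]
    exact (h.comp (hl.tendsto_add 1)).sub h
  have hk : ∀ k, Tendsto (fun i => ‖(r (i + 1) : ℂ) - r i‖ / |q k - 1|) l (𝓝 0) := fun k => by
    simpa using hd.norm.div_const (|q k - 1|)
  have h0 : Tendsto (fun i => (r i : ℂ)) l (𝓝 0) := by
    refine squeeze_zero_norm (fun i => ?_) (tendsto_along_dir (Γ := Γ) hk)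
    rw [hstep, Complex.ofReal_mul, ← mul_sub_one, norm_mul, ← Complex.ofReal_one,
      ← Complex.ofReal_sub, Complex.norm_real (q _ - 1), Real.norm_eq_abs,
      mul_div_assoc, div_self (abs_ne_zero.2 (hq1 _)), mul_one]
  exact tendsto_nhds_unique h h0

/-- The leading constants at an end are determined by a wave expansion of the dual function. -/
theorem EndBC.const_eq {s : ℝ} {l : Filter ℤ} (hl : IsEnd s l) {c₀ d₀ c d : ℝ}
    (h : EndBC D Γ u U s l c₀ d₀) {e ω₃ ω₄ : ℂ} {w₁ w₂ w₃ w₄ : ℤ → ℂ}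
    (h₁ : Tendsto w₁ l (𝓝 (s * (D.a + D.b) * d : ℝ))) (hz : d = 0 → ∀ i, w₁ i = 0)
    (h₂ : Tendsto w₂ l (𝓝 (s * (D.a - D.b) * c : ℝ))) (h₃ : Tendsto w₃ l (𝓝 ω₃)) (hω : ω₃ ≠ 0)
    (h₄ : Tendsto w₄ l (𝓝 ω₄))
    (hexp : ∀ i, (U (Γ.point i) : ℂ) = w₁ i * planeF D (Γ.point i) (s * D.a) (s * D.b)
      + w₂ i * planeF D (Γ.point i) (s * D.a) (s * -D.b)
      + e * w₃ i * planeF D (Γ.point i) (s * -D.a) (s * D.b)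
      + w₄ i * planeF D (Γ.point i) (s * -D.a) (s * -D.b)) :
    d = d₀ ∧ (d₀ = 0 → c = c₀) := by
  have := hl.neBot
  have hab := D.b_lt_a
  have hb := D.b_pos
  have cast : ∀ {f : ℤ → ℝ} {x : ℝ}, Tendsto f l (𝓝 x) →
      Tendsto (fun i => (f i : ℂ)) l (𝓝 (x : ℂ)) := fun hf =>
    (Complex.continuous_ofReal.tendsto _).comp hf
  have hU := (h 0 (by simp)).2
  simp only [zero_add] at hU
  have ratio : ∀ {x y x' y' : ℝ}, x ^ 2 = D.a ^ 2 → y ^ 2 = D.b ^ 2 → x' ^ 2 = D.a ^ 2 →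
      y' ^ 2 = D.b ^ 2 →
      (∀ k, |(D.p k + x) * (D.p k + y)| < |(D.p k + x') * (D.p k + y')|) →
      Tendsto (fun i => ((planeF D (Γ.point i) (s * x) (s * y)
        / planeF D (Γ.point i) (s * x') (s * y') : ℝ) : ℂ)) l (𝓝 0) := by
    intro x y x' y' hx hy hx' hy' hlt
    simpa using cast (planeF_ratio (Γ := Γ) hl hx hy hx' hy' hlt 0)
  have hd : d = d₀ := by
    have t1 : Tendsto (fun i => U (Γ.point i) / planeF D (Γ.point i) (s * D.a) (s * D.b)) l
        (𝓝 (s * (D.a + D.b) * d₀)) := by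
      refine tendsto_div_of_isEquivalent hU ?_
      simpa using tendsto_wave_div (D := D) (Γ := Γ) hl (s * (D.a - D.b) * c₀)
        (s * (D.a + D.b) * d₀) 0
    have r2 := ratio (x := D.a) (y := -D.b) (x' := D.a) (y' := D.b) rfl (by ring) rfl rfl
      fun k => (D.abs_lt_ab k).1
    have r3 := ratio (x := -D.a) (y := D.b) (x' := D.a) (y' := D.b) (by ring) rfl rfl rfl
      fun k => (D.abs_lt_ab k).2.1
    have r4 := ratio (x := -D.a) (y := -D.b) (x' := D.a) (y' := D.b) (by ring) (by ring) rfl rfl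
      fun k => (D.abs_lt_ab k).2.2.2
    have t2 := ((h₁.add (h₂.mul r2)).add ((h₃.const_mul e).mul r3)).add (h₄.mul r4)
    simp only [mul_zero, add_zero] at t2
    have t3 : ((s * (D.a + D.b) * d : ℝ) : ℂ) = (s * (D.a + D.b) * d₀ : ℝ) := by
      refine tendsto_nhds_unique t2 ((cast t1).congr fun i => ?_)
      have hF : (planeF D (Γ.point i) (s * D.a) (s * D.b) : ℂ) ≠ 0 := by
        exact_mod_cast wave_ne_zero (D := D) hl (x := D.a) (y := D.b) rfl rfl (Γ.point i)
      rw [Complex.ofReal_div, hexp]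
      push_cast
      field_simp
    exact mul_left_cancel₀ (mul_ne_zero hl.ne_zero (by linarith)) (Complex.ofReal_inj.1 t3)
  refine ⟨hd, fun h0 => ?_⟩
  subst h0 hd
  have t1 : Tendsto (fun i => U (Γ.point i) / planeF D (Γ.point i) (s * D.a) (s * -D.b)) l
      (𝓝 (s * (D.a - D.b) * c₀)) := by
    refine tendsto_div_of_isEquivalent hU (tendsto_const_nhds.congr fun i => ?_)
    have := wave_ne_zero (D := D) hl (x := D.a) (y := -D.b) rfl (by ring) (Γ.point i)
    rw [mul_zero, zero_mul, add_zero, mul_div_assoc, div_self this, mul_one]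
  have r4 := ratio (x := -D.a) (y := -D.b) (x' := D.a) (y' := -D.b) (by ring) (by ring) rfl
    (by ring) fun k => (D.abs_lt_ab k).2.2.1
  have t2 := ((cast t1).sub h₂).sub (h₄.mul r4)
  -- Without the dominant wave the two intermediate waves compete. The expansion forces their ratio,
  -- times e w₃, to converge, and a convergent ratio has limit zero; this holds whichever wave is
  -- larger, so c is determined.
  have t3 : Tendsto (fun i => e * w₃ i * ((planeF D (Γ.point i) (s * -D.a) (s * D.b)
      / planeF D (Γ.point i) (s * D.a) (s * -D.b) : ℝ) : ℂ)) l
      (𝓝 ((s * (D.a - D.b) * (c₀ - c) : ℝ) : ℂ)) := by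
    refine (t2.congr fun i => ?_).trans (le_of_eq ?_)
    · have hF : (planeF D (Γ.point i) (s * D.a) (s * -D.b) : ℂ) ≠ 0 := by
        exact_mod_cast wave_ne_zero (D := D) hl (x := D.a) (y := -D.b) rfl (by ring) (Γ.point i)
      rw [Complex.ofReal_div, hexp, hz rfl]
      simp only [Complex.ofReal_div]
      generalize (planeF D (Γ.point i) (s * D.a) (s * -D.b) : ℂ) = F at *
      field_simp
      ring
    · congr 1
      push_cast
      ring
  have t4 : s * (D.a - D.b) * (c₀ - c) = 0 := by
    rw [← Complex.ofReal_eq_zero]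
    by_cases he : e = 0
    · simp only [he, zero_mul] at t3
      exact tendsto_nhds_unique t3 tendsto_const_nhds
    · have t5 := t3.div (h₃.const_mul e) (mul_ne_zero he hω)
      have hne : ∀ᶠ i in l, w₃ i ≠ 0 := h₃.eventually_ne hω
      have t6 : Tendsto (fun i => ((planeF D (Γ.point i) (s * -D.a) (s * D.b)
          / planeF D (Γ.point i) (s * D.a) (s * -D.b) : ℝ) : ℂ)) l _ :=
        t5.congr' (hne.mono fun i hi => mul_div_cancel_left₀ _ (mul_ne_zero he hi))
      have := planeF_ratio_eq_zero hl t6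
      exact (div_eq_zero_iff.1 this).resolve_right (mul_ne_zero he hω)
  have := (mul_eq_zero.1 t4).resolve_left (mul_ne_zero hl.ne_zero (sub_ne_zero.2 hab.ne'))
  linarith

/-- Asymptotic equivalence does not see the subordinate coefficient when the leading one is nonzero.
Hence the computed and the given constants need only agree in the leading coefficient. -/
theorem EndBC.congr {s : ℝ} {l : Filter ℤ} (hl : IsEnd s l) {c₀ d₀ c d : ℝ}
    (h : EndBC D Γ u U s l c₀ d₀) (hd : d = d₀) (hc : d₀ = 0 → c = c₀) :
    EndBC D Γ u U s l c d := by
  subst hd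
  by_cases h0 : d = 0
  · rw [hc h0]; exact h
  · have hab : D.a + D.b ≠ 0 := by have := D.b_pos; have := D.b_lt_a; linarith
    intro m hm
    have hF := fun i => wave_ne_zero (D := D) hl (x := D.a) (y := D.b) rfl rfl (m + Γ.point i)
    exact ⟨(h m hm).1.trans (isEquivalent_of_tendsto_div h0 hF (tendsto_wave_div hl _ _ m)
        (tendsto_wave_div hl _ _ m)), (h m hm).2.trans (isEquivalent_of_tendsto_div
        (mul_ne_zero (mul_ne_zero hl.ne_zero hab) h0) hF (tendsto_wave_div hl _ _ m)
        (tendsto_wave_div hl _ _ m))⟩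

variable {Λ Υ : (Fin N → ℤ) → ℂ → ℂ}

/-- The constants of the second components satisfy the boundary conditions. -/
theorem CoeffRel.boundaryConditions {κ κ₀ : Coeffs} (R : CoeffRel D Γ u U Λ Υ κ)
    (J : Jost D Γ (laxG D u U) (laxH D u U) Λ Υ) (ha : specA D Γ Λ Υ D.a ≠ 0)
    (hb : specA D Γ Λ Υ D.b ≠ 0) (hbc : BoundaryConditions D Γ u U κ₀) :
    BoundaryConditions D Γ u U κ := by
  obtain ⟨-, h1, h2⟩ := boundaryConditions_iff.1 hbc
  have hao := ofReal_mem_orhp D.a_pos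
  have hbo := ofReal_mem_orhp D.b_pos
  have L1 : ∀ {c : ℂ}, c ∈ orhp → Tendsto (fun i => Λ (Γ.point i) c) atBot (𝓝 1) := fun hc => by
    simpa using (J.left _ (orhp_subset hc)).2 0
  have L2 : ∀ {c : ℂ}, c ∈ orhp → Tendsto (fun i => Λ (Γ.point i) c) atTop
      (𝓝 (specA D Γ Λ Υ c)) := fun hc => by simpa using J.tendsto_left_atTop hc 0
  have L3 : ∀ {c : ℂ}, c ∈ orhp → Tendsto (fun i => Υ (Γ.point i) c) atTop (𝓝 1) := fun hc => by
    simpa using (J.right _ (orhp_subset hc)).2 0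
  have L4 : ∀ {c : ℂ}, c ∈ orhp → specA D Γ Λ Υ c ≠ 0 →
      Tendsto (fun i => Υ (Γ.point i) c / specA D Γ Λ Υ c) atBot (𝓝 1) := by
    intro c hc hA
    simpa [div_self hA] using (J.tendsto_right_atBot hc 0).div_const (specA D Γ Λ Υ c)
  refine boundaryConditions_iff.2 ⟨R.quad, ?_, ?_⟩
  -- At the left end Λ and Υ / A tend to 1 for ζ = a, b, so the coefficients in the four-wave
  -- expansion of U converge to those of the boundary condition.
  · obtain ⟨e1, e2⟩ := h1.const_eq (c := κ.C) (d := κ.D) (e := (D.a - D.b) * κ.B)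
      (w₁ := fun i => -(D.a + D.b) * κ.D * ((Υ (Γ.point i) D.a / specA D Γ Λ Υ D.a)
        * (Υ (Γ.point i) D.b / specA D Γ Λ Υ D.b)))
      (w₂ := fun i => -(D.a - D.b) * κ.C * ((Υ (Γ.point i) D.a / specA D Γ Λ Υ D.a)
        * Λ (Γ.point i) D.b))
      (w₃ := fun i => Λ (Γ.point i) D.a * (Υ (Γ.point i) D.b / specA D Γ Λ Υ D.b))
      (w₄ := fun i => (D.a + D.b) * κ.A * (Λ (Γ.point i) D.a * Λ (Γ.point i) D.b))
      (Or.inr ⟨rfl, rfl⟩)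
      ((((L4 hao ha).mul (L4 hbo hb)).const_mul _).trans (le_of_eq (by push_cast; congr 1; ring)))
      (fun h i => by simp [h])
      ((((L4 hao ha).mul (L1 hbo)).const_mul _).trans (le_of_eq (by push_cast; congr 1; ring)))
      ((L1 hao).mul (L4 hbo hb)) (by simp) (((L1 hao).mul (L1 hbo)).const_mul _)
      (fun i => by
        rw [R.dual_eq J hb]
        simp only [neg_one_mul, neg_neg]
        ring)
    exact h1.congr (Or.inr ⟨rfl, rfl⟩) e1 e2
  -- At the right end Υ → 1 and Λ → A. The limits produce the products A(a)A(b) = K₀ and A(a)/A(b) =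
  -- K₁.
  · obtain ⟨e1, e2⟩ := h2.const_eq (c := κ.K₁ * κ.B) (d := κ.K₀ * κ.A) (e := -(D.a - D.b) * κ.C)
      (w₁ := fun i => (D.a + D.b) * κ.A * (Λ (Γ.point i) D.a * Λ (Γ.point i) D.b))
      (w₂ := fun i => (D.a - D.b) * κ.B / specA D Γ Λ Υ D.b * (Λ (Γ.point i) D.a
        * Υ (Γ.point i) D.b))
      (w₃ := fun i => 1 / specA D Γ Λ Υ D.a * (Υ (Γ.point i) D.a * Λ (Γ.point i) D.b))
      (w₄ := fun i => -(D.a + D.b) * κ.D / (specA D Γ Λ Υ D.a * specA D Γ Λ Υ D.b)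
        * (Υ (Γ.point i) D.a * Υ (Γ.point i) D.b))
      (Or.inl ⟨rfl, rfl⟩)
      ((((L2 hao).mul (L2 hbo)).const_mul _).trans
        (le_of_eq (by push_cast; rw [R.K₀]; congr 1; ring)))
      (fun h i => by
        have : (κ.K₀ : ℂ) ≠ 0 := by rw [R.K₀]; exact mul_ne_zero ha hb
        have : κ.A = 0 := (mul_eq_zero.1 h).resolve_left (by exact_mod_cast this)
        simp [this])
      ((((L2 hao).mul (L3 hbo)).const_mul _).trans
        (le_of_eq (by push_cast; rw [R.K₁]; congr 1; ring)))
      (((L3 hao).mul (L2 hbo)).const_mul _) (by simp [ha, hb])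
      (((L3 hao).mul (L3 hbo)).const_mul _)
      (fun i => by
        rw [R.dual_eq J hb]
        simp only [one_mul]
        field_simp
        ring)
    exact h2.congr (Or.inl ⟨rfl, rfl⟩) e1 e2

end Q3

/-! ### Recovery of the solution and assembly. -/

namespace Q3

variable {N : ℕ} {D : Params N} {Γ : Staircase N} {u U : (Fin N → ℤ) → ℝ}
  {Λ Υ : (Fin N → ℤ) → ℂ → ℂ}

theorem tendsto_inv_sub_cobounded (c : ℂ) :
    Tendsto (fun ζ : ℂ => (ζ - c)⁻¹) (Bornology.cobounded ℂ ⊓ 𝓟 rhp) (𝓝 0) := by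
  have h1 : Tendsto (fun ζ : ℂ => ζ - c) (Bornology.cobounded ℂ) (Bornology.cobounded ℂ) := by
    simp [sub_eq_add_neg]
  exact (tendsto_inv₀_cobounded.comp h1).mono_left inf_le_left

theorem tendsto_sq_div_cobounded (c : ℂ) :
    Tendsto (fun ζ : ℂ => ζ ^ 2 / (ζ ^ 2 - c ^ 2)) (Bornology.cobounded ℂ ⊓ 𝓟 rhp) (𝓝 1) := by
  have h := (((tendsto_inv_sub_cobounded c).mul (tendsto_inv_sub_cobounded (-c))).const_mul
    (c ^ 2)).const_add 1
  rw [mul_zero, mul_zero, add_zero] at h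
  refine h.congr' (eventually_of_norm_gt ‖c‖ fun ζ _ hζ => ?_)
  have h1 : ζ - c ≠ 0 := fun h => by rw [sub_eq_zero.1 h] at hζ; exact lt_irrefl _ hζ
  have h2 : ζ + c ≠ 0 := fun h => by
    rw [eq_neg_of_add_eq_zero_left h, norm_neg] at hζ; exact lt_irrefl _ hζ
  have h3 : ζ ^ 2 - c ^ 2 ≠ 0 := by
    rw [show ζ ^ 2 - c ^ 2 = (ζ + c) * (ζ - c) by ring]; exact mul_ne_zero h2 h1
  rw [sub_neg_eq_add]
  field_simp
  ring

theorem HalfReg.tendsto_one {f : ℂ → ℂ} (hf : HalfReg f) :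
    Tendsto f (Bornology.cobounded ℂ ⊓ 𝓟 rhp) (𝓝 1) := by
  obtain ⟨C, hC⟩ := hf.bound
  rw [tendsto_iff_norm_sub_tendsto_zero]
  have h := ((tendsto_inv_sub_cobounded 0).norm.const_mul C)
  rw [norm_zero, mul_zero] at h
  refine squeeze_zero' (Eventually.of_forall fun _ => norm_nonneg _)
    (eventually_of_norm_gt 0 fun ζ hζ h0 => ?_) h
  rw [sub_zero, norm_inv, ← div_eq_mul_inv, le_div_iff₀ h0]
  exact hC ζ hζ

/-- Recovery of the solution from the second components. -/
theorem tendsto_second (hU0 : ∀ n, U n ≠ 0) (J : Jost D Γ (laxG D u U) (laxH D u U) Λ Υ)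
    (n : Fin N → ℤ) (k : Fin N) :
    Tendsto (fun ζ : ℂ => ζ ^ 2 * (second D u U Λ D.b k n ζ - second D u U Λ D.a k n ζ)
      / ((D.a : ℂ) ^ 2 - (D.b : ℂ) ^ 2)) (Bornology.cobounded ℂ ⊓ 𝓟 rhp) (𝓝 (u n : ℂ)) := by
  have a0 := D.a_pos
  have b0 := D.b_pos
  obtain ⟨C, hC⟩ := (J.leftPsi_bdd a0 n).bound
  have hψ : Tendsto (fun ζ => leftPsi D Γ (laxG D u U) Λ n ζ * (ζ + D.a)⁻¹ * (ζ - D.a)⁻¹)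
      (Bornology.cobounded ℂ ⊓ 𝓟 rhp) (𝓝 0) := by
    have h := ((tendsto_inv_sub_cobounded D.a).norm.const_mul C)
    rw [norm_zero, mul_zero] at h
    refine squeeze_zero_norm' (eventually_of_norm_gt 0 fun ζ hζ h0 => ?_) h
    rw [norm_mul]
    exact mul_le_mul_of_nonneg_right (hC ζ hζ) (norm_nonneg _)
  have hb := tendsto_sq_div_cobounded D.b
  -- In the difference of the second components the ψ terms combine to (b² - a²) ψ ζ² over a
  -- quartic, which vanishes at infinity because ψ = O(ζ). The u terms leave uΛ, and Λ → 1.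
  have h := ((((J.left_reg n).tendsto_one.const_mul (u n : ℂ)).mul
    (tendsto_sq_div_cobounded D.a)).mul hb).sub ((hψ.const_mul (U n : ℂ)).mul hb)
  simp only [mul_one, mul_zero, sub_zero] at h
  have hab : (D.a : ℂ) ^ 2 - (D.b : ℂ) ^ 2 ≠ 0 := by
    have := D.b_lt_a
    have : D.a ^ 2 - D.b ^ 2 ≠ 0 := by nlinarith
    exact_mod_cast this
  refine h.congr' (eventually_of_norm_gt (D.a + D.b) fun ζ hζ hn => ?_)
  have ha : ζ ≠ D.a := by
    rintro rfl; rw [Complex.norm_real, Real.norm_of_nonneg a0.le] at hn; linarith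
  have hb : ζ ≠ D.b := by
    rintro rfl; rw [Complex.norm_real, Real.norm_of_nonneg b0.le] at hn; linarith
  have h1 := sq_sub_sq_ne_zero hζ a0 ha
  have h2 := sq_sub_sq_ne_zero hζ b0 hb
  have e : (ζ ^ 2 - (D.a : ℂ) ^ 2)⁻¹ = (ζ + D.a)⁻¹ * (ζ - D.a)⁻¹ := by
    rw [← mul_inv]; congr 1; ring
  beta_reduce
  rw [second_eq hU0 J hζ, second_eq hU0 J hζ, mul_assoc (leftPsi _ _ _ _ _ _), ← e]
  generalize leftPsi D Γ (laxG D u U) Λ n ζ = ψ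
  field_simp
  ring

/-- The functions `ξ_s` for `s = ±a, ±b`. -/
noncomputable def xi (D : Params N) (Γ : Staircase N) (g : Fin N → (Fin N → ℤ) → ℝ)
    (Λ Υ : (Fin N → ℤ) → ℂ → ℂ) (s : ℝ) (n : Fin N → ℤ) : ℂ → ℂ :=
  if 0 < s then xiPos D Γ g Λ s n else xiNeg D Γ g Λ Υ (-s) n

theorem xi_pos {g : Fin N → (Fin N → ℤ) → ℝ} {c : ℝ} (hc : 0 < c) (n : Fin N → ℤ) :
    xi D Γ g Λ Υ c n = xiPos D Γ g Λ c n := if_pos hc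

theorem xi_neg {g : Fin N → (Fin N → ℤ) → ℝ} {c : ℝ} (hc : 0 < c) (n : Fin N → ℤ) :
    xi D Γ g Λ Υ (-c) n = xiNeg D Γ g Λ Υ c n := by
  rw [xi, if_neg (by linarith), neg_neg]

/-- The second components in terms of the functions `ξ_s`. -/
theorem exists_coeffs (hU : IsDual D u U) (hU0 : ∀ n, U n ≠ 0) {κ₀ : Coeffs}
    (hbc : BoundaryConditions D Γ u U κ₀) (J : Jost D Γ (laxG D u U) (laxH D u U) Λ Υ)
    {M : ℕ} {z : Fin M → ℂ} {B : ℂ → ℂ} (H : SpecData D Γ (laxG D u U) Λ Υ z B)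
    (ha : specA D Γ Λ Υ D.a ≠ 0) (hb : specA D Γ Λ Υ D.b ≠ 0) :
    ∃ (κ : Coeffs) (ξ : ℝ → (Fin N → ℤ) → ℂ → ℂ),
      BoundaryConditions D Γ u U κ ∧
      (∀ s : ℝ, s ∈ ({D.a, -D.a, D.b, -D.b} : Set ℝ) → ∀ n,
        SolvesSIE z (fun k => B (z k) / deriv (specA D Γ Λ Υ) (z k))
          (fun σ => B σ / specA D Γ Λ Υ σ) (rho D n) (fun ζ => 1 / (ζ + s)) {-(s : ℂ)} (ξ s n)) ∧
      (∀ n k (ζ : ℂ), 0 ≤ ζ.re → ζ ≠ D.b →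
        second D u U Λ D.b k n ζ =
          (D.a + D.b) * (κ.K₀ / (specA D Γ Λ Υ D.a * specA D Γ Λ Υ D.b)) * κ.A
              * planeF D n D.a D.b * Λ n D.a * ξ D.b n ζ
            + (D.a - D.b) * (κ.K₁ * specA D Γ Λ Υ D.b / specA D Γ Λ Υ D.a) * κ.B
              * planeF D n D.a (-D.b) * Λ n D.a * ξ (-D.b) n ζ
            - (D.a - D.b) * κ.C * planeF D n (-D.a) D.b
              * (Υ n D.a / specA D Γ Λ Υ D.a) * ξ D.b n ζ
            - (D.a + D.b) * κ.D * planeF D n (-D.a) (-D.b)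
              * (Υ n D.a / specA D Γ Λ Υ D.a) * ξ (-D.b) n ζ) ∧
      (∀ n k (ζ : ℂ), 0 ≤ ζ.re → ζ ≠ D.a →
        second D u U Λ D.a k n ζ =
          (D.a + D.b) * (κ.K₀ / (specA D Γ Λ Υ D.a * specA D Γ Λ Υ D.b)) * κ.A
              * planeF D n D.a D.b * Λ n D.b * ξ D.a n ζ
            + (D.a - D.b) * (κ.K₁ * specA D Γ Λ Υ D.b / specA D Γ Λ Υ D.a) * κ.B
              * planeF D n D.a (-D.b) * (Υ n D.b / specA D Γ Λ Υ D.b) * ξ D.a n ζ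
            - (D.a - D.b) * κ.C * planeF D n (-D.a) D.b
              * Λ n D.b * ξ (-D.a) n ζ
            - (D.a + D.b) * κ.D * planeF D n (-D.a) (-D.b)
              * (Υ n D.b / specA D Γ Λ Υ D.b) * ξ (-D.a) n ζ) := by
  obtain ⟨κ, R⟩ := exists_coeffRel hU hU0 J ha hb
  have a0 := D.a_pos
  have b0 := D.b_pos
  -- For these constants the prefactors with K₀ and K₁ in the two formulas equal 1, so the formulas
  -- reduce to the linear relations of `CoeffRel`.
  have k0 : (κ.K₀ : ℂ) / (specA D Γ Λ Υ D.a * specA D Γ Λ Υ D.b) = 1 := by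
    rw [R.K₀, div_self (mul_ne_zero ha hb)]
  have k1 : (κ.K₁ : ℂ) * specA D Γ Λ Υ D.b / specA D Γ Λ Υ D.a = 1 := by
    rw [R.K₁, div_mul_cancel₀ _ hb, div_self ha]
  refine ⟨κ, xi D Γ (laxG D u U) Λ Υ, R.boundaryConditions J ha hb hbc, ?_, ?_, ?_⟩
  · rintro s (rfl | rfl | rfl | rfl) n
    · rw [xi_pos a0]; exact J.xiPos_solvesSIE H a0 ha n
    · rw [xi_neg a0]; exact J.xiNeg_solvesSIE H a0 ha n
    · rw [xi_pos b0]; exact J.xiPos_solvesSIE H b0 hb n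
    · rw [xi_neg b0]; exact J.xiNeg_solvesSIE H b0 hb n
  · intro n k ζ hζ hne
    rw [second_eq_xi hU0 J b0 hb n k hζ hne, ← R.rel₁, ← R.rel₂, xi_pos b0, xi_neg b0, k0, k1]
    ring
  · intro n k ζ hζ hne
    have r4 := R.rel₄ n
    rw [neg_div] at r4
    rw [second_eq_xi hU0 J a0 ha n k hζ hne, ← R.rel₃, ← neg_eq_iff_eq_neg.2 r4, xi_pos a0,
      xi_neg a0, k0, k1]
    ring

end Q3

theorem mainTheorem4 {N : ℕ} (D : Q3.Params N) (Γ : Q3.Staircase N)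
    (u U : (Fin N → ℤ) → ℝ) (κ₀ : Q3.Coeffs)
    (hu : Q3.IsSolution D u) (hU : Q3.IsDual D u U) (hU0 : ∀ n, U n ≠ 0)
    (hbc : Q3.BoundaryConditions D Γ u U κ₀)
    (hpot : Summable fun i : ℤ => |Q3.potential D Γ u U i| * (1 + |(i : ℝ)|)) :
    -- the Jost functions exist and are unique
    (∃ Λ, Q3.IsLeftJost D Γ u U Λ ∧ ∀ Λ', Q3.IsLeftJost D Γ u U Λ' →
      ∀ n (ζ : ℂ), 0 ≤ ζ.re → Λ' n ζ = Λ n ζ) ∧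
    (∃ Υ, Q3.IsRightJost D Γ u U Υ ∧ ∀ Υ', Q3.IsRightJost D Γ u U Υ' →
      ∀ n (ζ : ℂ), 0 ≤ ζ.re → Υ' n ζ = Υ n ζ) ∧
    ∀ Λ Υ : (Fin N → ℤ) → ℂ → ℂ, Q3.IsLeftJost D Γ u U Λ → Q3.IsRightJost D Γ u U Υ →
      -- recovery of the solution
      (∀ (n : Fin N → ℤ) (k : Fin N),
        Filter.Tendsto
          (fun ζ : ℂ => ζ ^ 2 * (Q3.second D u U Λ D.b k n ζ - Q3.second D u U Λ D.a k n ζ)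
            / ((D.a : ℂ) ^ 2 - (D.b : ℂ) ^ 2))
          (Bornology.cobounded ℂ ⊓ Filter.principal {ζ : ℂ | 0 ≤ ζ.re})
          (nhds (u n : ℂ))) ∧
      -- if the zeros of the spectral function `A` are simple and differ from the `p r`
      ((∀ ζ : ℂ, 0 < ζ.re → Q3.specA D Γ Λ Υ ζ = 0 → deriv (Q3.specA D Γ Λ Υ) ζ ≠ 0) →
        (∀ r, Q3.specA D Γ Λ Υ (D.p r) ≠ 0) →
        ∃ (B : ℂ → ℂ) (M : ℕ) (z : Fin M → ℂ),
          -- the scattering data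
          Function.Injective z ∧
          Set.range z = {ζ : ℂ | 0 < ζ.re ∧ Q3.specA D Γ Λ Υ ζ = 0} ∧
          (∀ n (ζ : ℂ), ζ.re = 0 → ζ ≠ 0 →
            Q3.specA D Γ Λ Υ ζ ≠ 0 ∧
            Υ n ζ = Q3.specA D Γ Λ Υ ζ * Λ n (-ζ) + B ζ * Λ n ζ * Q3.rho D n ζ) ∧
          (∀ n k, B (z k) ≠ 0 ∧ Υ n (z k) = B (z k) * Λ n (z k) * Q3.rho D n (z k)) ∧
          -- the singular integral equations for the Jost functions
          (∀ n, Q3.SolvesSIE z (fun k => B (z k) / deriv (Q3.specA D Γ Λ Υ) (z k))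
            (fun σ => B σ / Q3.specA D Γ Λ Υ σ) (Q3.rho D n) (fun _ => 1) ∅ (Λ n)) ∧
          (∀ n, Q3.SolvesSIE z (fun k => 1 / (deriv (Q3.specA D Γ Λ Υ) (z k) * B (z k)))
            (fun σ => -(B (-σ) / Q3.specA D Γ Λ Υ σ)) (fun σ => Q3.rho D n (-σ)) (fun _ => 1) ∅
            (Υ n)) ∧
          -- the second components
          (Q3.specA D Γ Λ Υ D.a ≠ 0 → Q3.specA D Γ Λ Υ D.b ≠ 0 →
            ∃ (κ : Q3.Coeffs) (ξ : ℝ → (Fin N → ℤ) → ℂ → ℂ),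
              Q3.BoundaryConditions D Γ u U κ ∧
              (∀ s : ℝ, s ∈ ({D.a, -D.a, D.b, -D.b} : Set ℝ) → ∀ n,
                Q3.SolvesSIE z (fun k => B (z k) / deriv (Q3.specA D Γ Λ Υ) (z k))
                  (fun σ => B σ / Q3.specA D Γ Λ Υ σ) (Q3.rho D n) (fun ζ => 1 / (ζ + s))
                  {-(s : ℂ)} (ξ s n)) ∧
              (∀ n k (ζ : ℂ), 0 ≤ ζ.re → ζ ≠ D.b →
                Q3.second D u U Λ D.b k n ζ =
                  (D.a + D.b) * (κ.K₀ / (Q3.specA D Γ Λ Υ D.a * Q3.specA D Γ Λ Υ D.b)) * κ.A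
                      * Q3.planeF D n D.a D.b * Λ n D.a * ξ D.b n ζ
                    + (D.a - D.b) * (κ.K₁ * Q3.specA D Γ Λ Υ D.b / Q3.specA D Γ Λ Υ D.a) * κ.B
                      * Q3.planeF D n D.a (-D.b) * Λ n D.a * ξ (-D.b) n ζ
                    - (D.a - D.b) * κ.C * Q3.planeF D n (-D.a) D.b
                      * (Υ n D.a / Q3.specA D Γ Λ Υ D.a) * ξ D.b n ζ
                    - (D.a + D.b) * κ.D * Q3.planeF D n (-D.a) (-D.b)
                      * (Υ n D.a / Q3.specA D Γ Λ Υ D.a) * ξ (-D.b) n ζ) ∧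
              (∀ n k (ζ : ℂ), 0 ≤ ζ.re → ζ ≠ D.a →
                Q3.second D u U Λ D.a k n ζ =
                  (D.a + D.b) * (κ.K₀ / (Q3.specA D Γ Λ Υ D.a * Q3.specA D Γ Λ Υ D.b)) * κ.A
                      * Q3.planeF D n D.a D.b * Λ n D.b * ξ D.a n ζ
                    + (D.a - D.b) * (κ.K₁ * Q3.specA D Γ Λ Υ D.b / Q3.specA D Γ Λ Υ D.a) * κ.B
                      * Q3.planeF D n D.a (-D.b) * (Υ n D.b / Q3.specA D Γ Λ Υ D.b) * ξ D.a n ζ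
                    - (D.a - D.b) * κ.C * Q3.planeF D n (-D.a) D.b
                      * Λ n D.b * ξ (-D.a) n ζ
                    - (D.a + D.b) * κ.D * Q3.planeF D n (-D.a) (-D.b)
                      * (Υ n D.b / Q3.specA D Γ Λ Υ D.b) * ξ (-D.a) n ζ))) := by
  have S := Q3.scatData hu hU hU0 hbc hpot
  refine ⟨?_, ?_, fun Λ Υ hΛ hΥ => ?_⟩
  · obtain ⟨Λ, h, -⟩ := S.exists_leftJost
    exact ⟨Λ, (Q3.isLeftJost_iff D Γ u U Λ).2 h, fun Λ' h' n ζ hζ =>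
      S.leftJost_unique h ((Q3.isLeftJost_iff D Γ u U Λ').1 h') n hζ⟩
  · obtain ⟨Υ, h⟩ := S.exists_rightJost
    exact ⟨Υ, (Q3.isRightJost_iff D Γ u U Υ).2 h, fun Υ' h' n ζ hζ =>
      S.rightJost_unique h ((Q3.isRightJost_iff D Γ u U Υ').1 h') n hζ⟩
  · have J : Q3.Jost D Γ (Q3.laxG D u U) (Q3.laxH D u U) Λ Υ :=
      ⟨S, (Q3.isLeftJost_iff D Γ u U Λ).1 hΛ, (Q3.isRightJost_iff D Γ u U Υ).1 hΥ⟩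
    refine ⟨Q3.tendsto_second hU0 J, fun hs hp => ?_⟩
    obtain ⟨B, M, z, H⟩ := J.exists_specData hs hp
    refine ⟨B, M, z, H.inj, H.range, fun n ζ hζ h0 => ⟨J.specA_axis_ne_zero hζ h0, ?_⟩,
      fun n k => ⟨H.ne_zero k, (H.proportional k n).1⟩, J.left_solvesSIE H, J.right_solvesSIE H,
      Q3.exists_coeffs hU hU0 hbc J H⟩
    rw [H.axis ζ hζ h0]
    exact (J.scattering hζ h0 n).1
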